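/- **Setting.** A metric graph is a complete graph on $n$ vertices with positive symmetric edge weights $w$ satisfying the triangle inequality. A path is a non-empty sequence of distinct vertices and $w(P)$ is the sum of the weights of its edges; for a family $\mathcal P$ of $m$ vertex-disjoint paths, $w(\mathcal P)=\sum_{P\in\mathcal P} w(P)$ and $V(\mathcal P)$ is the set of spanned vertices. The *multi-orienteering problem* (MOP) asks, given a metric graph, an integer $1\le m\le n$ and a budget $B>0$, for $m$ vertex-disjoint paths with $w(\mathcal P)\le B$ and $|V(\mathcal P)|$ maximum; $opt_{MO}$ is the maximum. For vertex penalties $\pi\ge 0$, a (deterministic) algorithm $\mathcal A_{PC}$ is a *4-LMP* for the prize-collecting vertex-disjoint $m$-paths problem if it always returns $m$ vertex-disjoint paths $\mathcal P$ with $w(\mathcal P)+4\pi(V\setminus V(\mathcal P))\le 4\min_{\mathcal P'}\bigl(w(\mathcal P')+\pi(V\setminus V(\mathcal P'))\bigr)$, the minimum being over all families of $m$ vertex-disjoint paths. **Algorithm** (subroutine $\mathcal A_{PC}$, parameters $\varepsilon,\alpha\in(0,1)$; ties are broken arbitrarily). For every guess $k=m,\dots,n$: 1. Let $\mathcal P_{m,L}$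 be the output of $\mathcal A_{PC}$ for the uniform penalty $L/((1-\alpha)k)$. Start with $L_2=0$ and $L_1=\min(Q,B)$, where $Q$ is the total weight of the $k-m$ longest edges. While $L_1-L_2>\varepsilon B$, put $L=(L_1+L_2)/2$ and replace $L_2$ by $L$ if $|V(\mathcal P_{m,L})|\le\alpha k$, and $L_1$ by $L$ otherwise. Take $\mathcal P_{m,L_1}$ for the final $L_1$. 2. While more than $2k$ vertices are spanned, trim every path with $q\ge2$ vertices once: of the sub-paths formed by its first and by its last $\lfloor q/2\rfloor$ vertices, remove one with the larger ratio of cost to number of vertices, where the cost includes the edge by which the sub-path is attached to the rest. The result is $\mathcal P_{m,k}$. 3. Put $ls=\lceil\frac{16}{1-\alpha}+\varepsilon\rceil$ if $|V(\mathcal P_{m,k})|\ge k$, and $ls=\lceil\frac{8-4\alpha}{1-\alpha}+\varepsilon\rceil$ otherwise. View each $P\in\mathcal P_{m,k}$ as a line segment of length $w(P)$, divide it into $ls$ (closed) pieces of equal length, and replace $P$ by a sub-path contained in one of the pieces with as many vertices as possible. The result is $\mathcal P'_{m,k}$. Return a $\mathcal P'_{m,k}$ spanning the most vertices among those with $w(\mathcal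 P'_{m,k})\le B$. **Theorem.** Let $\alpha^*=11-4\sqrt7\in(0,1)$. Then $$\frac{1-\alpha^*}{17-\alpha^*}=\frac{\alpha^*(1-\alpha^*)}{9-5\alpha^*}=\frac{4\sqrt7-10}{6+4\sqrt7}>0.035,$$ and this number is the maximum of $\min\{\frac{1-\alpha}{17-\alpha},\frac{\alpha(1-\alpha)}{9-5\alpha}\}$ over $\alpha\in(0,1)$. There is an absolute constant $C>0$ such that, for the algorithm with $\alpha=\alpha^*$, the following hold. * *(Approximation.)* For every 4-LMP $\mathcal A_{PC}$, every MOP instance and every $\varepsilon\in(0,1)$, every output of the algorithm is a family of $m$ vertex-disjoint paths of total weight at most $B$ that spans at least $\bigl(\frac{4\sqrt7-10}{6+4\sqrt7}-C\varepsilon\bigr)\,opt_{MO}$ vertices. That is, the algorithm is a $(0.035-O(\varepsilon))$-approximation for MOP. * *(Running time.)* There are a 4-LMP $\mathcal A_{PC}$ and one program for a real random access machine (unit-cost addition, subtraction and comparison of naturals, unit-cost $+,-,\times,/$ and comparison of reals, rational constants, arrays with indirect addressing, no rounding) which, on every MOP instance and every $\varepsilon\in(0,1)$, with input $(n,w,m,B,\varepsilon,\alpha^*)$,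 halts with an output of the algorithm with subroutine $\mathcal A_{PC}$ after at most $C\,\frac1\varepsilon\,n^4\log(n+1)$ steps. -/

import Mathlib

/-! ### Metric graphs, path systems, the multi-orienteering problem -/

namespace MOP

/-- The complete graph on `Fin n` with edge weights `w` is a metric graph. -/
structure IsMetric {n : ℕ} (w : Fin n → Fin n → ℝ) : Prop where
  self : ∀ u, w u u = 0
  pos : ∀ u v, u ≠ v → 0 < w u v
  symm : ∀ u v, w u v = w v u
  triangle : ∀ u v x, w u x ≤ w u v + w v x

/-- The weight of a path, given as its list of vertices: the sum of the weights of its edges. -/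
def pathWeight {n : ℕ} (w : Fin n → Fin n → ℝ) : List (Fin n) → ℝ
  | [] => 0
  | [_] => 0
  | u :: v :: l => w u v + pathWeight w (v :: l)

/-- A family of `m` vertex sequences in the complete graph on `Fin n`. -/
abbrev Family (n m : ℕ) : Type := Fin m → List (Fin n)

/-- `P` consists of `m` vertex-disjoint paths (a path has at least one vertex and no repetitions;
in a complete graph any such sequence is a path). -/
def IsPathSystem {n m : ℕ} (P : Family n m) : Prop :=
  (∀ i, P i ≠ [] ∧ (P i).Nodup) ∧ ∀ i j, i ≠ j → List.Disjoint (P i) (P j)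

/-- The total weight `w(P)` of a family. -/
noncomputable def weight {n m : ℕ} (w : Fin n → Fin n → ℝ) (P : Family n m) : ℝ :=
  ∑ i, pathWeight w (P i)

/-- The set `V(P)` of spanned vertices. -/
def spanned {n m : ℕ} (P : Family n m) : Finset (Fin n) :=
  Finset.univ.filter fun v => ∃ i, v ∈ P i

/-- Feasible solutions of MOP: `m` vertex-disjoint paths of total weight at most `B`. -/
def IsFeasible {n : ℕ} (w : Fin n → Fin n → ℝ) (m : ℕ) (B : ℝ) (P : Family n m) : Prop :=
  IsPathSystem P ∧ weight w P ≤ B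

/-- The optimal value of MOP: the largest number of vertices spanned by a feasible solution. -/
noncomputable def opt {n : ℕ} (w : Fin n → Fin n → ℝ) (m : ℕ) (B : ℝ) : ℕ :=
  sSup {q | ∃ P : Family n m, IsFeasible w m B P ∧ (spanned P).card = q}

/-! ### The prize-collecting problem and its Lagrangian multiplier preserving algorithms -/

/-- The penalty of the vertices that are not spanned. -/
noncomputable def penalty {n m : ℕ} (p : Fin n → ℝ) (P : Family n m) : ℝ :=
  ∑ v ∈ (spanned P)ᶜ, p v

/-- The optimal value of the prize-collecting vertex-disjoint `m`-paths problem. -/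
noncomputable def prizeOpt {n : ℕ} (w : Fin n → Fin n → ℝ) (m : ℕ) (p : Fin n → ℝ) : ℝ :=
  sInf {x | ∃ P : Family n m, IsPathSystem P ∧ x = weight w P + penalty p P}

/-- The input-output behaviour of a (deterministic) algorithm for the prize-collecting
vertex-disjoint `m`-paths problem, on input `n`, `w`, `m` and the penalties. -/
abbrev PrizeAlgorithm : Type :=
  (n : ℕ) → (Fin n → Fin n → ℝ) → (m : ℕ) → (Fin n → ℝ) → Family n m

/-- The guarantee of an `r`-LMP algorithm. -/
def IsLMP (r : ℝ) (A : PrizeAlgorithm) : Prop :=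
  ∀ (n : ℕ) (w : Fin n → Fin n → ℝ) (m : ℕ) (p : Fin n → ℝ),
    IsMetric w → 1 ≤ m → m ≤ n → (∀ v, 0 ≤ p v) →
      IsPathSystem (A n w m p) ∧
        weight w (A n w m p) + r * penalty p (A n w m p) ≤ r * prizeOpt w m p

/-! ### The algorithm -/

/-- The solution `P_{m,L}` computed by `A` for the uniform penalty `L / ((1 - α) k)`. -/
noncomputable def prizePaths (A : PrizeAlgorithm) {n : ℕ} (w : Fin n → Fin n → ℝ) (m k : ℕ)
    (α L : ℝ) : Family n m :=
  A n w m fun _ => L / ((1 - α) * k)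

/-- The total weight of the `q` longest edges. -/
noncomputable def longestEdges {n : ℕ} (w : Fin n → Fin n → ℝ) (q : ℕ) : ℝ :=
  sSup {x | ∃ S : Finset (Fin n × Fin n),
    (∀ e ∈ S, e.1 < e.2) ∧ S.card = q ∧ x = ∑ e ∈ S, w e.1 e.2}

/-- `BinarySearch num t tol L₁ L₂ L`: the bisection started with the interval `[L₂, L₁]` and ended
as soon as its length is at most `tol` returns the upper end `L`; a midpoint `x` becomes
the new lower end if `num x ≤ t`, and the new upper end otherwise. -/
inductive BinarySearch (num : ℝ → ℕ) (t tol : ℝ) : ℝ → ℝ → ℝ → Prop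
  | done (L₁ L₂ : ℝ) (h : L₁ - L₂ ≤ tol) : BinarySearch num t tol L₁ L₂ L₁
  | lower (L₁ L₂ L : ℝ) (h : tol < L₁ - L₂) (hx : (num ((L₁ + L₂) / 2) : ℝ) ≤ t)
      (hr : BinarySearch num t tol L₁ ((L₁ + L₂) / 2) L) : BinarySearch num t tol L₁ L₂ L
  | upper (L₁ L₂ L : ℝ) (h : tol < L₁ - L₂) (hx : t < (num ((L₁ + L₂) / 2) : ℝ))
      (hr : BinarySearch num t tol ((L₁ + L₂) / 2) L₂ L) : BinarySearch num t tol L₁ L₂ L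

/-- One trimming of one path with `q` vertices. A trivial path is kept. Otherwise, with `h = ⌊q/2⌋`,
the left part is formed by the first `h` vertices and the right part by the last `h` vertices;
each part is charged its own weight and the weight of the edge that leaves it towards the middle.
A part with the larger cost-to-vertex ratio is removed. -/
def TrimPath {n : ℕ} (w : Fin n → Fin n → ℝ) (P P' : List (Fin n)) : Prop :=
  let q := P.length
  let h := q / 2
  let cost₀ := pathWeight w (P.take (h + 1))
  let cost₁ := pathWeight w (P.drop (q - h - 1))
  (q ≤ 1 ∧ P' = P) ∨
    (2 ≤ q ∧ cost₁ / h ≤ cost₀ / h ∧ P' = P.drop h) ∨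
    (2 ≤ q ∧ cost₀ / h ≤ cost₁ / h ∧ P' = P.take (q - h))

/-- `Trim w k P P'`: as long as more than `2k` vertices are spanned, every path is trimmed once;
started from `P` this ends with `P'`. -/
inductive Trim {n m : ℕ} (w : Fin n → Fin n → ℝ) (k : ℕ) : Family n m → Family n m → Prop
  | done (P : Family n m) (h : (spanned P).card ≤ 2 * k) : Trim w k P P
  | round (P Q P' : Family n m) (h : 2 * k < (spanned P).card)
      (hQ : ∀ i, TrimPath w (P i) (Q i)) (hr : Trim w k Q P') : Trim w k P P'

/-- `P` is an output of the bicriteria algorithm for `m` vertex-disjoint paths spanning at least `k`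
vertices: the bisection on `[0, min Q B]`, where `Q` is the total weight of the `k - m` longest
edges, to precision `ε B`, followed by the trimming. -/
def IsBicriteriaOutput (A : PrizeAlgorithm) {n : ℕ} (w : Fin n → Fin n → ℝ) (m k : ℕ)
    (B ε α : ℝ) (P : Family n m) : Prop :=
  ∃ L, BinarySearch (fun x => (spanned (prizePaths A w m k α x)).card) (α * k) (ε * B)
      (min (longestEdges w (k - m)) B) 0 L ∧
    Trim w k (prizePaths A w m k α L) P

/-- View the path `P` as a line segment of length `w(P)`, divided into `s` pieces of equal length.
`IsPieceSubpath w P s Q` says that `Q` is a sub-path of `P` contained in one of these pieces.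
(In `P = X ++ Q ++ Y`, the position of the first vertex of `Q` is `pathWeight w (X ++ Q.take 1)`
and the position of the last one is `pathWeight w (X ++ Q)`.) -/
def IsPieceSubpath {n : ℕ} (w : Fin n → Fin n → ℝ) (P : List (Fin n)) (s : ℕ)
    (Q : List (Fin n)) : Prop :=
  Q ≠ [] ∧ ∃ X Y : List (Fin n), P = X ++ Q ++ Y ∧ ∃ j : ℕ, j < s ∧
    (j : ℝ) * (pathWeight w P / s) ≤ pathWeight w (X ++ Q.take 1) ∧
    pathWeight w (X ++ Q) ≤ ((j : ℝ) + 1) * (pathWeight w P / s)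

/-- `Q` is a heaviest sub-path: among the sub-paths of `P` contained in one of the `s` pieces,
it has the largest number of vertices. -/
def IsHeaviestSubpath {n : ℕ} (w : Fin n → Fin n → ℝ) (P : List (Fin n)) (s : ℕ)
    (Q : List (Fin n)) : Prop :=
  IsPieceSubpath w P s Q ∧ ∀ Q', IsPieceSubpath w P s Q' → Q'.length ≤ Q.length

/-- The number of pieces into which each path of `P` is divided. -/
noncomputable def pieces {n m : ℕ} (k : ℕ) (ε α : ℝ) (P : Family n m) : ℕ :=
  if k ≤ (spanned P).card then ⌈16 / (1 - α) + ε⌉₊ else ⌈(8 - 4 * α) / (1 - α) + ε⌉₊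

/-- `P` is an output of the algorithm for MOP that uses the subroutine `A` (with arbitrary
tie-breaking). For every guess `k`, `R k` is the path system returned by the bicriteria algorithm
and `S k` consists of heaviest sub-paths of its members; the output is an `S k` that
spans the most vertices among those of weight at most `B`. -/
def IsOutput (A : PrizeAlgorithm) {n : ℕ} (w : Fin n → Fin n → ℝ) (m : ℕ)
    (B ε α : ℝ) (P : Family n m) : Prop :=
  ∃ R S : ℕ → Family n m,
    (∀ k ∈ Finset.Icc m n, IsBicriteriaOutput A w m k B ε α (R k) ∧
      ∀ i, IsHeaviestSubpath w (R k i) (pieces k ε α (R k)) (S k i)) ∧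
    ∃ k₀ ∈ Finset.Icc m n, P = S k₀ ∧ weight w (S k₀) ≤ B ∧
      ∀ k ∈ Finset.Icc m n, weight w (S k) ≤ B → (spanned (S k)).card ≤ (spanned (S k₀)).card

end MOP

/-! ### Real random access machines

Programs of a structured language over a memory of natural numbers and real numbers, with indirect
addressing. Naturals can be added, subtracted (truncated) and compared; reals can be added,
subtracted, multiplied, divided (`x / 0 = 0`) and compared. There is no rounding and no
conversion between the two sorts. Every operation, memory access and test costs one step. -/

namespace RealRAM

/-- A memory state: finitely many names of two-dimensional arrays are used by any given program. -/
structure Store where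
  nat : ℕ → ℕ → ℕ → ℕ
  real : ℕ → ℕ → ℕ → ℝ

/-- Expressions for natural numbers; `read a i j` is the cell `(i, j)` of the array `a`. -/
inductive NatExp
  | const (c : ℕ)
  | read (a : ℕ) (i j : NatExp)
  | add (e f : NatExp)
  | sub (e f : NatExp)

/-- Expressions for real numbers. -/
inductive RealExp
  | const (c : ℚ)
  | read (a : ℕ) (i j : NatExp)
  | add (e f : RealExp)
  | sub (e f : RealExp)
  | mul (e f : RealExp)
  | div (e f : RealExp)

/-- Tests. -/
inductive Test
  | natLE (e f : NatExp)
  | realLE (e f : RealExp)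
  | neg (b : Test)

/-- Programs: assignments to array cells, composition, branching, and while-loops. -/
inductive Program
  | skip
  | setNat (a : ℕ) (i j : NatExp) (e : NatExp)
  | setReal (a : ℕ) (i j : NatExp) (e : RealExp)
  | seq (c d : Program)
  | branch (b : Test) (c d : Program)
  | loop (b : Test) (c : Program)

def NatExp.eval (σ : Store) : NatExp → ℕ
  | .const c => c
  | .read a i j => σ.nat a (i.eval σ) (j.eval σ)
  | .add e f => e.eval σ + f.eval σ
  | .sub e f => e.eval σ - f.eval σ

/-- The number of steps for evaluating an expression. -/
def NatExp.cost : NatExp → ℕ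
  | .const _ => 1
  | .read _ i j => i.cost + j.cost + 1
  | .add e f => e.cost + f.cost + 1
  | .sub e f => e.cost + f.cost + 1

noncomputable def RealExp.eval (σ : Store) : RealExp → ℝ
  | .const c => c
  | .read a i j => σ.real a (i.eval σ) (j.eval σ)
  | .add e f => e.eval σ + f.eval σ
  | .sub e f => e.eval σ - f.eval σ
  | .mul e f => e.eval σ * f.eval σ
  | .div e f => e.eval σ / f.eval σ

def RealExp.cost : RealExp → ℕ
  | .const _ => 1
  | .read _ i j => i.cost + j.cost + 1
  | .add e f => e.cost + f.cost + 1
  | .sub e f => e.cost + f.cost + 1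
  | .mul e f => e.cost + f.cost + 1
  | .div e f => e.cost + f.cost + 1

def Test.holds (σ : Store) : Test → Prop
  | .natLE e f => e.eval σ ≤ f.eval σ
  | .realLE e f => e.eval σ ≤ f.eval σ
  | .neg b => ¬ b.holds σ

def Test.cost : Test → ℕ
  | .natLE e f => e.cost + f.cost + 1
  | .realLE e f => e.cost + f.cost + 1
  | .neg b => b.cost + 1

def Store.setNat (σ : Store) (a i j x : ℕ) : Store where
  nat := fun a' i' j' => if a' = a ∧ i' = i ∧ j' = j then x else σ.nat a' i' j'
  real := σ.real

noncomputable def Store.setReal (σ : Store) (a i j : ℕ) (x : ℝ) : Store where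
  nat := σ.nat
  real := fun a' i' j' => if a' = a ∧ i' = i ∧ j' = j then x else σ.real a' i' j'

/-- `Exec c σ t τ`: started in `σ`, the program `c` halts after `t` steps in `τ`. -/
inductive Exec : Program → Store → ℕ → Store → Prop
  | skip (σ : Store) : Exec .skip σ 1 σ
  | setNat (σ : Store) (a : ℕ) (i j e : NatExp) :
      Exec (.setNat a i j e) σ (i.cost + j.cost + e.cost + 1)
        (σ.setNat a (i.eval σ) (j.eval σ) (e.eval σ))
  | setReal (σ : Store) (a : ℕ) (i j : NatExp) (e : RealExp) :
      Exec (.setReal a i j e) σ (i.cost + j.cost + e.cost + 1)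
        (σ.setReal a (i.eval σ) (j.eval σ) (e.eval σ))
  | seq (c d : Program) (σ τ ρ : Store) (s t : ℕ) (hc : Exec c σ s τ) (hd : Exec d τ t ρ) :
      Exec (.seq c d) σ (s + t) ρ
  | branchTrue (b : Test) (c d : Program) (σ τ : Store) (t : ℕ) (hb : b.holds σ)
      (hc : Exec c σ t τ) : Exec (.branch b c d) σ (b.cost + t) τ
  | branchFalse (b : Test) (c d : Program) (σ τ : Store) (t : ℕ) (hb : ¬ b.holds σ)
      (hd : Exec d σ t τ) : Exec (.branch b c d) σ (b.cost + t) τ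
  | loopEnd (b : Test) (c : Program) (σ : Store) (hb : ¬ b.holds σ) :
      Exec (.loop b c) σ b.cost σ
  | loopStep (b : Test) (c : Program) (σ τ ρ : Store) (s t : ℕ) (hb : b.holds σ)
      (hc : Exec c σ s τ) (hr : Exec (.loop b c) τ t ρ) :
      Exec (.loop b c) σ (b.cost + s + t) ρ

/-- The initial memory for the input `(n, w, m, B, ε, α)`: the natural cells `(0, 0)` of the arrays
`0` and `1` hold `n` and `m`; the real array `0` holds the weight matrix, and the real cells `(0, 0)`
of the arrays `1`, `2`, `3` hold `B`, `ε`, `α`; everything else is zero. -/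
noncomputable def input {n : ℕ} (w : Fin n → Fin n → ℝ) (m : ℕ) (B ε α : ℝ) : Store where
  nat := fun a i j =>
    if i = 0 ∧ j = 0 then (if a = 0 then n else if a = 1 then m else 0) else 0
  real := fun a i j =>
    if a = 0 then (if h : i < n ∧ j < n then w ⟨i, h.1⟩ ⟨j, h.2⟩ else 0)
    else if i = 0 ∧ j = 0 then
      (if a = 1 then B else if a = 2 then ε else if a = 3 then α else 0)
    else 0

/-- The final memory `σ` holds the family `P`: the cell `(i, 0)` of the natural array `2` holds the
number of vertices of the `i`-th path, and row `i` of the natural array `3` lists them. -/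
def Holds {n m : ℕ} (σ : Store) (P : MOP.Family n m) : Prop :=
  ∀ i : Fin m, σ.nat 2 i 0 = (P i).length ∧
    ∀ (j : ℕ) (hj : j < (P i).length), σ.nat 3 i j = ((P i)[j] : Fin n)

end RealRAM

/-! ### Reasoning about programs -/

namespace RealRAM

/-! Approximation. Let `k` be the optimum, `O` an optimal solution and `π = L / ((1 - α) k)`. With a
uniform penalty the 4-LMP inequality becomes `w(P_L) ≤ 4 w(O) + 4 π (|V(P_L)| - k)`. The bisection
returns either its original upper end or a value at which more than `α k` vertices are spanned. In
the first case `L = min Q B ≥ w(O)`, because `O` has `k - m` edges; fewer than `α k` vertices would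
then make the right side less than `4 w(O) - 4 L ≤ 0`, unless `L = 0`, and for `L = 0` the optimum
consists of `m = k` single vertices. So at least `α k` vertices are spanned and `L ≤ B`
(`le_card_of_binarySearch`); the precision of the bisection is irrelevant here.

If at least `k` vertices are spanned, the average cost per vertex is at most `4 B / ((1 - α) k)`.
Trimming keeps at least half of the vertices and at most half of the weight of every path, so the
average does not grow, and the result has between `k` and `2 k` vertices and weight at most `8 B /
(1 - α)`. If fewer than `k` are spanned, the weight is at most `4 B` and nothing is trimmed. In both
cases the number `s` of pieces brings the weight down to at most `B`, and by the pigeonhole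
principle a fraction `1 / s` of the vertices survives. Rounding up adds one to the number of pieces,
which gives `(1 - α) / (17 - α)` and `α (1 - α) / (9 - 5 α)`, up to the summand `ε` (`guess_opt`).
The final maximum over all guesses includes the guess `k`.

A 4-LMP subroutine. Primal-dual moat growing: each vertex is a component with its penalty as
potential. Active components grow at unit speed and use up their potential; a component without
potential becomes inactive, and a tight edge merges two components. Growth stops when `m` components
are active. Let `D` be the integral of the number of active components minus `m`. A path that meets
`a` active components has at least `a - 1` active ends of crossing edges, and an active component
missed by all paths pays from its potential. Hence every family of `m` paths costs at least `D`
(`restCost_grow`, `Hist.le_restCost`). Then the merges are undone, latest first, and inactive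
components that would be leaves are discarded. The accepted edges form `m` trees in which every
inactive component has degree at least two. Counting ends of edges bounds their weight plus twice
the penalty of the discarded vertices by `2 D` (`Good.grow`, `Hist.good`). Joining cycles along the
accepted edges and deleting one edge of each cycle costs a factor of two (`Tour.merge`,
`sum_swapNext_le`), so `w + 4 π ≤ 4 D` (`Moat.lmp`).

Running time. A growth step scans all edges, and there are at most `2 n` steps since each lowers the
number of active components plus the number of components. So the subroutine takes `O(n³)` steps,
and one guess takes `O(n³)` times the number of bisection rounds. The crude bound `⌈1/ε⌉` for this
number suffices, and over at most `n` guesses this is `O(n⁴ / ε)`, already without the logarithm.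
Two devices keep the verification modular. Programs come with the list of arrays that they may
write, so every other array is known to be unchanged. The subroutine is local to one row of its
arrays, so a call in a fresh row is an exact copy of a call on a canonical input (`Exec.sim`). This
makes its output a function of the instance and spares clearing the memory. -/

/-- `c` halts from `σ` within `T` steps in a state satisfying `Q`. -/
def Runs (c : Program) (σ : Store) (T : ℕ) (Q : Store → Prop) : Prop :=
  ∃ t τ, Exec c σ t τ ∧ t ≤ T ∧ Q τ

/-- The natural arrays to which a program may write. -/
def Program.natW : Program → List ℕ
  | .skip => []
  | .setNat a _ _ _ => [a]
  | .setReal _ _ _ _ => []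
  | .seq c d => c.natW ++ d.natW
  | .branch _ c d => c.natW ++ d.natW
  | .loop _ c => c.natW

/-- The real arrays to which a program may write. -/
def Program.realW : Program → List ℕ
  | .skip => []
  | .setNat _ _ _ _ => []
  | .setReal a _ _ _ => [a]
  | .seq c d => c.realW ++ d.realW
  | .branch _ c d => c.realW ++ d.realW
  | .loop _ c => c.realW

/-- `σ` and `τ` agree outside the natural arrays `ns` and the real arrays `rs`. -/
def Frame (ns rs : List ℕ) (σ τ : Store) : Prop :=
  (∀ a, a ∉ ns → τ.nat a = σ.nat a) ∧ ∀ a, a ∉ rs → τ.real a = σ.real a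

theorem Frame.refl (ns rs : List ℕ) (σ : Store) : Frame ns rs σ σ :=
  ⟨fun _ _ => rfl, fun _ _ => rfl⟩

theorem Frame.trans {ns rs : List ℕ} {σ τ ρ : Store} (h : Frame ns rs σ τ)
    (h' : Frame ns rs τ ρ) : Frame ns rs σ ρ :=
  ⟨fun a ha => (h'.1 a ha).trans (h.1 a ha), fun a ha => (h'.2 a ha).trans (h.2 a ha)⟩

theorem Frame.mono {ns rs ns' rs' : List ℕ} {σ τ : Store} (h : Frame ns rs σ τ)
    (hn : ns ⊆ ns') (hr : rs ⊆ rs') : Frame ns' rs' σ τ :=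
  ⟨fun a ha => h.1 a fun hc => ha (hn hc), fun a ha => h.2 a fun hc => ha (hr hc)⟩

/-- Only arrays named as targets of assignments can change. A fact about any other array passes
through a program at the price of a membership test in a list of numerals. -/
theorem Exec.frame {c : Program} {σ τ : Store} {t : ℕ} (h : Exec c σ t τ) :
    Frame c.natW c.realW σ τ := by
  induction h with
  | skip σ => exact Frame.refl _ _ _
  | setNat σ a i j e =>
    refine ⟨fun b hb => ?_, fun b _ => rfl⟩
    funext i' j'
    have : b ≠ a := by simpa [Program.natW] using hb
    simp [Store.setNat, this]
  | setReal σ a i j e =>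
    refine ⟨fun b _ => rfl, fun b hb => ?_⟩
    funext i' j'
    have : b ≠ a := by simpa [Program.realW] using hb
    simp [Store.setReal, this]
  | seq c d σ τ ρ s t _ _ h1 h2 =>
    exact (h1.mono (by simp [Program.natW]) (by simp [Program.realW])).trans
      (h2.mono (by simp [Program.natW]) (by simp [Program.realW]))
  | branchTrue b c d σ τ t _ _ h1 =>
    exact h1.mono (by simp [Program.natW]) (by simp [Program.realW])
  | branchFalse b c d σ τ t _ _ h1 =>
    exact h1.mono (by simp [Program.natW]) (by simp [Program.realW])
  | loopEnd b c σ _ => exact Frame.refl _ _ _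
  | loopStep b c σ τ ρ s t _ _ _ h1 h2 => exact Frame.trans h1 h2

theorem Runs.mono {c : Program} {σ : Store} {T T' : ℕ} {Q Q' : Store → Prop}
    (h : Runs c σ T Q) (hT : T ≤ T') (hQ : ∀ τ, Q τ → Q' τ) : Runs c σ T' Q' := by
  obtain ⟨t, τ, h1, h2, h3⟩ := h
  exact ⟨t, τ, h1, h2.trans hT, hQ _ h3⟩

theorem Runs.frame {c : Program} {σ : Store} {T : ℕ} {Q : Store → Prop}
    (h : Runs c σ T Q) : Runs c σ T fun τ => Q τ ∧ Frame c.natW c.realW σ τ := by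
  obtain ⟨t, τ, h1, h2, h3⟩ := h
  exact ⟨t, τ, h1, h2, h3, h1.frame⟩

/-- The second program may also use the frame of the first, so specifications need to mention only
what changes. -/
theorem Runs.seq {c d : Program} {σ : Store} {T₁ T₂ : ℕ} {Q Q' : Store → Prop}
    (h : Runs c σ T₁ Q) (h' : ∀ τ, Q τ → Frame c.natW c.realW σ τ → Runs d τ T₂ Q') :
    Runs (.seq c d) σ (T₁ + T₂) Q' := by
  obtain ⟨t, τ, h1, h2, h3⟩ := h
  obtain ⟨t', τ', h1', h2', h3'⟩ := h' τ h3 h1.frame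
  exact ⟨t + t', τ', .seq _ _ _ _ _ _ _ h1 h1', by omega, h3'⟩

theorem Runs.branch {b : Test} {c d : Program} {σ : Store} {T : ℕ} {Q : Store → Prop}
    (hc : b.holds σ → Runs c σ T Q) (hd : ¬ b.holds σ → Runs d σ T Q) :
    Runs (.branch b c d) σ (b.cost + T) Q := by
  by_cases hb : b.holds σ
  · obtain ⟨t, τ, h1, h2, h3⟩ := hc hb
    exact ⟨_, τ, .branchTrue _ _ _ _ _ _ hb h1, by omega, h3⟩
  · obtain ⟨t, τ, h1, h2, h3⟩ := hd hb
    exact ⟨_, τ, .branchFalse _ _ _ _ _ _ hb h1, by omega, h3⟩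

/-- The rule for loops: `I k` is the invariant when at most `k` more iterations are needed. -/
theorem Runs.loop {b : Test} {c : Program} {T : ℕ} (I : ℕ → Store → Prop)
    (hI : ∀ k τ, I k τ → b.holds τ → ∃ k', k = k' + 1 ∧ Runs c τ T (I k')) {k : ℕ} {σ : Store}
    (h0 : I k σ) :
    Runs (.loop b c) σ (k * (b.cost + T) + b.cost) fun τ => (∃ k', I k' τ) ∧ ¬ b.holds τ := by
  induction k generalizing σ with
  | zero =>
    by_cases hb : b.holds σ
    · obtain ⟨k', h, -⟩ := hI _ _ h0 hb
      omega
    · exact ⟨_, σ, .loopEnd _ _ _ hb, by omega, ⟨_, h0⟩, hb⟩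
  | succ k ih =>
    by_cases hb : b.holds σ
    · obtain ⟨k', h, t, τ, h1, h2, h3⟩ := hI _ _ h0 hb
      obtain rfl : k' = k := by omega
      obtain ⟨t', τ', h1', h2', h3'⟩ := ih h3
      refine ⟨_, τ', .loopStep _ _ _ _ _ _ _ hb h1 h1', ?_, h3'⟩
      have : (k' + 1) * (b.cost + T) = k' * (b.cost + T) + (b.cost + T) := by ring
      omega
    · exact ⟨_, σ, .loopEnd _ _ _ hb, by omega, ⟨_, h0⟩, hb⟩

/-! #### Straight-line programs -/

/-- Programs without loops. -/
def Program.loopFree : Program → Bool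
  | .skip => true
  | .setNat _ _ _ _ => true
  | .setReal _ _ _ _ => true
  | .seq c d => c.loopFree && d.loopFree
  | .branch _ c d => c.loopFree && d.loopFree
  | .loop _ _ => false

/-- The running time of a program without loops is at most this number. -/
def Program.maxCost : Program → ℕ
  | .skip => 1
  | .setNat _ i j e => i.cost + j.cost + e.cost + 1
  | .setReal _ i j e => i.cost + j.cost + e.cost + 1
  | .seq c d => c.maxCost + d.maxCost
  | .branch b c d => b.cost + max c.maxCost d.maxCost
  | .loop _ _ => 0

open Classical in
/-- The effect of a program without loops. -/
noncomputable def Program.step : Program → Store → Store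
  | .skip, σ => σ
  | .setNat a i j e, σ => σ.setNat a (i.eval σ) (j.eval σ) (e.eval σ)
  | .setReal a i j e, σ => σ.setReal a (i.eval σ) (j.eval σ) (e.eval σ)
  | .seq c d, σ => d.step (c.step σ)
  | .branch b c d, σ => if b.holds σ then c.step σ else d.step σ
  | .loop _ _, σ => σ

theorem Program.runs_step (c : Program) (h : c.loopFree = true) (σ : Store) :
    Runs c σ c.maxCost fun τ => τ = c.step σ := by
  induction c generalizing σ with
  | skip => exact ⟨_, _, .skip _, le_rfl, rfl⟩
  | setNat a i j e => exact ⟨_, _, .setNat _ _ _ _ _, le_rfl, rfl⟩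
  | setReal a i j e => exact ⟨_, _, .setReal _ _ _ _ _, le_rfl, rfl⟩
  | seq c d hc hd =>
    simp only [Program.loopFree, Bool.and_eq_true] at h
    exact (hc h.1 σ).seq fun τ hτ _ => by subst hτ; exact hd h.2 _
  | branch b c d hc hd =>
    simp only [Program.loopFree, Bool.and_eq_true] at h
    refine Runs.branch (fun hb => ?_) fun hb => ?_
    · exact (hc h.1 σ).mono (le_max_left _ _) fun τ hτ => by simp [Program.step, hb, hτ]
    · exact (hd h.2 σ).mono (le_max_right _ _) fun τ hτ => by simp [Program.step, hb, hτ]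
  | loop b c _ => simp [Program.loopFree] at h

/-- Loop-free code is executed symbolically: `step` is unfolded by simplification and `maxCost` is a
numeral that can be decided. -/
theorem Runs.of_step {c : Program} {σ : Store} {T : ℕ} {Q : Store → Prop}
    (h : c.loopFree = true) (hT : c.maxCost ≤ T) (hQ : Q (c.step σ)) : Runs c σ T Q :=
  (c.runs_step h σ).mono hT fun τ hτ => hτ ▸ hQ

/-! #### Abbreviations -/

/-- The row of the scratch arrays of the subroutine. -/
abbrev rv : NatExp := .read 9 (.const 0) (.const 0)

/-- `x ← 0; while x < N: c; x ← x + 1`, where `x` is the cell `(i, 0)` of the array `a`. -/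
def forLoop (i : NatExp) (a : ℕ) (N : NatExp) (c : Program) : Program :=
  .seq (.setNat a i (.const 0) (.const 0))
    (.loop (.natLE (.add (.read a i (.const 0)) (.const 1)) N)
      (.seq c (.setNat a i (.const 0) (.add (.read a i (.const 0)) (.const 1)))))

/-- Equality of natural numbers. -/
def natEq (e f : NatExp) : Test := .natLE (.add (.sub e f) (.sub f e)) (.const 0)

@[simp] theorem natEq_holds (e f : NatExp) (σ : Store) :
    (natEq e f).holds σ ↔ e.eval σ = f.eval σ := by
  simp only [natEq, Test.holds, NatExp.eval]
  omega

/-- Strict comparison of reals. -/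
abbrev realLT (e f : RealExp) : Test := .neg (.realLE f e)

/-- The address of the counter and the bound are expressions. Hypotheses `hr` and `hn` say that
their values survive whatever the body may write. The invariant is asserted after the counter has
been advanced, which is why the conclusion of `hI` contains `setNat`. -/
theorem Runs.for_loop {i N : NatExp} {a : ℕ} {c : Program} {σ : Store} {r n T : ℕ}
    (I : ℕ → Store → Prop) (hi : i.cost ≤ 5) (hN : N.cost ≤ 10)
    (hr : ∀ τ, Frame (a :: c.natW) c.realW σ τ → i.eval τ = r)
    (hn : ∀ τ, Frame (a :: c.natW) c.realW σ τ → N.eval τ = n)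
    (ha : a ∉ c.natW)
    (h0 : I 0 (σ.setNat a r 0 0))
    (hI : ∀ k < n, ∀ τ, Frame (a :: c.natW) c.realW σ τ → τ.nat a r 0 = k → I k τ →
      Runs c τ T fun ρ => I (k + 1) (ρ.setNat a r 0 (k + 1))) :
    Runs (forLoop i a N c) σ (n * (T + 40) + 40) fun τ => I n τ ∧ τ.nat a r 0 = n := by
  have fset : ∀ (τ : Store) (x : ℕ), Frame (a :: c.natW) c.realW τ (τ.setNat a r 0 x) := by
    intro τ x
    refine ⟨fun b hb => ?_, fun b _ => rfl⟩
    have : b ≠ a := fun h => hb (by simp [h])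
    funext i' j'
    simp [Store.setNat, this]
  have e0 := hr σ (Frame.refl _ _ _)
  unfold forLoop
  have h1 : Runs (.setNat a i (.const 0) (.const 0)) σ 8 fun τ => τ = σ.setNat a r 0 0 := by
    refine Runs.of_step rfl ?_ ?_
    · simp [Program.maxCost, NatExp.cost]; omega
    · simp [Program.step, NatExp.eval, e0]
  have h2 := h1.seq (d := .loop (.natLE (.add (.read a i (.const 0)) (.const 1)) N)
      (.seq c (.setNat a i (.const 0) (.add (.read a i (.const 0)) (.const 1)))))
    (T₂ := n * (20 + (T + 16)) + 20) (Q' := fun τ => I n τ ∧ τ.nat a r 0 = n) ?_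
  · exact h2.mono (by ring_nf; omega) fun _ h => h
  rintro τ rfl -
  -- Here `k` is the number of iterations still to come and `x` the current value of the counter.
  let J : ℕ → Store → Prop := fun k τ => Frame (a :: c.natW) c.realW σ τ ∧
    ∃ x, k + x = n ∧ τ.nat a r 0 = x ∧ I x τ
  have hc : (Test.natLE (.add (.read a i (.const 0)) (.const 1)) N).cost ≤ 20 := by
    simp [Test.cost, NatExp.cost]; omega
  have h3 := Runs.loop (b := .natLE (.add (.read a i (.const 0)) (.const 1)) N)
    (c := .seq c (.setNat a i (.const 0) (.add (.read a i (.const 0)) (.const 1))))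
    (T := T + 16) J ?_ (k := n) (σ := σ.setNat a r 0 0)
    ⟨fset _ _, 0, rfl, by simp [Store.setNat], h0⟩
  · refine h3.mono (by gcongr) ?_
    rintro τ ⟨⟨k, hf, x, hx, hx', hx''⟩, hb⟩
    simp only [Test.holds, NatExp.eval, hr τ hf, hn τ hf, hx'] at hb
    obtain rfl : x = n := by omega
    exact ⟨hx'', hx'⟩
  · rintro k τ ⟨hf, x, hx, hx', hx''⟩ hb
    simp only [Test.holds, NatExp.eval, hr τ hf, hn τ hf, hx'] at hb
    refine ⟨k - 1, by omega, ?_⟩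
    refine (hI x (by omega) τ hf hx' hx'').seq ?_
    intro ρ hρ fr
    have fr' : Frame (a :: c.natW) c.realW σ ρ :=
      hf.trans (fr.mono (by simp) (by simp))
    have hxρ : ρ.nat a r 0 = x := by rw [fr.1 a ha, hx']
    refine Runs.of_step rfl ?_ ?_
    · simp [Program.maxCost, NatExp.cost]; omega
    · simp only [Program.step, NatExp.eval, hr ρ fr', hxρ]
      exact ⟨fr'.trans (fset _ _), x + 1, by omega, by simp [Store.setNat], hρ⟩

/-! #### Relocation of a subroutine

A local program reads the input and its own arrays (numbered from `100` on), and these only in the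
row given by the cell `(0, 0)` of the natural array `9`; it writes only to this row. -/

/-- Local expressions. -/
def NatExp.isLocal : NatExp → Bool
  | .const _ => true
  | .read a (.const 0) (.const 0) => a == 0 || a == 1
  | .read a (.read 9 (.const 0) (.const 0)) j => decide (100 ≤ a) && j.isLocal
  | .read _ _ _ => false
  | .add e f => e.isLocal && f.isLocal
  | .sub e f => e.isLocal && f.isLocal

/-- Local expressions. -/
def RealExp.isLocal : RealExp → Bool
  | .const _ => true
  | .read a (.read 9 (.const 0) (.const 0)) j => decide (100 ≤ a) && j.isLocal
  | .read a i j => a == 0 && i.isLocal && j.isLocal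
  | .add e f => e.isLocal && f.isLocal
  | .sub e f => e.isLocal && f.isLocal
  | .mul e f => e.isLocal && f.isLocal
  | .div e f => e.isLocal && f.isLocal

/-- Local tests. -/
def Test.isLocal : Test → Bool
  | .natLE e f => e.isLocal && f.isLocal
  | .realLE e f => e.isLocal && f.isLocal
  | .neg b => b.isLocal

/-- Local programs. -/
def Program.isLocal : Program → Bool
  | .skip => true
  | .setNat a (.read 9 (.const 0) (.const 0)) j e => decide (100 ≤ a) && j.isLocal && e.isLocal
  | .setNat _ _ _ _ => false
  | .setReal a (.read 9 (.const 0) (.const 0)) j e => decide (100 ≤ a) && j.isLocal && e.isLocal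
  | .setReal _ _ _ _ => false
  | .seq c d => c.isLocal && d.isLocal
  | .branch b c d => b.isLocal && c.isLocal && d.isLocal
  | .loop b c => b.isLocal && c.isLocal

/-- The row `r` of `σ` looks to local programs like the row `r'` of `σ'`. -/
structure Sim (r : ℕ) (σ : Store) (r' : ℕ) (σ' : Store) : Prop where
  row : σ.nat 9 0 0 = r
  row' : σ'.nat 9 0 0 = r'
  size : σ.nat 0 0 0 = σ'.nat 0 0 0
  number : σ.nat 1 0 0 = σ'.nat 1 0 0
  weights : ∀ i j, σ.real 0 i j = σ'.real 0 i j
  nat : ∀ a, 100 ≤ a → ∀ j, σ.nat a r j = σ'.nat a r' j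
  real : ∀ a, 100 ≤ a → ∀ j, σ.real a r j = σ'.real a r' j

/-- `τ` differs from `σ` at most in the row `r` of the arrays from `100` on. -/
def RowFrame (r : ℕ) (σ τ : Store) : Prop :=
  (∀ a i j, ¬ (100 ≤ a ∧ i = r) → τ.nat a i j = σ.nat a i j) ∧
    ∀ a i j, ¬ (100 ≤ a ∧ i = r) → τ.real a i j = σ.real a i j

theorem Sim.natEval {r r' : ℕ} {σ σ' : Store} (h : Sim r σ r' σ') (e : NatExp)
    (he : e.isLocal = true) : e.eval σ = e.eval σ' := by
  fun_induction NatExp.isLocal e with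
  | case1 => rfl
  | case2 a =>
    simp only [Bool.or_eq_true, beq_iff_eq] at he
    rcases he with rfl | rfl
    · simpa [NatExp.eval] using h.size
    · simpa [NatExp.eval] using h.number
  | case3 a j ih =>
    simp only [Bool.and_eq_true, decide_eq_true_eq] at he
    simp only [NatExp.eval, h.row, h.row', ih he.2]
    exact h.nat a he.1 _
  | case4 => simp at he
  | case5 e f ih1 ih2 =>
    simp only [Bool.and_eq_true] at he
    simp [NatExp.eval, ih1 he.1, ih2 he.2]
  | case6 e f ih1 ih2 =>
    simp only [Bool.and_eq_true] at he
    simp [NatExp.eval, ih1 he.1, ih2 he.2]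

theorem Sim.realEval {r r' : ℕ} {σ σ' : Store} (h : Sim r σ r' σ') (e : RealExp)
    (he : e.isLocal = true) : e.eval σ = e.eval σ' := by
  fun_induction RealExp.isLocal e with
  | case1 => rfl
  | case2 a j =>
    simp only [Bool.and_eq_true, decide_eq_true_eq] at he
    simp only [RealExp.eval, NatExp.eval, h.row, h.row', h.natEval _ he.2]
    exact h.real a he.1 _
  | case3 a i j =>
    simp only [Bool.and_eq_true, beq_iff_eq] at he
    obtain ⟨⟨rfl, hi⟩, hj⟩ := he
    simp only [RealExp.eval, h.natEval _ hi, h.natEval _ hj]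
    exact h.weights _ _
  | case4 e f ih1 ih2 | case5 e f ih1 ih2 | case6 e f ih1 ih2 | case7 e f ih1 ih2 =>
    simp only [Bool.and_eq_true] at he
    simp [RealExp.eval, ih1 he.1, ih2 he.2]

theorem Sim.testHolds {r r' : ℕ} {σ σ' : Store} (h : Sim r σ r' σ') (b : Test)
    (hb : b.isLocal = true) : b.holds σ ↔ b.holds σ' := by
  induction b with
  | natLE e f =>
    simp only [Test.isLocal, Bool.and_eq_true] at hb
    simp [Test.holds, h.natEval _ hb.1, h.natEval _ hb.2]
  | realLE e f =>
    simp only [Test.isLocal, Bool.and_eq_true] at hb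
    simp [Test.holds, h.realEval _ hb.1, h.realEval _ hb.2]
  | neg b ih => simpa [Test.holds] using not_congr (ih hb)

theorem Sim.setNat {r r' : ℕ} {σ σ' : Store} (h : Sim r σ r' σ') {a : ℕ} (ha : 100 ≤ a)
    (j x : ℕ) : Sim r (σ.setNat a r j x) r' (σ'.setNat a r' j x) where
  row := by simpa [Store.setNat, show (9 : ℕ) ≠ a by omega] using h.row
  row' := by simpa [Store.setNat, show (9 : ℕ) ≠ a by omega] using h.row'
  size := by simpa [Store.setNat, show (0 : ℕ) ≠ a by omega] using h.size
  number := by simpa [Store.setNat, show (1 : ℕ) ≠ a by omega] using h.number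
  weights := h.weights
  nat b hb i := by
    by_cases hc : b = a ∧ i = j
    · simp [Store.setNat, hc]
    · have := h.nat b hb i
      simpa [Store.setNat, hc] using this
  real := h.real

theorem Sim.setReal {r r' : ℕ} {σ σ' : Store} (h : Sim r σ r' σ') {a : ℕ} (ha : 100 ≤ a)
    (j : ℕ) (x : ℝ) : Sim r (σ.setReal a r j x) r' (σ'.setReal a r' j x) where
  row := h.row
  row' := h.row'
  size := h.size
  number := h.number
  weights i i' := by simpa [Store.setReal, show (0 : ℕ) ≠ a by omega] using h.weights i i'
  nat := h.nat
  real b hb i := by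
    by_cases hc : b = a ∧ i = j
    · simp [Store.setReal, hc]
    · have := h.real b hb i
      simpa [Store.setReal, hc] using this

theorem RowFrame.trans {r : ℕ} {σ τ ρ : Store} (h : RowFrame r σ τ) (h' : RowFrame r τ ρ) :
    RowFrame r σ ρ :=
  ⟨fun a i j hc => (h'.1 a i j hc).trans (h.1 a i j hc),
    fun a i j hc => (h'.2 a i j hc).trans (h.2 a i j hc)⟩

/-- Local programs can be relocated, and leave everything but their row alone. -/
theorem Exec.sim {c : Program} {σ τ σ' : Store} {t r r' : ℕ} (h : Exec c σ t τ)
    (hc : c.isLocal = true) (hs : Sim r σ r' σ') :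
    ∃ τ', Exec c σ' t τ' ∧ Sim r τ r' τ' ∧ RowFrame r' σ' τ' := by
  induction h generalizing σ' with
  | skip σ => exact ⟨σ', .skip _, hs, fun _ _ _ _ => rfl, fun _ _ _ _ => rfl⟩
  | setNat σ a i j e =>
    unfold Program.isLocal at hc
    -- Of all assignments only those to the row `rv` are local; the other cases contradict `hc`.
    split at hc <;> simp_all only [Program.setNat.injEq, reduceCtorEq, Bool.and_eq_true, decide_eq_true_eq,
      Bool.false_eq_true]
    rename_i x1 x2 x3 x4 x5 h5
    obtain ⟨rfl, rfl, rfl, rfl⟩ := h5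
    refine ⟨_, .setNat _ _ _ _ _, ?_, fun b i j hb => ?_, fun _ _ _ _ => rfl⟩
    · simp only [NatExp.eval, hs.row, hs.row', hs.natEval _ hc.1.2, hs.natEval _ hc.2]
      exact hs.setNat hc.1.1 _ _
    · simp only [NatExp.eval, hs.row', Store.setNat]
      rw [if_neg]
      rintro ⟨rfl, rfl, -⟩
      exact hb ⟨hc.1.1, rfl⟩
  | setReal σ a i j e =>
    unfold Program.isLocal at hc
    split at hc <;> simp_all only [Program.setReal.injEq, reduceCtorEq, Bool.and_eq_true, decide_eq_true_eq,
      Bool.false_eq_true]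
    rename_i x1 x2 x3 x4 x5 h5
    obtain ⟨rfl, rfl, rfl, rfl⟩ := h5
    refine ⟨_, .setReal _ _ _ _ _, ?_, fun _ _ _ _ => rfl, fun b i j hb => ?_⟩
    · simp only [NatExp.eval, hs.row, hs.row', hs.natEval _ hc.1.2, hs.realEval _ hc.2]
      exact hs.setReal hc.1.1 _ _
    · simp only [NatExp.eval, hs.row', Store.setReal]
      rw [if_neg]
      rintro ⟨rfl, rfl, -⟩
      exact hb ⟨hc.1.1, rfl⟩
  | seq c d σ τ ρ s t _ _ h1 h2 =>
    simp only [Program.isLocal, Bool.and_eq_true] at hc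
    obtain ⟨τ', a1, a2, a3⟩ := h1 hc.1 hs
    obtain ⟨ρ', b1, b2, b3⟩ := h2 hc.2 a2
    exact ⟨ρ', .seq _ _ _ _ _ _ _ a1 b1, b2, a3.trans b3⟩
  | branchTrue b c d σ τ t hb _ h1 =>
    simp only [Program.isLocal, Bool.and_eq_true] at hc
    obtain ⟨τ', a1, a2, a3⟩ := h1 hc.1.2 hs
    exact ⟨τ', .branchTrue _ _ _ _ _ _ ((hs.testHolds _ hc.1.1).1 hb) a1, a2, a3⟩
  | branchFalse b c d σ τ t hb _ h1 =>
    simp only [Program.isLocal, Bool.and_eq_true] at hc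
    obtain ⟨τ', a1, a2, a3⟩ := h1 hc.2 hs
    exact ⟨τ', .branchFalse _ _ _ _ _ _ (mt (hs.testHolds _ hc.1.1).2 hb) a1, a2, a3⟩
  | loopEnd b c σ hb =>
    simp only [Program.isLocal, Bool.and_eq_true] at hc
    exact ⟨σ', .loopEnd _ _ _ (mt (hs.testHolds _ hc.1).2 hb), hs,
      fun _ _ _ _ => rfl, fun _ _ _ _ => rfl⟩
  | loopStep b c σ τ ρ s t hb _ _ h1 h2 =>
    have hc' := hc
    simp only [Program.isLocal, Bool.and_eq_true] at hc
    obtain ⟨τ', a1, a2, a3⟩ := h1 hc.2 hs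
    obtain ⟨ρ', b1, b2, b3⟩ := h2 hc' a2
    exact ⟨ρ', .loopStep _ _ _ _ _ _ _ ((hs.testHolds _ hc.1).1 hb) a1 b1, b2, a3.trans b3⟩

end RealRAM

/-! ### Moat growing for the prize-collecting problem

The vertices are the naturals below `n`. A component is named by one of its vertices. -/

namespace Moat

open Finset

/-- A state of the growth phase: the component of each vertex, the active components (flag `1`),
the dual load of each vertex and the remaining potential of each component. -/
structure State where
  comp : ℕ → ℕ
  act : ℕ → ℕ
  load : ℕ → ℝ
  pot : ℕ → ℝ

/-- The invariants of the growth phase. -/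
structure Valid (n : ℕ) (w : ℕ → ℕ → ℝ) (s : State) : Prop where
  comp_lt : ∀ v < n, s.comp v < n
  comp_comp : ∀ v < n, s.comp (s.comp v) = s.comp v
  act_comp : ∀ l < n, s.act l = 1 → s.comp l = l
  load_le : ∀ u < n, ∀ v < n, s.comp u ≠ s.comp v → s.load u + s.load v ≤ w u v
  pot_nonneg : ∀ l < n, s.comp l = l → 0 ≤ s.pot l
  pot_zero : ∀ l < n, s.comp l = l → s.act l ≠ 1 → s.pot l = 0

/-- The active components. -/
def actives (n : ℕ) (s : State) : Finset ℕ := (range n).filter fun l => s.act l = 1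

/-- The record of a merge along the edge `u v`: `inact = 1` if the component of `v` was inactive,
and `set` was the vertex set of this component. -/
structure Rec where
  u : ℕ
  v : ℕ
  inact : ℕ
  set : Finset ℕ

/-- All active components grow by `δ`. -/
structure Grow (n : ℕ) (δ : ℝ) (s s' : State) : Prop where
  nonneg : 0 ≤ δ
  comp : ∀ v < n, s'.comp v = s.comp v
  act : ∀ l < n, s'.act l = s.act l
  load : ∀ v < n, s'.load v = s.load v + if s.act (s.comp v) = 1 then δ else 0
  pot : ∀ l < n, s.comp l = l → s'.pot l = s.pot l - if s.act l = 1 then δ else 0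

/-- Some active component becomes inactive. -/
structure Deact (n : ℕ) (s s' : State) : Prop where
  comp : ∀ v < n, s'.comp v = s.comp v
  act : ∀ l < n, s'.act l = 1 → s.act l = 1
  load : ∀ v < n, s'.load v = s.load v
  pot : ∀ l < n, s.comp l = l → s'.pot l = s.pot l

/-- The active component of `u` absorbs the component of `v`. -/
structure Merge (n : ℕ) (w : ℕ → ℕ → ℝ) (u v : ℕ) (s s' : State) : Prop where
  u_lt : u < n
  v_lt : v < n
  ne : s.comp u ≠ s.comp v
  act_u : s.act (s.comp u) = 1
  tight : s.load u + s.load v = w u v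
  comp : ∀ z < n, s'.comp z = if s.comp z = s.comp v then s.comp u else s.comp z
  act : ∀ l < n, s'.act l = if l = s.comp v then 0 else s.act l
  load : ∀ z < n, s'.load z = s.load z
  pot : ∀ l < n, s.comp l = l → l ≠ s.comp v →
    s'.pot l = s.pot l + if l = s.comp u then s.pot (s.comp v) else 0

/-- The record of a merge. -/
def mergeRec (n u v : ℕ) (s : State) : Rec where
  u := u
  v := v
  inact := if s.act (s.comp v) = 1 then 0 else 1
  set := (range n).filter fun z => s.comp z = s.comp v

/-- `Hist n m w s₀ rs D s`: the growth phase leads from `s₀` to `s`, with the merges `rs`, and the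
integral of the excess of the number of active components over `m` is `D`. -/
inductive Hist (n m : ℕ) (w : ℕ → ℕ → ℝ) (s₀ : State) : List Rec → ℝ → State → Prop
  | start : Hist n m w s₀ [] 0 s₀
  | grow (rs : List Rec) (D : ℝ) (s s' : State) (δ : ℝ) (h : Hist n m w s₀ rs D s)
      (hs : Valid n w s) (g : Grow n δ s s') :
      Hist n m w s₀ rs (D + δ * ((actives n s).card - m)) s'
  | deact (rs : List Rec) (D : ℝ) (s s' : State) (h : Hist n m w s₀ rs D s)
      (hs : Valid n w s) (g : Deact n s s') : Hist n m w s₀ rs D s'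
  | merge (rs : List Rec) (D : ℝ) (s s' : State) (u v : ℕ) (h : Hist n m w s₀ rs D s)
      (hs : Valid n w s) (g : Merge n w u v s s') :
      Hist n m w s₀ (rs ++ [mergeRec n u v s]) D s'

/-! #### The dual lower bound -/

/-- The weight of a path after the loads have been subtracted; edges inside components are free. -/
noncomputable def crossCost (w : ℕ → ℕ → ℝ) (s : State) : List ℕ → ℝ
  | [] => 0
  | [_] => 0
  | x :: y :: l =>
      (if s.comp x = s.comp y then 0 else w x y - s.load x - s.load y) + crossCost w s (y :: l)

/-- No path meets the component `l`. -/
def Untouched {m : ℕ} (s : State) (P : Fin m → List ℕ) (l : ℕ) : Prop :=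
  ∀ i, ∀ x ∈ P i, s.comp x ≠ l

open Classical in
/-- The cost of a family of paths with respect to the remaining weights and potentials. -/
noncomputable def restCost {m : ℕ} (n : ℕ) (w : ℕ → ℕ → ℝ) (s : State) (P : Fin m → List ℕ) : ℝ :=
  ∑ i, crossCost w s (P i) +
    ∑ l ∈ range n, if s.comp l = l ∧ Untouched s P l then s.pot l else 0

theorem crossCost_nonneg {n : ℕ} {w : ℕ → ℕ → ℝ} {s : State} (hs : Valid n w s) :
    ∀ l : List ℕ, (∀ x ∈ l, x < n) → 0 ≤ crossCost w s l
  | [], _ => le_rfl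
  | [_], _ => le_rfl
  | x :: y :: l, h => by
    have h1 := crossCost_nonneg hs (y :: l) fun z hz => h z (by simp [hz])
    simp only [crossCost]
    split_ifs with hc
    · simpa using h1
    · have := hs.load_le x (h x (by simp)) y (h y (by simp)) hc
      linarith

theorem restCost_nonneg {m n : ℕ} {w : ℕ → ℕ → ℝ} {s : State} (hs : Valid n w s)
    {P : Fin m → List ℕ} (hP : ∀ i, ∀ x ∈ P i, x < n) : 0 ≤ restCost n w s P := by
  refine add_nonneg (sum_nonneg fun i _ => crossCost_nonneg hs _ (hP i)) (sum_nonneg fun l hl => ?_)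
  split_ifs with h
  · exact hs.pot_nonneg l (mem_range.1 hl) h.1
  · exact le_rfl

/-- The number of active components met by a path is at most one more than the number of active
ends of its crossing edges. -/
theorem card_touched_le {n : ℕ} {s : State} : ∀ l : List ℕ,
    (((actives n s).filter fun c => ∃ x ∈ l, s.comp x = c).card : ℝ) ≤
      1 + crossCost (fun _ _ => 0) { s with load := fun v => if s.act (s.comp v) = 1 then -1 else 0 }
        l
  -- For zero weights and load `-1` on active components, `crossCost` counts the active ends of
  -- crossing edges.
  | [] => by simp [crossCost]
  | [x] => by
    simp only [crossCost, add_zero, List.mem_singleton, exists_eq_left]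
    norm_cast
    exact card_le_one.2 fun a ha b hb => by
      rw [mem_filter] at ha hb
      exact ha.2.symm.trans hb.2
  | x :: y :: l => by
    have ih := card_touched_le (n := n) (s := s) (y :: l)
    simp only [crossCost]
    by_cases hc : s.comp x = s.comp y
    · rw [if_pos hc, zero_add]
      refine le_trans ?_ ih
      norm_cast
      refine card_le_card fun c hx => ?_
      rw [mem_filter] at hx ⊢
      obtain ⟨hx, z, hz, rfl⟩ := hx
      refine ⟨hx, ?_⟩
      rcases List.mem_cons.1 hz with rfl | hz
      · exact ⟨y, by simp, hc.symm⟩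
      · exact ⟨z, hz, rfl⟩
    · rw [if_neg hc]
      -- The new first vertex contributes a new component only if its own component is active, and
      -- then the crossing edge has an active end at `x`. The end at `y` can only help.
      have h1 : ((((actives n s).filter fun c => ∃ z ∈ x :: y :: l, s.comp z = c).card : ℕ) : ℝ) ≤
          (((actives n s).filter fun c => ∃ z ∈ y :: l, s.comp z = c).card : ℝ) +
            if s.act (s.comp x) = 1 then 1 else 0 := by
        have : ((actives n s).filter fun c => ∃ z ∈ x :: y :: l, s.comp z = c) ⊆
            ((actives n s).filter fun c => ∃ z ∈ y :: l, s.comp z = c) ∪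
              if s.act (s.comp x) = 1 then {s.comp x} else ∅ := by
          intro c hcc
          rw [mem_filter] at hcc
          obtain ⟨ha, z, hz, rfl⟩ := hcc
          rcases List.mem_cons.1 hz with rfl | hz
          · have : s.act (s.comp z) = 1 := (mem_filter.1 ha).2
            simp [this]
          · exact mem_union_left _ (mem_filter.2 ⟨ha, z, hz, rfl⟩)
        refine (Nat.cast_le.2 ((card_le_card this).trans (card_union_le _ _))).trans ?_
        push_cast
        gcongr
        split_ifs <;> simp
      refine h1.trans ?_
      have h2 : (0 : ℝ) ≤ if s.act (s.comp y) = 1 then 1 else 0 := by split_ifs <;> simp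
      have e : ∀ c : ℕ, (if s.act c = 1 then (-1 : ℝ) else 0) = -if s.act c = 1 then 1 else 0 := by
        intro c; split_ifs <;> simp
      simp only [e] at ih ⊢
      linarith

/-- A crossing edge loses `δ` for each of its active ends, and the second `crossCost` counts these
ends. -/
theorem crossCost_grow {n : ℕ} {w : ℕ → ℕ → ℝ} {s s' : State} {δ : ℝ} (g : Grow n δ s s') :
    ∀ l : List ℕ, (∀ x ∈ l, x < n) → crossCost w s l = crossCost w s' l + δ *
      crossCost (fun _ _ => 0) { s with load := fun v => if s.act (s.comp v) = 1 then -1 else 0 } l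
  | [], _ => by simp [crossCost]
  | [_], _ => by simp [crossCost]
  | x :: y :: l, h => by
    have ih := crossCost_grow (w := w) g (y :: l) fun z hz => h z (by simp [hz])
    have hx := h x (by simp)
    have hy := h y (by simp)
    simp only [crossCost, g.comp x hx, g.comp y hy, ih, g.load x hx, g.load y hy]
    split_ifs <;> ring

/-- This is the dual bound. An active component missed by all paths loses `δ` of its potential; a
path meeting `a` active components loses at least `δ (a - 1)` on its crossing edges. Over `m` paths
the loss is at least `δ` times the number of active components minus `m`. -/
theorem restCost_grow {m n : ℕ} {w : ℕ → ℕ → ℝ} {s s' : State} {δ : ℝ} (hs : Valid n w s)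
    (g : Grow n δ s s') {P : Fin m → List ℕ} (hP : ∀ i, ∀ x ∈ P i, x < n) :
    restCost n w s' P + δ * ((actives n s).card - m) ≤ restCost n w s P := by
  classical
  have h1 : ∀ l ∈ range n, (if s.comp l = l ∧ Untouched s P l then s.pot l else 0) =
      (if s'.comp l = l ∧ Untouched s' P l then s'.pot l else 0) +
        δ * if s.act l = 1 ∧ Untouched s P l then 1 else 0 := by
    intro l hl
    have hl := mem_range.1 hl
    have hu : Untouched s' P l ↔ Untouched s P l := by
      constructor
      · intro h i x hx
        rw [← g.comp x (hP i x hx)]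
        exact h i x hx
      · intro h i x hx
        rw [g.comp x (hP i x hx)]
        exact h i x hx
    rw [g.comp l hl, hu]
    by_cases hc : s.comp l = l ∧ Untouched s P l
    · rw [if_pos hc, if_pos hc, g.pot l hl hc.1]
      simp only [hc.2, and_true]
      split_ifs <;> ring
    · rw [if_neg hc, if_neg hc, if_neg]
      · ring
      · exact fun h => hc ⟨hs.act_comp l hl h.1, h.2⟩
  have h2 : ∑ l ∈ range n, (if s.act l = 1 ∧ Untouched s P l then (1 : ℝ) else 0) =
      ((actives n s).filter fun l => Untouched s P l).card := by
    rw [actives, filter_filter, sum_boole]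
  -- Each active component is untouched or met by one of the paths.
  have h3 : ((actives n s).card : ℝ) ≤ ((actives n s).filter fun l => Untouched s P l).card +
      ∑ i, (((actives n s).filter fun c => ∃ x ∈ P i, s.comp x = c).card : ℝ) := by
    have : actives n s ⊆ ((actives n s).filter fun l => Untouched s P l) ∪
        univ.biUnion fun i => (actives n s).filter fun c => ∃ x ∈ P i, s.comp x = c := by
      intro c hc
      by_cases hu : Untouched s P c
      · exact mem_union_left _ (mem_filter.2 ⟨hc, hu⟩)
      · simp only [Untouched, not_forall, not_not] at hu
        obtain ⟨i, x, hx, h⟩ := hu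
        exact mem_union_right _ (mem_biUnion.2 ⟨i, mem_univ _, mem_filter.2 ⟨hc, x, hx, h⟩⟩)
    have := (card_le_card this).trans ((card_union_le _ _).trans
      (Nat.add_le_add_left card_biUnion_le _))
    exact_mod_cast this
  have h4 := h3.trans (add_le_add_right (sum_le_sum fun i (_ : i ∈ univ) =>
    card_touched_le (n := n) (s := s) (P i)) _)
  rw [sum_add_distrib, sum_const, card_univ, Fintype.card_fin, nsmul_eq_mul, mul_one] at h4
  unfold restCost
  rw [sum_congr rfl h1, sum_add_distrib, ← mul_sum, h2,
    sum_congr rfl fun i _ => crossCost_grow (w := w) g (P i) (hP i), sum_add_distrib, ← mul_sum]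
  nlinarith [mul_le_mul_of_nonneg_left h4 g.nonneg]

/-- Edges between the two components become free, and what remained of their weight was nonnegative
by `load_le`. -/
theorem crossCost_merge {n : ℕ} {w : ℕ → ℕ → ℝ} {u v : ℕ} {s s' : State} (hs : Valid n w s)
    (g : Merge n w u v s s') : ∀ l : List ℕ, (∀ x ∈ l, x < n) →
      crossCost w s' l ≤ crossCost w s l
  | [], _ => by simp [crossCost]
  | [_], _ => by simp [crossCost]
  | x :: y :: l, h => by
    have ih := crossCost_merge hs g (y :: l) fun z hz => h z (by simp [hz])
    have hx := h x (by simp)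
    have hy := h y (by simp)
    simp only [crossCost, g.load x hx, g.load y hy]
    refine add_le_add ?_ ih
    by_cases hc : s.comp x = s.comp y
    · rw [if_pos hc, if_pos (by rw [g.comp x hx, g.comp y hy, hc])]
    · rw [if_neg hc]
      split_ifs
      · linarith [hs.load_le x hx y hy hc]
      · exact le_rfl

/-- The effect of a merge on a sum over components. -/
theorem sum_merge_le {n : ℕ} {w : ℕ → ℕ → ℝ} {u v : ℕ} {s s' : State} (hs : Valid n w s)
    (g : Merge n w u v s s') (f f' : ℕ → ℝ) (hv : f' (s.comp v) ≤ 0)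
    (hu : f' (s.comp u) ≤ f (s.comp u) + f (s.comp v))
    (hf : ∀ l < n, l ≠ s.comp u → l ≠ s.comp v → f' l ≤ f l) :
    ∑ l ∈ range n, f' l ≤ ∑ l ∈ range n, f l := by
  have h1 : s.comp u ∈ range n := mem_range.2 (hs.comp_lt u g.u_lt)
  have h2 : s.comp v ∈ (range n).erase (s.comp u) :=
    mem_erase.2 ⟨g.ne.symm, mem_range.2 (hs.comp_lt v g.v_lt)⟩
  rw [← add_sum_erase _ _ h1, ← add_sum_erase _ _ h1, ← add_sum_erase _ _ h2,
    ← add_sum_erase _ _ h2]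
  have h3 := sum_le_sum (s := ((range n).erase (s.comp u)).erase (s.comp v)) (f := f') (g := f)
    fun l hl => by
      simp only [mem_erase, mem_range] at hl
      exact hf l hl.2.2 hl.2.1 hl.1
  linarith

theorem Merge.comp_u {n : ℕ} {w : ℕ → ℕ → ℝ} {u v : ℕ} {s s' : State} (hs : Valid n w s)
    (g : Merge n w u v s s') : s'.comp (s.comp u) = s.comp u := by
  rw [g.comp _ (hs.comp_lt u g.u_lt), hs.comp_comp u g.u_lt, if_neg g.ne]

theorem Merge.comp_v {n : ℕ} {w : ℕ → ℕ → ℝ} {u v : ℕ} {s s' : State} (hs : Valid n w s)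
    (g : Merge n w u v s s') : s'.comp (s.comp v) = s.comp u := by
  rw [g.comp _ (hs.comp_lt v g.v_lt), hs.comp_comp v g.v_lt, if_pos rfl]

theorem Merge.comp_self {n : ℕ} {w : ℕ → ℕ → ℝ} {u v : ℕ} {s s' : State} (hs : Valid n w s)
    (g : Merge n w u v s s') {l : ℕ} (hl : l < n) :
    s'.comp l = l ↔ s.comp l = l ∧ l ≠ s.comp v := by
  constructor
  · intro h
    have hne : l ≠ s.comp v := by
      rintro rfl
      rw [g.comp_v hs] at h
      exact g.ne h
    rw [g.comp l hl] at h
    split_ifs at h with hc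
    · subst h
      rw [hs.comp_comp u g.u_lt] at hc
      exact absurd hc g.ne
    · exact ⟨h, hne⟩
  · rintro ⟨h, hne⟩
    rw [g.comp l hl, h, if_neg hne]

/-- If the union is untouched, so were both parts, and its potential is the sum of theirs. If it is
touched, it contributes nothing, whereas the parts contributed nonnegative amounts. -/
theorem restCost_merge {m n : ℕ} {w : ℕ → ℕ → ℝ} {u v : ℕ} {s s' : State} (hs : Valid n w s)
    (g : Merge n w u v s s') {P : Fin m → List ℕ} (hP : ∀ i, ∀ x ∈ P i, x < n) :
    restCost n w s' P ≤ restCost n w s P := by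
  classical
  refine add_le_add (sum_le_sum fun i _ => crossCost_merge hs g _ (hP i))
    (sum_merge_le hs g _ _ ?_ ?_ ?_)
  · rw [if_neg]
    rintro ⟨h, -⟩
    rw [g.comp_v hs] at h
    exact g.ne h
  · have hcu := hs.comp_lt u g.u_lt
    have hcv := hs.comp_lt v g.v_lt
    have a1 : 0 ≤ if s.comp (s.comp u) = s.comp u ∧ Untouched s P (s.comp u)
        then s.pot (s.comp u) else 0 := by
      split_ifs with h
      exacts [hs.pot_nonneg _ hcu h.1, le_rfl]
    have a2 : 0 ≤ if s.comp (s.comp v) = s.comp v ∧ Untouched s P (s.comp v)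
        then s.pot (s.comp v) else 0 := by
      split_ifs with h
      exacts [hs.pot_nonneg _ hcv h.1, le_rfl]
    split_ifs with h h1 h2 h2
    · rw [g.pot _ hcu (hs.comp_comp u g.u_lt) g.ne, if_pos rfl]
    · refine absurd ⟨hs.comp_comp v g.v_lt, fun i x hx hc => h.2 i x hx ?_⟩ h2
      rw [g.comp x (hP i x hx), if_pos hc]
    · refine absurd ⟨hs.comp_comp u g.u_lt, fun i x hx hc => h.2 i x hx ?_⟩ h1
      rw [g.comp x (hP i x hx), if_neg (by rw [hc]; exact g.ne), hc]
    · refine absurd ⟨hs.comp_comp u g.u_lt, fun i x hx hc => h.2 i x hx ?_⟩ h1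
      rw [g.comp x (hP i x hx), if_neg (by rw [hc]; exact g.ne), hc]
    all_goals simp_all
    all_goals linarith
  · intro l hl h1 h2
    have hu : Untouched s' P l ↔ Untouched s P l := by
      have : ∀ i, ∀ x ∈ P i, s'.comp x = l ↔ s.comp x = l := by
        intro i x hx
        rw [g.comp x (hP i x hx)]
        split_ifs with hc
        · exact ⟨fun h => absurd h.symm h1, fun h => absurd (h.symm.trans hc) h2⟩
        · rfl
      simp only [Untouched]
      exact forall_congr' fun i => forall₂_congr fun x hx => not_congr (this i x hx)
    simp only [g.comp_self hs hl, hu, ne_eq, h2, not_false_eq_true, and_true]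
    split_ifs with h
    · rw [g.pot l hl h.1 h2, if_neg h1, add_zero]
    · exact le_rfl

theorem restCost_deact {m n : ℕ} {w : ℕ → ℕ → ℝ} {s s' : State} 
    (g : Deact n s s') {P : Fin m → List ℕ} (hP : ∀ i, ∀ x ∈ P i, x < n) :
    restCost n w s' P = restCost n w s P := by
  classical
  have hc : ∀ l : List ℕ, (∀ x ∈ l, x < n) → crossCost w s' l = crossCost w s l := by
    intro l
    induction l using crossCost.induct with
    | case1 => intro _; rfl
    | case2 => intro _; rfl
    | case3 x y l ih =>
      intro h
      simp only [crossCost, ih fun z hz => h z (by simp [hz]), g.comp x (h x (by simp)),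
        g.comp y (h y (by simp)), g.load x (h x (by simp)), g.load y (h y (by simp))]
  unfold restCost
  congr 1
  · exact sum_congr rfl fun i _ => hc _ (hP i)
  · refine sum_congr rfl fun l hl => ?_
    have hl := mem_range.1 hl
    have hu : Untouched s' P l ↔ Untouched s P l := by
      simp only [Untouched]
      exact forall_congr' fun i => forall₂_congr fun x hx => by rw [g.comp x (hP i x hx)]
    rw [g.comp l hl, hu]
    split_ifs with h
    · exact g.pot l hl h.1
    · rfl

/-- The growth phase yields a lower bound for the cost of every family of paths. -/
theorem Hist.le_restCost {m n : ℕ} {w : ℕ → ℕ → ℝ} {s₀ s : State} {rs : List Rec} {D : ℝ}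
    (h : Hist n m w s₀ rs D s) {P : Fin m → List ℕ} (hP : ∀ i, ∀ x ∈ P i, x < n) :
    D + restCost n w s P ≤ restCost n w s₀ P := by
  induction h with
  | start => simp
  | grow rs D s s' δ _ hs g ih => linarith [restCost_grow hs g hP]
  | deact rs D s s' _ _ g ih => linarith [restCost_deact (w := w) g hP]
  | merge rs D s s' u v _ hs g ih => linarith [restCost_merge hs g hP]

/-! #### Pruning -/

open Classical in
/-- One step of pruning: the edge of the record is accepted unless its ends have been removed
or it leads to an inactive component that meets no accepted edge, which is then removed. -/
noncomputable def prune (r : Rec) (x : Finset ℕ × List (ℕ × ℕ)) : Finset ℕ × List (ℕ × ℕ) :=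
  if r.u ∉ x.1 then x
  else if r.inact = 1 ∧ ∀ e ∈ x.2, e.1 ∉ r.set ∧ e.2 ∉ r.set then (x.1 \ r.set, x.2)
  else (x.1, (r.u, r.v) :: x.2)

/-- The number of ends of edges in the component `l`. -/
def ends (s : State) (E : List (ℕ × ℕ)) (l : ℕ) : ℕ :=
  (E.map fun e => (if s.comp e.1 = l then 1 else 0) + if s.comp e.2 = l then 1 else 0).sum

/-- The invariant of the pruning phase, for the kept vertices `K` and the accepted edges `E`;
`F` consists of the components that are active in the end. -/
structure Good (n m : ℕ) (w : ℕ → ℕ → ℝ) (F : Finset ℕ) (s : State) (K : Finset ℕ)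
    (E : List (ℕ × ℕ)) (D : ℝ) : Prop where
  sub : K ⊆ range n
  sat : ∀ x < n, ∀ y < n, s.comp x = s.comp y → x ∈ K → y ∈ K
  count : ((range n).filter fun l => s.comp l = l ∧ l ∈ K).card = m + E.length
  mem : ∀ e ∈ E, e.1 ∈ K ∧ e.2 ∈ K
  deg : ∀ l ∈ K, s.comp l = l → s.act l ≠ 1 → 2 ≤ ends s E l
  cost : (E.map fun e => w e.1 e.2 - s.load e.1 - s.load e.2).sum +
    2 * ∑ l ∈ range n, (if s.comp l = l ∧ l ∉ K then s.pot l else 0) ≤ 2 * D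
  root : ∀ l ∈ F, l ∈ K ∧ s.comp l = l

theorem ends_congr {s s' : State} {E : List (ℕ × ℕ)} {l : ℕ}
    (h : ∀ e ∈ E, (s'.comp e.1 = l ↔ s.comp e.1 = l) ∧ (s'.comp e.2 = l ↔ s.comp e.2 = l)) :
    ends s' E l = ends s E l := by
  unfold ends
  congr 1
  exact List.map_congr_left fun e he => by simp only [(h e he).1, (h e he).2]

/-- Undoing growth by `δ` raises the reduced cost of the accepted edges by `δ` per active end. There
are `2 |E|` ends, at least two of them at each kept inactive component. Since the kept components
number `m + |E|`, at most `2 (|A| - m)` ends are active, where `A` is the set of kept active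
components. Each discarded active component regains `δ` of potential, counted twice. Both together
give at most `2 δ` times the excess of active components over `m`. -/
theorem Good.grow {n m : ℕ} {w : ℕ → ℕ → ℝ} {F : Finset ℕ} {s s' : State} {K : Finset ℕ}
    {E : List (ℕ × ℕ)} {D δ : ℝ} (h : Good n m w F s' K E D) (hs : Valid n w s)
    (g : Grow n δ s s') : Good n m w F s K E (D + δ * ((actives n s).card - m)) := by
  have hlt : ∀ x ∈ K, x < n := fun x hx => mem_range.1 (h.sub hx)
  have hdeg : ∀ l ∈ K, s.comp l = l → s.act l ≠ 1 → 2 ≤ ends s E l := by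
    intro l hl h1 h2
    rw [← g.comp l (hlt l hl)] at h1
    rw [← g.act l (hlt l hl)] at h2
    refine (h.deg l hl h1 h2).trans_eq (ends_congr fun e he => ?_)
    rw [g.comp _ (hlt _ (h.mem e he).1), g.comp _ (hlt _ (h.mem e he).2)]
    simp
  have hcount : ((range n).filter fun l => s.comp l = l ∧ l ∈ K).card = m + E.length := by
    rw [← h.count]
    congr 1
    exact filter_congr fun l hl => by rw [g.comp l (mem_range.1 hl)]
  refine ⟨h.sub, fun x hx y hy hxy => h.sat x hx y hy (by rw [g.comp x hx, g.comp y hy, hxy]),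
    hcount, h.mem, hdeg, ?_, fun l hl => ?_⟩
  swap
  · have := h.root l hl
    rw [g.comp l (hlt l this.1)] at this
    exact this
  -- the ends of the accepted edges in active components
  set I := (range n).filter fun l => (s.comp l = l ∧ l ∈ K) ∧ ¬ s.act l = 1 with hI
  set A := (range n).filter fun l => (s.comp l = l ∧ l ∈ K) ∧ s.act l = 1 with hA
  set N := (range n).filter fun l => s.act l = 1 ∧ l ∉ K with hN
  -- `A` and `I` are the kept components, active and inactive; `N` consists of the discarded active
  -- ones.
  have c1 : A.card + I.card = m + E.length := by
    rw [← hcount, hA, hI, ← card_filter_add_card_filter_not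
      (s := (range n).filter fun l => s.comp l = l ∧ l ∈ K) (fun l => s.act l = 1),
      filter_filter, filter_filter]
  have c2 : A.card + N.card = (actives n s).card := by
    rw [actives, ← card_filter_add_card_filter_not (s := (range n).filter fun l => s.act l = 1)
      (fun l => l ∈ K), filter_filter, filter_filter]
    congr 2
    refine filter_congr fun l hl => ?_
    constructor
    · exact fun h => ⟨h.2, h.1.2⟩
    · exact fun h => ⟨⟨hs.act_comp l (mem_range.1 hl) h.1, h.2⟩, h.1⟩
  -- The missing `δ` at inactive ends is added on the left, so that every edge accounts for exactly
  -- `2 δ`. The sublist `E'` is only there for the induction.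
  have c3 : ∀ E' : List (ℕ × ℕ), (∀ e ∈ E', e.1 ∈ K ∧ e.2 ∈ K) → 
      (E'.map fun e => w e.1 e.2 - s.load e.1 - s.load e.2).sum + δ * ∑ l ∈ I, (ends s E' l : ℝ) =
      (E'.map fun e => w e.1 e.2 - s'.load e.1 - s'.load e.2).sum + δ * (2 * E'.length) := by
    intro E' hE'
    induction E' with
    | nil => simp [ends]
    | cons e E' ih =>
      have ih := ih fun e' he' => hE' e' (by simp [he'])
      have he := hE' e (by simp)
      have key : ∀ x ∈ K, ∑ l ∈ I, (if s.comp x = l then (1 : ℝ) else 0) =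
          1 - if s.act (s.comp x) = 1 then 1 else 0 := by
        intro x hx
        have hx' := hlt x hx
        rw [sum_ite_eq]
        have h1 : s.comp x ∈ K := h.sat x hx' _ (hs.comp_lt x hx')
          (by rw [g.comp x hx', g.comp _ (hs.comp_lt x hx'), hs.comp_comp x hx']) hx
        have h2 := hs.comp_comp x hx'
        have h3 := hs.comp_lt x hx'
        by_cases ha : s.act (s.comp x) = 1
        · rw [if_neg (by simp [hI, ha]), if_pos ha, sub_self]
        · rw [if_pos (by simp [hI, ha, h1, h2, h3]), if_neg ha, sub_zero]
      have e1 : ∑ l ∈ I, (ends s (e :: E') l : ℝ) = ∑ l ∈ I, (ends s E' l : ℝ) +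
          (1 - if s.act (s.comp e.1) = 1 then 1 else 0) +
          (1 - if s.act (s.comp e.2) = 1 then 1 else 0) := by
        rw [← key _ he.1, ← key _ he.2, ← sum_add_distrib, ← sum_add_distrib]
        refine sum_congr rfl fun l _ => ?_
        simp only [ends, List.map_cons, List.sum_cons]
        push_cast
        ring
      have e2 : ∀ x ∈ K, s'.load x = s.load x + δ * if s.act (s.comp x) = 1 then 1 else 0 := by
        intro x hx
        rw [g.load x (hlt x hx)]
        split_ifs <;> simp
      rw [e1]
      simp only [List.map_cons, List.sum_cons, List.length_cons, e2 _ he.1, e2 _ he.2]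
      push_cast
      linarith
  -- The only use of the degree condition, and the reason why inactive leaves are pruned.
  have c4 : (2 * I.card : ℝ) ≤ ∑ l ∈ I, (ends s E l : ℝ) := by
    rw [mul_comm, ← nsmul_eq_mul, ← sum_const]
    refine sum_le_sum fun l hl => ?_
    rw [hI, mem_filter] at hl
    exact_mod_cast hdeg l hl.2.1.2 hl.2.1.1 hl.2.2
  have c5 : ∑ l ∈ range n, (if s.comp l = l ∧ l ∉ K then s.pot l else 0) =
      ∑ l ∈ range n, (if s'.comp l = l ∧ l ∉ K then s'.pot l else 0) + δ * N.card := by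
    rw [hN, card_filter, Nat.cast_sum, mul_sum, ← sum_add_distrib]
    refine sum_congr rfl fun l hl => ?_
    have hl := mem_range.1 hl
    rw [g.comp l hl]
    by_cases hc : s.comp l = l
    · rw [g.pot l hl hc]
      by_cases hk : l ∈ K <;> by_cases ha : s.act l = 1 <;> simp [hc, hk, ha]
    · have : s.act l ≠ 1 := fun ha => hc (hs.act_comp l hl ha)
      simp [hc, this]
  have c6 := c3 E h.mem
  have c7 := h.cost
  have c8 := mul_le_mul_of_nonneg_left c4 g.nonneg
  have c9 : (A.card : ℝ) + I.card = m + E.length := by exact_mod_cast c1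
  have c10 : (A.card : ℝ) + N.card = (actives n s).card := by exact_mod_cast c2
  rw [c5, ← c10]
  -- The forest has `|A| + |I| - m` edges; this eliminates `E.length`.
  have c11 : δ * ((A.card : ℝ) + I.card) = δ * (m + E.length) := by rw [c9]
  nlinarith

/-- Backwards in time a component can only become active, which weakens the degree conditions;
nothing else depends on activity. -/
theorem Good.deact {n m : ℕ} {w : ℕ → ℕ → ℝ} {F : Finset ℕ} {s s' : State} {K : Finset ℕ}
    {E : List (ℕ × ℕ)} {D : ℝ} (h : Good n m w F s' K E D) 
    (g : Deact n s s') : Good n m w F s K E D := by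
  have hlt : ∀ x ∈ K, x < n := fun x hx => mem_range.1 (h.sub hx)
  refine ⟨h.sub, fun x hx y hy hxy => h.sat x hx y hy (by rw [g.comp x hx, g.comp y hy, hxy]),
    ?_, h.mem, fun l hl h1 h2 => ?_, ?_, fun l hl => ?_⟩
  · rw [← h.count]
    congr 1
    exact filter_congr fun l hl => by rw [g.comp l (mem_range.1 hl)]
  · rw [← g.comp l (hlt l hl)] at h1
    refine (h.deg l hl h1 (mt (g.act l (hlt l hl)) h2)).trans_eq (ends_congr fun e he => ?_)
    rw [g.comp _ (hlt _ (h.mem e he).1), g.comp _ (hlt _ (h.mem e he).2)]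
    simp
  · refine le_trans (le_of_eq ?_) h.cost
    congr 1
    · congr 1
      exact List.map_congr_left fun e he => by
        rw [g.load _ (hlt _ (h.mem e he).1), g.load _ (hlt _ (h.mem e he).2)]
    · congr 1
      refine sum_congr rfl fun l hl => ?_
      rw [g.comp l (mem_range.1 hl)]
      split_ifs with hc
      · rw [g.pot l (mem_range.1 hl) hc.1]
      · rfl
  · have := h.root l hl
    rw [g.comp l (hlt l this.1)] at this
    exact this

end Moat

namespace Moat

open Finset

theorem sum_merge_ge {n : ℕ} {w : ℕ → ℕ → ℝ} {u v : ℕ} {s s' : State} (hs : Valid n w s)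
    (g : Merge n w u v s s') (f f' : ℕ → ℝ) (hv : 0 ≤ f' (s.comp v))
    (hu : f (s.comp u) + f (s.comp v) ≤ f' (s.comp u))
    (hf : ∀ l < n, l ≠ s.comp u → l ≠ s.comp v → f l ≤ f' l) :
    ∑ l ∈ range n, f l ≤ ∑ l ∈ range n, f' l := by
  have := sum_merge_le hs g (fun l => -f l) (fun l => -f' l) (by simpa using hv)
    (by linarith) fun l hl h1 h2 => by simpa using hf l hl h1 h2
  simpa using this

theorem prune_of_removed {r : Rec} {x : Finset ℕ × List (ℕ × ℕ)} (h : r.u ∈ x.1)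
    (h' : r.inact = 1 ∧ ∀ e ∈ x.2, e.1 ∉ r.set ∧ e.2 ∉ r.set) :
    prune r x = (x.1 \ r.set, x.2) := by
  unfold prune
  rw [if_neg (not_not.2 h), if_pos h']

theorem prune_of_accepted {r : Rec} {x : Finset ℕ × List (ℕ × ℕ)} (h : r.u ∈ x.1)
    (h' : ¬ (r.inact = 1 ∧ ∀ e ∈ x.2, e.1 ∉ r.set ∧ e.2 ∉ r.set)) :
    prune r x = (x.1, (r.u, r.v) :: x.2) := by
  unfold prune
  rw [if_neg (not_not.2 h), if_neg h']

theorem ends_pos {s : State} {E : List (ℕ × ℕ)} {l : ℕ} {e : ℕ × ℕ} (he : e ∈ E)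
    (h : s.comp e.1 = l ∨ s.comp e.2 = l) : 1 ≤ ends s E l := by
  unfold ends
  have h1 := List.single_le_sum (l := E.map fun e =>
    (if s.comp e.1 = l then 1 else 0) + if s.comp e.2 = l then 1 else 0) (by simp) _
    (List.mem_map_of_mem he)
  refine le_trans ?_ h1
  rcases h with h | h <;> simp [h]

/-- Undoing a merge splits one component into those of `u` and `v`. If it had been discarded, both
parts are discarded. If the part of `v` is inactive and meets no accepted edge, dropping it is free
because its potential is used up. Otherwise the edge is accepted: it is tight, hence has reduced
cost zero, and it compensates for the additional component in `count`. -/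
theorem Good.merge {n m : ℕ} {w : ℕ → ℕ → ℝ} {F : Finset ℕ} {s s' : State} {K : Finset ℕ}
    {E : List (ℕ × ℕ)} {D : ℝ} {u v : ℕ} (h : Good n m w F s' K E D) (hs : Valid n w s)
    (g : Merge n w u v s s') :
    Good n m w F s (prune (mergeRec n u v s) (K, E)).1 (prune (mergeRec n u v s) (K, E)).2 D := by
  have hlt : ∀ x ∈ K, x < n := fun x hx => mem_range.1 (h.sub hx)
  have hX := hs.comp_lt u g.u_lt
  have hY := hs.comp_lt v g.v_lt
  have hXX := hs.comp_comp u g.u_lt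
  have hYY := hs.comp_comp v g.v_lt
  have sat : ∀ x < n, ∀ y < n, s.comp x = s.comp y → x ∈ K → y ∈ K :=
    fun x hx y hy hxy => h.sat x hx y hy (by rw [g.comp x hx, g.comp y hy, hxy])
  have uv : u ∈ K ↔ v ∈ K := by
    have : s'.comp u = s'.comp v := by
      rw [g.comp u g.u_lt, g.comp v g.v_lt, if_neg g.ne, if_pos rfl]
    exact ⟨h.sat u g.u_lt v g.v_lt this, h.sat v g.v_lt u g.u_lt this.symm⟩
  have uX : u ∈ K ↔ s.comp u ∈ K :=
    ⟨sat u g.u_lt _ hX hXX.symm, sat _ hX u g.u_lt hXX⟩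
  have vY : v ∈ K ↔ s.comp v ∈ K :=
    ⟨sat v g.v_lt _ hY hYY.symm, sat _ hY v g.v_lt hYY⟩
  have hcost : (E.map fun e => w e.1 e.2 - s.load e.1 - s.load e.2).sum =
      (E.map fun e => w e.1 e.2 - s'.load e.1 - s'.load e.2).sum := by
    congr 1
    exact List.map_congr_left fun e he => by
      rw [g.load _ (hlt _ (h.mem e he).1), g.load _ (hlt _ (h.mem e he).2)]
  have hcount : ((range n).filter fun l => s.comp l = l ∧ l ∈ K ∧ l ≠ s.comp v).card =
      m + E.length := by
    rw [← h.count]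
    congr 1
    refine filter_congr fun l hl => ?_
    rw [g.comp_self hs (mem_range.1 hl)]
    tauto
  have hends : ∀ l ∈ K, s.comp l = l → s.act l ≠ 1 → l ≠ s.comp v → 2 ≤ ends s E l := by
    intro l hl h1 h2 h3
    have hl' := hlt l hl
    have h4 : l ≠ s.comp u := by rintro rfl; exact h2 g.act_u
    refine (h.deg l hl ((g.comp_self hs hl').2 ⟨h1, h3⟩) ?_).trans_eq (ends_congr fun e he => ?_)
    · rw [g.act l hl', if_neg h3]; exact h2
    · have : ∀ x < n, s'.comp x = l ↔ s.comp x = l := by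
        intro x hx
        rw [g.comp x hx]
        split_ifs with hc
        · exact ⟨fun h => absurd h.symm h4, fun h => absurd (h.symm.trans hc) h3⟩
        · rfl
      exact ⟨this _ (hlt _ (h.mem e he).1), this _ (hlt _ (h.mem e he).2)⟩
  have hroot : ∀ l ∈ F, l ∈ K ∧ s.comp l = l ∧ l ≠ s.comp v := fun l hl =>
    ⟨(h.root l hl).1, (g.comp_self hs (hlt l (h.root l hl).1)).1 (h.root l hl).2⟩
  have hother : ∀ K' : Finset ℕ, (∀ l < n, s.comp l = l → l ≠ s.comp v → (l ∈ K' ↔ l ∈ K)) →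
      ∀ l < n, l ≠ s.comp u → l ≠ s.comp v →
      (if s.comp l = l ∧ l ∉ K' then s.pot l else 0) ≤
        if s'.comp l = l ∧ l ∉ K then s'.pot l else 0 := by
    intro K' hK' l hl h1 h2
    simp only [g.comp_self hs hl]
    by_cases hc : s.comp l = l
    · simp [hc, h2, hK' l hl hc h2, g.pot l hl hc h2, h1]
    · simp [hc]
  have hv0 : (0 : ℝ) ≤ if s'.comp (s.comp v) = s.comp v ∧ s.comp v ∉ K
      then s'.pot (s.comp v) else 0 := by
    rw [if_neg]
    rintro ⟨hc, -⟩
    exact ((g.comp_self hs hY).1 hc).2 rfl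
  have hset : ∀ x, x ∈ (mergeRec n u v s).set ↔ x < n ∧ s.comp x = s.comp v := by
    simp [mergeRec]
  have hXpot := g.pot _ hX hXX g.ne
  rw [if_pos rfl] at hXpot
  have hXs := (g.comp_self hs hX).2 ⟨hXX, g.ne⟩
  by_cases hu : u ∈ K
  swap
  · rw [show prune (mergeRec n u v s) (K, E) = (K, E) from if_pos hu]
    have hYK : s.comp v ∉ K := fun hc => hu (uv.2 (vY.2 hc))
    have hXK : s.comp u ∉ K := fun hc => hu (uX.2 hc)
    have hne : ∀ l ∈ K, l ≠ s.comp v := by rintro l hl rfl; exact hYK hl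
    refine ⟨h.sub, sat, ?_, h.mem, fun l hl h1 h2 => hends l hl h1 h2 (hne l hl), ?_,
      fun l hl => ⟨(hroot l hl).1, (hroot l hl).2.1⟩⟩
    · rw [← hcount]
      congr 1
      refine filter_congr fun l _ => ⟨fun h => ⟨h.1, h.2, hne l h.2⟩, fun h => ⟨h.1, h.2.1⟩⟩
    · refine le_trans ?_ h.cost
      simp only [hcost]
      have := sum_merge_ge hs g (fun l => if s.comp l = l ∧ l ∉ K then s.pot l else 0)
        (fun l => if s'.comp l = l ∧ l ∉ K then s'.pot l else 0) hv0 ?_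
        (hother K fun _ _ _ _ => Iff.rfl)
      · linarith
      · simp [hXX, hYY, hXK, hYK, hXs, hXpot]
  · have hXK := uX.1 hu
    have hYK := vY.1 (uv.1 hu)
    by_cases hr : (mergeRec n u v s).inact = 1 ∧
        ∀ e ∈ E, e.1 ∉ (mergeRec n u v s).set ∧ e.2 ∉ (mergeRec n u v s).set
    · rw [prune_of_removed (r := mergeRec n u v s) (x := (K, E)) hu hr]
      have hina : s.act (s.comp v) ≠ 1 := by
        intro hc
        simp [mergeRec, hc] at hr
      have hmem : ∀ l, l ∈ K \ (mergeRec n u v s).set ↔ l ∈ K ∧ s.comp l ≠ s.comp v := by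
        intro l
        rw [mem_sdiff, hset]
        constructor
        · exact fun hc => ⟨hc.1, fun h' => hc.2 ⟨hlt l hc.1, h'⟩⟩
        · exact fun hc => ⟨hc.1, fun h' => hc.2 h'.2⟩
      refine ⟨fun x hx => h.sub (mem_sdiff.1 hx).1, fun x hx y hy hxy hxK => ?_, ?_, fun e he => ?_,
        fun l hl h1 h2 => ?_, ?_, fun l hl => ?_⟩
      · rw [hmem] at hxK ⊢
        exact ⟨sat x hx y hy hxy hxK.1, hxy ▸ hxK.2⟩
      · rw [← hcount]
        congr 1
        refine filter_congr fun l _ => ?_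
        simp only [hmem]
        constructor
        · exact fun hc => ⟨hc.1, hc.2.1, fun h' => hc.2.2 (hc.1.trans h')⟩
        · exact fun hc => ⟨hc.1, hc.2.1, fun h' => hc.2.2 (hc.1.symm.trans h')⟩
      · exact ⟨mem_sdiff.2 ⟨(h.mem e he).1, (hr.2 e he).1⟩, mem_sdiff.2 ⟨(h.mem e he).2, (hr.2 e he).2⟩⟩
      · rw [hmem] at hl
        exact hends l hl.1 h1 h2 (h1 ▸ hl.2)
      · refine le_trans ?_ h.cost
        simp only [hcost]
        have := sum_merge_ge hs g
          (fun l => if s.comp l = l ∧ l ∉ K \ (mergeRec n u v s).set then s.pot l else 0)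
          (fun l => if s'.comp l = l ∧ l ∉ K then s'.pot l else 0) hv0 ?_
          (hother _ fun l hl h1 h2 => by
            rw [hmem]; exact ⟨fun hc => hc.1, fun hc => ⟨hc, by rw [h1]; exact h2⟩⟩)
        · linarith
        · have h0 := hs.pot_zero _ hY hYY hina
          simp [-mem_sdiff, hmem, hXX, hYY, hXK, hXs, g.ne, h0]
      · have := hroot l hl
        rw [hmem]
        exact ⟨⟨this.1, fun hc => this.2.2 (this.2.1.symm.trans hc)⟩, this.2.1⟩
    · rw [show prune (mergeRec n u v s) (K, E) = (K, (u, v) :: E) from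
        prune_of_accepted (r := mergeRec n u v s) (x := (K, E)) hu hr]
      refine ⟨h.sub, sat, ?_, ?_, fun l hl h1 h2 => ?_, ?_,
        fun l hl => ⟨(hroot l hl).1, (hroot l hl).2.1⟩⟩
      · have : ((range n).filter fun l => s.comp l = l ∧ l ∈ K) = insert (s.comp v)
            ((range n).filter fun l => s.comp l = l ∧ l ∈ K ∧ l ≠ s.comp v) := by
          ext l
          simp only [mem_filter, mem_range, mem_insert]
          by_cases hl : l = s.comp v
          · subst hl; simp [hY, hYY, hYK]
          · simp [hl]
        rw [this, card_insert_of_notMem (by simp), hcount, List.length_cons, add_assoc]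
      · intro e he
        rcases List.mem_cons.1 he with rfl | he
        · exact ⟨hu, uv.1 hu⟩
        · exact h.mem e he
      · have e1 : ends s ((u, v) :: E) l =
            ((if s.comp u = l then 1 else 0) + if s.comp v = l then 1 else 0) + ends s E l := by
          simp [ends]
        rw [e1]
        by_cases hl' : l = s.comp v
        · subst hl'
          -- The component of `v` is inactive but was not dropped, so some accepted edge already
          -- ends there. With the new edge its degree is at least two.
          have hex : ¬ ∀ e ∈ E, e.1 ∉ (mergeRec n u v s).set ∧ e.2 ∉ (mergeRec n u v s).set :=
            fun hc => hr ⟨by simp [mergeRec, h2], hc⟩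
          push Not at hex
          obtain ⟨e, he, hc⟩ := hex
          have := ends_pos (s := s) (l := s.comp v) he (by
            by_cases h' : e.1 ∈ (mergeRec n u v s).set
            · exact Or.inl ((hset _).1 h').2
            · exact Or.inr ((hset _).1 (hc h')).2)
          simp only [if_true]
          omega
        · have := hends l hl h1 h2 hl'
          omega
      · refine le_trans ?_ h.cost
        have e1 : w u v - s.load u - s.load v = 0 := by linarith [g.tight]
        simp only [List.map_cons, List.sum_cons, hcost, e1, zero_add]
        have := sum_merge_ge hs g (fun l => if s.comp l = l ∧ l ∉ K then s.pot l else 0)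
          (fun l => if s'.comp l = l ∧ l ∉ K then s'.pot l else 0) hv0 ?_
          (hother K fun _ _ _ _ => Iff.rfl)
        · linarith
        · simp [hXK, hYK]

/-- The history is undone from its end. Records are appended at the end of the list, so `foldr`
treats the latest merge first, as reverse deletion demands. -/
theorem Hist.good {n m : ℕ} {w : ℕ → ℕ → ℝ} {F : Finset ℕ} {s₀ s : State} {rs : List Rec} {D : ℝ}
    (h : Hist n m w s₀ rs D s) {x : Finset ℕ × List (ℕ × ℕ)} {D' : ℝ}
    (hx : Good n m w F s x.1 x.2 D') :
    Good n m w F s₀ (rs.foldr prune x).1 (rs.foldr prune x).2 (D + D') := by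
  induction h generalizing x D' with
  | start => simpa using hx
  | grow rs D s s' δ _ hs g ih =>
    have := ih (hx.grow hs g)
    rwa [add_assoc, add_comm (δ * _)]
  | deact rs D s s' _ hs g ih => exact ih (hx.deact g)
  | merge rs D s s' u v _ hs g ih =>
    rw [List.foldr_append]
    exact ih (hx.merge hs g)

/-- The vertices of the active components. -/
def core (n : ℕ) (s : State) : Finset ℕ := (range n).filter fun v => s.act (s.comp v) = 1

/-- The result of the pruning phase. -/
noncomputable def pruned (n : ℕ) (s : State) (rs : List Rec) : Finset ℕ × List (ℕ × ℕ) :=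
  rs.foldr prune (core n s, [])

/-- The start of the pruning: no edges, `m` kept components, all of them active, and no potential
left in the others. -/
theorem good_core {n m : ℕ} {w : ℕ → ℕ → ℝ} {s : State} (hs : Valid n w s)
    (hm : (actives n s).card = m) : Good n m w (actives n s) s (core n s) [] 0 := by
  refine ⟨filter_subset _ _, fun x hx y hy hxy hxK => ?_, ?_, by simp, fun l hl h1 h2 => ?_, ?_,
    fun l hl => ?_⟩
  · rw [core, mem_filter] at hxK ⊢
    exact ⟨mem_range.2 hy, hxy ▸ hxK.2⟩
  · rw [List.length_nil, add_zero, ← hm, actives]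
    congr 1
    refine filter_congr fun l hl => ⟨fun h => ?_, fun h => ?_⟩
    · have := (mem_filter.1 h.2).2
      rwa [h.1] at this
    · have := hs.act_comp l (mem_range.1 hl) h
      exact ⟨this, mem_filter.2 ⟨hl, by rwa [this]⟩⟩
  · have := (mem_filter.1 hl).2
    rw [h1] at this
    exact absurd this h2
  · simp only [List.map_nil, List.sum_nil, zero_add, mul_zero]
    rw [sum_eq_zero, mul_zero]
    intro l hl
    split_ifs with h
    · refine hs.pot_zero l (mem_range.1 hl) h.1 fun ha => h.2 (mem_filter.2 ⟨hl, ?_⟩)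
      rwa [h.1]
    · rfl
  · rw [actives, mem_filter] at hl
    have := hs.act_comp l (mem_range.1 hl.1) hl.2
    exact ⟨mem_filter.2 ⟨hl.1, by rw [this]; exact hl.2⟩, this⟩

/-! #### Tours -/

/-- Exchange the successors of the ends of an edge. -/
def swapNext (f : ℕ → ℕ) (e : ℕ × ℕ) : ℕ → ℕ :=
  fun z => if z = e.1 then f e.2 else if z = e.2 then f e.1 else f z

/-- `y` is obtained from `x` by iterating `f`. -/
abbrev Reach (f : ℕ → ℕ) : ℕ → ℕ → Prop := Relation.ReflTransGen fun a b => f a = b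

/-- The cycles of `f` on `K` are the components of `s`. -/
structure Tour (n : ℕ) (s : State) (K : Finset ℕ) (f : ℕ → ℕ) : Prop where
  lt : ∀ z < n, f z < n
  comp : ∀ z < n, s.comp (f z) = s.comp z
  mem : ∀ z ∈ K, f z ∈ K
  reach : ∀ x ∈ K, ∀ y ∈ K, s.comp x = s.comp y → Reach f x y

theorem Tour.congr {n : ℕ} {s s' : State} {K : Finset ℕ} {f : ℕ → ℕ} (h : Tour n s K f)
    (h1 : ∀ x < n, ∀ y < n, s.comp x = s.comp y → s'.comp x = s'.comp y)
    (h2 : ∀ x ∈ K, ∀ y ∈ K, s'.comp x = s'.comp y → s.comp x = s.comp y) : Tour n s' K f :=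
  ⟨h.lt, fun z hz => h1 _ (h.lt z hz) z hz (h.comp z hz), h.mem,
    fun x hx y hy hxy => h.reach x hx y hy (h2 x hx y hy hxy)⟩

/-- Exchanging the successors of two vertices on different cycles joins the cycles: `u` continues
with the old successor of `v`, the cycle of `v` is traversed up to `v`, and then the old successor
of `u` follows. -/
theorem Tour.merge {n : ℕ} {w : ℕ → ℕ → ℝ} {u v : ℕ} {s s' : State} {K : Finset ℕ} {f : ℕ → ℕ}
    (h : Tour n s K f) (g : Merge n w u v s s') (hK : K ⊆ range n)
    (hu : u ∈ K) (hv : v ∈ K) : Tour n s' K (swapNext f (u, v)) := by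
  have huv : v ≠ u := by rintro rfl; exact g.ne rfl
  have hfu : swapNext f (u, v) u = f v := by simp [swapNext]
  have hfv : swapNext f (u, v) v = f u := by simp [swapNext, huv]
  have hf : ∀ z, z ≠ u → z ≠ v → swapNext f (u, v) z = f z := fun z h1 h2 => by
    simp [swapNext, h1, h2]
  have hlt : ∀ x ∈ K, x < n := fun x hx => mem_range.1 (hK hx)
  generalize swapNext f (u, v) = f' at hfu hfv hf
  -- within its own component every vertex reaches the end of the new edge
  have key : ∀ a b : ℕ, (∀ z, z ≠ a → s.comp z = s.comp a → f' z = f z) → ∀ x ∈ K, Reach f x a →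
      s.comp x = s.comp a → Reach f' x a := by
    intro a b hab x hx hr
    induction hr using Relation.ReflTransGen.head_induction_on with
    | refl => exact fun _ => .refl
    | @head x y h1 _ ih =>
      intro hc
      by_cases hxa : x = a
      · subst hxa; exact .refl
      · have h2 := ih (h1 ▸ h.mem x hx) (by rw [← h1, h.comp x (hlt x hx), hc])
        exact .head (by rw [hab x hxa hc, h1]) h2
  have toU : ∀ x ∈ K, s.comp x = s.comp u → Reach f' x u := fun x hx hc =>
    key u v (fun z h1 h2 => hf z h1 (by rintro rfl; exact g.ne h2.symm)) x hx
      (h.reach x hx u hu hc) hc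
  have toV : ∀ x ∈ K, s.comp x = s.comp v → Reach f' x v := fun x hx hc =>
    key v u (fun z h1 h2 => hf z (by rintro rfl; exact g.ne h2) h1) x hx
      (h.reach x hx v hv hc) hc
  have uv : Reach f' u v := .head hfu (toV _ (h.mem v hv) (h.comp v g.v_lt))
  have vu : Reach f' v u := .head hfv (toU _ (h.mem u hu) (h.comp u g.u_lt))
  -- The only arc of the old cycle that is lost is the one leaving `a`. It is replaced by the detour
  -- from `a` to `b` followed by the new arc from `b`.
  have frm : ∀ a b : ℕ, f' b = f a → a ∈ K → Reach f' a b →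
      (∀ z, z ≠ a → s.comp z = s.comp a → f' z = f z) → ∀ y, Reach f a y →
      Reach f' a y ∧ y ∈ K ∧ s.comp y = s.comp a := by
    intro a b hb ha hab hz y hr
    induction hr with
    | refl => exact ⟨.refl, ha, rfl⟩
    | @tail x y h1 h2 ih =>
      refine ⟨?_, h2 ▸ h.mem x ih.2.1, by rw [← h2, h.comp x (hlt x ih.2.1), ih.2.2]⟩
      by_cases hxa : x = a
      · subst hxa
        exact hab.tail (hb.trans h2)
      · exact ih.1.tail (by rw [hz x hxa ih.2.2, h2])
  have fromU : ∀ y ∈ K, s.comp y = s.comp u → Reach f' u y := fun y hy hc =>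
    (frm u v hfv hu uv (fun z h1 h2 => hf z h1 (by rintro rfl; exact g.ne h2.symm)) y
      (h.reach u hu y hy hc.symm)).1
  have fromV : ∀ y ∈ K, s.comp y = s.comp v → Reach f' v y := fun y hy hc =>
    (frm v u hfu hv vu (fun z h1 h2 => hf z (by rintro rfl; exact g.ne h2) h1) y
      (h.reach v hv y hy hc.symm)).1
  have e : ∀ z < n, s'.comp (f z) = s'.comp z := fun z hz => by
    rw [g.comp _ (h.lt z hz), g.comp z hz, h.comp z hz]
  have euv : s'.comp u = s'.comp v := by
    rw [g.comp u g.u_lt, g.comp v g.v_lt, if_neg g.ne, if_pos rfl]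
  refine ⟨fun z hz => ?_, fun z hz => ?_, fun z hz => ?_, fun x hx y hy hxy => ?_⟩
  · by_cases h1 : z = u
    · rw [h1, hfu]; exact h.lt v g.v_lt
    · by_cases h2 : z = v
      · rw [h2, hfv]; exact h.lt u g.u_lt
      · rw [hf z h1 h2]; exact h.lt z hz
  · by_cases h1 : z = u
    · rw [h1, hfu, e v g.v_lt, euv]
    · by_cases h2 : z = v
      · rw [h2, hfv, e u g.u_lt, euv]
      · rw [hf z h1 h2, e z hz]
  · by_cases h1 : z = u
    · rw [h1, hfu]; exact h.mem v hv
    · by_cases h2 : z = v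
      · rw [h2, hfv]; exact h.mem u hu
      · rw [hf z h1 h2]; exact h.mem z hz
  · have hx' := g.comp x (hlt x hx)
    have hy' := g.comp y (hlt y hy)
    rw [hx', hy'] at hxy
    by_cases hxv : s.comp x = s.comp v
    · rw [if_pos hxv] at hxy
      by_cases hyv : s.comp y = s.comp v
      · exact (toV x hx hxv).trans (fromV y hy hyv)
      · rw [if_neg hyv] at hxy
        exact ((toV x hx hxv).trans vu).trans (fromU y hy hxy.symm)
    · rw [if_neg hxv] at hxy
      by_cases hyv : s.comp y = s.comp v
      · rw [if_pos hyv] at hxy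
        exact ((toU x hx hxy).trans uv).trans (fromV y hy hyv)
      · rw [if_neg hyv] at hxy
        by_cases hxu : s.comp x = s.comp u
        · exact (toU x hx hxu).trans (fromU y hy (hxy.symm.trans hxu))
        · -- a component that is not affected
          have other : ∀ a, a ∈ K → s.comp a ≠ s.comp u → s.comp a ≠ s.comp v →
              ∀ b, Reach f a b → Reach f' a b ∧ b ∈ K ∧ s.comp b = s.comp a := by
            intro a ha h1 h2 b hr
            induction hr with
            | refl => exact ⟨.refl, ha, rfl⟩
            | @tail b c h3 h4 ih =>
              refine ⟨ih.1.tail ?_, h4 ▸ h.mem b ih.2.1,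
                by rw [← h4, h.comp b (hlt b ih.2.1), ih.2.2]⟩
              rw [hf b (by rintro rfl; exact h1 ih.2.2.symm) (by rintro rfl; exact h2 ih.2.2.symm),
                h4]
          exact (other x hx hxu hxv y (h.reach x hx y hy hxy)).1

/-- Pruning only removes vertices, and accepts edges in the order of the merges. -/
theorem prune_cases (r : Rec) (x : Finset ℕ × List (ℕ × ℕ)) :
    (prune r x).1 ⊆ x.1 ∧
      ((r.u ∉ x.1 ∧ (prune r x).2 = x.2) ∨
        (Disjoint (prune r x).1 r.set ∧ (prune r x).2 = x.2) ∨
        (prune r x).2 = (r.u, r.v) :: x.2) := by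
  unfold prune
  split_ifs with h1 h2
  · exact ⟨sdiff_subset, .inr (.inl ⟨sdiff_disjoint, rfl⟩)⟩
  · exact ⟨subset_rfl, .inr (.inr rfl)⟩
  · exact ⟨subset_rfl, .inl ⟨h1, rfl⟩⟩

theorem foldr_prune_subset (rs : List Rec) (x : Finset ℕ × List (ℕ × ℕ)) :
    (rs.foldr prune x).1 ⊆ x.1 := by
  induction rs with
  | nil => exact subset_rfl
  | cons r rs ih => exact (prune_cases r _).1.trans ih

/-- Restricted to the vertices `K` that survive all pruning, a merge has an effect only if its edge
is accepted; otherwise one of the two components contains no vertex of `K`. Thus joining cycles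
along the accepted edges in the order of the merges follows the growth of the components. The list
`E` comes from the merges so far, `x.2` from the later ones. -/
theorem Hist.tour {n m : ℕ} {w : ℕ → ℕ → ℝ} {F : Finset ℕ} {s₀ s : State} {rs : List Rec} {D : ℝ}
    (h : Hist n m w s₀ rs D s) (h0 : ∀ v < n, s₀.comp v = v) {x : Finset ℕ × List (ℕ × ℕ)} {D' : ℝ}
    (hx : Good n m w F s x.1 x.2 D') {K : Finset ℕ} (hK : K ⊆ (rs.foldr prune x).1)
    (hE : ∀ e ∈ (rs.foldr prune x).2, e.1 ∈ K ∧ e.2 ∈ K) :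
    ∃ E, (rs.foldr prune x).2 = E ++ x.2 ∧ Tour n s K (E.foldl swapNext id) := by
  induction h generalizing x D' with
  | start =>
    refine ⟨[], rfl, fun z hz => hz, fun z hz => rfl, fun z hz => hz, fun a ha b hb hab => ?_⟩
    have hl : ∀ z ∈ K, z < n := fun z hz => mem_range.1 (hx.sub (hK hz))
    rw [h0 a (hl a ha), h0 b (hl b hb)] at hab
    exact hab ▸ .refl
  | grow rs D s s' δ _ hs g ih =>
    obtain ⟨E, h1, h2⟩ := ih (hx.grow hs g) hK hE
    have hl : ∀ z ∈ K, z < n := fun z hz =>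
      mem_range.1 (hx.sub (foldr_prune_subset rs x (hK hz)))
    refine ⟨E, h1, h2.congr (fun a ha b hb hab => by rw [g.comp a ha, g.comp b hb, hab])
      fun a ha b hb hab => ?_⟩
    rwa [g.comp a (hl a ha), g.comp b (hl b hb)] at hab
  | deact rs D s s' _ hs g ih =>
    obtain ⟨E, h1, h2⟩ := ih (hx.deact g) hK hE
    have hl : ∀ z ∈ K, z < n := fun z hz =>
      mem_range.1 (hx.sub (foldr_prune_subset rs x (hK hz)))
    refine ⟨E, h1, h2.congr (fun a ha b hb hab => by rw [g.comp a ha, g.comp b hb, hab])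
      fun a ha b hb hab => ?_⟩
    rwa [g.comp a (hl a ha), g.comp b (hl b hb)] at hab
  | merge rs D s s' u v _ hs g ih =>
    rw [List.foldr_append] at hK hE ⊢
    simp only [List.foldr_cons, List.foldr_nil] at hK hE ⊢
    obtain ⟨E, h1, h2⟩ := ih (x := prune (mergeRec n u v s) x) (hx.merge hs g) hK hE
    have hKx : K ⊆ (prune (mergeRec n u v s) x).1 := hK.trans (foldr_prune_subset rs _)
    have hKx' : K ⊆ x.1 := hKx.trans (prune_cases _ _).1
    have hl : ∀ z ∈ K, z < n := fun z hz => mem_range.1 (hx.sub (hKx' hz))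
    have hc : ∀ a < n, ∀ b < n, s.comp a = s.comp b → s'.comp a = s'.comp b :=
      fun a ha b hb hab => by rw [g.comp a ha, g.comp b hb, hab]
    rcases (prune_cases (mergeRec n u v s) x).2 with ⟨h3, h4⟩ | ⟨h3, h4⟩ | h3
    · refine ⟨E, by rw [h1, h4], h2.congr hc fun a ha b hb hab => ?_⟩
      -- The kept set is a union of components; as `u` has been removed, so has the whole merged
      -- component.
      have hno : ∀ z ∈ K, s'.comp z ≠ s.comp u := by
        intro z hz hc'
        refine h3 (hx.sat z (hl z hz) u g.u_lt ?_ (hKx' hz))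
        rw [hc', g.comp u g.u_lt, if_neg g.ne]
      have ha' := hno a ha
      have hb' := hno b hb
      rw [g.comp _ (hl _ ha)] at hab ha'
      rw [g.comp _ (hl _ hb)] at hab hb'
      split_ifs at hab ha' hb' <;> simp_all
    · refine ⟨E, by rw [h1, h4], h2.congr hc fun a ha b hb hab => ?_⟩
      have hno : ∀ z ∈ K, s.comp z ≠ s.comp v := by
        intro z hz hc'
        exact disjoint_left.1 h3 (hKx hz) (by simp [mergeRec, hc', hl z hz])
      rwa [g.comp a (hl a ha), g.comp b (hl b hb), if_neg (hno a ha), if_neg (hno b hb)] at hab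
    · refine ⟨E ++ [(u, v)], by rw [h1, h3]; simp [mergeRec], ?_⟩
      have := hE (u, v) (by rw [h1, h3]; simp [mergeRec])
      rw [List.foldl_append]
      exact h2.merge g (fun z hz => mem_range.2 (hl z hz)) this.1 this.2

/-- A metric on the vertices. -/
structure IsMet (n : ℕ) (w : ℕ → ℕ → ℝ) : Prop where
  self : ∀ u < n, w u u = 0
  nonneg : ∀ u < n, ∀ v < n, 0 ≤ w u v
  symm : ∀ u < n, ∀ v < n, w u v = w v u
  triangle : ∀ u < n, ∀ v < n, ∀ x < n, w u x ≤ w u v + w v x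

/-- Both new arcs are shortcuts through the edge `u v`: `w u (f v) ≤ w u v + w v (f v)`, and
likewise with the roles exchanged. -/
theorem sum_swapNext_le {n : ℕ} {w : ℕ → ℕ → ℝ} (hw : IsMet n w) {f : ℕ → ℕ}
    (hf : ∀ z < n, f z < n) {u v : ℕ} (hu : u < n) (hv : v < n) :
    ∑ z ∈ range n, w z (swapNext f (u, v) z) ≤ ∑ z ∈ range n, w z (f z) + 2 * w u v := by
  by_cases huv : u = v
  · subst huv
    have : swapNext f (u, u) = f := by
      funext z
      simp only [swapNext]
      split_ifs with h <;> simp_all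
    rw [this]
    linarith [hw.nonneg u hu u hu]
  · have h1 : u ∈ range n := mem_range.2 hu
    have h2 : v ∈ (range n).erase u := mem_erase.2 ⟨Ne.symm huv, mem_range.2 hv⟩
    rw [← add_sum_erase _ _ h1, ← add_sum_erase _ _ h1, ← add_sum_erase _ _ h2,
      ← add_sum_erase _ _ h2]
    have h3 : ∑ z ∈ ((range n).erase u).erase v, w z (swapNext f (u, v) z) =
        ∑ z ∈ ((range n).erase u).erase v, w z (f z) := by
      refine sum_congr rfl fun z hz => ?_
      simp only [mem_erase] at hz
      simp [swapNext, hz.1, hz.2.1]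
    have h4 : swapNext f (u, v) u = f v := by simp [swapNext]
    have h5 : swapNext f (u, v) v = f u := by simp [swapNext, Ne.symm huv]
    rw [h3, h4, h5]
    have h6 := hw.triangle u hu v hv (f v) (hf v hv)
    have h7 := hw.triangle v hv u hu (f u) (hf u hu)
    have h8 := hw.symm u hu v hv
    linarith

theorem foldl_swapNext {n : ℕ} {w : ℕ → ℕ → ℝ} (hw : IsMet n w) (E : List (ℕ × ℕ))
    (hE : ∀ e ∈ E, e.1 < n ∧ e.2 < n) : ∀ f : ℕ → ℕ, (∀ z < n, f z < n) →
    (∀ z < n, E.foldl swapNext f z < n) ∧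
    ∑ z ∈ range n, w z (E.foldl swapNext f z) ≤
      ∑ z ∈ range n, w z (f z) + 2 * (E.map fun e => w e.1 e.2).sum := by
  induction E with
  | nil => intro f hf; exact ⟨hf, by simp⟩
  | cons e E ih =>
    intro f hf
    have he := hE e (by simp)
    have hf' : ∀ z < n, swapNext f e z < n := by
      intro z hz
      simp only [swapNext]
      split_ifs
      exacts [hf _ he.2, hf _ he.1, hf z hz]
    have h1 := ih (fun e' he' => hE e' (by simp [he'])) _ hf'
    have h2 := sum_swapNext_le hw hf he.1 he.2
    refine ⟨h1.1, ?_⟩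
    simp only [List.foldl_cons, List.map_cons, List.sum_cons]
    linarith [h1.2]

end Moat

/-! ### From tours to paths -/

namespace MOP

open Finset

theorem pathWeight_map_range' {n : ℕ} (w : Fin n → Fin n → ℝ) (g : ℕ → Fin n) (k : ℕ) :
    ∀ s, pathWeight w ((List.range' s k).map g) =
      ∑ j ∈ range (k - 1), w (g (s + j)) (g (s + j + 1)) := by
  induction k with
  | zero => intro s; simp [pathWeight]
  | succ k ih =>
    intro s
    cases k with
    | zero => simp [pathWeight]
    | succ k =>
      have := ih (s + 1)
      rw [List.range'_succ, List.map_cons] at this ⊢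
      rw [List.range'_succ, List.map_cons, pathWeight, this, Nat.add_sub_cancel,
        Nat.add_sub_cancel, sum_range_succ', add_comm]
      congr 1
      refine sum_congr rfl fun j _ => ?_
      congr 2 <;> ring

theorem pathWeight_nonneg {n : ℕ} {w : Fin n → Fin n → ℝ} (hw : IsMetric w) :
    ∀ l : List (Fin n), 0 ≤ pathWeight w l
  | [] => le_rfl
  | [_] => le_rfl
  | u :: v :: l => by
    have := pathWeight_nonneg hw (v :: l)
    rw [pathWeight]
    rcases eq_or_ne u v with rfl | h
    · rw [hw.self]; linarith
    · linarith [hw.pos u v h]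

theorem weight_nonneg {n m : ℕ} {w : Fin n → Fin n → ℝ} (hw : IsMetric w) (P : Family n m) :
    0 ≤ weight w P := sum_nonneg fun _ _ => pathWeight_nonneg hw _

/-- The vertex with a given number. -/
def vtx {n : ℕ} (h : 0 < n) (x : ℕ) : Fin n := ⟨x % n, Nat.mod_lt _ h⟩

theorem vtx_val {n : ℕ} (h : 0 < n) {x : ℕ} (hx : x < n) : (vtx h x : ℕ) = x :=
  Nat.mod_eq_of_lt hx

theorem exists_isPathSystem {n m : ℕ} (h : m ≤ n) : ∃ P : Family n m, IsPathSystem P :=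
  ⟨fun i => [Fin.castLE h i], fun i => by simp, fun i j hij => by simpa using Ne.symm hij⟩

end MOP

namespace Moat

open Finset MOP

/-- The initial state for the penalties `p`. -/
structure Initial (n : ℕ) (p : ℕ → ℝ) (s : State) : Prop where
  comp : ∀ v < n, s.comp v = v
  act : ∀ v < n, s.act v = 1
  load : ∀ v < n, s.load v = 0
  pot : ∀ v < n, s.pot v = p v

theorem isMet {n : ℕ} {w : Fin n → Fin n → ℝ} (hw : IsMetric w) {W : ℕ → ℕ → ℝ}
    (hW : ∀ i j : Fin n, W i j = w i j) : IsMet n W := by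
  refine ⟨fun u hu => ?_, fun u hu v hv => ?_, fun u hu v hv => ?_, fun u hu v hv x hx => ?_⟩
  · exact (hW ⟨u, hu⟩ ⟨u, hu⟩).trans (hw.self _)
  · rw [hW ⟨u, hu⟩ ⟨v, hv⟩]
    rcases eq_or_ne u v with rfl | h
    · rw [hw.self]
    · exact (hw.pos _ _ fun hc => h (congrArg Fin.val hc)).le
  · rw [hW ⟨u, hu⟩ ⟨v, hv⟩, hW ⟨v, hv⟩ ⟨u, hu⟩, hw.symm]
  · rw [hW ⟨u, hu⟩ ⟨v, hv⟩, hW ⟨v, hv⟩ ⟨x, hx⟩, hW ⟨u, hu⟩ ⟨x, hx⟩]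
    exact hw.triangle _ _ _

theorem penalty_eq {n m : ℕ} {p : Fin n → ℝ} {q : ℕ → ℝ} (hp : ∀ v : Fin n, q v = p v)
    (P : Family n m) (K : Finset ℕ) (hK : ∀ v : Fin n, (v : ℕ) ∈ K ↔ v ∈ spanned P) :
    penalty p P = ∑ l ∈ range n, if l ∉ K then q l else 0 := by
  rw [penalty, Finset.sum_range, ← sum_filter]
  refine sum_congr ?_ fun v _ => (hp v).symm
  ext v
  simp [hK]

/-- Initially all components are singletons without load, so nothing has been subtracted from
weights and penalties. With `Hist.le_restCost` this turns `D` into a lower bound for the objective.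
-/
theorem restCost_initial {n m : ℕ} {w : Fin n → Fin n → ℝ} (hw : IsMetric w) {W : ℕ → ℕ → ℝ}
    (hW : ∀ i j : Fin n, W i j = w i j) {p : Fin n → ℝ} {q : ℕ → ℝ} (hp : ∀ v : Fin n, q v = p v)
    {s : State} (hs : Initial n q s) (P : Family n m) :
    restCost n W s (fun i => (P i).map Fin.val) = weight w P + penalty p P := by
  classical
  have hc : ∀ l : List (Fin n), crossCost W s (l.map Fin.val) = pathWeight w l := by
    intro l
    induction l using pathWeight.induct with
    | case1 => rfl
    | case2 => rfl
    | case3 u v l ih =>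
      simp only [List.map_cons] at ih
      simp only [List.map_cons, crossCost, pathWeight, ih, hs.comp _ u.2, hs.comp _ v.2,
        hs.load _ u.2, hs.load _ v.2, hW, sub_zero]
      congr 1
      split_ifs with h
      · rw [Fin.ext h, hw.self]
      · rfl
  unfold restCost weight
  rw [penalty_eq hp P ((range n).filter fun l => ¬ Untouched s (fun i => (P i).map Fin.val) l)]
  · congr 1
    · exact sum_congr rfl fun i _ => hc _
    · refine sum_congr rfl fun l hl => ?_
      have hl' := mem_range.1 hl
      simp [hs.comp l hl', hs.pot l hl', hl']
  · intro v
    have h1 : ∀ i, ∀ x ∈ P i, s.comp (x : ℕ) = v ↔ x = v := by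
      intro i x _
      rw [hs.comp x x.2, Fin.ext_iff]
    simp only [mem_filter, mem_range, v.2, true_and, Untouched, List.mem_map, spanned, mem_univ]
    push Not
    constructor
    · rintro ⟨i, -, ⟨x, hx, rfl⟩, h⟩
      rw [h1 i x hx] at h
      exact ⟨i, h ▸ hx⟩
    · rintro ⟨i, hi⟩
      exact ⟨i, v, ⟨v, hi, rfl⟩, (h1 i v hi).2 rfl⟩

/-- `P` consists of the cycles of `f` through the vertices `a i`, of lengths `k i`. -/
structure IsCycleSystem {n m : ℕ} (h : 0 < n) (f : ℕ → ℕ) (a k : ℕ → ℕ) (P : Family n m) :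
    Prop where
  pos : ∀ i < m, 0 < k i
  closed : ∀ i < m, f^[k i] (a i) = a i
  minimal : ∀ i < m, ∀ j, 0 < j → j < k i → f^[j] (a i) ≠ a i
  eq : ∀ i : Fin m, P i = (List.range (k i)).map fun j => vtx h (f^[j] (a i))

/-- Growing, pruning and short-cutting is a 4-approximation that preserves Lagrangian
multipliers. -/
theorem lmp {n m : ℕ} (h : 0 < n) (hmn : m ≤ n) {w : Fin n → Fin n → ℝ} (hw : IsMetric w)
    {W : ℕ → ℕ → ℝ} (hW : ∀ i j : Fin n, W i j = w i j) {p : Fin n → ℝ} {q : ℕ → ℝ}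
    (hp : ∀ v : Fin n, q v = p v) {s₀ s : State} (h₀ : Initial n q s₀) {rs : List Rec}
    {D : ℝ} (hh : Hist n m W s₀ rs D s) (hs : Valid n W s) (hm : (actives n s).card = m)
    {a k : ℕ → ℕ} (ha : ∀ i < m, a i ∈ actives n s) (ha' : ∀ i < m, ∀ j < m, a i = a j → i = j)
    {P : Family n m} (hP : IsCycleSystem h ((pruned n s rs).2.foldl swapNext id) a k P) :
    IsPathSystem P ∧ weight w P + 4 * penalty p P ≤ 4 * prizeOpt w m p := by
  classical
  have hgood := hh.good (x := (core n s, [])) (good_core hs hm)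
  rw [add_zero] at hgood
  change Good n m W (actives n s) s₀ (pruned n s rs).1 (pruned n s rs).2 D at hgood
  obtain ⟨E', hE', ht⟩ := hh.tour h₀.comp (x := (core n s, [])) (good_core hs hm)
    (K := (pruned n s rs).1) subset_rfl hgood.mem
  rw [List.append_nil] at hE'
  rw [← hE'] at ht
  change Tour n s (pruned n s rs).1 ((pruned n s rs).2.foldl swapNext id) at ht
  have hcore : (pruned n s rs).1 ⊆ core n s := foldr_prune_subset rs _
  generalize (pruned n s rs).1 = K at *
  have hfold := foldl_swapNext (isMet hw hW) (pruned n s rs).2 (fun e he =>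
    ⟨mem_range.1 (hgood.sub (hgood.mem e he).1), mem_range.1 (hgood.sub (hgood.mem e he).2)⟩) id
    fun z hz => hz
  generalize (pruned n s rs).2 = E at *
  clear hE'
  generalize hf : E.foldl swapNext id = f at *
  have hK : ∀ z ∈ K, z < n := fun z hz => mem_range.1 (hgood.sub hz)
  have haK : ∀ i < m, a i ∈ K := fun i hi => (hgood.root _ (ha i hi)).1
  have hit : ∀ i < m, ∀ j, f^[j] (a i) ∈ K := by
    intro i hi j
    induction j with
    | zero => exact haK i hi
    | succ j ih => rw [Function.iterate_succ_apply']; exact ht.mem _ ih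
  have hcomp : ∀ i < m, ∀ j, s.comp (f^[j] (a i)) = a i := by
    intro i hi j
    induction j with
    | zero => exact hs.act_comp _ (hK _ (haK i hi)) (mem_filter.1 (ha i hi)).2
    | succ j ih => rw [Function.iterate_succ_apply', ht.comp _ (hK _ (hit i hi j)), ih]
  -- Two equal iterates before the first return would yield an earlier return.
  have hinj : ∀ i < m, ∀ j₁ < k i, ∀ j₂ < k i, f^[j₁] (a i) = f^[j₂] (a i) → j₁ = j₂ := by
    have : ∀ i < m, ∀ j₁ < k i, ∀ j₂ < k i, f^[j₁] (a i) = f^[j₂] (a i) → ¬ j₁ < j₂ := by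
      intro i hi j₁ h1 j₂ h2 he hlt
      refine hP.minimal i hi (k i - j₂ + j₁) (by omega) (by omega) ?_
      rw [Function.iterate_add_apply, he, ← Function.iterate_add_apply,
        Nat.sub_add_cancel h2.le, hP.closed i hi]
    intro i hi j₁ h1 j₂ h2 he
    have h3 := this i hi j₁ h1 j₂ h2 he
    have h4 := this i hi j₂ h2 j₁ h1 he.symm
    omega
  have hval : ∀ i < m, ∀ j, (vtx h (f^[j] (a i)) : ℕ) = f^[j] (a i) :=
    fun i hi j => vtx_val h (hK _ (hit i hi j))
  have hmemP : ∀ i : Fin m, ∀ x, x ∈ P i ↔ ∃ j < k i, f^[j] (a i) = x := by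
    intro i x
    rw [hP.eq i]
    simp only [List.mem_map, List.mem_range]
    refine exists_congr fun j => and_congr_right fun _ => ?_
    rw [Fin.ext_iff, hval i i.2]
  have hspan : ∀ v : Fin n, (v : ℕ) ∈ K ↔ v ∈ spanned P := by
    intro v
    simp only [spanned, mem_filter, mem_univ, true_and, hmemP]
    constructor
    · intro hv
      have hact : s.comp v ∈ actives n s :=
        mem_filter.2 ⟨mem_range.2 (hs.comp_lt v v.2), (mem_filter.1 (hcore hv)).2⟩
      -- The `a i` are `m` distinct active components, and there are only `m` of them. So every kept
      -- vertex lies on one of the cycles.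
      have hsurj : (range m).image a = actives n s := by
        refine eq_of_subset_of_card_le (fun x hx => ?_) ?_
        · obtain ⟨i, hi, rfl⟩ := mem_image.1 hx
          exact ha i (mem_range.1 hi)
        · rw [hm, card_image_of_injOn, card_range]
          intro i hi j hj hij
          exact ha' i (by simpa using hi) j (by simpa using hj) hij
      rw [← hsurj] at hact
      obtain ⟨i, hi, hai⟩ := mem_image.1 hact
      have hi := mem_range.1 hi
      have hr := ht.reach _ (haK i hi) _ hv (by rw [← hai]; exact hcomp i hi 0)
      have : ∃ j, f^[j] (a i) = v := by
        generalize (v : ℕ) = y at hr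
        induction hr with
        | refl => exact ⟨0, rfl⟩
        | tail _ h2 ih =>
          obtain ⟨j, hj⟩ := ih
          exact ⟨j + 1, by rw [Function.iterate_succ_apply', hj, h2]⟩
      obtain ⟨j, hj⟩ := this
      refine ⟨⟨i, hi⟩, j % k i, Nat.mod_lt _ (hP.pos i hi), ?_⟩
      have hper : Function.IsPeriodicPt f (k i) (a i) := hP.closed i hi
      rw [← hj]
      exact hper.iterate_mod_apply j
    · rintro ⟨i, j, -, hj⟩
      exact hj ▸ hit i i.2 j
  refine ⟨⟨fun i => ⟨?_, ?_⟩, fun i j hij x hx hx' => ?_⟩, ?_⟩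
  · intro hc
    have := (hmemP i (vtx h (a i))).2 ⟨0, hP.pos i i.2, (hval i i.2 0).symm⟩
    rw [hc] at this
    simp at this
  · rw [hP.eq i]
    refine List.Nodup.map_on (fun j₁ h1 j₂ h2 he => ?_) List.nodup_range
    rw [List.mem_range] at h1 h2
    have := congrArg Fin.val he
    rw [hval i i.2, hval i i.2] at this
    exact hinj i i.2 j₁ h1 j₂ h2 this
  · obtain ⟨j₁, -, h1⟩ := (hmemP i x).1 hx
    obtain ⟨j₂, -, h2⟩ := (hmemP j x).1 hx'
    have := hcomp i i.2 j₁
    rw [h1, ← h2, hcomp j j.2] at this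
    exact hij (Fin.ext (ha' j j.2 i i.2 this).symm)
  · -- the weight of the paths
    have hmet := isMet hw hW
    -- A path is its cycle without the closing arc, and the cycles are disjoint, so all paths
    -- together weigh at most the sum over all arcs of `f`.
    have hwP : weight w P ≤ ∑ z ∈ range n, W z (f z) := by
      have h1 : ∀ i : Fin m, pathWeight w (P i) ≤
          ∑ z ∈ (range (k i)).image fun j => f^[j] (a i), W z (f z) := by
        intro i
        rw [hP.eq i, List.range_eq_range', pathWeight_map_range', sum_image]
        · have h2 : ∀ j, w (vtx h (f^[0 + j] (a i))) (vtx h (f^[0 + j + 1] (a i))) =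
              W (f^[j] (a i)) (f (f^[j] (a i))) := by
            intro j
            rw [← hW, hval i i.2, hval i i.2, zero_add, Function.iterate_succ_apply']
          simp only [h2]
          refine sum_le_sum_of_subset_of_nonneg (range_mono (Nat.sub_le _ _)) fun j _ _ => ?_
          exact hmet.nonneg _ (hK _ (hit i i.2 j)) _ (ht.lt _ (hK _ (hit i i.2 j)))
        · intro j₁ h1 j₂ h2 he
          exact hinj i i.2 j₁ (by simpa using h1) j₂ (by simpa using h2) he
      refine (sum_le_sum fun i _ => h1 i).trans ?_
      rw [← sum_biUnion]
      · refine sum_le_sum_of_subset_of_nonneg (fun z hz => ?_) fun z hz _ => ?_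
        · obtain ⟨i, -, hz⟩ := mem_biUnion.1 hz
          obtain ⟨j, -, rfl⟩ := mem_image.1 hz
          exact mem_range.2 (hK _ (hit i i.2 j))
        · exact hmet.nonneg _ (mem_range.1 hz) _ (ht.lt _ (mem_range.1 hz))
      · intro i _ j _ hij
        refine disjoint_left.2 fun z hz hz' => ?_
        obtain ⟨j₁, -, h1⟩ := mem_image.1 hz
        obtain ⟨j₂, -, h2⟩ := mem_image.1 hz'
        have := hcomp i i.2 j₁
        rw [h1, ← h2, hcomp j j.2] at this
        exact hij (Fin.ext (ha' j j.2 i i.2 this).symm)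
    have hid : ∑ z ∈ range n, W z (id z) = 0 :=
      sum_eq_zero fun z hz => hmet.self z (mem_range.1 hz)
    have hcost := hgood.cost
    have e1 : (E.map fun e => W e.1 e.2 - s₀.load e.1 - s₀.load e.2).sum =
        (E.map fun e => W e.1 e.2).sum := by
      congr 1
      refine List.map_congr_left fun e he => ?_
      rw [h₀.load _ (hK _ (hgood.mem e he).1), h₀.load _ (hK _ (hgood.mem e he).2)]
      ring
    have e2 : ∑ l ∈ range n, (if s₀.comp l = l ∧ l ∉ K then s₀.pot l else 0) = penalty p P := by
      rw [penalty_eq hp P K hspan]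
      refine sum_congr rfl fun l hl => ?_
      have hl := mem_range.1 hl
      simp [h₀.comp l hl, h₀.pot l hl]
    rw [e1, e2] at hcost
    -- Weak duality: what remains at the end of the growth phase is nonnegative.
    have hD : D ≤ prizeOpt w m p := by
      obtain ⟨P₀, hP₀⟩ := exists_isPathSystem (n := n) hmn
      refine le_csInf ⟨_, P₀, hP₀, rfl⟩ ?_
      rintro x ⟨P', -, rfl⟩
      have hlt : ∀ i : Fin m, ∀ x ∈ (P' i).map Fin.val, x < n := by
        intro i x hx
        obtain ⟨y, -, rfl⟩ := List.mem_map.1 hx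
        exact y.2
      have h1 := hh.le_restCost hlt
      rw [restCost_initial hw hW hp h₀] at h1
      linarith [restCost_nonneg hs hlt]
    -- With `E` the accepted edges: `w(P) ≤ 2 w(E)` and `w(E) + 2 penalty ≤ 2 D ≤ 2 prizeOpt`.
    linarith [hfold.2]

end Moat

/-! ### The program for the prize-collecting problem

Natural arrays: `100` component, `101` activity, `102` multiples of `n`, `103`, `104`, `105` ends
and inactivity flag of the merges, `106` vertex sets of absorbed components, `107` kept vertices,
`108` ends of accepted edges, `109` accepted merges, `110` successors, `111`, `112`, `113` lengths,
vertices and first vertices of the paths; scalars from `120` on: `120` number of active components,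
`121` number of merges, `122`, `123`, `124` next event. Real arrays: `100` penalties, `101` loads,
`102` potentials; scalars `110` time to the next event, `111` auxiliary. -/

namespace RealRAM

abbrev c0 : NatExp := .const 0
abbrev c1 : NatExp := .const 1
/-- The number of vertices. -/
abbrev nn : NatExp := .read 0 c0 c0
/-- The number of paths. -/
abbrev mm : NatExp := .read 1 c0 c0
/-- A scratch array of the subroutine. -/
abbrev ra (a : ℕ) (j : NatExp) : NatExp := .read a rv j
abbrev rs (a : ℕ) : NatExp := .read a rv c0
abbrev fa (a : ℕ) (j : NatExp) : RealExp := .read a rv j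
abbrev fs (a : ℕ) : RealExp := .read a rv c0
abbrev setA (a : ℕ) (j e : NatExp) : Program := .setNat a rv j e
abbrev setS (a : ℕ) (e : NatExp) : Program := .setNat a rv c0 e
abbrev setFA (a : ℕ) (j : NatExp) (e : RealExp) : Program := .setReal a rv j e
abbrev setFS (a : ℕ) (e : RealExp) : Program := .setReal a rv c0 e

/-- Natural numbers cannot be multiplied, so the multiples of `n` are tabulated once; they serve as
offsets of blocks of length `n`. -/
def gwInit : Program :=
  .seq (setS 120 nn) <| forLoop rv 125 nn <|
    .seq (setA 100 (rs 125) (rs 125)) <|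
    .seq (setA 101 (rs 125) c1) <|
    .seq (setFA 102 (rs 125) (fa 100 (rs 125))) <|
    .seq (setA 110 (rs 125) (rs 125)) <|
    setA 102 (.add (rs 125) c1) (.add (ra 102 (rs 125)) nn)

/-- Find the active component with the smallest potential. -/
def gwScanPot : Program :=
  forLoop rv 125 nn <|
    .branch (natEq (ra 101 (rs 125)) c1)
      (.branch (natEq (rs 122) c0)
        (.seq (setFS 110 (fa 102 (rs 125))) (.seq (setS 122 c1) (setS 123 (rs 125))))
        (.branch (realLT (fa 102 (rs 125)) (fs 110))
          (.seq (setFS 110 (fa 102 (rs 125))) (.seq (setS 122 c1) (setS 123 (rs 125))))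
          .skip))
      .skip

/-- The remaining weight of the edge between the vertices `125` and `126`. -/
abbrev restWeight : RealExp :=
  .sub (.sub (.read 0 (rs 125) (rs 126)) (fa 101 (rs 125))) (fa 101 (rs 126))

/-- Find the edge between components that becomes tight first. -/
def gwScanEdge : Program :=
  forLoop rv 125 nn <|
    .branch (natEq (ra 101 (ra 100 (rs 125))) c1)
      (forLoop rv 126 nn <|
        .branch (natEq (ra 100 (rs 125)) (ra 100 (rs 126))) .skip <|
          .seq (.branch (natEq (ra 101 (ra 100 (rs 126))) c1)
            (setFS 111 (.div restWeight (.const 2))) (setFS 111 restWeight)) <|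
          .branch (realLT (fs 111) (fs 110))
            (.seq (setFS 110 (fs 111)) <| .seq (setS 122 (.const 2)) <|
              .seq (setS 123 (rs 125)) (setS 124 (rs 126)))
            .skip)
      .skip

/-- Active components are marked at the vertex that names them, so one pass over the vertices
updates both the loads and the potentials. -/
def gwGrow : Program :=
  forLoop rv 125 nn <|
    .seq (.branch (natEq (ra 101 (ra 100 (rs 125))) c1)
      (setFA 101 (rs 125) (.add (fa 101 (rs 125)) (fs 110))) .skip) <|
    .branch (natEq (ra 101 (rs 125)) c1)
      (setFA 102 (rs 125) (.sub (fa 102 (rs 125)) (fs 110))) .skip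

def gwDeact : Program :=
  .seq (setA 101 (rs 123) c0) (setS 120 (.sub (rs 120) c1))

/-- Since activity is a number `0` or `1`, subtracting it updates the number of active components
and yields the inactivity flag of the record without branching. -/
def gwMergeHead : Program :=
  .seq (setS 131 (ra 100 (rs 123))) <|
  .seq (setS 132 (ra 100 (rs 124))) <|
  .seq (setFA 102 (rs 131) (.add (fa 102 (rs 131)) (fa 102 (rs 132)))) <|
  .seq (setA 105 (rs 121) (.sub c1 (ra 101 (rs 132)))) <|
  .seq (setS 120 (.sub (rs 120) (ra 101 (rs 132)))) <|
  .seq (setA 101 (rs 132) c0) <|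
  .seq (setA 103 (rs 121) (rs 123)) (setA 104 (rs 121) (rs 124))

def gwMerge : Program :=
  .seq gwMergeHead <|
  .seq (forLoop rv 125 nn <|
    .branch (natEq (ra 100 (rs 125)) (rs 132))
      (.seq (setA 106 (.add (ra 102 (rs 121)) (rs 125)) c1) (setA 100 (rs 125) (rs 131))) .skip) <|
  setS 121 (.add (rs 121) c1)

def gwStep : Program :=
  .seq (setS 122 c0) <| .seq gwScanPot <| .seq gwScanEdge <| .seq gwGrow <|
    .branch (natEq (rs 122) c1) gwDeact gwMerge

def gwPhase : Program := .loop (.natLE (.add mm c1) (rs 120)) gwStep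

/-- The index of the merge that is treated next. -/
abbrev mi : NatExp := .sub (.sub (rs 121) c1) (rs 125)

def gwCore : Program :=
  forLoop rv 125 nn <|
    .branch (natEq (ra 101 (ra 100 (rs 125))) c1) (setA 107 (rs 125) c1) .skip

/-- The scalar `127` tells whether the absorbed set contains an end of an accepted edge. The sum
that is tested vanishes exactly if the inactivity flag equals `1` and `127` equals `0`: the two
truncated differences add up to the distance of the flag from `1`. -/
def gwPrune : Program :=
  forLoop rv 125 (rs 121) <|
    .seq (setS 130 mi) <|
    .branch (natEq (ra 107 (ra 103 (rs 130))) c1)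
      (.seq (setS 127 c0) <|
        .seq (forLoop rv 126 nn <|
          .branch (natEq (ra 106 (.add (ra 102 (rs 130)) (rs 126))) c1)
            (.branch (natEq (ra 108 (rs 126)) c1) (setS 127 c1) .skip) .skip) <|
        .branch (natEq (.add (.add (.sub (ra 105 (rs 130)) c1) (.sub c1 (ra 105 (rs 130))))
            (rs 127)) c0)
          (forLoop rv 126 nn <|
            .branch (natEq (ra 106 (.add (ra 102 (rs 130)) (rs 126))) c1)
              (setA 107 (rs 126) c0) .skip)
          (.seq (setA 108 (ra 103 (rs 130)) c1) <|
            .seq (setA 108 (ra 104 (rs 130)) c1) (setA 109 (rs 130) c1)))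
      .skip

def gwTour : Program :=
  forLoop rv 125 (rs 121) <|
    .branch (natEq (ra 109 (rs 125)) c1)
      (.seq (setS 129 (ra 110 (ra 103 (rs 125)))) <|
        .seq (setA 110 (ra 103 (rs 125)) (ra 110 (ra 104 (rs 125))))
          (setA 110 (ra 104 (rs 125)) (rs 129)))
      .skip

/-- A component is named by one of its vertices. Starting there, the successors are followed until
the cycle closes; the path number `128` is written to its own block of length `n`. -/
def gwOut : Program :=
  forLoop rv 125 nn <|
    .branch (natEq (ra 101 (rs 125)) c1)
      (.seq (setA 112 (ra 102 (rs 128)) (rs 125)) <|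
        .seq (setS 126 c1) <|
        .seq (setS 129 (ra 110 (rs 125))) <|
        .seq (.loop (.neg (natEq (rs 129) (rs 125))) <|
          .seq (setA 112 (.add (ra 102 (rs 128)) (rs 126)) (rs 129)) <|
            .seq (setS 126 (.add (rs 126) c1)) (setS 129 (ra 110 (rs 129)))) <|
        .seq (setA 111 (rs 128) (rs 126)) <|
        .seq (setA 113 (rs 128) (rs 125)) <|
        setS 128 (.add (rs 128) c1))
      .skip

def gw : Program :=
  .seq gwInit <| .seq gwPhase <| .seq gwCore <| .seq gwPrune <| .seq gwTour gwOut

theorem gw_isLocal : gw.isLocal = true := by decide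

@[simp] theorem nat_setNat (σ : Store) (a i j x i' j' : ℕ) :
    (σ.setNat a i j x).nat a i' j' = if i' = i ∧ j' = j then x else σ.nat a i' j' := by
  simp [Store.setNat]

@[simp] theorem nat_setNat_of_ne (σ : Store) {a b : ℕ} (h : b ≠ a) (i j x : ℕ) :
    (σ.setNat a i j x).nat b = σ.nat b := by
  funext i' j'
  simp [Store.setNat, h]

@[simp] theorem real_setNat (σ : Store) (a i j x : ℕ) : (σ.setNat a i j x).real = σ.real := rfl

@[simp] theorem real_setReal (σ : Store) (a i j : ℕ) (x : ℝ) (i' j' : ℕ) :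
    (σ.setReal a i j x).real a i' j' = if i' = i ∧ j' = j then x else σ.real a i' j' := by
  simp [Store.setReal]

@[simp] theorem real_setReal_of_ne (σ : Store) {a b : ℕ} (h : b ≠ a) (i j : ℕ) (x : ℝ) :
    (σ.setReal a i j x).real b = σ.real b := by
  funext i' j'
  simp [Store.setReal, h]

@[simp] theorem nat_setReal (σ : Store) (a i j : ℕ) (x : ℝ) : (σ.setReal a i j x).nat = σ.nat :=
  rfl

/-! #### Running times -/

theorem pow_bound_mono {M k k' c c' : ℕ} (hk : k ≤ k') (hc : c ≤ c') :
    c * (M + 1) ^ k ≤ c' * (M + 1) ^ k' :=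
  Nat.mul_le_mul hc (Nat.pow_le_pow_right (Nat.succ_pos M) hk)

/-- Bounds of the form `C * (M + 1) ^ k` are closed under all program constructions. A loop with at
most `M` rounds adds one to the exponent and `40` to the constant, so the side conditions become
inequalities between numerals. -/
theorem Runs.for_pow {i N : NatExp} {a : ℕ} {c : Program} {σ : Store} {r n M C C' k k' : ℕ}
    {Q : Store → Prop} (I : ℕ → Store → Prop) (hi : i.cost ≤ 5) (hN : N.cost ≤ 10)
    (hr : ∀ τ, Frame (a :: c.natW) c.realW σ τ → i.eval τ = r)
    (hn : ∀ τ, Frame (a :: c.natW) c.realW σ τ → N.eval τ = n) (hM : n ≤ M)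
    (ha : a ∉ c.natW)
    (h0 : I 0 (σ.setNat a r 0 0))
    (hI : ∀ x < n, ∀ τ, Frame (a :: c.natW) c.realW σ τ → τ.nat a r 0 = x → I x τ →
      Runs c τ (C * (M + 1) ^ k) fun ρ => I (x + 1) (ρ.setNat a r 0 (x + 1)))
    (hC : C + 40 ≤ C') (hk : k + 1 ≤ k') (hQ : ∀ τ, I n τ → τ.nat a r 0 = n → Q τ) :
    Runs (forLoop i a N c) σ (C' * (M + 1) ^ k') Q := by
  refine (Runs.for_loop I hi hN hr hn ha h0 hI).mono
    (le_trans ?_ (pow_bound_mono hk hC)) fun τ h => hQ τ h.1 h.2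
  have h1 : 1 ≤ (M + 1) ^ k := Nat.one_le_pow _ _ (Nat.succ_pos M)
  have h2 : n * (C * (M + 1) ^ k + 40) ≤ M * (C * (M + 1) ^ k + 40) :=
    Nat.mul_le_mul_right _ hM
  have h3 : M * (C * (M + 1) ^ k + 40) + 40 ≤ (M + 1) * (C * (M + 1) ^ k) + (M + 1) * 40 := by
    nlinarith
  have h4 : (M + 1) * 40 ≤ 40 * (M + 1) ^ (k + 1) := by
    rw [pow_succ]
    nlinarith
  calc _ ≤ (M + 1) * (C * (M + 1) ^ k) + (M + 1) * 40 := by omega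
    _ ≤ (M + 1) * (C * (M + 1) ^ k) + 40 * (M + 1) ^ (k + 1) := by omega
    _ = _ := by ring

theorem Runs.seq_pow {c d : Program} {σ : Store} {M k k₁ k₂ C C₁ C₂ : ℕ} {Q Q' : Store → Prop}
    (h : Runs c σ (C₁ * (M + 1) ^ k₁) Q)
    (h' : ∀ τ, Q τ → Frame c.natW c.realW σ τ → Runs d τ (C₂ * (M + 1) ^ k₂) Q')
    (hC : C₁ + C₂ ≤ C) (hk₁ : k₁ ≤ k) (hk₂ : k₂ ≤ k) :
    Runs (.seq c d) σ (C * (M + 1) ^ k) Q' := by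
  refine (h.seq h').mono ?_ fun _ h => h
  calc _ ≤ C₁ * (M + 1) ^ k + C₂ * (M + 1) ^ k :=
        Nat.add_le_add (pow_bound_mono hk₁ le_rfl) (pow_bound_mono hk₂ le_rfl)
    _ = (C₁ + C₂) * (M + 1) ^ k := by ring
    _ ≤ _ := Nat.mul_le_mul_right _ hC

theorem Runs.branch_pow {b : Test} {c d : Program} {σ : Store} {M k C C' : ℕ} {Q : Store → Prop}
    (hc : b.holds σ → Runs c σ (C * (M + 1) ^ k) Q)
    (hd : ¬ b.holds σ → Runs d σ (C * (M + 1) ^ k) Q) (hC : b.cost + C ≤ C') :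
    Runs (.branch b c d) σ (C' * (M + 1) ^ k) Q := by
  refine (Runs.branch hc hd).mono ?_ fun _ h => h
  have h1 : 1 ≤ (M + 1) ^ k := Nat.one_le_pow _ _ (Nat.succ_pos M)
  calc _ ≤ b.cost * (M + 1) ^ k + C * (M + 1) ^ k := by nlinarith
    _ = (b.cost + C) * (M + 1) ^ k := by ring
    _ ≤ _ := Nat.mul_le_mul_right _ hC

theorem Runs.step_pow {c : Program} {σ : Store} {M C k : ℕ} {Q : Store → Prop}
    (h : c.loopFree = true) (hT : c.maxCost ≤ C) (hQ : Q (c.step σ)) :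
    Runs c σ (C * (M + 1) ^ k) Q :=
  Runs.of_step h (hT.trans (Nat.le_mul_of_pos_right _ (Nat.pow_pos (Nat.succ_pos M)))) hQ

/-- The input of the subroutine is in place. -/
structure Ctx (n m : ℕ) (W : ℕ → ℕ → ℝ) (r : ℕ) (σ : Store) : Prop where
  row : σ.nat 9 0 0 = r
  size : σ.nat 0 0 0 = n
  number : σ.nat 1 0 0 = m
  weights : ∀ i j, σ.real 0 i j = W i j

theorem Ctx.frame {n m : ℕ} {W : ℕ → ℕ → ℝ} {r : ℕ} {σ τ : Store} {ns ls : List ℕ}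
    (h : Ctx n m W r σ) (f : Frame ns ls σ τ)
    (hf : (0 ∉ ns ∧ 1 ∉ ns ∧ 9 ∉ ns) ∧ 0 ∉ ls) : Ctx n m W r τ :=
  ⟨by rw [f.1 9 hf.1.2.2, h.row], by rw [f.1 0 hf.1.1, h.size], by rw [f.1 1 hf.1.2.1, h.number],
    fun i j => by rw [f.2 0 hf.2, h.weights]⟩

/-- The state of the growth phase that is stored in the row `r`. -/
def gst (σ : Store) (r : ℕ) : Moat.State where
  comp := σ.nat 100 r
  act := σ.nat 101 r
  load := σ.real 101 r
  pot := σ.real 102 r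

theorem gst_frame {σ τ : Store} {ns ls : List ℕ} (f : Frame ns ls σ τ) (r : ℕ)
    (hf : (100 ∉ ns ∧ 101 ∉ ns) ∧ 101 ∉ ls ∧ 102 ∉ ls) : gst τ r = gst σ r := by
  unfold gst
  rw [f.1 100 hf.1.1, f.1 101 hf.1.2, f.2 101 hf.2.1, f.2 102 hf.2.2]

section

variable {n m : ℕ} {W : ℕ → ℕ → ℝ} {r : ℕ} {σ : Store}

theorem runs_gwInit (hc : Ctx n m W r σ) (h0 : σ.nat 102 r 0 = 0) :
    Runs gwInit σ (1000 * (n + 1) ^ 1) fun τ => τ.nat 120 r 0 = n ∧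
      (∀ v < n, τ.nat 100 r v = v ∧ τ.nat 101 r v = 1 ∧ τ.real 102 r v = σ.real 100 r v ∧
        τ.nat 110 r v = v) ∧ ∀ v ≤ n, τ.nat 102 r v = v * n := by
  unfold gwInit
  refine Runs.seq_pow (C₁ := 10) (C₂ := 900) (k₁ := 0) (k₂ := 1)
    (Q := fun τ => τ.nat 120 r 0 = n) (Runs.step_pow rfl (by decide) ?_) ?_ (by norm_num)
    (by norm_num) le_rfl
  · simp [Program.step, NatExp.eval, Store.setNat, hc.row, hc.size]
  intro τ hτ f
  have hc := hc.frame f (by decide)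
  rw [← f.1 102 (by decide)] at h0
  rw [← f.2 100 (by decide)]
  refine Runs.for_pow (C := 200) (k := 0) (r := r) (n := n) (M := n)
    (fun k ρ => ρ.nat 120 r 0 = n ∧
      (∀ v < k, ρ.nat 100 r v = v ∧ ρ.nat 101 r v = 1 ∧ ρ.real 102 r v = τ.real 100 r v ∧
        ρ.nat 110 r v = v) ∧ ∀ v ≤ k, ρ.nat 102 r v = v * n) (by decide) (by decide)
      (fun ρ f => (hc.frame f (by decide)).row) (fun ρ f => (hc.frame f (by decide)).size) le_rfl
      (by decide) ?_ ?_ (by norm_num) (by norm_num) fun ρ h _ => h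
  · simp [hτ, h0]
  · intro k hk ρ f hx ⟨h1, h2, h3⟩
    have hc := hc.frame f (by decide)
    have hp := f.2 100 (by decide)
    have hk3 := h3 k le_rfl
    refine Runs.step_pow rfl (by decide) ?_
    simp [Program.step, NatExp.eval, RealExp.eval, hc.row, hc.size, hx, h1, hk3, hp]
    refine ⟨fun v hv => ?_, fun v hv => ?_⟩
    · rcases hv.lt_or_eq with hv | rfl
      · have := h2 v hv
        simp [this, hv.ne]
      · simp
    · rcases hv.lt_or_eq with hv | rfl
      · simp [hv.ne, h3 v (by omega)]
      · simp
        ring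

end

end RealRAM

/-! ### Events of the growth phase and preservation of its invariants. -/

namespace Moat

open Finset

/-- The time until the edge `u v` with `u` in an active component becomes tight. -/
noncomputable def slack (W : ℕ → ℕ → ℝ) (s : State) (u v : ℕ) : ℝ :=
  if s.act (s.comp v) = 1 then (W u v - s.load u - s.load v) / 2 else W u v - s.load u - s.load v

/-- The next event is the deactivation of `x` (type `1`) or the merge along `x y` (type `2`),
after the time `δ`. -/
def Event (n : ℕ) (W : ℕ → ℕ → ℝ) (s : State) (t x y : ℕ) (δ : ℝ) : Prop :=
  (t = 1 ∧ x < n ∧ s.act x = 1 ∧ δ = s.pot x) ∨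
    (t = 2 ∧ x < n ∧ y < n ∧ s.act (s.comp x) = 1 ∧ s.comp x ≠ s.comp y ∧ δ = slack W s x y)

/-- The current components. -/
def currents (n : ℕ) (s : State) : Finset ℕ := (range n).filter fun l => s.comp l = l

/-- No potential becomes negative and no edge is overloaded as long as the growth does not exceed
the time to the next event. An edge between two active components is used up at double speed, hence
the division by two in `slack`. -/
theorem Valid.grow {n : ℕ} {W : ℕ → ℕ → ℝ} {s s' : State} {δ : ℝ} (hs : Valid n W s)
    (hW : ∀ u < n, ∀ v < n, W u v = W v u)
    (h1 : ∀ l < n, s.act l = 1 → δ ≤ s.pot l)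
    (h2 : ∀ u < n, ∀ v < n, s.act (s.comp u) = 1 → s.comp u ≠ s.comp v → δ ≤ slack W s u v)
    (g : Grow n δ s s') : Valid n W s' := by
  refine ⟨fun v hv => ?_, fun v hv => ?_, fun l hl ha => ?_, fun u hu v hv huv => ?_,
    fun l hl hc => ?_, fun l hl hc ha => ?_⟩
  · rw [g.comp v hv]; exact hs.comp_lt v hv
  · rw [g.comp v hv, g.comp _ (hs.comp_lt v hv), hs.comp_comp v hv]
  · rw [g.comp l hl]
    rw [g.act l hl] at ha
    exact hs.act_comp l hl ha
  · rw [g.comp u hu, g.comp v hv] at huv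
    rw [g.load u hu, g.load v hv]
    have h3 := hs.load_le u hu v hv huv
    have h4 := h2 u hu v hv
    have h5 := h2 v hv u hu
    rw [slack] at h4 h5
    by_cases hau : s.act (s.comp u) = 1 <;> by_cases hav : s.act (s.comp v) = 1
    · have := h4 hau huv
      simp only [hau, hav, if_true] at this ⊢
      linarith
    · have := h4 hau huv
      simp only [hau, hav, if_true, if_false] at this ⊢
      linarith
    -- `slack` presupposes that the first end is active, so this edge is read backwards.
    · have := h5 hav (Ne.symm huv)
      rw [hW v hv u hu] at this
      simp only [hau, hav, if_true, if_false] at this ⊢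
      linarith
    · simpa [hau, hav] using h3
  · rw [g.comp l hl] at hc
    rw [g.pot l hl hc]
    have := hs.pot_nonneg l hl hc
    split_ifs with ha
    · linarith [h1 l hl ha]
    · linarith
  · rw [g.comp l hl] at hc
    rw [g.act l hl] at ha
    rw [g.pot l hl hc, if_neg ha, hs.pot_zero l hl hc ha, sub_zero]

theorem Event.nonneg {n : ℕ} {W : ℕ → ℕ → ℝ} {s : State} {t x y : ℕ} {δ : ℝ} (hs : Valid n W s)
    (h : Event n W s t x y δ) : 0 ≤ δ := by
  rcases h with ⟨-, hx, ha, rfl⟩ | ⟨-, hx, hy, -, hxy, rfl⟩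
  · exact hs.pot_nonneg x hx (hs.act_comp x hx ha)
  · have := hs.load_le x hx y hy hxy
    rw [slack]
    split_ifs <;> linarith

theorem actives_congr {n : ℕ} {s s' : State} (h : ∀ l < n, s'.act l = s.act l) :
    actives n s' = actives n s :=
  filter_congr fun l hl => by rw [h l (mem_range.1 hl)]

theorem currents_congr {n : ℕ} {s s' : State} (h : ∀ l < n, s'.comp l = s.comp l) :
    currents n s' = currents n s :=
  filter_congr fun l hl => by rw [h l (mem_range.1 hl)]

theorem card_actives_remove {n x : ℕ} {s s' : State} (hx : x < n) (h1 : s.act x ≤ 1)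
    (h : ∀ l < n, s'.act l = if l = x then 0 else s.act l) :
    (actives n s').card = (actives n s).card - s.act x := by
  have : actives n s' = (actives n s).erase x := by
    ext l
    simp only [actives, mem_filter, mem_range, mem_erase]
    constructor
    · rintro ⟨hl, ha⟩
      rw [h l hl] at ha
      split_ifs at ha with hc
      exact ⟨hc, hl, ha⟩
    · rintro ⟨hc, hl, ha⟩
      exact ⟨hl, by rw [h l hl, if_neg hc, ha]⟩
  rw [this, card_erase_eq_ite]
  by_cases ha : s.act x = 1
  · rw [if_pos (show x ∈ actives n s from mem_filter.2 ⟨mem_range.2 hx, ha⟩), ha]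
  · rw [if_neg fun hc : x ∈ actives n s => ha (mem_filter.1 hc).2]
    omega

theorem Valid.deact {n x : ℕ} {W : ℕ → ℕ → ℝ} {s s' : State} (hs : Valid n W s)
    (hx : s.pot x = 0) (hcomp : ∀ v < n, s'.comp v = s.comp v)
    (hact : ∀ l < n, s'.act l = if l = x then 0 else s.act l)
    (hload : ∀ v < n, s'.load v = s.load v) (hpot : ∀ v < n, s'.pot v = s.pot v) :
    Valid n W s' ∧ Deact n s s' := by
  have ha : ∀ l < n, s'.act l = 1 → s.act l = 1 := by
    intro l hl h
    rw [hact l hl] at h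
    split_ifs at h
    exact h
  refine ⟨⟨fun v hv => ?_, fun v hv => ?_, fun l hl h => ?_, fun u hu v hv huv => ?_,
    fun l hl hc => ?_, fun l hl hc h => ?_⟩, hcomp, ha, hload, fun l hl _ => hpot l hl⟩
  · rw [hcomp v hv]; exact hs.comp_lt v hv
  · rw [hcomp v hv, hcomp _ (hs.comp_lt v hv), hs.comp_comp v hv]
  · rw [hcomp l hl]; exact hs.act_comp l hl (ha l hl h)
  · rw [hcomp u hu, hcomp v hv] at huv
    rw [hload u hu, hload v hv]
    exact hs.load_le u hu v hv huv
  · rw [hcomp l hl] at hc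
    rw [hpot l hl]
    exact hs.pot_nonneg l hl hc
  · rw [hcomp l hl] at hc
    rw [hpot l hl]
    by_cases hl' : l = x
    · rw [hl', hx]
    · rw [hact l hl, if_neg hl'] at h
      exact hs.pot_zero l hl hc h

theorem Valid.merge {n u v : ℕ} {W : ℕ → ℕ → ℝ} {s s' : State} (hs : Valid n W s)
    (g : Merge n W u v s s') : Valid n W s' := by
  have hX := hs.comp_lt u g.u_lt
  have hY := hs.comp_lt v g.v_lt
  refine ⟨fun z hz => ?_, fun z hz => ?_, fun l hl h => ?_, fun a ha b hb hab => ?_,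
    fun l hl hc => ?_, fun l hl hc h => ?_⟩
  · rw [g.comp z hz]
    split_ifs
    exacts [hX, hs.comp_lt z hz]
  · rw [g.comp z hz]
    split_ifs with hc
    · exact g.comp_u hs
    · rw [g.comp _ (hs.comp_lt z hz), hs.comp_comp z hz, if_neg hc]
  · rw [g.act l hl] at h
    split_ifs at h with hc
    exact (g.comp_self hs hl).2 ⟨hs.act_comp l hl h, hc⟩
  · rw [g.load a ha, g.load b hb]
    refine hs.load_le a ha b hb fun hc => hab ?_
    rw [g.comp a ha, g.comp b hb, hc]
  · obtain ⟨h1, h2⟩ := (g.comp_self hs hl).1 hc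
    rw [g.pot l hl h1 h2]
    have := hs.pot_nonneg l hl h1
    have := hs.pot_nonneg _ hY (hs.comp_comp v g.v_lt)
    split_ifs <;> linarith
  · obtain ⟨h1, h2⟩ := (g.comp_self hs hl).1 hc
    rw [g.act l hl, if_neg h2] at h
    rw [g.pot l hl h1 h2, hs.pot_zero l hl h1 h, if_neg, add_zero]
    rintro rfl
    exact h g.act_u

theorem Merge.card_currents {n u v : ℕ} {W : ℕ → ℕ → ℝ} {s s' : State} (hs : Valid n W s)
    (g : Merge n W u v s s') : (currents n s').card + 1 = (currents n s).card := by
  have hv : s.comp v ∈ currents n s :=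
    mem_filter.2 ⟨mem_range.2 (hs.comp_lt v g.v_lt), hs.comp_comp v g.v_lt⟩
  have : currents n s' = (currents n s).erase (s.comp v) := by
    ext l
    simp only [currents, mem_filter, mem_range, mem_erase]
    constructor
    · rintro ⟨hl, hc⟩
      have := (g.comp_self hs hl).1 hc
      exact ⟨this.2, hl, this.1⟩
    · rintro ⟨h2, hl, h1⟩
      exact ⟨hl, (g.comp_self hs hl).2 ⟨h1, h2⟩⟩
  rw [this, card_erase_add_one hv]

end Moat

/-! ### Correctness of the scans for the next event and of the growth. -/

namespace RealRAM

open Moat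

section

variable {n m : ℕ} {W : ℕ → ℕ → ℝ} {r : ℕ} {σ : Store}

/-- The time in `110` is meaningless while `122` is zero, that is, until an active component has
been seen; this is the first alternative of the invariant. The hypothesis `hex` excludes it at the
end. -/
theorem runs_gwScanPot (hc : Ctx n m W r σ) {s : State} (hs : gst σ r = s)
    (he : σ.nat 122 r 0 = 0) (hex : ∃ l < n, s.act l = 1) :
    Runs gwScanPot σ (1000 * (n + 1) ^ 1) fun τ =>
      Event n W s (τ.nat 122 r 0) (τ.nat 123 r 0) (τ.nat 124 r 0) (τ.real 110 r 0) ∧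
      ∀ l < n, s.act l = 1 → τ.real 110 r 0 ≤ s.pot l := by
  unfold gwScanPot
  refine Runs.for_pow (C := 200) (k := 0) (r := r) (n := n) (M := n)
    (fun k ρ => (ρ.nat 122 r 0 = 0 ∧ ∀ l < k, s.act l ≠ 1) ∨
      (ρ.nat 122 r 0 = 1 ∧ ρ.nat 123 r 0 < n ∧ s.act (ρ.nat 123 r 0) = 1 ∧
        ρ.real 110 r 0 = s.pot (ρ.nat 123 r 0) ∧
        ∀ l < k, s.act l = 1 → ρ.real 110 r 0 ≤ s.pot l)) (by decide) (by decide)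
      (fun ρ f => (hc.frame f (by decide)).row) (fun ρ f => (hc.frame f (by decide)).size) le_rfl
      (by decide) ?_ ?_ (by norm_num) (by norm_num) ?_
  · exact .inl ⟨by simpa using he, by simp⟩
  · intro k hk ρ f hx hI
    have hc := hc.frame f (by decide)
    have hs' := (gst_frame f r (by decide)).trans hs
    have e1 : ρ.nat 101 r = s.act := by rw [← hs']; rfl
    have e2 : ρ.real 102 r = s.pot := by rw [← hs']; rfl
    refine Runs.step_pow rfl (by decide) ?_
    by_cases ha : s.act k = 1
    · by_cases hz : ρ.nat 122 r 0 = 0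
      · have h2 : ∀ l < k, s.act l ≠ 1 := by
          rcases hI with ⟨-, h⟩ | ⟨h, -⟩
          · exact h
          · rw [hz] at h; cases h
        refine .inr ?_
        simp [Program.step, NatExp.eval, RealExp.eval, hc.row, hx, e1, e2, ha, hz, hk]
        intro l hl hla
        rcases hl.lt_or_eq with hl | rfl
        · exact absurd hla (h2 l hl)
        · exact le_rfl
      · obtain ⟨h1, h2, h3, h4, h5⟩ := hI.resolve_left fun h => hz h.1
        refine .inr ?_
        by_cases hlt : ρ.real 110 r 0 ≤ s.pot k
        · simp [Program.step, NatExp.eval, RealExp.eval, Test.holds, hc.row, hx, e1, e2, ha, hlt,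
            h1, h2, h3, ← h4]
          intro l hl hla
          rcases hl.lt_or_eq with hl | rfl
          · exact h5 l hl hla
          · exact hlt
        · simp [Program.step, NatExp.eval, RealExp.eval, Test.holds, hc.row, hx, e1, e2, ha, hlt,
            h1, hk]
          intro l hl hla
          rcases hl.lt_or_eq with hl | rfl
          · exact (not_le.1 hlt).le.trans (h5 l hl hla)
          · exact le_rfl
    · simp [Program.step, NatExp.eval, hc.row, hx, e1, ha]
      refine hI.imp (fun h => ⟨h.1, fun l hl => ?_⟩) fun h => ⟨h.1, h.2.1, h.2.2.1, h.2.2.2.1,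
        fun l hl hla => ?_⟩
      · rcases hl.lt_or_eq with hl | rfl
        exacts [h.2 l hl, ha]
      · rcases hl.lt_or_eq with hl | rfl
        exacts [h.2.2.2.2 l hl hla, absurd hla ha]
  · rintro ρ hI -
    obtain ⟨l, hl, hla⟩ := hex
    obtain ⟨h1, h2, h3, h4, h5⟩ := hI.resolve_left fun h => h.2 l hl hla
    exact ⟨.inl ⟨h1, h2, h3, h4⟩, h5⟩

/-- The scan starts from the event found among the potentials and replaces it only by an earlier
one. So there is always a genuine event, and its time is a lower bound for everything examined so
far. -/
theorem runs_gwScanEdge (hc : Ctx n m W r σ) {s : State} (hs : gst σ r = s)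
    (he : Event n W s (σ.nat 122 r 0) (σ.nat 123 r 0) (σ.nat 124 r 0) (σ.real 110 r 0))
    (hp : ∀ l < n, s.act l = 1 → σ.real 110 r 0 ≤ s.pot l) :
    Runs gwScanEdge σ (1000 * (n + 1) ^ 2) fun τ =>
      Event n W s (τ.nat 122 r 0) (τ.nat 123 r 0) (τ.nat 124 r 0) (τ.real 110 r 0) ∧
      (∀ l < n, s.act l = 1 → τ.real 110 r 0 ≤ s.pot l) ∧
      ∀ u < n, ∀ v < n, s.act (s.comp u) = 1 → s.comp u ≠ s.comp v →
        τ.real 110 r 0 ≤ slack W s u v := by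
  unfold gwScanEdge
  refine Runs.for_pow (C := 500) (k := 1) (r := r) (n := n) (M := n)
    (fun k ρ => Event n W s (ρ.nat 122 r 0) (ρ.nat 123 r 0) (ρ.nat 124 r 0) (ρ.real 110 r 0) ∧
      (∀ l < n, s.act l = 1 → ρ.real 110 r 0 ≤ s.pot l) ∧
      ∀ u < k, ∀ v < n, s.act (s.comp u) = 1 → s.comp u ≠ s.comp v →
        ρ.real 110 r 0 ≤ slack W s u v) (by decide) (by decide)
      (fun ρ f => (hc.frame f (by decide)).row) (fun ρ f => (hc.frame f (by decide)).size) le_rfl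
      (by decide) ⟨by simpa using he, by simpa using hp, by simp⟩ ?_ (by norm_num) (by norm_num)
      fun ρ h _ => h
  rintro k hk ρ f hx ⟨h1, h2, h3⟩
  have hc := hc.frame f (by decide)
  have hs := (gst_frame f r (by decide)).trans hs
  have e0 : ρ.nat 100 r = s.comp := by rw [← hs]; rfl
  have e1 : ρ.nat 101 r = s.act := by rw [← hs]; rfl
  refine Runs.branch_pow (C := 460) (fun hb => ?_) (fun hb => ?_) (by decide)
  swap
  · simp only [natEq_holds, NatExp.eval, hc.row, hx, e0, e1] at hb
    refine Runs.step_pow rfl (by decide) ?_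
    simp [Program.step]
    refine ⟨h1, h2, fun u hu v hv ha => ?_⟩
    rcases hu.lt_or_eq with hu | rfl
    exacts [h3 u hu v hv ha, absurd ha hb]
  simp only [natEq_holds, NatExp.eval, hc.row, hx, e0, e1] at hb
  refine Runs.for_pow (C := 400) (k := 0) (r := r) (n := n) (M := n)
    (fun j ρ => Event n W s (ρ.nat 122 r 0) (ρ.nat 123 r 0) (ρ.nat 124 r 0) (ρ.real 110 r 0) ∧
      (∀ l < n, s.act l = 1 → ρ.real 110 r 0 ≤ s.pot l) ∧
      (∀ u < k, ∀ v < n, s.act (s.comp u) = 1 → s.comp u ≠ s.comp v →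
        ρ.real 110 r 0 ≤ slack W s u v) ∧
      ∀ v < j, s.comp k ≠ s.comp v → ρ.real 110 r 0 ≤ slack W s k v) (by decide) (by decide)
      (fun ρ f => (hc.frame f (by decide)).row) (fun ρ f => (hc.frame f (by decide)).size) le_rfl
      (by decide) ⟨by simpa using h1, by simpa using h2, by simpa using h3, by simp⟩ ?_
      (by norm_num) (by norm_num) ?_
  · clear h1 h2 h3
    rintro j hj π f hx' ⟨h1, h2, h3, h4⟩
    rw [← f.1 125 (by decide)] at hx
    have hc := hc.frame f (by decide)
    have hs := (gst_frame f r (by decide)).trans hs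
    have e0 : π.nat 100 r = s.comp := by rw [← hs]; rfl
    have e1 : π.nat 101 r = s.act := by rw [← hs]; rfl
    have e2 : π.real 101 r = s.load := by rw [← hs]; rfl
    refine Runs.step_pow rfl (by decide) ?_
    by_cases hcc : s.comp k = s.comp j
    · simp [Program.step, NatExp.eval, hc.row, hx, hx', e0, hcc]
      refine ⟨h1, h2, h3, fun v hv hne => ?_⟩
      rcases hv.lt_or_eq with hv | rfl
      exacts [h4 v hv (hcc ▸ hne), absurd rfl hne]
    · have hsl : (if s.act (s.comp j) = 1 then (W k j - s.load k - s.load j) / 2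
          else W k j - s.load k - s.load j) = slack W s k j := rfl
      -- Lowering the time preserves all bounds established so far; only the bound for the edge `k
      -- j` is new.
      have h5 : ∀ x, x ≤ π.real 110 r 0 → x ≤ slack W s k j →
          (∀ l < n, s.act l = 1 → x ≤ s.pot l) ∧
          (∀ u < k, ∀ v < n, s.act (s.comp u) = 1 → s.comp u ≠ s.comp v → x ≤ slack W s u v) ∧
          ∀ v < j + 1, s.comp k ≠ s.comp v → x ≤ slack W s k v := by
        intro x hx1 hx2
        refine ⟨fun l hl ha => hx1.trans (h2 l hl ha),
          fun u hu v hv ha hne => hx1.trans (h3 u hu v hv ha hne), fun v hv hne => ?_⟩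
        rcases Nat.lt_succ_iff_lt_or_eq.1 hv with hv | rfl
        exacts [hx1.trans (h4 v hv hne), hx2]
      by_cases hja : s.act (s.comp j) = 1
      · rw [if_pos hja] at hsl
        by_cases hlt : π.real 110 r 0 ≤ slack W s k j
        · simp [Program.step, NatExp.eval, RealExp.eval, Test.holds, hc.row, hc.weights, hx, hx',
            e0, e1, e2, hcc, hja, hsl, hlt]
          exact ⟨h1, by simpa using h5 _ le_rfl hlt⟩
        · simp [Program.step, NatExp.eval, RealExp.eval, Test.holds, hc.row, hc.weights, hx, hx',
            e0, e1, e2, hcc, hja, hsl, hlt]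
          exact ⟨.inr ⟨rfl, hk, hj, hb, hcc, rfl⟩, by simpa using h5 _ (not_le.1 hlt).le le_rfl⟩
      · rw [if_neg hja] at hsl
        by_cases hlt : π.real 110 r 0 ≤ slack W s k j
        · simp [Program.step, NatExp.eval, RealExp.eval, Test.holds, hc.row, hc.weights, hx, hx',
            e0, e1, e2, hcc, hja, hsl, hlt]
          exact ⟨h1, by simpa using h5 _ le_rfl hlt⟩
        · simp [Program.step, NatExp.eval, RealExp.eval, Test.holds, hc.row, hc.weights, hx, hx',
            e0, e1, e2, hcc, hja, hsl, hlt]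
          exact ⟨.inr ⟨rfl, hk, hj, hb, hcc, rfl⟩, by simpa using h5 _ (not_le.1 hlt).le le_rfl⟩
  · rintro π ⟨h1, h2, h3, h4⟩ -
    simp
    refine ⟨h1, h2, fun u hu v hv ha hne => ?_⟩
    rcases hu.lt_or_eq with hu | rfl
    exacts [h3 u hu v hv ha hne, h4 v hv hne]

theorem runs_gwGrow (hc : Ctx n m W r σ) {s : State} (hs : gst σ r = s)
    (hcomp : ∀ v < n, s.comp v < n) (hδ : 0 ≤ σ.real 110 r 0) :
    Runs gwGrow σ (1000 * (n + 1) ^ 1) fun τ => Grow n (σ.real 110 r 0) s (gst τ r) := by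
  unfold gwGrow
  refine Runs.for_pow (C := 200) (k := 0) (r := r) (n := n) (M := n)
    (fun k ρ => ρ.nat 100 = σ.nat 100 ∧ ρ.nat 101 = σ.nat 101 ∧
      (∀ v < n, ρ.real 101 r v =
        s.load v + if v < k ∧ s.act (s.comp v) = 1 then σ.real 110 r 0 else 0) ∧
      ∀ l < n, ρ.real 102 r l = s.pot l - if l < k ∧ s.act l = 1 then σ.real 110 r 0 else 0)
      (by decide) (by decide)
      (fun ρ f => (hc.frame f (by decide)).row) (fun ρ f => (hc.frame f (by decide)).size) le_rfl
      (by decide) ?_ ?_ (by norm_num) (by norm_num) ?_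
  · subst hs
    simp [gst]
  · rintro k hk ρ f hx ⟨h1, h2, h3, h4⟩
    have hc := hc.frame f (by decide)
    have e0 : ρ.nat 100 r = s.comp := by rw [h1, ← hs]; rfl
    have e1 : ρ.nat 101 r = s.act := by rw [h2, ← hs]; rfl
    have e2 : ρ.real 110 = σ.real 110 := f.2 110 (by decide)
    refine Runs.step_pow rfl (by decide) ?_
    have h3k := h3 k hk
    have h4k := h4 k hk
    simp only [lt_irrefl, false_and, if_false, add_zero, sub_zero] at h3k h4k
    have hlt : ∀ v, v < k + 1 ↔ v < k ∨ v = k := fun v => by omega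
    by_cases ha : s.act (s.comp k) = 1 <;> by_cases ha' : s.act k = 1 <;>
    · simp [Program.step, NatExp.eval, RealExp.eval, hc.row, hx, e0, e1, e2, ha, ha', h1, h2, h3k,
        h4k, hlt]
      refine ⟨fun v hv => ?_, fun v hv => ?_⟩
      · by_cases hvk : v = k
        · subst hvk; simp [ha, h3k]
        · simp [hvk, h3 v hv]
      · by_cases hvk : v = k
        · subst hvk; simp [ha', h4k]
        · simp [hvk, h4 v hv]
  · rintro ρ ⟨h1, h2, h3, h4⟩ -
    subst hs
    refine ⟨hδ, fun v _ => by simp [gst, h1], fun v _ => by simp [gst, h2], fun v hv => ?_,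
      fun l hl _ => ?_⟩
    · rw [show (gst ρ r).load v = _ from h3 v hv]
      simp [hv]
    · rw [show (gst ρ r).pot l = _ from h4 l hl]
      simp [hl]

end

end RealRAM

/-! ### Merges in memory and the loop of the growth phase. -/

namespace RealRAM

open Moat Finset

/-- The stored record of the merge number `i`. -/
def storedRec (n : ℕ) (σ : Store) (r i : ℕ) : Rec where
  u := σ.nat 103 r i
  v := σ.nat 104 r i
  inact := σ.nat 105 r i
  set := (range n).filter fun z => σ.nat 106 r (i * n + z) = 1

section

variable {n m : ℕ} {W : ℕ → ℕ → ℝ} {r : ℕ} {σ : Store}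

theorem runs_gwMergeHead (hc : Ctx n m W r σ) {s : State} (hs : gst σ r = s) {x y N : ℕ}
    (hx : σ.nat 123 r 0 = x) (hy : σ.nat 124 r 0 = y) (hN : σ.nat 121 r 0 = N) :
    Runs gwMergeHead σ (300 * (n + 1) ^ 0) fun τ =>
      τ.nat 131 r 0 = s.comp x ∧ τ.nat 132 r 0 = s.comp y ∧
      (∀ l, τ.real 102 r l = if l = s.comp x then s.pot (s.comp x) + s.pot (s.comp y)
        else s.pot l) ∧
      (∀ i, τ.nat 105 r i = if i = N then 1 - s.act (s.comp y) else σ.nat 105 r i) ∧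
      τ.nat 120 r 0 = σ.nat 120 r 0 - s.act (s.comp y) ∧
      (∀ l, τ.nat 101 r l = if l = s.comp y then 0 else s.act l) ∧
      (∀ i, τ.nat 103 r i = if i = N then x else σ.nat 103 r i) ∧
      ∀ i, τ.nat 104 r i = if i = N then y else σ.nat 104 r i := by
  have e0 : σ.nat 100 r = s.comp := by rw [← hs]; rfl
  have e1 : σ.nat 101 r = s.act := by rw [← hs]; rfl
  have e2 : σ.real 102 r = s.pot := by rw [← hs]; rfl
  refine Runs.step_pow rfl (by decide) ?_
  simp [gwMergeHead, Program.step, NatExp.eval, RealExp.eval, hc.row, hx, hy, hN, e0, e1, e2]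

/-- The vertex set of merge number `N` occupies the block of length `n` at the offset `N * n` of the
array `106`. Hypothesis `hM` says that this block and everything behind it is still zero, so only
the members have to be written. -/
theorem runs_gwMerge (hc : Ctx n m W r σ) {s : State} (hs : gst σ r = s) {x y N : ℕ}
    (hx : σ.nat 123 r 0 = x) (hy : σ.nat 124 r 0 = y) (hN : σ.nat 121 r 0 = N)
    (hv : Valid n W s) (hxn : x < n) (hyn : y < n) (hax : s.act (s.comp x) = 1)
    (hxy : s.comp x ≠ s.comp y) (ht : s.load x + s.load y = W x y)
    (hact : ∀ l < n, s.act l ≤ 1) (hoff : σ.nat 102 r N = N * n)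
    (hM : ∀ i, N * n ≤ i → σ.nat 106 r i = 0) :
    Runs gwMerge σ (1000 * (n + 1) ^ 1) fun τ => Merge n W x y s (gst τ r) ∧
      τ.nat 121 r 0 = N + 1 ∧ τ.nat 120 r 0 = σ.nat 120 r 0 - s.act (s.comp y) ∧
      storedRec n τ r N = mergeRec n x y s ∧
      (∀ i < N, storedRec n τ r i = storedRec n σ r i) ∧
      ∀ i, (N + 1) * n ≤ i → τ.nat 106 r i = 0 := by
  unfold gwMerge
  refine Runs.seq_pow (C₁ := 300) (C₂ := 700) (k₁ := 0) (k₂ := 1) (runs_gwMergeHead hc hs hx hy hN)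
    ?_ (by norm_num) (by norm_num) le_rfl
  rintro τ ⟨h131, h132, hpot, h105, h120, h101, h103, h104⟩ f
  have hc := hc.frame f (by decide)
  have e0 : τ.nat 100 r = s.comp := by rw [f.1 100 (by decide), ← hs]; rfl
  have hN' : τ.nat 121 r 0 = N := by rw [f.1 121 (by decide), hN]
  have hoff' : τ.nat 102 r N = N * n := by rw [f.1 102 (by decide), hoff]
  have e3 : τ.nat 106 = σ.nat 106 := f.1 106 (by decide)
  have e4 : τ.real 101 r = s.load := by rw [f.2 101 (by decide), ← hs]; rfl
  refine Runs.seq_pow (C₁ := 300) (C₂ := 100) (k₁ := 1) (k₂ := 0) (Q := fun ρ =>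
    (∀ v < n, ρ.nat 100 r v = if s.comp v = s.comp y then s.comp x else s.comp v) ∧
    ∀ i, ρ.nat 106 r i = if N * n ≤ i ∧ i < N * n + n ∧ s.comp (i - N * n) = s.comp y then 1
      else σ.nat 106 r i)
    (Runs.for_pow (C := 200) (k := 0) (r := r) (n := n) (M := n) (fun k ρ =>
      (∀ v < n, ρ.nat 100 r v = if v < k ∧ s.comp v = s.comp y then s.comp x else s.comp v) ∧
      ∀ i, ρ.nat 106 r i = if N * n ≤ i ∧ i < N * n + k ∧ s.comp (i - N * n) = s.comp y then 1
        else σ.nat 106 r i) (by decide) (by decide)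
      (fun ρ f => (hc.frame f (by decide)).row) (fun ρ f => (hc.frame f (by decide)).size) le_rfl
      (by decide) ?_ ?_ (by norm_num) (by norm_num) ?_) ?_ (by norm_num) (by norm_num) (by norm_num)
  · simp only [ne_eq, Nat.reduceEqDiff, not_false_eq_true, nat_setNat_of_ne,
      e0, e3]
    refine ⟨fun v _ => by simp, fun i => ?_⟩
    rw [if_neg]
    omega
  · rintro k hk ρ f hk' ⟨h1, h2⟩
    have hc := hc.frame f (by decide)
    rw [← f.1 131 (by decide)] at h131
    rw [← f.1 132 (by decide)] at h132
    rw [← f.1 121 (by decide)] at hN'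
    rw [← f.1 102 (by decide)] at hoff'
    refine Runs.step_pow rfl (by decide) ?_
    have h1k := h1 k hk
    simp only [lt_irrefl, false_and, if_false] at h1k
    by_cases hcy : s.comp k = s.comp y
    · rw [hcy] at h1k
      simp [Program.step, NatExp.eval, hc.row, hk', h131, h132, hN', hoff', h1k]
      refine ⟨fun v hv => ?_, fun i => ?_⟩
      · by_cases hvk : v = k
        · subst hvk; simp [hcy]
        · simp only [hvk, if_false, h1 v hv]
          have : v ≤ k ↔ v < k := by omega
          simp [this]
      · by_cases hik : i = N * n + k
        · subst hik
          simp [hcy]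
        · simp only [hik, if_false, h2 i]
          have : i < N * n + (k + 1) ↔ i < N * n + k := by omega
          simp [this]
    · have hcy' : ρ.nat 100 r k ≠ s.comp y := by rw [h1k]; exact hcy
      simp [Program.step, NatExp.eval, hc.row, hk', h132, hcy']
      refine ⟨fun v hv => ?_, fun i => ?_⟩
      · by_cases hvk : v = k
        · subst hvk; simp [hcy, h1k]
        · rw [h1 v hv]
          have : v ≤ k ↔ v < k := by omega
          simp [this]
      · by_cases hik : i = N * n + k
        · subst hik
          simp [hcy, h2]
        · rw [h2 i]
          have : i < N * n + (k + 1) ↔ i < N * n + k := by omega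
          simp [this]
  · rintro ρ ⟨h1, h2⟩ -
    exact ⟨fun v hv => by rw [h1 v hv]; simp [hv], h2⟩
  rintro ρ ⟨h1, h2⟩ f'
  have hc := hc.frame f' (by decide)
  rw [← f'.1 101 (by decide)] at h101
  rw [← f'.1 103 (by decide)] at h103
  rw [← f'.1 104 (by decide)] at h104
  rw [← f'.1 105 (by decide)] at h105
  rw [← f'.1 120 (by decide)] at h120
  rw [← f'.1 121 (by decide)] at hN'
  rw [← f'.2 102 (by decide)] at hpot
  rw [← f'.2 101 (by decide)] at e4
  refine Runs.step_pow rfl (by decide) ?_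
  simp only [Program.step, NatExp.eval, hc.row, hN']
  have hpoty := hv.comp_lt y hyn
  refine ⟨⟨hxn, hyn, hxy, hax, ht, ?_, ?_, ?_, ?_⟩, by simp, by simpa using h120, ?_, ?_, ?_⟩
  · intro z hz
    simpa [gst] using h1 z hz
  · intro l hl
    simpa [gst] using h101 l
  · intro z hz
    simp [gst, e4]
  · intro l hl _ _
    simp only [gst, real_setNat, hpot]
    split_ifs with h
    · rw [h]
    · simp
  · simp only [storedRec, mergeRec, ne_eq, Nat.reduceEqDiff,
      not_false_eq_true, nat_setNat_of_ne, h103, h104, h105, h2, if_true, Rec.mk.injEq, true_and]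
    constructor
    · have := hact _ (hv.comp_lt y hyn)
      split_ifs with h
      · rw [h]
      · omega
    · refine filter_congr fun z hz => ?_
      have hz := mem_range.1 hz
      by_cases hzy : s.comp z = s.comp y
      · simp [hzy, hz]
      · simp [hzy, hM (N * n + z) (by omega)]
  · intro i hi
    -- Earlier records are unaffected because their blocks end before `N * n`.
    have hi' : (i + 1) * n ≤ N * n := Nat.mul_le_mul_right _ hi
    simp only [storedRec, ne_eq, Nat.reduceEqDiff,
      not_false_eq_true, nat_setNat_of_ne, h103, h104, h105, h2, hi.ne, if_false,
      Rec.mk.injEq, true_and]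
    refine filter_congr fun z hz => ?_
    have hz := mem_range.1 hz
    rw [if_neg]
    rintro ⟨h, -⟩
    rw [add_mul, one_mul] at hi'
    omega
  · intro i hi
    simp only [ne_eq, Nat.reduceEqDiff, not_false_eq_true, nat_setNat_of_ne,
      h2]
    rw [add_mul, one_mul] at hi
    rw [if_neg (by omega)]
    exact hM i (by omega)

/-- The invariant of the growth phase, in memory. -/
structure Growing (n m : ℕ) (W : ℕ → ℕ → ℝ) (r : ℕ) (s₀ : State) (σ : Store) : Prop where
  ctx : Ctx n m W r σ
  valid : Valid n W (gst σ r)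
  hist : ∃ D, Hist n m W s₀ ((List.range' 0 (σ.nat 121 r 0)).map (storedRec n σ r)) D (gst σ r)
  act_le : ∀ l < n, σ.nat 101 r l ≤ 1
  count : σ.nat 120 r 0 = (actives n (gst σ r)).card
  merges : σ.nat 121 r 0 + (currents n (gst σ r)).card = n
  ends_lt : ∀ i < σ.nat 121 r 0, σ.nat 103 r i < n ∧ σ.nat 104 r i < n
  off : ∀ v ≤ n, σ.nat 102 r v = v * n
  zero : ∀ i, σ.nat 121 r 0 * n ≤ i → σ.nat 106 r i = 0
  le : m ≤ σ.nat 120 r 0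

/-- The number of active components plus the number of all components strictly decreases: a
deactivation lowers the first, a merge lowers the second and does not raise the first. This bounds
the number of steps. -/
theorem runs_gwStep (hW : ∀ u < n, ∀ v < n, W u v = W v u) {s₀ : State} (h : Growing n m W r s₀ σ)
    (hm : m < σ.nat 120 r 0) :
    Runs gwStep σ (5000 * (n + 1) ^ 2) fun τ => Growing n m W r s₀ τ ∧
      τ.nat 120 r 0 + (currents n (gst τ r)).card <
        σ.nat 120 r 0 + (currents n (gst σ r)).card := by
  have hc := h.ctx
  unfold gwStep
  refine Runs.seq_pow (C₁ := 10) (C₂ := 4900) (k₁ := 0) (k₂ := 2)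
    (Q := fun τ => τ.nat 122 r 0 = 0) (Runs.step_pow rfl (by decide)
      (by simp [Program.step, NatExp.eval, hc.row])) ?_ (by norm_num) (by norm_num) le_rfl
  intro τ₁ hτ f₁
  have hc₁ := hc.frame f₁ (by decide)
  have hs₁ := gst_frame f₁ r (by decide)
  have hex : ∃ l < n, (gst σ r).act l = 1 := by
    have : 0 < (actives n (gst σ r)).card := by rw [← h.count]; omega
    obtain ⟨l, hl⟩ := card_pos.1 this
    exact ⟨l, mem_range.1 (mem_filter.1 hl).1, (mem_filter.1 hl).2⟩
  refine Runs.seq_pow (C₁ := 1000) (C₂ := 3900) (k₁ := 1) (k₂ := 2) (runs_gwScanPot hc₁ hs₁ hτ hex)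
    ?_ (by norm_num) (by norm_num) le_rfl
  rintro τ₂ ⟨hev, hpot⟩ f₂
  have hc₂ := hc₁.frame f₂ (by decide)
  have hs₂ := (gst_frame f₂ r (by decide)).trans hs₁
  refine Runs.seq_pow (C₁ := 1000) (C₂ := 2900) (k₁ := 2) (k₂ := 2)
    (runs_gwScanEdge hc₂ hs₂ hev hpot) ?_ (by norm_num) le_rfl le_rfl
  clear hev hpot
  rintro τ₃ ⟨hev, hpot, hsl⟩ f₃
  have hc₃ := hc₂.frame f₃ (by decide)
  have hs₃ := (gst_frame f₃ r (by decide)).trans hs₂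
  refine Runs.seq_pow (C₁ := 1000) (C₂ := 1900) (k₁ := 1) (k₂ := 1)
    (runs_gwGrow hc₃ hs₃ h.valid.comp_lt (hev.nonneg h.valid)) ?_ (by norm_num) (by norm_num)
    (by norm_num)
  rintro τ₄ g f₄
  have hc₄ := hc₃.frame f₄ (by decide)
  have hv := h.valid.grow hW hpot hsl g
  obtain ⟨D, hD⟩ := h.hist
  have hD := Hist.grow _ _ _ _ _ hD h.valid g
  have n0 : ∀ a, a ∉ [125, 122, 123, 126, 124] → τ₄.nat a = σ.nat a := by
    intro a ha
    have hb : a ∉ gwScanPot.natW := fun hc => ha (by revert hc; simp [gwScanPot, forLoop, Program.natW]; tauto)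
    have hb' : a ∉ gwScanEdge.natW := fun hc => ha (by revert hc; simp [gwScanEdge, forLoop, Program.natW]; tauto)
    have hb'' : a ∉ gwGrow.natW := fun hc => ha (by revert hc; simp [gwGrow, forLoop, Program.natW]; tauto)
    rw [f₄.1 a hb'', f₃.1 a hb', f₂.1 a hb, f₁.1 a (fun hc => ha (by
      revert hc; simp [Program.natW]; tauto))]
  have hrec : storedRec n τ₄ r = storedRec n σ r := by
    funext i
    simp only [storedRec, n0 103 (by decide), n0 104 (by decide), n0 105 (by decide),
      n0 106 (by decide)]
  have hacts : actives n (gst τ₄ r) = actives n (gst σ r) := actives_congr g.act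
  have hcurs : currents n (gst τ₄ r) = currents n (gst σ r) := currents_congr g.comp
  have hal : ∀ l < n, (gst τ₄ r).act l ≤ 1 := fun l hl => by rw [g.act l hl]; exact h.act_le l hl
  have e120 := n0 120 (by decide)
  have e121 := n0 121 (by decide)
  have hcount := h.count
  have hmerges := h.merges
  refine Runs.branch_pow (C := 1800) (fun hb => ?_) (fun hb => ?_) (by decide)
  · -- a component becomes inactive
    simp only [natEq_holds, NatExp.eval, hc₄.row, f₄.1 122 (by decide)] at hb
    obtain ⟨-, hx, ha, hδ⟩ : _ := hev.resolve_right fun h => by rw [hb] at h; simp at h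
    refine Runs.step_pow rfl (by decide) ?_
    have e3 : τ₄.nat 123 r 0 = τ₃.nat 123 r 0 := by rw [f₄.1 123 (by decide)]
    simp only [gwDeact, Program.step, NatExp.eval, hc₄.row, e3]
    generalize τ₃.nat 123 r 0 = x at hx ha hδ
    -- The component has just grown for a time equal to its potential.
    have hx0 : (gst τ₄ r).pot x = 0 := by
      rw [g.pot x hx (h.valid.act_comp x hx ha), if_pos ha, hδ, sub_self]
    have e9 : (τ₄.setNat 101 r x 0).nat 9 0 0 = r := by simp [hc₄.row]
    rw [e9]
    set τ₅ := (τ₄.setNat 101 r x 0).setNat 120 r 0 ((τ₄.setNat 101 r x 0).nat 120 r 0 - 1) with hτ₅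
    have n1 : ∀ a, a ≠ 101 → a ≠ 120 → τ₅.nat a = τ₄.nat a := by
      intro a h1 h2
      simp [hτ₅, h1, h2]
    have q1 : ∀ l, τ₅.nat 101 r l = if l = x then 0 else τ₄.nat 101 r l := by simp [hτ₅]
    have q2 : τ₅.nat 120 r 0 = τ₄.nat 120 r 0 - 1 := by simp [hτ₅]
    have q3 : τ₅.real = τ₄.real := by simp [hτ₅]
    clear_value τ₅
    have hact : ∀ l < n, (gst τ₅ r).act l = if l = x then 0 else (gst τ₄ r).act l :=
      fun l _ => q1 l
    have hcomp : ∀ v < n, (gst τ₅ r).comp v = (gst τ₄ r).comp v := fun v _ => by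
      simp [gst, n1 100 (by decide) (by decide)]
    obtain ⟨hv', g'⟩ := hv.deact hx0 hcomp hact (fun v _ => by simp [gst, q3])
      (fun v _ => by simp [gst, q3])
    have hca := card_actives_remove hx (hal x hx) hact
    have hax : (gst τ₄ r).act x = 1 := by rw [g.act x hx, ha]
    rw [hacts, hax] at hca
    have hcc := currents_congr hcomp
    rw [hcurs] at hcc
    have e121' : τ₅.nat 121 = σ.nat 121 := by rw [n1 121 (by decide) (by decide), e121]
    have hrec' : storedRec n τ₅ r = storedRec n τ₄ r := by
      funext i
      simp only [storedRec, n1 103 (by decide) (by decide), n1 104 (by decide) (by decide),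
        n1 105 (by decide) (by decide), n1 106 (by decide) (by decide)]
    refine ⟨⟨⟨?_, ?_, ?_, ?_⟩, hv',
      ⟨D + τ₃.real 110 r 0 * ((actives n (gst σ r)).card - m), ?_⟩, ?_, ?_, ?_, ?_, ?_, ?_, ?_⟩, ?_⟩
    · rw [n1 9 (by decide) (by decide), hc₄.row]
    · rw [n1 0 (by decide) (by decide), hc₄.size]
    · rw [n1 1 (by decide) (by decide), hc₄.number]
    · rw [q3]; exact hc₄.weights
    · rw [e121', hrec', hrec]
      exact Hist.deact _ _ _ _ hD hv g'
    · intro l hl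
      rw [q1]
      split_ifs
      exacts [Nat.zero_le _, hal l hl]
    · rw [q2, hca, e120, hcount]
    · rw [e121', hcc, hmerges]
    · rw [e121', n1 103 (by decide) (by decide), n1 104 (by decide) (by decide),
        n0 103 (by decide), n0 104 (by decide)]
      exact h.ends_lt
    · rw [n1 102 (by decide) (by decide), n0 102 (by decide)]
      exact h.off
    · rw [e121', n1 106 (by decide) (by decide), n0 106 (by decide)]
      exact h.zero
    · rw [q2, e120]
      omega
    · rw [q2, hcc, e120]
      omega
  · -- a component is absorbed
    simp only [natEq_holds, NatExp.eval, hc₄.row, f₄.1 122 (by decide)] at hb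
    obtain ⟨-, hx, hy, hax, hxy, hδ⟩ : _ := hev.resolve_left fun h => hb h.1
    have hcur : 0 < (currents n (gst σ r)).card := card_pos.2 ⟨_, mem_filter.2
      ⟨mem_range.2 (h.valid.comp_lt _ hx), h.valid.comp_comp _ hx⟩⟩
    have ex : τ₄.nat 123 r 0 = τ₃.nat 123 r 0 := by rw [f₄.1 123 (by decide)]
    have ey : τ₄.nat 124 r 0 = τ₃.nat 124 r 0 := by rw [f₄.1 124 (by decide)]
    generalize τ₃.nat 123 r 0 = x at *
    generalize τ₃.nat 124 r 0 = y at *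
    have cx := g.comp x hx
    have cy := g.comp y hy
    have ax := g.act _ (h.valid.comp_lt x hx)
    have hY := h.valid.comp_lt y hy
    refine (runs_gwMerge hc₄ rfl ex ey rfl hv hx hy ?_ ?_ ?_ hal ?_ ?_).frame.mono
      (pow_bound_mono le_rfl (by norm_num)) ?_
    · rw [cx, ax, hax]
    · rw [cx, cy]; exact hxy
    -- Growing by the slack of the edge makes it tight, whether one or both ends are active.
    · rw [g.load x hx, g.load y hy, if_pos hax, hδ, slack]
      split_ifs <;> ring
    · rw [n0 102 (by decide), e121]
      exact h.off _ (by omega)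
    · rw [n0 106 (by decide), e121]
      exact h.zero
    · rintro τ₅ ⟨⟨gm, hN, hcnt, hr1, hr2, hz⟩, f₅⟩
      have hY' := hv.comp_lt y hy
      have hca := card_actives_remove hY' (hal _ hY') gm.act
      have hcc := gm.card_currents hv
      have haY := hal _ hY'
      have haY' : (gst τ₄ r).act ((gst τ₄ r).comp y) ≤ τ₄.nat 120 r 0 := by
        rw [e120]; omega
      rw [hacts] at hca
      rw [hcurs] at hcc
      rw [e121] at hN hr1 hr2 hz
      refine ⟨⟨hc₄.frame f₅ (by decide), hv.merge gm,
        ⟨D + τ₃.real 110 r 0 * ((actives n (gst σ r)).card - m), ?_⟩, ?_, ?_, ?_, ?_, ?_, ?_, ?_⟩, ?_⟩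
      · have hD' := Hist.merge _ _ _ _ _ _ hD hv gm
        rw [hN, List.range'_1_concat, List.map_append, List.map_singleton, zero_add, hr1]
        convert hD' using 2
        refine List.map_congr_left fun i hi => ?_
        rw [hr2 i (by simpa using hi), hrec]
      · intro l hl
        rw [show τ₅.nat 101 r l = _ from gm.act l hl]
        split_ifs
        exacts [Nat.zero_le _, hal l hl]
      · rw [hcnt, hca, e120, hcount]
      · rw [hN]
        omega
      · intro i hi
        rw [hN] at hi
        rcases Nat.lt_succ_iff_lt_or_eq.1 hi with hi | rfl
        · have := hr2 i hi
          rw [hrec] at this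
          have h1 := congrArg Rec.u this
          have h2 := congrArg Rec.v this
          simp only [storedRec] at h1 h2
          rw [h1, h2]
          exact h.ends_lt i hi
        · have h1 := congrArg Rec.u hr1
          have h2 := congrArg Rec.v hr1
          simp only [storedRec, mergeRec] at h1 h2
          rw [h1, h2]
          exact ⟨hx, hy⟩
      · rw [f₅.1 102 (by decide), n0 102 (by decide)]
        exact h.off
      · rw [hN]
        exact hz
      · rw [hcnt, e120]
        omega
      · rw [hcnt, e120]
        omega

/-- The measure is at most `2 n` at the beginning and a step costs `O(n²)`. A step removes at most
one active component, so the loop stops with exactly `m` of them. -/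
theorem runs_gwPhase (hW : ∀ u < n, ∀ v < n, W u v = W v u) {s₀ : State}
    (h : Growing n m W r s₀ σ) :
    Runs gwPhase σ (20000 * (n + 1) ^ 3) fun τ => Growing n m W r s₀ τ ∧ τ.nat 120 r 0 = m := by
  have key : ∀ ρ, Growing n m W r s₀ ρ →
      (Test.natLE (.add mm c1) (rs 120)).holds ρ → m < ρ.nat 120 r 0 := by
    intro ρ h hb
    simpa [Test.holds, NatExp.eval, h.ctx.row, h.ctx.number] using hb
  have hle : ∀ ρ : Store, (currents n (gst ρ r)).card ≤ n ∧ (actives n (gst ρ r)).card ≤ n :=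
    fun ρ => ⟨(card_filter_le _ _).trans (card_range n).le,
      (card_filter_le _ _).trans (card_range n).le⟩
  have := Runs.loop (b := .natLE (.add mm c1) (rs 120)) (c := gwStep)
    (fun k ρ => Growing n m W r s₀ ρ ∧ ρ.nat 120 r 0 + (currents n (gst ρ r)).card ≤ k)
    (T := 5000 * (n + 1) ^ 2) ?_ (k := 2 * n) (σ := σ)
    ⟨h, by rw [h.count]; have := hle σ; omega⟩
  · refine this.mono ?_ ?_
    · have hb : (Test.natLE (.add mm c1) (rs 120)).cost ≤ 12 := by decide
      rw [pow_succ _ 2]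
      have : 1 ≤ (n + 1) ^ 2 := Nat.one_le_pow _ _ (Nat.succ_pos n)
      nlinarith
    · rintro τ ⟨⟨k, h, -⟩, hb⟩
      refine ⟨h, le_antisymm ?_ h.le⟩
      simpa [Test.holds, NatExp.eval, h.ctx.row, h.ctx.number] using hb
  · rintro k ρ ⟨h, hk⟩ hb
    have hm := key ρ h hb
    refine ⟨k - 1, by omega, (runs_gwStep hW h hm).mono le_rfl ?_⟩
    rintro τ ⟨h', hlt⟩
    exact ⟨h', by omega⟩

end

end RealRAM

/-! ### Pruning and tour construction in memory. -/

namespace RealRAM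

open Moat Finset

section

variable {n m : ℕ} {W : ℕ → ℕ → ℝ} {r : ℕ} {σ : Store}

theorem runs_gwCore (hc : Ctx n m W r σ) (hz : ∀ z, σ.nat 107 r z = 0) :
    Runs gwCore σ (500 * (n + 1) ^ 1) fun τ =>
      ∀ z < n, τ.nat 107 r z = 1 ↔ z ∈ core n (gst σ r) := by
  refine Runs.for_pow (C := 400) (k := 0) (r := r) (n := n) (M := n) (fun k ρ =>
    ∀ z < n, ρ.nat 107 r z = 1 ↔ z < k ∧ z ∈ core n (gst σ r)) (by decide) (by decide)
    (fun ρ f => (hc.frame f (by decide)).row) (fun ρ f => (hc.frame f (by decide)).size) le_rfl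
    (by decide) ?_ ?_ (by norm_num) (by norm_num) ?_
  · simp [hz]
  · intro k hk ρ f hk' h1
    have hc := hc.frame f (by decide)
    have hs := gst_frame f r (by decide)
    rw [← hs] at h1 ⊢
    have h1k := h1 k hk
    simp only [lt_irrefl, false_and, iff_false] at h1k
    have hcore : k ∈ core n (gst ρ r) ↔ ρ.nat 101 r (ρ.nat 100 r k) = 1 := by
      simp only [core, mem_filter, mem_range, hk, true_and]
      rfl
    have key : ∀ z, z ≤ k ↔ z < k ∨ z = k := fun z => by omega
    refine Runs.step_pow rfl (by decide) ?_
    by_cases ha : ρ.nat 101 r (ρ.nat 100 r k) = 1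
    · simp [Program.step, NatExp.eval, hc.row, hk', ha]
      intro z hz
      by_cases hzk : z = k
      · subst hzk; simp [hcore, ha]
      · simp [hzk, key, h1 z hz]
    · simp [Program.step, NatExp.eval, hc.row, hk', ha]
      intro z hz
      by_cases hzk : z = k
      · subst hzk; simp [hcore, ha, h1k]
      · simp [hzk, key, h1 z hz]
  · intro ρ h _ z hz
    simp [h z hz, hz]

/-- The stored merges from the number `i` on. -/
def lastRecs (n : ℕ) (σ : Store) (r N i : ℕ) : List Rec :=
  (List.range' (N - i) i).map (storedRec n σ r)

/-- The accepted edges among the last `i` merges. -/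
def accepted (σ : Store) (r N i : ℕ) : List (ℕ × ℕ) :=
  ((List.range' (N - i) i).filter fun j => σ.nat 109 r j = 1).map
    fun j => (σ.nat 103 r j, σ.nat 104 r j)

/-- The invariant of the pruning phase, in memory. -/
structure Pruning (n r N : ℕ) (K₀ : Finset ℕ) (i : ℕ) (σ : Store) : Prop where
  kept : ∀ z < n, σ.nat 107 r z = 1 ↔ z ∈ ((lastRecs n σ r N i).foldr prune (K₀, [])).1
  acc : accepted σ r N i = ((lastRecs n σ r N i).foldr prune (K₀, [])).2
  need : ∀ z < n, σ.nat 108 r z = 1 ↔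
    ∃ e ∈ ((lastRecs n σ r N i).foldr prune (K₀, [])).2, e.1 = z ∨ e.2 = z
  fresh : ∀ j < N - i, σ.nat 109 r j = 0

theorem range'_sub_succ {N i : ℕ} (h : i < N) :
    List.range' (N - (i + 1)) (i + 1) = (N - 1 - i) :: List.range' (N - i) i := by
  rw [List.range'_succ, show N - (i + 1) = N - 1 - i by omega, show N - 1 - i + 1 = N - i by omega]

theorem runs_gwPruneFlag (hc : Ctx n m W r σ) {p : ℕ} (hp : σ.nat 130 r 0 = p)
    (hoff : σ.nat 102 r p = p * n) (h0 : σ.nat 127 r 0 = 0) :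
    Runs (forLoop rv 126 nn <|
          .branch (natEq (ra 106 (.add (ra 102 (rs 130)) (rs 126))) c1)
            (.branch (natEq (ra 108 (rs 126)) c1) (setS 127 c1) .skip) .skip) σ
      (500 * (n + 1) ^ 1) fun τ => (τ.nat 127 r 0 = 0 ↔
        ∀ z < n, z ∈ (storedRec n σ r p).set → σ.nat 108 r z ≠ 1) := by
  refine Runs.for_pow (C := 400) (k := 0) (r := r) (n := n) (M := n) (fun k ρ =>
    (ρ.nat 127 r 0 = 0 ↔
        ∀ z < k, z ∈ (storedRec n σ r p).set → σ.nat 108 r z ≠ 1)) (by decide) (by decide)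
    (fun ρ f => (hc.frame f (by decide)).row) (fun ρ f => (hc.frame f (by decide)).size) le_rfl
    (by decide) ?_ ?_ (by norm_num) (by norm_num) ?_
  · simp [h0]
  · intro k hk ρ f hk' h1
    have hc := hc.frame f (by decide)
    simp only [storedRec] at h1 ⊢
    rw [← f.1 102 (by decide)] at hoff
    rw [← f.1 130 (by decide)] at hp
    rw [← f.1 106 (by decide), ← f.1 108 (by decide)] at h1 ⊢
    have key : ∀ z, z < k + 1 ↔ z < k ∨ z = k := fun z => by omega
    refine Runs.step_pow rfl (by decide) ?_
    simp only [key, or_imp, forall_and, forall_eq]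
    by_cases ha : ρ.nat 106 r (p * n + k) = 1
    · by_cases hb : ρ.nat 108 r k = 1
      · simp [Program.step, NatExp.eval, hc.row, hk', hoff, hp, ha, hb, hk]
      · simp [Program.step, NatExp.eval, hc.row, hk', hoff, hp, ha, hb]
        simpa using h1
    · simp [Program.step, NatExp.eval, hc.row, hk', hoff, hp, ha]
      simpa using h1
  · intro ρ h _
    exact h

theorem runs_gwPruneRemove (hc : Ctx n m W r σ) {p : ℕ} (hp : σ.nat 130 r 0 = p)
    (hoff : σ.nat 102 r p = p * n) :
    Runs (forLoop rv 126 nn <|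
            .branch (natEq (ra 106 (.add (ra 102 (rs 130)) (rs 126))) c1)
              (setA 107 (rs 126) c0) .skip) σ
      (500 * (n + 1) ^ 1) fun τ => ∀ z < n, τ.nat 107 r z =
        if σ.nat 106 r (p * n + z) = 1 then 0 else σ.nat 107 r z := by
  refine Runs.for_pow (C := 400) (k := 0) (r := r) (n := n) (M := n) (fun k ρ =>
    ∀ z < n, ρ.nat 107 r z =
        if z < k ∧ σ.nat 106 r (p * n + z) = 1 then 0 else σ.nat 107 r z) (by decide) (by decide)
    (fun ρ f => (hc.frame f (by decide)).row) (fun ρ f => (hc.frame f (by decide)).size) le_rfl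
    (by decide) ?_ ?_ (by norm_num) (by norm_num) ?_
  · simp
  · intro k hk ρ f hk' h1
    have hc := hc.frame f (by decide)
    rw [← f.1 102 (by decide)] at hoff
    rw [← f.1 130 (by decide)] at hp
    simp only [← f.1 106 (by decide)] at h1 ⊢
    have key : ∀ z, z ≤ k ↔ z < k ∨ z = k := fun z => by omega
    refine Runs.step_pow rfl (by decide) ?_
    by_cases ha : ρ.nat 106 r (p * n + k) = 1
    · simp [Program.step, NatExp.eval, hc.row, hk', hoff, hp, ha]
      intro z hz
      by_cases hzk : z = k
      · subst hzk; simp [ha]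
      · simp [hzk, key, h1 z hz]
    · simp [Program.step, NatExp.eval, hc.row, hk', hoff, hp, ha]
      intro z hz
      by_cases hzk : z = k
      · subst hzk; simp [ha, h1 z hz]
      · simp [hzk, key, h1 z hz]
  · intro ρ h _ z hz
    simp [h z hz, hz]

theorem storedRec_frame {σ τ : Store} {ns ls : List ℕ} (f : Frame ns ls σ τ) (n r : ℕ)
    (hf : 103 ∉ ns ∧ 104 ∉ ns ∧ 105 ∉ ns ∧ 106 ∉ ns) : storedRec n τ r = storedRec n σ r := by
  funext i
  simp only [storedRec, f.1 103 hf.1, f.1 104 hf.2.1, f.1 105 hf.2.2.1, f.1 106 hf.2.2.2]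

/-- The array `108` marks the ends of accepted edges. This lets the test whether an absorbed set
meets an accepted edge run in linear time, and the whole phase in quadratic time. -/
theorem runs_gwPrune (hc : Ctx n m W r σ) {N : ℕ} (hN : σ.nat 121 r 0 = N) (hNn : N ≤ n)
    (hoff : ∀ v ≤ n, σ.nat 102 r v = v * n) (hends : ∀ i < N, σ.nat 103 r i < n ∧ σ.nat 104 r i < n)
    {K₀ : Finset ℕ} (hK : ∀ z < n, σ.nat 107 r z = 1 ↔ z ∈ K₀)
    (h108 : ∀ z, σ.nat 108 r z = 0) (h109 : ∀ z, σ.nat 109 r z = 0) :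
    Runs gwPrune σ (2000 * (n + 1) ^ 2) fun τ => accepted τ r N N =
      (((List.range' 0 N).map (storedRec n σ r)).foldr prune (K₀, [])).2 := by
  have hrange : List.range' 0 N = List.range' (N - N) N := by rw [Nat.sub_self]
  suffices h : Runs gwPrune σ (2000 * (n + 1) ^ 2) (Pruning n r N K₀ N) by
    refine h.frame.mono le_rfl ?_
    rintro ρ ⟨h, f⟩
    rw [h.acc, hrange, lastRecs, storedRec_frame f n r (by decide)]
  refine Runs.for_pow (C := 1900) (k := 1) (r := r) (n := N) (M := n) (Pruning n r N K₀)
    (by decide) (by decide)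
    (fun ρ f => (hc.frame f (by decide)).row) (fun ρ f => ?_) hNn
    (by decide) ?_ ?_ (by norm_num) (by norm_num) fun ρ h _ => h
  · simp [NatExp.eval, (hc.frame f (by decide)).row, f.1 121 (by decide), hN]
  · refine ⟨fun z hz => ?_, ?_, fun z hz => ?_, fun j _ => ?_⟩ <;>
      simp [lastRecs, accepted, *]
  · intro i hi τ f hi' hI
    have hc := hc.frame f (by decide)
    rw [← f.1 121 (by decide)] at hN
    rw [← f.1 102 (by decide)] at hoff
    rw [← f.1 103 (by decide), ← f.1 104 (by decide)] at hends
    generalize hp : N - 1 - i = p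
    have hpN : p < N := by omega
    refine Runs.seq_pow (C₁ := 100) (C₂ := 1800) (k₁ := 0) (k₂ := 1)
      (Q := fun ρ => ρ.nat 130 r 0 = p)
      (Runs.step_pow rfl (by decide) ?_) ?_ (by norm_num) (by norm_num) le_rfl
    · simp [Program.step, NatExp.eval, hc.row, hN, hi', hp]
    intro τ₁ h130 f₁
    have hrec₁ := storedRec_frame f₁ n r (by decide)
    have hc := hc.frame f₁ (by decide)
    rw [← f₁.1 102 (by decide)] at hoff
    have hI : Pruning n r N K₀ i τ₁ := by
      refine ⟨?_, ?_, ?_, ?_⟩ <;> simp only [lastRecs, hrec₁, accepted, f₁.1 103 (by decide),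
        f₁.1 104 (by decide), f₁.1 107 (by decide), f₁.1 108 (by decide), f₁.1 109 (by decide)]
      exacts [hI.kept, hI.acc, hI.need, hI.fresh]
    rw [← f₁.1 103 (by decide), ← f₁.1 104 (by decide)] at hends
    clear hi' hrec₁ f₁ f
    have hlast : lastRecs n τ₁ r N (i + 1) = storedRec n τ₁ r p :: lastRecs n τ₁ r N i := by
      rw [lastRecs, range'_sub_succ hi, hp]
      rfl
    have hu := (hends p hpN).1
    have hkept := hI.kept _ hu
    -- from the new values of the arrays to the invariant
    have fin : ∀ ρ : Store, storedRec n ρ r = storedRec n τ₁ r →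
        (∀ z < n, ρ.nat 107 r z = 1 ↔
          z ∈ ((lastRecs n τ₁ r N (i + 1)).foldr prune (K₀, [])).1) →
        (∀ z < n, ρ.nat 108 r z = 1 ↔
          ∃ e ∈ ((lastRecs n τ₁ r N (i + 1)).foldr prune (K₀, [])).2, e.1 = z ∨ e.2 = z) →
        (∀ j, j ≠ p → ρ.nat 109 r j = τ₁.nat 109 r j) →
        ((lastRecs n τ₁ r N (i + 1)).foldr prune (K₀, [])).2 = (if ρ.nat 109 r p = 1 then
          [(τ₁.nat 103 r p, τ₁.nat 104 r p)] else []) ++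
            ((lastRecs n τ₁ r N i).foldr prune (K₀, [])).2 →
        Pruning n r N K₀ (i + 1) (ρ.setNat 125 r 0 (i + 1)) := by
      intro ρ h1 h2 h3 h4 h5
      have h1' : storedRec n (ρ.setNat 125 r 0 (i + 1)) r = storedRec n τ₁ r := by
        rw [← h1]
        funext j
        simp [storedRec]
      have e3 : ∀ j, ρ.nat 103 r j = τ₁.nat 103 r j := fun j => congrArg Rec.u (congrFun h1 j)
      have e4 : ∀ j, ρ.nat 104 r j = τ₁.nat 104 r j := fun j => congrArg Rec.v (congrFun h1 j)
      have h1'' : lastRecs n (ρ.setNat 125 r 0 (i + 1)) r N (i + 1) =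
          lastRecs n τ₁ r N (i + 1) := by simp only [lastRecs, h1']
      refine ⟨?_, ?_, ?_, ?_⟩
      · rw [h1'']
        simpa using h2
      · rw [h1'', h5, ← hI.acc]
        simp only [accepted, range'_sub_succ hi, hp, ne_eq, Nat.reduceEqDiff, not_false_eq_true,
          nat_setNat_of_ne, e3, e4]
        have hf : (List.range' (N - i) i).filter (fun j => decide (ρ.nat 109 r j = 1)) =
            (List.range' (N - i) i).filter (fun j => decide (τ₁.nat 109 r j = 1)) := by
          refine List.filter_congr fun j hj => ?_
          rw [h4 j]
          have := (List.mem_range'_1.1 hj).1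
          omega
        rw [List.filter_cons, hf]
        split_ifs with h <;> simp_all
      · rw [h1'']
        simpa using h3
      · intro j hj
        simp only [ne_eq, Nat.reduceEqDiff, not_false_eq_true, nat_setNat_of_ne]
        rw [h4 j (by omega)]
        exact hI.fresh j (by omega)
    rw [hlast, List.foldr_cons] at fin
    have hacc := hI.acc
    have hneed := hI.need
    have hkall := hI.kept
    have hfr : τ₁.nat 109 r p = 0 := hI.fresh p (by omega)
    generalize (lastRecs n τ₁ r N i).foldr prune (K₀, []) = X at *
    refine Runs.branch_pow (C := 1750) (fun hb => ?_) (fun hb => ?_) (by decide)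
    · simp only [natEq_holds, NatExp.eval, hc.row, h130] at hb
      have hX : (storedRec n τ₁ r p).u ∈ X.1 := hkept.1 hb
      refine Runs.seq_pow (C₁ := 10) (C₂ := 1700) (k₁ := 0) (k₂ := 1)
        (Q := fun ρ => ρ.nat 127 r 0 = 0)
        (Runs.step_pow rfl (by decide) ?_) ?_ (by norm_num) (by norm_num) le_rfl
      · simp [Program.step, NatExp.eval, hc.row]
      intro τ₂ h127 f₂
      have hc₂ := hc.frame f₂ (by decide)
      have h130₂ : τ₂.nat 130 r 0 = p := by rw [f₂.1 130 (by decide), h130]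
      refine Runs.seq_pow (C₁ := 500) (C₂ := 1200) (k₁ := 1) (k₂ := 1)
        (runs_gwPruneFlag hc₂ h130₂ (by rw [f₂.1 102 (by decide)]; exact hoff p (by omega)) h127)
        ?_ (by norm_num) le_rfl le_rfl
      intro τ₃ hflag f₃
      have hc₃ := hc₂.frame f₃ (by decide)
      have h130₃ : τ₃.nat 130 r 0 = p := by rw [f₃.1 130 (by decide), h130₂]
      have f₂₃ : Frame [127, 126] [] τ₁ τ₃ := (f₂.mono (by decide) (by decide)).trans
        (f₃.mono (by decide) (by decide))
      have hrec := storedRec_frame f₂₃ n r (by decide)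
      rw [storedRec_frame f₂ n r (by decide), f₂.1 108 (by decide)] at hflag
      clear f₂ f₃ hc₂ h130₂
      have hset : ∀ z ∈ (storedRec n τ₁ r p).set, z < n := fun z hz =>
        mem_range.1 (mem_filter.1 hz).1
      -- The numerical test of the program is the removal condition of `prune`: `108` is marked
      -- somewhere on the set exactly if an accepted edge ends there.
      have hcond : (τ₃.nat 105 r p = 1 ∧ τ₃.nat 127 r 0 = 0) ↔
          ((storedRec n τ₁ r p).inact = 1 ∧
            ∀ e ∈ X.2, e.1 ∉ (storedRec n τ₁ r p).set ∧ e.2 ∉ (storedRec n τ₁ r p).set) := by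
        rw [f₂₃.1 105 (by decide), hflag]
        refine and_congr Iff.rfl ⟨fun h e he => ⟨fun hs => ?_, fun hs => ?_⟩, fun h z hz hzs hz1 => ?_⟩
        · exact h _ (hset _ hs) hs ((hneed _ (hset _ hs)).2 ⟨e, he, .inl rfl⟩)
        · exact h _ (hset _ hs) hs ((hneed _ (hset _ hs)).2 ⟨e, he, .inr rfl⟩)
        · obtain ⟨e, he, rfl | rfl⟩ := (hneed z hz).1 hz1
          exacts [(h e he).1 hzs, (h e he).2 hzs]
      refine Runs.branch_pow (C := 1100) (fun hb' => ?_) (fun hb' => ?_) (by decide)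
      · have hcd := hcond.1 (by
          simp only [natEq_holds, NatExp.eval, hc₃.row, h130₃] at hb'
          omega)
        refine (runs_gwPruneRemove hc₃ h130₃ (by
          rw [f₂₃.1 102 (by decide)]; exact hoff p (by omega))).frame.mono
          (pow_bound_mono le_rfl (by norm_num)) ?_
        rintro ρ ⟨h107, f₄⟩
        rw [prune_of_removed hX hcd] at fin
        rw [f₂₃.1 106 (by decide), f₂₃.1 107 (by decide)] at h107
        refine fin ρ ((storedRec_frame f₄ n r (by decide)).trans hrec) (fun z hz => ?_)
          (fun z hz => ?_) (fun j _ => ?_) ?_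
        · have hzs : z ∈ (storedRec n τ₁ r p).set ↔ τ₁.nat 106 r (p * n + z) = 1 := by
            simp [storedRec, hz]
          rw [h107 z hz, mem_sdiff, ← hkall z hz, hzs]
          split_ifs with h <;> simp [h]
        · rw [f₄.1 108 (by decide), f₂₃.1 108 (by decide), hneed z hz]
        · rw [f₄.1 109 (by decide), f₂₃.1 109 (by decide)]
        · rw [f₄.1 109 (by decide), f₂₃.1 109 (by decide), hfr]
          rfl
      · have hcd := mt hcond.2 (by
          simp only [natEq_holds, NatExp.eval, hc₃.row, h130₃] at hb'
          omega)
        rw [prune_of_accepted hX hcd] at fin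
        refine Runs.step_pow rfl (by decide) ?_
        simp only [Program.step, NatExp.eval, hc₃.row, h130₃]
        refine fin _ ?_ (fun z hz => ?_) (fun z hz => ?_) (fun j hj => ?_) ?_
        · rw [← hrec]
          funext j
          simp [storedRec]
        · simp [f₂₃.1 107 (by decide), hkall z hz]
        · have h5 := hneed z hz
          have e3 : (storedRec n τ₁ r p).u = τ₁.nat 103 r p := rfl
          have e4 : (storedRec n τ₁ r p).v = τ₁.nat 104 r p := rfl
          simp only [List.mem_cons, exists_eq_or_imp, ← h5, e3, e4]
          simp [hc₃.row, h130₃, f₂₃.1 108 (by decide), f₂₃.1 103 (by decide),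
            f₂₃.1 104 (by decide)]
          by_cases hzv : z = τ₁.nat 104 r p
          · simp [hzv]
          · by_cases hzu : z = τ₁.nat 103 r p
            · simp [hzu]
            · simp [hzv, hzu, Ne.symm hzv, Ne.symm hzu]
        · simp [hc₃.row, h130₃, hj, f₂₃.1 109 (by decide)]
        · simp [hc₃.row, h130₃, storedRec]
    · simp only [natEq_holds, NatExp.eval, hc.row, h130] at hb
      have hX : (storedRec n τ₁ r p).u ∉ X.1 := fun h => hb (hkept.2 h)
      rw [show prune (storedRec n τ₁ r p) X = X by rw [prune, if_pos hX]] at fin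
      refine Runs.step_pow rfl (by decide) ?_
      exact fin τ₁ rfl hkall hneed (fun _ _ => rfl) (by rw [hfr]; rfl)

/-- Reading the accepted edges in the order of the merges. -/
theorem accepted_succ (σ : Store) (r k : ℕ) : accepted σ r (k + 1) (k + 1) = accepted σ r k k ++
    if σ.nat 109 r k = 1 then [(σ.nat 103 r k, σ.nat 104 r k)] else [] := by
  simp only [accepted, Nat.sub_self, List.range'_1_concat, zero_add, List.filter_append,
    List.map_append]
  congr 1
  split_ifs with h <;> simp [h]

theorem accepted_frame {σ τ : Store} {ns ls : List ℕ} (f : Frame ns ls σ τ) (r N i : ℕ)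
    (hf : 103 ∉ ns ∧ 104 ∉ ns ∧ 109 ∉ ns) : accepted τ r N i = accepted σ r N i := by
  simp only [accepted, f.1 103 hf.1, f.1 104 hf.2.1, f.1 109 hf.2.2]

theorem runs_gwTour (hc : Ctx n m W r σ) {N : ℕ} (hN : σ.nat 121 r 0 = N) (hNn : N ≤ n)
    (hends : ∀ i < N, σ.nat 103 r i < n ∧ σ.nat 104 r i < n)
    (hnxt : ∀ z < n, σ.nat 110 r z = z) :
    Runs gwTour σ (500 * (n + 1) ^ 1) fun τ => ∀ z < n, τ.nat 110 r z =
      (accepted σ r N N).foldl swapNext id z := by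
  refine Runs.for_pow (C := 400) (k := 0) (r := r) (n := N) (M := n) (fun k ρ =>
    ∀ z < n, ρ.nat 110 r z = (accepted σ r k k).foldl swapNext id z) (by decide) (by decide)
    (fun ρ f => (hc.frame f (by decide)).row) (fun ρ f => ?_) hNn
    (by decide) ?_ ?_ (by norm_num) (by norm_num) fun ρ h _ => h
  · simp [NatExp.eval, (hc.frame f (by decide)).row, f.1 121 (by decide), hN]
  · simpa [accepted] using hnxt
  · intro k hk ρ f hk' h1
    have hc := hc.frame f (by decide)
    rw [← f.1 103 (by decide), ← f.1 104 (by decide)] at hends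
    rw [accepted_succ]
    simp only [← accepted_frame f r _ _ (by decide)] at h1 ⊢
    rw [← f.1 103 (by decide), ← f.1 104 (by decide), ← f.1 109 (by decide)]
    obtain ⟨hu, hv⟩ := hends k hk
    refine Runs.step_pow rfl (by decide) ?_
    by_cases ha : ρ.nat 109 r k = 1
    · simp [Program.step, NatExp.eval, hc.row, hk', ha, swapNext, ← h1 _ hu, ← h1 _ hv]
      intro z hz
      rw [← h1 z hz]
      split_ifs <;> simp_all
    · simpa [Program.step, NatExp.eval, hc.row, hk', ha] using h1

end

end RealRAM

/-! ### Reading off the cycles of the successor function. -/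

namespace RealRAM

open Moat Finset Function

theorem iterate_lt {n : ℕ} {F : ℕ → ℕ} (hF : ∀ z < n, F z < n) {x : ℕ} (hx : x < n) (j : ℕ) :
    F^[j] x < n := by
  induction j with
  | zero => exact hx
  | succ j ih => rw [iterate_succ_apply']; exact hF _ ih

/-- The iterates before the first return are distinct numbers below `n`. This bounds the running
time of one cycle and makes it fit into a block of length `n`. -/
theorem minimalPeriod_le {n : ℕ} {F : ℕ → ℕ} (hF : ∀ z < n, F z < n) {x : ℕ} (hx : x < n) :
    minimalPeriod F x ≤ n := by
  have h1 : ((range (minimalPeriod F x)).image fun j => F^[j] x) ⊆ range n := by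
    intro z hz
    obtain ⟨j, -, rfl⟩ := mem_image.1 hz
    exact mem_range.2 (iterate_lt hF hx j)
  have h2 := card_le_card h1
  rwa [card_image_of_injOn, card_range, card_range] at h2
  intro i hi j hj h
  exact iterate_injOn_Iio_minimalPeriod (by simpa using hi) (by simpa using hj) h

section

variable {n m : ℕ} {W : ℕ → ℕ → ℝ} {r : ℕ} {σ : Store}

/-- The cycles of `F` through the first `q` active components are stored. -/
structure Cycles (n r : ℕ) (F : ℕ → ℕ) (s : State) (x q : ℕ) (τ : Store) : Prop where
  lt : ∀ i < q, τ.nat 113 r i < x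
  act : ∀ i < q, s.act (τ.nat 113 r i) = 1
  inj : ∀ i < q, ∀ j < i, τ.nat 113 r j < τ.nat 113 r i
  len : ∀ i < q, τ.nat 111 r i = minimalPeriod F (τ.nat 113 r i)
  verts : ∀ i < q, ∀ j < τ.nat 111 r i, τ.nat 112 r (i * n + j) = F^[j] (τ.nat 113 r i)

theorem runs_gwCycle (hc : Ctx n m W r σ) {F : ℕ → ℕ} (hF : ∀ z < n, F z < n)
    (hnxt : ∀ z < n, σ.nat 110 r z = F z) {x q : ℕ} (hx : x < n) (hper : x ∈ periodicPts F)
    (h125 : σ.nat 125 r 0 = x) (h128 : σ.nat 128 r 0 = q) (hoff : σ.nat 102 r q = q * n)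
    (h126 : σ.nat 126 r 0 = 1) (h129 : σ.nat 129 r 0 = F x) (h112 : σ.nat 112 r (q * n) = x) :
    Runs (.loop (.neg (natEq (rs 129) (rs 125))) <|
          .seq (setA 112 (.add (ra 102 (rs 128)) (rs 126)) (rs 129)) <|
            .seq (setS 126 (.add (rs 126) c1)) (setS 129 (ra 110 (rs 129)))) σ
      (200 * (n + 1) ^ 1) fun τ => τ.nat 126 r 0 = minimalPeriod F x ∧
        (∀ j < minimalPeriod F x, τ.nat 112 r (q * n + j) = F^[j] x) ∧
        ∀ i < q * n, τ.nat 112 r i = σ.nat 112 r i := by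
  have hp := minimalPeriod_pos_of_mem_periodicPts hper
  have hpn := minimalPeriod_le hF hx
  have hend : F^[minimalPeriod F x] x = x := iterate_minimalPeriod
  generalize hpd : minimalPeriod F x = p at *
  have := Runs.loop (b := .neg (natEq (rs 129) (rs 125)))
    (c := .seq (setA 112 (.add (ra 102 (rs 128)) (rs 126)) (rs 129)) <|
            .seq (setS 126 (.add (rs 126) c1)) (setS 129 (ra 110 (rs 129)))) (T := 60)
    (fun k τ => Frame [112, 126, 129] [] σ τ ∧ ∃ j, 1 ≤ j ∧ j + k = p ∧ τ.nat 126 r 0 = j ∧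
      τ.nat 129 r 0 = F^[j] x ∧ (∀ i < j, τ.nat 112 r (q * n + i) = F^[i] x) ∧
        ∀ i < q * n, τ.nat 112 r i = σ.nat 112 r i) ?_ (k := p - 1) (σ := σ)
      ⟨Frame.refl _ _ _, 1, le_rfl, by omega, h126, h129, by simpa using h112, fun _ _ => rfl⟩
  · refine this.mono ?_ ?_
    · have hb : (Test.neg (natEq (rs 129) (rs 125))).cost ≤ 30 := by decide
      have h1 : (p - 1) * ((Test.neg (natEq (rs 129) (rs 125))).cost + 60) ≤ n * 90 :=
        Nat.mul_le_mul (by omega) (by omega)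
      rw [pow_one]
      omega
    · rintro τ ⟨⟨k, f, j, h1, h2, h3, h4, h5, h6⟩, hb⟩
      have hc := hc.frame f (by decide)
      simp only [Test.holds, natEq_holds, NatExp.eval, hc.row, not_not, h4,
        f.1 125 (by decide), h125] at hb
      -- The loop ends at the first return; if iterations were left over, this would be a return
      -- before the minimal period.
      have : j = p := by
        rcases Nat.eq_zero_or_pos k with rfl | hk
        · omega
        · exact absurd (IsPeriodicPt.minimalPeriod_le (f := F) h1 hb) (by omega)
      subst this
      exact ⟨h3, h5, h6⟩
  · rintro k τ ⟨f, j, h1, h2, h3, h4, h5, h6⟩ hb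
    have hc := hc.frame f (by decide)
    simp only [Test.holds, natEq_holds, NatExp.eval, hc.row, h4, f.1 125 (by decide),
      h125] at hb
    have hk : k ≠ 0 := by
      rintro rfl
      rw [show j = p by omega] at hb
      exact hb hend
    refine ⟨k - 1, by omega, ?_⟩
    refine (Runs.of_step (Q := fun ρ => ρ.nat 126 r 0 = j + 1 ∧
      ρ.nat 129 r 0 = F^[j + 1] x ∧ (∀ i < j + 1, ρ.nat 112 r (q * n + i) = F^[i] x) ∧
        ∀ i < q * n, ρ.nat 112 r i = σ.nat 112 r i) rfl (by decide) ?_).frame.mono le_rfl ?_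
    · have hlt := iterate_lt hF hx j
      rw [← f.1 128 (by decide)] at h128
      rw [← f.1 102 (by decide)] at hoff
      rw [← f.1 110 (by decide)] at hnxt
      simp [Program.step, NatExp.eval, hc.row, h3, h4, h128, hoff, hnxt _ hlt,
        iterate_succ_apply', -iterate_succ]
      constructor
      · intro i hi
        rcases hi.lt_or_eq with hi | rfl
        · rw [if_neg (by omega), h5 i hi]
        · simp
      · intro i hi
        rw [if_neg (by omega), h6 i hi]
    · rintro ρ ⟨⟨g1, g2, g3, g4⟩, g⟩
      exact ⟨f.trans (g.mono (by decide) (by decide)), j + 1, by omega, by omega, g1, g2, g3, g4⟩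

theorem runs_gwOut (hc : Ctx n m W r σ) {F : ℕ → ℕ} (hF : ∀ z < n, F z < n)
    (hnxt : ∀ z < n, σ.nat 110 r z = F z)
    (hper : ∀ x < n, (gst σ r).act x = 1 → x ∈ periodicPts F) (hoff : ∀ v ≤ n, σ.nat 102 r v = v * n)
    (h128 : σ.nat 128 r 0 = 0) (hcard : (actives n (gst σ r)).card = m) :
    Runs gwOut σ (1000 * (n + 1) ^ 2) (Cycles n r F (gst σ r) n m) := by
  refine Runs.for_pow (C := 900) (k := 1) (r := r) (n := n) (M := n) (fun x ρ => ∃ q,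
    ρ.nat 128 r 0 = q ∧ q = ((range x).filter fun l => (gst σ r).act l = 1).card ∧
    Cycles n r F (gst σ r) x q ρ) (by decide) (by decide)
    (fun ρ f => (hc.frame f (by decide)).row) (fun ρ f => (hc.frame f (by decide)).size) le_rfl
    (by decide) ?_ ?_ (by norm_num) (by norm_num) ?_
  · refine ⟨0, by simpa using h128, by simp, ?_⟩
    constructor <;> simp
  · rintro x hx ρ f hx' ⟨q, hq, hqc, hI⟩
    have hc := hc.frame f (by decide)
    have hs := gst_frame f r (by decide)
    rw [← hs] at hqc hI hper ⊢
    rw [← f.1 110 (by decide)] at hnxt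
    rw [← f.1 102 (by decide)] at hoff
    have hqx : q ≤ x := by
      rw [hqc]
      exact (card_filter_le _ _).trans (card_range x).le
    have hoffq := hoff q (by omega)
    rw [range_add_one, filter_insert]
    refine Runs.branch_pow (C := 850) (fun hb => ?_) (fun hb => ?_) (by decide)
    · simp only [natEq_holds, NatExp.eval, hc.row, hx'] at hb
      change (gst ρ r).act x = 1 at hb
      rw [if_pos hb, card_insert_of_notMem (by simp), ← hqc]
      have hxp := hper x hx hb
      have hpn := minimalPeriod_le hF hx
      refine Runs.seq_pow (C₁ := 20) (C₂ := 800) (k₁ := 0) (k₂ := 1)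
        (Q := fun τ => ∀ i, τ.nat 112 r i = if i = q * n then x else ρ.nat 112 r i)
        (Runs.step_pow rfl (by decide) ?_) ?_ (by norm_num) (by norm_num) le_rfl
      · simp [Program.step, NatExp.eval, hc.row, hq, hx', hoffq]
      intro τ₁ h112 f₁
      have hc₁ := hc.frame f₁ (by decide)
      refine Runs.seq_pow (C₁ := 20) (C₂ := 700) (k₁ := 0) (k₂ := 1)
        (Q := fun τ => τ.nat 126 r 0 = 1)
        (Runs.step_pow rfl (by decide) ?_) ?_ (by norm_num) (by norm_num) le_rfl
      · simp [Program.step, NatExp.eval, hc₁.row]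
      intro τ₂ h126 f₂
      have f₁₂ : Frame [112, 126] [] ρ τ₂ := (f₁.mono (by decide) (by decide)).trans
        (f₂.mono (by decide) (by decide))
      have hc₂ := hc.frame f₁₂ (by decide)
      refine Runs.seq_pow (C₁ := 20) (C₂ := 600) (k₁ := 0) (k₂ := 1)
        (Q := fun τ => τ.nat 129 r 0 = F x)
        (Runs.step_pow rfl (by decide) ?_) ?_ (by norm_num) (by norm_num) le_rfl
      · simp [Program.step, NatExp.eval, hc₂.row, f₁₂.1 125 (by decide), hx',
          f₁₂.1 110 (by decide), hnxt x hx]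
      intro τ₃ h129 f₃
      have f₁₃ : Frame [112, 126, 129] [] ρ τ₃ := (f₁₂.mono (by decide) (by decide)).trans
        (f₃.mono (by decide) (by decide))
      have hc₃ := hc.frame f₁₃ (by decide)
      rw [← f₂.1 112 (by decide), ← f₃.1 112 (by decide)] at h112
      rw [← f₃.1 126 (by decide)] at h126
      refine Runs.seq_pow (C₁ := 200) (C₂ := 100) (k₁ := 1) (k₂ := 0)
        (runs_gwCycle hc₃ hF (by rwa [f₁₃.1 110 (by decide)]) hx hxp
          (by rw [f₁₃.1 125 (by decide), hx']) (by rw [f₁₃.1 128 (by decide), hq])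
          (by rw [f₁₃.1 102 (by decide), hoffq]) h126 h129 (by rw [h112, if_pos rfl]))
        ?_ (by norm_num) (by norm_num) (by norm_num)
      rintro τ₄ ⟨g1, g2, g3⟩ f₄
      have f₁₄ : Frame [112, 126, 129] [] ρ τ₄ :=
        f₁₃.trans (f₄.mono (by decide) (by decide))
      have hc₄ := hc.frame f₁₄ (by decide)
      simp only [h112] at g3
      clear f₁ f₂ f₃ f₄ f₁₂ f₁₃ hc₁ hc₂ hc₃ h112 h126 h129
      refine Runs.step_pow rfl (by decide) ⟨q + 1, ?_, rfl, ?_⟩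
      · simp [Program.step, NatExp.eval, hc₄.row, f₁₄.1 128 (by decide), hq]
      · have e11 : ∀ i, (τ₄.nat 111 r i) = ρ.nat 111 r i := by simp [f₁₄.1 111 (by decide)]
        have e13 : ∀ i, (τ₄.nat 113 r i) = ρ.nat 113 r i := by simp [f₁₄.1 113 (by decide)]
        simp only [Program.step, NatExp.eval, hc₄.row, f₁₄.1 128 (by decide), hq]
        constructor <;> simp [f₁₄.1 125 (by decide), f₁₄.1 128 (by decide), hx', hq, hc₄.row, e11,
          e13, g1]
        · intro i hi
          split_ifs with h
          · omega
          · have := hI.lt i (by omega)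
            omega
        · intro i hi
          split_ifs with h
          · exact hb
          · exact hI.act i (by omega)
        · intro i hi j hj
          rw [if_neg (show j ≠ q by omega)]
          split_ifs with h
          · exact hI.lt j (by omega)
          · exact hI.inj i (by omega) j hj
        · intro i hi
          split_ifs with h
          · rfl
          · exact hI.len i (by omega)
        · intro i hi j hj
          split_ifs at hj ⊢ with h
          · subst h
            exact g2 j hj
          · have hi' : i < q := by omega
            have hlen := hI.len i hi'
            -- A stored cycle has at most `n` vertices, so its block ends before the block `q`,
            -- which is the only one written now.
            have := minimalPeriod_le hF (x := ρ.nat 113 r i) ((hI.lt i hi').trans hx)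
            have hlt : i * n + j < q * n := by
              have : (i + 1) * n ≤ q * n := Nat.mul_le_mul_right _ hi'
              rw [add_mul, one_mul] at this
              omega
            rw [g3 _ hlt, if_neg hlt.ne]
            exact hI.verts i hi' j hj
    · simp only [natEq_holds, NatExp.eval, hc.row, hx'] at hb
      change (gst ρ r).act x ≠ 1 at hb
      rw [if_neg hb, ← hqc]
      refine Runs.step_pow rfl (by decide) ⟨q, ?_, rfl, ?_⟩
      · simpa [Program.step] using hq
      · constructor <;> simp [Program.step]
        exacts [fun i hi => (hI.lt i hi).le, hI.act, hI.inj, hI.len, hI.verts]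
  · rintro ρ ⟨q, -, hq, h⟩ -
    rw [show q = m from hq.trans hcard] at h
    exact h

end

end RealRAM

/-! ### The subroutine as a whole and its calls in arbitrary rows. -/

namespace RealRAM

open Moat Finset Function MOP

theorem exists_iterate_eq {F : ℕ → ℕ} {x y : ℕ} (h : Reach F x y) : ∃ j, F^[j] x = y := by
  induction h with
  | refl => exact ⟨0, rfl⟩
  | tail _ h2 ih =>
    obtain ⟨j, hj⟩ := ih
    exact ⟨j + 1, by rw [iterate_succ_apply', hj, h2]⟩

/-- The path system that the subroutine leaves in the row `r`. -/
def decode {n : ℕ} (h : 0 < n) (m : ℕ) (σ : Store) (r : ℕ) : Family n m :=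
  fun i => (List.range (σ.nat 111 r i)).map fun j => vtx h (σ.nat 112 r (i * n + j))

/-- The row `r` holds an approximate solution of the prize-collecting problem. -/
structure Solved {n : ℕ} (h : 0 < n) (w : Fin n → Fin n → ℝ) (m : ℕ) (p : Fin n → ℝ) (r : ℕ)
    (τ : Store) : Prop where
  paths : IsPathSystem (decode h m τ r)
  lmp : weight w (decode h m τ r) + 4 * penalty p (decode h m τ r) ≤ 4 * prizeOpt w m p
  lt : ∀ i < m, ∀ j < τ.nat 111 r i, τ.nat 112 r (i * n + j) < n

/-- The growth phase dominates the running time. The program relies on its row being zero, apart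
from the penalties: flags, counters and set blocks are never cleared. -/
theorem runs_gw {n m : ℕ} (h : 0 < n) (hmn : m ≤ n) {w : Fin n → Fin n → ℝ} (hw : IsMetric w)
    {W : ℕ → ℕ → ℝ} (hW : ∀ i j : Fin n, W i j = w i j) {p : Fin n → ℝ} (hp : ∀ v, 0 ≤ p v)
    {r : ℕ} {σ : Store} (hc : Ctx n m W r σ) (hpen : ∀ v : Fin n, σ.real 100 r v = p v)
    (hload : ∀ v, σ.real 101 r v = 0) (hnat : ∀ a, 100 ≤ a → ∀ v, σ.nat a r v = 0) :
    Runs gw σ (30000 * (n + 1) ^ 3) (Solved h w m p r) := by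
  have hsymm : ∀ u < n, ∀ v < n, W u v = W v u := (isMet hw hW).symm
  refine Runs.seq_pow (C₁ := 1000) (C₂ := 28000) (k₁ := 1) (k₂ := 3)
    (runs_gwInit hc (hnat _ (by norm_num) _)) ?_ (by norm_num) (by norm_num) le_rfl
  rintro τ₁ ⟨h120, hst, hoff⟩ f₁
  have hc₁ := hc.frame f₁ (by decide)
  have h₀ : Initial n (σ.real 100 r) (gst τ₁ r) := by
    refine ⟨fun v hv => (hst v hv).1, fun v hv => (hst v hv).2.1, fun v hv => ?_,
      fun v hv => (hst v hv).2.2.1⟩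
    change τ₁.real 101 r v = 0
    rw [f₁.2 101 (by decide), hload]
  have hact : actives n (gst τ₁ r) = range n := by
    rw [actives, filter_true_of_mem fun l hl => h₀.act l (mem_range.1 hl)]
  have hcur : currents n (gst τ₁ r) = range n := by
    rw [currents, filter_true_of_mem fun l hl => h₀.comp l (mem_range.1 hl)]
  have h121 : τ₁.nat 121 r 0 = 0 := by rw [f₁.1 121 (by decide), hnat _ (by norm_num)]
  have hv₁ : Valid n W (gst τ₁ r) := by
    refine ⟨fun v hv => by rwa [h₀.comp v hv], fun v hv => by rw [h₀.comp v hv, h₀.comp v hv],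
      fun l hl _ => h₀.comp l hl, fun u hu v hv _ => ?_, fun l hl _ => ?_,
      fun l hl _ ha => absurd (h₀.act l hl) ha⟩
    · rw [h₀.load u hu, h₀.load v hv, add_zero]
      exact (isMet hw hW).nonneg u hu v hv
    · rw [h₀.pot l hl, show σ.real 100 r l = _ from hpen ⟨l, hl⟩]
      exact hp _
  have hg : Growing n m W r (gst τ₁ r) τ₁ := by
    refine ⟨hc₁, hv₁, ⟨0, ?_⟩, fun l hl => (hst l hl).2.1.le, ?_, ?_, ?_, hoff, fun i _ => ?_, ?_⟩
    · rw [h121]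
      exact Hist.start
    · rw [hact, h120, card_range]
    · rw [hcur, h121, card_range, zero_add]
    · simp [h121]
    · rw [f₁.1 106 (by decide), hnat _ (by norm_num)]
    · rw [h120]
      exact hmn
  refine Runs.seq_pow (C₁ := 20000) (C₂ := 8000) (k₁ := 3) (k₂ := 2) (runs_gwPhase hsymm hg) ?_
    (by norm_num) le_rfl (by norm_num)
  rintro τ₂ ⟨hg, hm⟩ f₂
  have hc₂ := hg.ctx
  have z₂ : ∀ a, 100 ≤ a → a ∉ gwInit.natW → a ∉ gwPhase.natW → ∀ j, τ₂.nat a r j = 0 := by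
    intro a ha h1 h2 j
    rw [f₂.1 a h2, f₁.1 a h1, hnat a ha]
  have hNn : τ₂.nat 121 r 0 ≤ n := by
    have := hg.merges
    omega
  refine Runs.seq_pow (C₁ := 500) (C₂ := 7000) (k₁ := 1) (k₂ := 2)
    (runs_gwCore hc₂ (z₂ 107 (by norm_num) (by decide) (by decide))) ?_
    (by norm_num) (by norm_num) le_rfl
  rintro τ₃ hK f₃
  have hc₃ := hc₂.frame f₃ (by decide)
  refine Runs.seq_pow (C₁ := 2000) (C₂ := 4000) (k₁ := 2) (k₂ := 2)
    (runs_gwPrune hc₃ (N := τ₂.nat 121 r 0) (by rw [f₃.1 121 (by decide)]) hNn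
      (by rw [f₃.1 102 (by decide)]; exact hg.off)
      (by rw [f₃.1 103 (by decide), f₃.1 104 (by decide)]; exact hg.ends_lt) hK
      (by rw [f₃.1 108 (by decide)]; exact z₂ 108 (by norm_num) (by decide) (by decide))
      (by rw [f₃.1 109 (by decide)]; exact z₂ 109 (by norm_num) (by decide) (by decide))) ?_
    (by norm_num) le_rfl le_rfl
  rintro τ₄ hE f₄
  have hc₄ := hc₃.frame f₄ (by decide)
  rw [storedRec_frame f₃ n r (by decide)] at hE
  change _ = (pruned n (gst τ₂ r) _).2 at hE
  refine Runs.seq_pow (C₁ := 500) (C₂ := 2000) (k₁ := 1) (k₂ := 2)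
    (runs_gwTour hc₄ (N := τ₂.nat 121 r 0)
      (by rw [f₄.1 121 (by decide), f₃.1 121 (by decide)]) hNn
      (by rw [f₄.1 103 (by decide), f₄.1 104 (by decide), f₃.1 103 (by decide),
        f₃.1 104 (by decide)]; exact hg.ends_lt)
      fun z hz => by rw [f₄.1 110 (by decide), f₃.1 110 (by decide), f₂.1 110 (by decide),
        (hst z hz).2.2.2]) ?_ (by norm_num) (by norm_num) le_rfl
  rintro τ₅ hF f₅
  have hc₅ := hc₄.frame f₅ (by decide)
  have hs₅ : gst τ₅ r = gst τ₂ r := by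
    rw [gst_frame f₅ r (by decide), gst_frame f₄ r (by decide), gst_frame f₃ r (by decide)]
  rw [hE] at hF
  have hm' : (actives n (gst τ₂ r)).card = m := by rw [← hg.count, hm]
  obtain ⟨D, hD⟩ := hg.hist
  generalize (List.range' 0 (τ₂.nat 121 r 0)).map (storedRec n τ₂ r) = recs at *
  have hgood := hD.good (x := (core n (gst τ₂ r), [])) (good_core hg.valid hm')
  obtain ⟨E', hE', ht⟩ := hD.tour h₀.comp (x := (core n (gst τ₂ r), []))
    (good_core hg.valid hm') subset_rfl hgood.mem
  rw [List.append_nil] at hE'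
  rw [← hE'] at ht
  change Tour n (gst τ₂ r) (pruned n (gst τ₂ r) recs).1
    ((pruned n (gst τ₂ r) recs).2.foldl swapNext id) at ht
  -- The guarantee is prepared while the successor function still has its explicit form; the cycles
  -- to which it applies are known only after the last phase.
  have hfin := fun (a k : ℕ → ℕ) (ha) (ha') (P : Family n m) (hP) =>
    Moat.lmp (p := p) (a := a) (k := k) (P := P) h hmn hw hW hpen h₀ hD hg.valid hm' ha ha' hP
  generalize (pruned n (gst τ₂ r) recs).2.foldl swapNext id = F at *
  -- The vertex naming an active component is kept, and the cycle of its component leads back to it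
  -- from its successor.
  have hper : ∀ x < n, (gst τ₂ r).act x = 1 → x ∈ periodicPts F := by
    intro x hx hax
    have hxa : x ∈ actives n (gst τ₂ r) := mem_filter.2 ⟨mem_range.2 hx, hax⟩
    have hxK := (hgood.root x hxa).1
    have := ht.reach _ (ht.mem x hxK) x hxK (ht.comp x hx)
    obtain ⟨j, hj⟩ := exists_iterate_eq this
    exact mk_mem_periodicPts (Nat.succ_pos j) hj
  refine (runs_gwOut (m := m) hc₅ ht.lt hF (by rw [hs₅]; exact hper)
    (by rw [f₅.1 102 (by decide), f₄.1 102 (by decide), f₃.1 102 (by decide)]; exact hg.off)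
    (by rw [f₅.1 128 (by decide), f₄.1 128 (by decide), f₃.1 128 (by decide)];
        exact z₂ 128 (by norm_num) (by decide) (by decide) 0)
    (by rw [hs₅]; exact hm')).mono (pow_bound_mono le_rfl (by norm_num)) ?_
  intro τ hτ
  rw [hs₅] at hτ
  have hpd : ∀ i < m, τ.nat 113 r i ∈ periodicPts F :=
    fun i hi => hper _ (hτ.lt i hi) (hτ.act i hi)
  have hsys := hfin (τ.nat 113 r) (τ.nat 111 r)
    (fun i hi => mem_filter.2 ⟨mem_range.2 (hτ.lt i hi), hτ.act i hi⟩)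
    (fun i hi j hj hij => by
      rcases lt_trichotomy i j with h | h | h
      · exact absurd hij (hτ.inj j hj i h).ne
      · exact h
      · exact absurd hij (hτ.inj i hi j h).ne')
    (decode h m τ r) ⟨fun i hi => ?_, fun i hi => ?_, fun i hi j hj hj' => ?_, fun i => ?_⟩
  · refine ⟨hsys.1, hsys.2, fun i hi j hj => ?_⟩
    rw [hτ.verts i hi j hj]
    exact iterate_lt ht.lt (hτ.lt i hi) j
  · rw [hτ.len i hi]
    exact minimalPeriod_pos_of_mem_periodicPts (hpd i hi)
  · rw [hτ.len i hi]
    exact iterate_minimalPeriod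
  · rw [hτ.len i hi] at hj'
    exact fun hc => absurd (IsPeriodicPt.minimalPeriod_le (f := F) hj hc) (by omega)
  · refine List.map_congr_left fun j hj => ?_
    rw [hτ.verts i i.2 j (List.mem_range.1 hj)]

/-- The weights, extended by zero. -/
noncomputable def extend {n : ℕ} (w : Fin n → Fin n → ℝ) (i j : ℕ) : ℝ :=
  if h : i < n ∧ j < n then w ⟨i, h.1⟩ ⟨j, h.2⟩ else 0

theorem extend_coe {n : ℕ} (w : Fin n → Fin n → ℝ) (i j : Fin n) : extend w i j = w i j := by
  simp [extend]

/-- A store with the input of the subroutine, in the row `1`. -/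
noncomputable def gwInput {n : ℕ} (w : Fin n → Fin n → ℝ) (m : ℕ) (p : Fin n → ℝ) : Store where
  nat a i j := if i = 0 ∧ j = 0 then
    (if a = 0 then n else if a = 1 then m else if a = 9 then 1 else 0) else 0
  real a i j := if a = 0 then extend w i j
    else if h : a = 100 ∧ i = 1 ∧ j < n then p ⟨j, h.2.2⟩ else 0

open Classical in
/-- The algorithm for the prize-collecting problem that is computed by `gw`. -/
noncomputable def gwAlgorithm : PrizeAlgorithm := fun n w m p i =>
  if h : ∃ h : 0 < n, Runs gw (gwInput w m p) (30000 * (n + 1) ^ 3) (Solved h w m p 1) then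
    decode h.1 m h.2.choose_spec.choose 1 i
  else []

/-- The algorithm is read off from one chosen execution on a canonical store. Calls in other rows
will be relocated copies of this very execution, so it is not necessary to prove that executions are
unique. -/
theorem gwAlgorithm_spec {n m : ℕ} (h : 0 < n) (hmn : m ≤ n) {w : Fin n → Fin n → ℝ}
    (hw : IsMetric w) {p : Fin n → ℝ} (hp : ∀ v, 0 ≤ p v) :
    Runs gw (gwInput w m p) (30000 * (n + 1) ^ 3) fun τ => Solved h w m p 1 τ ∧
      gwAlgorithm n w m p = decode h m τ 1 := by
  have hr : ∃ h : 0 < n, Runs gw (gwInput w m p) (30000 * (n + 1) ^ 3) (Solved h w m p 1) := by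
    refine ⟨h, runs_gw h hmn hw (extend_coe w) hp ⟨?_, ?_, ?_, ?_⟩ ?_ ?_ ?_⟩
    · simp [gwInput]
    · simp [gwInput]
    · simp [gwInput]
    · simp [gwInput]
    · intro v
      simp [gwInput]
    · simp [gwInput]
    · intro a ha v
      simp [gwInput]
  obtain ⟨h1, h2, h3⟩ := hr.2.choose_spec.choose_spec
  refine ⟨_, _, h1, h2, h3, ?_⟩
  funext i
  rw [gwAlgorithm, dif_pos hr]

theorem gwAlgorithm_isLMP : IsLMP 4 gwAlgorithm := by
  intro n w m p hw h1 hmn hp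
  obtain ⟨t, τ, -, -, hs, he⟩ := gwAlgorithm_spec (h1.trans hmn) hmn hw hp
  rw [he]
  exact ⟨hs.paths, hs.lmp⟩

/-- The row `r` and all later rows of the scratch arrays of the subroutine are zero. -/
def Fresh (r : ℕ) (σ : Store) : Prop :=
  ∀ a, 100 ≤ a → ∀ i, r ≤ i → ∀ j, σ.nat a i j = 0 ∧ σ.real a i j = 0

/-- The subroutine can be called on any fresh row. -/
theorem runs_gw_relocated {n m : ℕ} (h : 0 < n) (hmn : m ≤ n) {w : Fin n → Fin n → ℝ}
    (hw : IsMetric w) {p : Fin n → ℝ} (hp : ∀ v, 0 ≤ p v) {r : ℕ} {σ : Store}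
    (hc : Ctx n m (extend w) r σ) (hpen : ∀ v : Fin n, σ.real 100 r v = p v)
    (hz : ∀ a, 100 ≤ a → ∀ j, σ.nat a r j = 0 ∧ (a ≠ 100 ∨ n ≤ j → σ.real a r j = 0)) :
    Runs gw σ (30000 * (n + 1) ^ 3) fun τ => gwAlgorithm n w m p = decode h m τ r ∧
      (∀ i < m, ∀ j < τ.nat 111 r i, τ.nat 112 r (i * n + j) < n) ∧ RowFrame r σ τ := by
  obtain ⟨t, τ, he, ht, hs, hA⟩ := gwAlgorithm_spec h hmn hw hp
  have hsim : Sim 1 (gwInput w m p) r σ := by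
    refine ⟨by simp [gwInput], hc.row, by simp [gwInput, hc.size], by simp [gwInput, hc.number],
      fun i j => by simp [gwInput, hc.weights], fun a ha j => ?_, fun a ha j => ?_⟩
    · rw [(hz a ha j).1]
      simp [gwInput]
    · by_cases hj : a = 100 ∧ j < n
      · obtain ⟨rfl, hj⟩ := hj
        have := hpen ⟨j, hj⟩
        simp only at this
        simp [gwInput, hj, this]
      · rw [(hz a ha j).2 (by omega)]
        have ha0 : a ≠ 0 := by omega
        simp [gwInput, hj, ha0]
  -- The chosen execution is replayed in the row `r`, so the same tie-breaking and the same output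
  -- occur there.
  obtain ⟨τ', h1, h2, h3⟩ := he.sim gw_isLocal hsim
  have e1 := h2.nat 111 (by norm_num)
  have e2 := h2.nat 112 (by norm_num)
  refine ⟨t, τ', h1, ht, ?_, ?_, h3⟩
  · rw [hA]
    funext i
    simp only [decode, e1, e2]
  · simpa only [e1, e2] using hs.lt

end RealRAM

/-! ### The approximation guarantee -/

namespace MOP

open Finset

theorem IsMetric.nonneg {n : ℕ} {w : Fin n → Fin n → ℝ} (hw : IsMetric w) (u v : Fin n) :
    0 ≤ w u v := by
  rcases eq_or_ne u v with rfl | h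
  exacts [(hw.self u).ge, (hw.pos u v h).le]

/-- The two parts share the vertex at position `t`, so every edge is counted exactly once. -/
theorem pathWeight_take_add_drop {n : ℕ} (w : Fin n → Fin n → ℝ) (P : List (Fin n)) {t : ℕ}
    (ht : t < P.length) :
    pathWeight w (P.take (t + 1)) + pathWeight w (P.drop t) = pathWeight w P := by
  induction P generalizing t with
  | nil => simp at ht
  | cons u P ih =>
    cases t with
    | zero => simp [pathWeight]
    | succ t =>
      cases P with
      | nil => simp at ht
      | cons v P =>
        have := ih (t := t) (by simpa using ht)
        simp only [List.take_succ_cons, List.drop_succ_cons, pathWeight] at this ⊢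
        linarith

theorem pathWeight_append {n : ℕ} (w : Fin n → Fin n → ℝ) (X : List (Fin n)) {Q : List (Fin n)}
    (hQ : Q ≠ []) :
    pathWeight w (X ++ Q.take 1) + pathWeight w Q = pathWeight w (X ++ Q) := by
  have h := pathWeight_take_add_drop w (X ++ Q) (t := X.length)
    (by simpa using List.length_pos_iff.2 hQ)
  rwa [List.take_append, List.drop_append, List.take_of_length_le (by omega),
    List.drop_of_length_le le_rfl, Nat.sub_self, Nat.add_sub_cancel_left, List.drop_zero,
    List.nil_append] at h

theorem pathWeight_take_le {n : ℕ} {w : Fin n → Fin n → ℝ} (hw : IsMetric w) (P : List (Fin n))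
    {s t : ℕ} (h : s ≤ t) : pathWeight w (P.take s) ≤ pathWeight w (P.take t) := by
  rcases s with - | s
  · simpa [pathWeight] using pathWeight_nonneg hw (P.take t)
  by_cases hs : s < P.length
  · have := pathWeight_take_add_drop w (P.take t) (t := s) (by simp; omega)
    rw [List.take_take, min_eq_left (by omega)] at this
    linarith [pathWeight_nonneg hw ((P.take t).drop s)]
  · rw [List.take_of_length_le (by omega), List.take_of_length_le (by omega)]

theorem pathWeight_drop_le {n : ℕ} {w : Fin n → Fin n → ℝ} (hw : IsMetric w) (P : List (Fin n))
    {s t : ℕ} (h : s ≤ t) : pathWeight w (P.drop t) ≤ pathWeight w (P.drop s) := by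
  by_cases ht : t < P.length
  · have := pathWeight_take_add_drop w (P.drop s) (t := t - s) (by rw [List.length_drop]; omega)
    rw [List.drop_drop, Nat.add_sub_cancel' h] at this
    linarith [pathWeight_nonneg hw ((P.drop s).take (t - s + 1))]
  · rw [List.drop_of_length_le (by omega)]
    exact pathWeight_nonneg hw _

theorem card_spanned {n m : ℕ} {P : Family n m} (hP : IsPathSystem P) :
    (spanned P).card = ∑ i, (P i).length := by
  have : spanned P = univ.biUnion fun i => (P i).toFinset := by
    ext v
    simp [spanned]
  rw [this, card_biUnion]
  · exact sum_congr rfl fun i _ => List.toFinset_card_of_nodup (hP.1 i).2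
  · intro i _ j _ hij
    refine disjoint_left.2 fun v h1 h2 => ?_
    exact hP.2 i j hij (List.mem_toFinset.1 h1) (List.mem_toFinset.1 h2)

theorem card_spanned_le {n m : ℕ} (P : Family n m) : (spanned P).card ≤ n :=
  (card_le_univ _).trans (Fintype.card_fin n).le

theorem le_card_spanned {n m : ℕ} {P : Family n m} (hP : IsPathSystem P) :
    m ≤ (spanned P).card := by
  rw [card_spanned hP]
  calc m = ∑ _i : Fin m, 1 := by simp
    _ ≤ _ := sum_le_sum fun i _ => List.length_pos_iff.2 (hP.1 i).1

theorem IsPathSystem.of_sublist {n m : ℕ} {P Q : Family n m} (hP : IsPathSystem P)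
    (h0 : ∀ i, Q i ≠ []) (h : ∀ i, (Q i).Sublist (P i)) : IsPathSystem Q :=
  ⟨fun i => ⟨h0 i, (h i).nodup (hP.1 i).2⟩, fun i j hij _ h1 h2 =>
    hP.2 i j hij ((h i).subset h1) ((h j).subset h2)⟩

/-! #### The optimal value -/

theorem opt_spec {n : ℕ} {w : Fin n → Fin n → ℝ} {m : ℕ} (hmn : m ≤ n) {B : ℝ} (hB : 0 < B) :
    ∃ P : Family n m, IsFeasible w m B P ∧ (spanned P).card = opt w m B := by
  have hne : {q | ∃ P : Family n m, IsFeasible w m B P ∧ (spanned P).card = q}.Nonempty := by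
    refine ⟨_, fun i => [⟨i, i.2.trans_le hmn⟩], ⟨⟨fun i => ⟨by simp, by simp⟩,
      fun i j hij => ?_⟩, ?_⟩, rfl⟩
    · simp only [List.disjoint_singleton, List.mem_singleton, Fin.mk.injEq]
      exact fun h => hij (Fin.ext h.symm)
    · simpa [weight, pathWeight] using hB.le
  exact Nat.sSup_mem hne ⟨n, by rintro q ⟨P, -, rfl⟩; exact card_spanned_le P⟩

/-- Edges are written with the smaller end first. Both membership clauses are needed: in the
induction they show that the new edge, which contains `u`, is new, and the first one later shows
that different paths have different edges. -/
theorem exists_edges {n : ℕ} {w : Fin n → Fin n → ℝ} (hw : IsMetric w) (P : List (Fin n))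
    (hP : P.Nodup) : ∃ S : Finset (Fin n × Fin n), (∀ e ∈ S, e.1 < e.2 ∧ e.1 ∈ P) ∧
      S.card = P.length - 1 ∧ ∑ e ∈ S, w e.1 e.2 = pathWeight w P ∧ ∀ e ∈ S, e.2 ∈ P := by
  induction P using pathWeight.induct with
  | case1 => exact ⟨∅, by simp [pathWeight]⟩
  | case2 => exact ⟨∅, by simp [pathWeight]⟩
  | case3 u v P ih =>
    obtain ⟨S, h1, h2, h3, h4⟩ := ih (List.nodup_cons.1 hP).2
    have hu := (List.nodup_cons.1 hP).1
    have huv : u ≠ v := fun h => hu (by simp [h])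
    refine ⟨insert (min u v, max u v) S, fun e he => ?_, ?_, ?_, fun e he => ?_⟩
    · rcases mem_insert.1 he with rfl | he
      · refine ⟨min_lt_max.2 huv, ?_⟩
        rcases min_choice u v with h | h <;> simp [h]
      · exact ⟨(h1 e he).1, List.mem_cons_of_mem _ (h1 e he).2⟩
    · rw [card_insert_of_notMem, h2]
      · simp
      · intro he
        rcases lt_or_gt_of_ne huv with h | h
        · have := (h1 _ he).2
          rw [min_eq_left h.le] at this
          exact hu this
        · have := h4 _ he
          rw [max_eq_left h.le] at this
          exact hu this
    · rw [sum_insert, h3, pathWeight]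
      · congr 1
        rcases le_total u v with h | h
        · simp [h]
        · simp [h, hw.symm u v]
      · intro he
        rcases lt_or_gt_of_ne huv with h | h
        · have := (h1 _ he).2
          rw [min_eq_left h.le] at this
          exact hu this
        · have := h4 _ he
          rw [max_eq_left h.le] at this
          exact hu this
    · rcases mem_insert.1 he with rfl | he
      · rcases max_choice u v with h | h <;> simp [h]
      · exact List.mem_cons_of_mem _ (h4 e he)

theorem bddAbove_edges {n : ℕ} {w : Fin n → Fin n → ℝ} (hw : IsMetric w) (q : ℕ) :
    BddAbove {x | ∃ S : Finset (Fin n × Fin n),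
      (∀ e ∈ S, e.1 < e.2) ∧ S.card = q ∧ x = ∑ e ∈ S, w e.1 e.2} := by
  refine ⟨∑ e : Fin n × Fin n, w e.1 e.2, ?_⟩
  rintro x ⟨S, -, -, rfl⟩
  exact sum_le_sum_of_subset_of_nonneg (subset_univ _) fun e _ _ => hw.nonneg _ _

/-- Disjoint paths with `q` vertices in total have `q - m` distinct edges. So the initial upper end
of the bisection is not less than the weight of an optimal solution. -/
theorem weight_le_longestEdges {n m : ℕ} {w : Fin n → Fin n → ℝ} (hw : IsMetric w)
    {P : Family n m} (hP : IsPathSystem P) :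
    weight w P ≤ longestEdges w ((spanned P).card - m) := by
  choose S h1 h2 h3 h4 using fun i => exists_edges hw (P i) (hP.1 i).2
  have hdis : (↑(univ : Finset (Fin m)) : Set (Fin m)).PairwiseDisjoint S := by
    intro i _ j _ hij
    exact disjoint_left.2 fun e he he' => hP.2 i j hij (h1 i e he).2 (h1 j e he').2
  refine le_csSup (bddAbove_edges hw _) ⟨univ.biUnion S, fun e he => ?_, ?_, ?_⟩
  · obtain ⟨i, -, he⟩ := mem_biUnion.1 he
    exact (h1 i e he).1
  · rw [card_biUnion hdis, card_spanned hP]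
    have : ∑ i, (P i).length = ∑ i, ((S i).card + 1) := sum_congr rfl fun i _ => by
      have := List.length_pos_iff.2 (hP.1 i).1
      have := h2 i
      omega
    rw [this, sum_add_distrib]
    simp
  · rw [sum_biUnion hdis]
    exact sum_congr rfl fun i _ => (h3 i).symm

theorem longestEdges_nonneg {n : ℕ} {w : Fin n → Fin n → ℝ} (hw : IsMetric w) (q : ℕ) :
    0 ≤ longestEdges w q := by
  refine Real.sSup_nonneg ?_
  rintro x ⟨S, -, -, rfl⟩
  exact sum_nonneg fun e _ => hw.nonneg _ _

/-! #### Bisection and trimming -/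

/-- The upper end moves only to points where more than `t` vertices are spanned. Nothing about the
lower end or the precision is retained. -/
theorem BinarySearch.spec {num : ℝ → ℕ} {t tol L₁ L₂ L : ℝ} (h : BinarySearch num t tol L₁ L₂ L)
    (h₂ : 0 ≤ L₂) (h₁ : L₂ ≤ L₁) : 0 ≤ L ∧ L ≤ L₁ ∧ (L = L₁ ∨ t < num L) := by
  induction h with
  | done L₁ L₂ h => exact ⟨h₂.trans h₁, le_rfl, .inl rfl⟩
  | lower L₁ L₂ L h hx hr ih => exact ih (by linarith) (by linarith)
  | upper L₁ L₂ L h hx hr ih =>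
    obtain ⟨h3, h4, h5⟩ := ih h₂ (by linarith)
    refine ⟨h3, by linarith, .inr ?_⟩
    rcases h5 with rfl | h5
    exacts [hx, h5]

/-- What remains after the removal of one part is contained in the other part with its attaching
edge. It is therefore no more expensive than what was removed, and so has at most half of the
weight. -/
theorem TrimPath.spec {n : ℕ} {w : Fin n → Fin n → ℝ} (hw : IsMetric w) {P P' : List (Fin n)}
    (h : TrimPath w P P') : P'.Sublist P ∧ P.length ≤ 2 * P'.length ∧
      2 * pathWeight w P' ≤ pathWeight w P := by
  rcases h with ⟨hq, rfl⟩ | ⟨hq, hc, rfl⟩ | ⟨hq, hc, rfl⟩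
  · refine ⟨List.Sublist.refl _, by omega, ?_⟩
    match P', hq with
    | [], _ => simp [pathWeight]
    | [_], _ => simp [pathWeight]
  all_goals
    have hh : (0 : ℝ) < ((P.length / 2 : ℕ) : ℝ) := by
      have : 0 < P.length / 2 := by omega
      exact_mod_cast this
    rw [div_le_div_iff_of_pos_right hh] at hc
  · refine ⟨List.drop_sublist _ _, by rw [List.length_drop]; omega, ?_⟩
    have h1 := pathWeight_take_add_drop w P (t := P.length / 2) (by omega)
    have h2 := pathWeight_drop_le hw P (s := P.length - P.length / 2 - 1) (t := P.length / 2)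
      (by omega)
    linarith
  · refine ⟨List.take_sublist _ _, by rw [List.length_take]; omega, ?_⟩
    have h1 := pathWeight_take_add_drop w P (t := P.length - P.length / 2 - 1) (by omega)
    have h2 := pathWeight_take_le hw P (s := P.length - P.length / 2) (t := P.length / 2 + 1)
      (by omega)
    rw [show P.length - P.length / 2 - 1 + 1 = P.length - P.length / 2 by omega] at h1
    linarith

theorem TrimPath.length_pos {n : ℕ} {w : Fin n → Fin n → ℝ} (hw : IsMetric w)
    {P P' : List (Fin n)} (h : TrimPath w P P') (hP : P ≠ []) : P' ≠ [] := by
  have h1 := (h.spec hw).2.1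
  have h2 := List.length_pos_iff.2 hP
  exact List.length_pos_iff.1 (by omega)

theorem Trim.isPathSystem {n m k : ℕ} {w : Fin n → Fin n → ℝ} (hw : IsMetric w)
    {P P' : Family n m} (h : Trim w k P P') (hP : IsPathSystem P) : IsPathSystem P' := by
  induction h with
  | done => exact hP
  | round P Q P' h hQ _ ih =>
    exact ih (hP.of_sublist (fun i => (hQ i).length_pos hw (hP.1 i).1) fun i => ((hQ i).spec hw).1)

/-- A round at least halves the weight and at most halves the number of vertices, so the bound `c`
on the average cost persists. A round starts above `2 k` and thus never ends below `k`. -/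
theorem Trim.spec {n m k : ℕ} {w : Fin n → Fin n → ℝ} (hw : IsMetric w) {P P' : Family n m}
    (h : Trim w k P P') (hP : IsPathSystem P) {c : ℝ} (hc : 0 ≤ c) (hk : k ≤ (spanned P).card)
    (hwP : weight w P ≤ c * (spanned P).card) :
    k ≤ (spanned P').card ∧ weight w P' ≤ c * (2 * k) := by
  induction h with
  | done P h =>
    refine ⟨hk, hwP.trans (mul_le_mul_of_nonneg_left ?_ hc)⟩
    exact_mod_cast h
  | round P Q P' h hQ _ ih =>
    have hQs := hP.of_sublist (fun i => (hQ i).length_pos hw (hP.1 i).1)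
      fun i => ((hQ i).spec hw).1
    have h1 : (spanned P).card ≤ 2 * (spanned Q).card := by
      rw [card_spanned hP, card_spanned hQs, mul_sum]
      exact sum_le_sum fun i _ => ((hQ i).spec hw).2.1
    have h2 : 2 * weight w Q ≤ weight w P := by
      rw [weight, weight, mul_sum]
      exact sum_le_sum fun i _ => ((hQ i).spec hw).2.2
    refine ih hQs (by omega) ?_
    have h3 : ((spanned P).card : ℝ) ≤ 2 * (spanned Q).card := by exact_mod_cast h1
    nlinarith [mul_le_mul_of_nonneg_left h3 hc]

theorem Trim.eq_of_le {n m k : ℕ} {w : Fin n → Fin n → ℝ} {P P' : Family n m}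
    (h : Trim w k P P') (hk : (spanned P).card ≤ 2 * k) : P' = P := by
  cases h with
  | done => rfl
  | round Q _ h => omega

/-! #### Pieces -/

theorem IsPieceSubpath.spec {n s : ℕ} {w : Fin n → Fin n → ℝ} {P Q : List (Fin n)}
    (h : IsPieceSubpath w P s Q) : Q ≠ [] ∧ Q.Sublist P ∧ pathWeight w Q ≤ pathWeight w P / s := by
  obtain ⟨h0, X, Y, rfl, j, -, h1, h2⟩ := h
  refine ⟨h0, ?_, ?_⟩
  · exact (List.sublist_append_right X Q).trans (List.sublist_append_left _ Y)
  · have := pathWeight_append w X h0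
    linarith

theorem exists_piece {s : ℕ} (hs : 0 < s) {W x : ℝ} (hx : 0 ≤ x) (hxW : x ≤ W) :
    ∃ j < s, (j : ℝ) * (W / s) ≤ x ∧ x ≤ ((j : ℝ) + 1) * (W / s) := by
  have hs' : (0 : ℝ) < s := by exact_mod_cast hs
  rcases hxW.lt_or_eq with h | rfl
  · have hW : 0 < W / s := div_pos (hx.trans_lt h) hs'
    refine ⟨⌊x / (W / s)⌋₊, ?_, ?_, ?_⟩
    · rw [Nat.floor_lt (div_nonneg hx hW.le), div_lt_iff₀ hW, mul_div_cancel₀ _ hs'.ne']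
      exact h
    · rw [← le_div_iff₀ hW]
      exact Nat.floor_le (div_nonneg hx hW.le)
    · rw [← div_le_iff₀ hW]
      exact (Nat.lt_floor_add_one _).le
  -- At the right end rounding down would give the non-existent piece `s`; the last piece is closed
  -- and takes this point. The case `W = 0` is included here.
  · refine ⟨s - 1, by omega, ?_, ?_⟩
    · rw [mul_div_assoc', div_le_iff₀ hs', mul_comm]
      exact mul_le_mul_of_nonneg_left (by exact_mod_cast Nat.sub_le _ _) hx
    · rw [Nat.cast_sub hs, Nat.cast_one, sub_add_cancel, mul_div_cancel₀ _ hs'.ne']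

/-- Pigeonhole: each vertex is assigned to a piece containing its position. The vertices assigned to
one piece lie on the sub-path from the first to the last of them, and this sub-path is contained in
the piece, so it has at most `Q.length` vertices. -/
theorem IsHeaviestSubpath.length_le {n s : ℕ} {w : Fin n → Fin n → ℝ} (hw : IsMetric w)
    (hs : 0 < s) {P Q : List (Fin n)} (h : IsHeaviestSubpath w P s Q) :
    P.length ≤ Q.length * s := by
  have hpos : ∀ t, ∃ j < s, (j : ℝ) * (pathWeight w P / s) ≤ pathWeight w (P.take t) ∧
      pathWeight w (P.take t) ≤ ((j : ℝ) + 1) * (pathWeight w P / s) := by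
    intro t
    refine exists_piece hs (pathWeight_nonneg hw _) ?_
    have := pathWeight_take_le hw P (le_max_left t P.length)
    rwa [List.take_of_length_le (le_max_right _ _)] at this
  choose f hf h1 h2 using hpos
  have key := card_le_mul_card_image (f := fun t => f (t + 1)) (range P.length) Q.length ?_
  · rw [card_range] at key
    refine key.trans (Nat.mul_le_mul_left _ ?_)
    calc _ ≤ (range s).card := card_le_card fun j hj => by
          obtain ⟨t, -, rfl⟩ := mem_image.1 hj
          exact mem_range.2 (hf _)
      _ = s := card_range s
  intro j hj
  obtain ⟨t₀, ht₀, hj⟩ := mem_image.1 hj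
  set T := (range P.length).filter fun t => f (t + 1) = j
  have hT : T.Nonempty := ⟨t₀, mem_filter.2 ⟨ht₀, hj⟩⟩
  obtain ⟨ha, ha'⟩ := mem_filter.1 (T.min'_mem hT)
  obtain ⟨hb, hb'⟩ := mem_filter.1 (T.max'_mem hT)
  have hab : T.min' hT ≤ T.max' hT := T.min'_le _ (T.max'_mem hT)
  have hsub : T ⊆ Icc (T.min' hT) (T.max' hT) := fun t ht =>
    mem_Icc.2 ⟨T.min'_le _ ht, T.le_max' _ ht⟩
  generalize T.min' hT = a at *
  generalize T.max' hT = b at *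
  rw [mem_range] at ha hb
  have hlen : ((P.drop a).take (b + 1 - a)).length = b + 1 - a := by
    rw [List.length_take, List.length_drop]
    omega
  have e1 : P.take a ++ (P.drop a).take (b + 1 - a) = P.take (b + 1) := by
    rw [← List.take_add]
    congr 1
    omega
  have e2 : P.take a ++ ((P.drop a).take (b + 1 - a)).take 1 = P.take (a + 1) := by
    rw [List.take_take, min_eq_left (by omega), ← List.take_add]
  have hQ := h.2 ((P.drop a).take (b + 1 - a)) ⟨fun hc => ?_, P.take a, P.drop (b + 1), ?_,
    j, hj ▸ hf _, ?_, ?_⟩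
  · calc T.card ≤ (Icc a b).card := card_le_card hsub
      _ = b + 1 - a := Nat.card_Icc _ _
      _ ≤ Q.length := hlen ▸ hQ
  · rw [hc] at hlen
    simp at hlen
    omega
  · rw [e1, List.take_append_drop]
  · rw [e2, ← ha']
    exact h1 _
  · rw [e1, ← hb']
    exact h2 _

end MOP

/-! ### The guarantee for the guess that equals the optimum. -/

namespace MOP

open Finset

theorem penalty_const {n m : ℕ} (x : ℝ) (P : Family n m) :
    penalty (fun _ => x) P = (n - (spanned P).card) * x := by
  rw [penalty, sum_const, nsmul_eq_mul, card_compl, Fintype.card_fin,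
    Nat.cast_sub (card_spanned_le P)]

theorem prizeOpt_le {n m : ℕ} {w : Fin n → Fin n → ℝ} (hw : IsMetric w) {p : Fin n → ℝ}
    (hp : ∀ v, 0 ≤ p v) {P : Family n m} (hP : IsPathSystem P) :
    prizeOpt w m p ≤ weight w P + penalty p P := by
  refine csInf_le ⟨0, ?_⟩ ⟨P, hP, rfl⟩
  rintro x ⟨P', -, rfl⟩
  exact add_nonneg (weight_nonneg hw _) (sum_nonneg fun v _ => hp v)

section

variable {A : PrizeAlgorithm} {n m k : ℕ} {w : Fin n → Fin n → ℝ} {B ε α : ℝ}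

theorem prize_nonneg (hα : α < 1) {L : ℝ} (hL : 0 ≤ L) : 0 ≤ L / ((1 - α) * k) :=
  div_nonneg hL (mul_nonneg (by linarith) (Nat.cast_nonneg _))

theorem prizePaths_isPathSystem (hA : IsLMP 4 A) (hw : IsMetric w) (hm : 1 ≤ m) (hmn : m ≤ n)
    (hα : α < 1) {L : ℝ} (hL : 0 ≤ L) : IsPathSystem (prizePaths A w m k α L) :=
  (hA n w m _ hw hm hmn fun _ => prize_nonneg hα hL).1

/-- For a uniform penalty the number `n` cancels from both sides of the 4-LMP inequality, because
the factor `4` stands before the penalty on both sides. Only the difference of the numbers of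
spanned vertices remains. -/
theorem weight_prizePaths_le (hA : IsLMP 4 A) (hw : IsMetric w) (hm : 1 ≤ m) (hmn : m ≤ n)
    (hα : α < 1) {L : ℝ} (hL : 0 ≤ L) {P : Family n m} (hP : IsPathSystem P) :
    weight w (prizePaths A w m k α L) ≤ 4 * weight w P +
      4 * (L / ((1 - α) * k)) * ((spanned (prizePaths A w m k α L)).card - (spanned P).card) := by
  have hp : ∀ v : Fin n, 0 ≤ (fun _ : Fin n => L / ((1 - α) * k)) v := fun _ => prize_nonneg hα hL
  have h1 := (hA n w m _ hw hm hmn hp).2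
  have h2 := prizeOpt_le hw hp hP
  rw [penalty_const] at h1 h2
  change weight w (prizePaths A w m k α L) +
    4 * ((n - (spanned (prizePaths A w m k α L)).card) * _) ≤ _ at h1
  linarith

theorem min_longestEdges_nonneg (hw : IsMetric w) (hB : 0 < B) (q : ℕ) :
    0 ≤ min (longestEdges w q) B := le_min (longestEdges_nonneg hw _) hB.le

theorem IsBicriteriaOutput.isPathSystem (hA : IsLMP 4 A) (hw : IsMetric w) (hm : 1 ≤ m)
    (hmn : m ≤ n) (hα : α < 1) (hB : 0 < B) {P : Family n m}
    (h : IsBicriteriaOutput A w m k B ε α P) : IsPathSystem P := by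
  obtain ⟨L, h1, h2⟩ := h
  exact h2.isPathSystem hw (prizePaths_isPathSystem hA hw hm hmn hα
    (h1.spec le_rfl (min_longestEdges_nonneg hw hB _)).1)

theorem heaviest_isPathSystem {R S : Family n m} (hR : IsPathSystem R) {s : ℕ}
    (h : ∀ i, IsHeaviestSubpath w (R i) s (S i)) : IsPathSystem S :=
  hR.of_sublist (fun i => (h i).1.spec.1) fun i => (h i).1.spec.2.1

theorem IsOutput.isFeasible (hA : IsLMP 4 A) (hw : IsMetric w) (hm : 1 ≤ m)
    (hmn : m ≤ n) (hα : α < 1) (hB : 0 < B) {P : Family n m} (h : IsOutput A w m B ε α P) :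
    IsFeasible w m B P := by
  obtain ⟨R, S, h1, k, hk, rfl, h2, -⟩ := h
  exact ⟨heaviest_isPathSystem ((h1 k hk).1.isPathSystem hA hw hm hmn hα hB) (h1 k hk).2, h2⟩

/-- The bisection ends with a solution that spans many vertices. -/
theorem le_card_of_binarySearch (hA : IsLMP 4 A) (hw : IsMetric w) (hm : 1 ≤ m) (hmn : m ≤ n)
    (hα : α < 1) (hB : 0 < B) {tol L : ℝ} {P : Family n m} (hP : IsFeasible w m B P)
    (hk : (spanned P).card = k)
    (h : BinarySearch (fun x => (spanned (prizePaths A w m k α x)).card) (α * k) tol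
      (min (longestEdges w (k - m)) B) 0 L) :
    0 ≤ L ∧ L ≤ B ∧ α * k ≤ (spanned (prizePaths A w m k α L)).card := by
  obtain ⟨hL, hL', h1⟩ := h.spec le_rfl (min_longestEdges_nonneg hw hB _)
  refine ⟨hL, hL'.trans (min_le_right _ _), ?_⟩
  rcases h1 with h1 | h1
  swap
  · exact h1.le
  have hs := prizePaths_isPathSystem (k := k) hA hw hm hmn hα hL
  have hmk : m ≤ k := hk ▸ le_card_spanned hP.1
  have hk0 : (0 : ℝ) < k := by exact_mod_cast hm.trans hmk
  by_contra hlt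
  rw [not_le] at hlt
  have h2 := weight_prizePaths_le (k := k) hA hw hm hmn hα hL hP.1
  have hLP : weight w P ≤ L := by
    rw [h1]
    refine le_min ?_ hP.2
    rw [← hk]
    exact weight_le_longestEdges hw hP.1
  have hmq : (m : ℝ) ≤ (spanned (prizePaths A w m k α L)).card := by
    exact_mod_cast le_card_spanned hs
  have hpos := weight_nonneg hw (prizePaths A w m k α L)
  have h1α : 0 < (1 - α) * k := mul_pos (by linarith) hk0
  -- For `L > 0` a deficit of more than `(1 - α) k` vertices saves more than `L`, so the weight
  -- would be less than `4 w(P) - 4 L ≤ 0`.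
  have hL0 : L = 0 := by
    by_contra hL0
    have hLpos : 0 < L / ((1 - α) * k) := div_pos (lt_of_le_of_ne hL (Ne.symm hL0)) h1α
    have h3 : L / ((1 - α) * k) * ((1 - α) * k) = L := div_mul_cancel₀ _ h1α.ne'
    rw [hk] at h2
    have h4 : L / ((1 - α) * k) * ((spanned (prizePaths A w m k α L)).card - k) <
        L / ((1 - α) * k) * -((1 - α) * k) := by
      refine mul_lt_mul_of_pos_left ?_ hLpos
      linarith
    linarith
  -- For `L = 0` the solution `P` has weight zero and consists of single vertices. But any `m` paths
  -- span at least `m`, which is more than `α m`.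
  have hkm : k = m := by
    have hw0 : weight w P = 0 := le_antisymm (hLP.trans hL0.le) (weight_nonneg hw _)
    rw [← hk, card_spanned hP.1]
    have : ∀ i, (P i).length = 1 := by
      intro i
      have h5 : pathWeight w (P i) = 0 :=
        (sum_eq_zero_iff_of_nonneg fun i _ => pathWeight_nonneg hw _).1 hw0 i (mem_univ _)
      have h6 := (hP.1.1 i).2
      have h7 := (hP.1.1 i).1
      match hPi : P i with
      | [] => exact absurd hPi h7
      | [_] => rfl
      | u :: v :: l =>
        rw [hPi] at h5 h6
        simp only [pathWeight] at h5
        have := hw.pos u v (fun h => by simp [h] at h6)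
        linarith [pathWeight_nonneg hw (v :: l)]
    simp [this]
  rw [hkm] at hlt hk0 hmq
  nlinarith

/-- A short computation with the number of pieces. -/
theorem div_ceil_ge {x X ε q s : ℝ} (hX : 1 ≤ X) (hε : 0 ≤ ε) (hx : x ≤ 1) (hx0 : 0 ≤ x)
    (hs : 0 < s) (hsX : s ≤ X + ε) {k : ℝ} (hk : 0 ≤ k) (h : x * k ≤ q * s) :
    (x / X - ε) * k ≤ q := by
  have hX0 : 0 < X := by linarith
  have h0 : x * k ≤ q * (X + ε) := by
    rcases le_total 0 q with hq | hq
    · exact h.trans (mul_le_mul_of_nonneg_left hsX hq)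
    · have : q * s = 0 := le_antisymm (mul_nonpos_of_nonpos_of_nonneg hq hs.le)
        ((mul_nonneg hx0 hk).trans h)
      have hq0 : q = 0 := by
        rcases mul_eq_zero.1 this with h | h
        exacts [h, absurd h hs.ne']
      rw [hq0] at h ⊢
      linarith
  -- The product exceeds `x` by `ε (x / X - X - ε)`, which is nonpositive because `x / X ≤ 1 ≤ X`.
  have h1 : (x / X - ε) * (X + ε) ≤ x := by
    have e : (x / X - ε) * (X + ε) = x + ε * (x / X - X - ε) := by
      field_simp
      ring
    have : x / X ≤ 1 := (div_le_one hX0).2 (hx.trans hX)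
    rw [e]
    nlinarith
  have h2 : (x / X - ε) * k * (X + ε) ≤ q * (X + ε) := by
    nlinarith [mul_le_mul_of_nonneg_right h1 hk]
  exact le_of_mul_le_mul_right h2 (by linarith)

/-- The guess of the optimal value leads to a good feasible solution. -/
theorem guess_opt (hA : IsLMP 4 A) (hw : IsMetric w) (hm : 1 ≤ m) (hmn : m ≤ n)
    (hα0 : 0 < α) (hα : α < 1) (hB : 0 < B) (hε : 0 < ε) {R S : Family n m}
    (hb : IsBicriteriaOutput A w m (opt w m B) B ε α R)
    (hheavy : ∀ i, IsHeaviestSubpath w (R i) (pieces (opt w m B) ε α R) (S i))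
    {c : ℝ} (hc₁ : c ≤ (1 - α) / (17 - α)) (hc₂ : c ≤ α * (1 - α) / (9 - 5 * α)) :
    weight w S ≤ B ∧ (c - ε) * opt w m B ≤ (spanned S).card := by
  obtain ⟨O, hO, hk⟩ := opt_spec (w := w) hmn hB
  generalize opt w m B = k at *
  have hmk : m ≤ k := hk ▸ le_card_spanned hO.1
  have hk0 : (0 : ℝ) < k := by exact_mod_cast hm.trans hmk
  obtain ⟨L, hbin, htrim⟩ := hb
  obtain ⟨hL, hLB, hq⟩ := le_card_of_binarySearch hA hw hm hmn hα hB hO hk hbin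
  have hps := prizePaths_isPathSystem (k := k) hA hw hm hmn hα hL
  have hwt := weight_prizePaths_le (k := k) hA hw hm hmn hα hL hO.1
  rw [hk] at hwt
  have hR := htrim.isPathSystem hw hps
  have hS := heaviest_isPathSystem hR hheavy
  have hα1 : 0 < 1 - α := by linarith
  -- the number of pieces and its consequences
  have hpieces : ∀ {s : ℕ}, 0 < s → pieces k ε α R = s →
      weight w S ≤ weight w R / s ∧
      ((spanned R).card : ℝ) ≤ (spanned S).card * s := by
    intro s hs hps
    rw [hps] at hheavy
    constructor
    · rw [weight, weight, sum_div]
      exact sum_le_sum fun i _ => (hheavy i).1.spec.2.2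
    · rw [card_spanned hR, card_spanned hS]
      have : ∑ i, (R i).length ≤ (∑ i, (S i).length) * s := by
        rw [sum_mul]
        exact sum_le_sum fun i _ => (hheavy i).length_le hw hs
      exact_mod_cast this
  have hπ : L / ((1 - α) * k) ≤ B / ((1 - α) * k) :=
    div_le_div_of_nonneg_right hLB (mul_pos hα1 hk0).le
  have hOB := hO.2
  rcases le_or_gt k (spanned (prizePaths A w m k α L)).card with hkq | hkq
  · -- many vertices are spanned
    have hkq' : (k : ℝ) ≤ (spanned (prizePaths A w m k α L)).card := by exact_mod_cast hkq
    -- The term `4 w(O) ≤ 4 B` is spread over `k` vertices at the rate `4 B / ((1 - α) k)`, which is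
    -- possible since `1 - α < 1`; the penalty term pays the same rate for the remaining vertices.
    have hc : weight w (prizePaths A w m k α L) ≤
        4 * B / ((1 - α) * k) * (spanned (prizePaths A w m k α L)).card := by
      have h2 : 4 * B ≤ 4 * B / ((1 - α) * k) * k := by
        rw [div_mul_eq_mul_div, le_div_iff₀ (mul_pos hα1 hk0)]
        have := mul_pos hB hk0
        nlinarith
      have h3 := mul_le_mul_of_nonneg_right hπ (sub_nonneg.2 hkq')
      rw [mul_div_assoc] at h2 ⊢
      linarith
    obtain ⟨h4, h5⟩ := htrim.spec hw hps (div_nonneg (by linarith) (mul_pos hα1 hk0).le) hkq hc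
    have hX : 0 ≤ 16 / (1 - α) + ε := by positivity
    obtain ⟨h6, h7⟩ := hpieces (s := ⌈16 / (1 - α) + ε⌉₊) (Nat.ceil_pos.2 (by positivity))
      (if_pos h4)
    have hs0 : 16 / (1 - α) + ε ≤ (⌈16 / (1 - α) + ε⌉₊ : ℝ) := Nat.le_ceil _
    have hs1 := (Nat.ceil_lt_add_one hX).le
    generalize (⌈16 / (1 - α) + ε⌉₊ : ℝ) = s at *
    have hs : 0 < s := lt_of_lt_of_le (by positivity) hs0
    have hwB : weight w S ≤ B := by
      refine h6.trans ((div_le_iff₀ hs).2 (h5.trans ?_))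
      have e : 4 * B / ((1 - α) * k) * (2 * k) = B * (8 / (1 - α)) := by
        field_simp
        ring
      rw [e]
      refine mul_le_mul_of_nonneg_left (le_trans ?_ hs0) hB.le
      have : 8 / (1 - α) ≤ 16 / (1 - α) := div_le_div_of_nonneg_right (by norm_num) hα1.le
      linarith
    refine ⟨hwB, ?_⟩
    have h4' : (k : ℝ) ≤ (spanned R).card := by exact_mod_cast h4
    -- The number `X` is `16 / (1 - α) + 1`, where the one accounts for rounding up. At least `k`
    -- vertices are distributed, hence `x = 1`.
    have := div_ceil_ge (x := 1) (X := (17 - α) / (1 - α)) (ε := ε) (s := s) (k := k)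
      (q := (spanned S).card) (by rw [le_div_iff₀ hα1]; linarith) hε.le le_rfl zero_le_one hs
      (by
        have : (17 - α) / (1 - α) = 16 / (1 - α) + 1 := by field_simp; ring
        linarith) hk0.le (by linarith)
    rw [one_div_div] at this
    refine le_trans (mul_le_mul_of_nonneg_right ?_ hk0.le) this
    linarith
  · -- few vertices are spanned
    -- Fewer than `k` vertices are spanned, so the trimming does nothing.
    have hRk := htrim.eq_of_le (by omega)
    have hkq' : ((spanned (prizePaths A w m k α L)).card : ℝ) ≤ k := by exact_mod_cast hkq.le
    -- With fewer than `k` vertices the penalty term is nonpositive and only `4 w(O)` is left.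
    have hW : weight w R ≤ 4 * B := by
      rw [hRk]
      have := mul_nonneg (prize_nonneg (k := k) hα hL) (sub_nonneg.2 hkq')
      linarith
    have hX : 0 < (8 - 4 * α) / (1 - α) + ε := add_pos (div_pos (by linarith) hα1) hε
    obtain ⟨h6, h7⟩ := hpieces (s := ⌈(8 - 4 * α) / (1 - α) + ε⌉₊) (Nat.ceil_pos.2 hX)
      (if_neg (by rw [hRk]; omega))
    have hs0 : (8 - 4 * α) / (1 - α) + ε ≤ (⌈(8 - 4 * α) / (1 - α) + ε⌉₊ : ℝ) := Nat.le_ceil _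
    have hs1 := (Nat.ceil_lt_add_one hX.le).le
    generalize (⌈(8 - 4 * α) / (1 - α) + ε⌉₊ : ℝ) = s at *
    have hs : 0 < s := lt_of_lt_of_le hX hs0
    have hwB : weight w S ≤ B := by
      refine h6.trans ((div_le_iff₀ hs).2 (hW.trans ?_))
      rw [mul_comm]
      refine mul_le_mul_of_nonneg_left (le_trans ?_ hs0) hB.le
      have : 4 ≤ (8 - 4 * α) / (1 - α) := by rw [le_div_iff₀ hα1]; linarith
      linarith
    refine ⟨hwB, ?_⟩
    rw [hRk] at h7
    have := div_ceil_ge (x := α) (X := (9 - 5 * α) / (1 - α)) (ε := ε) (s := s) (k := k)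
      (q := (spanned S).card) (by rw [le_div_iff₀ hα1]; linarith) hε.le hα.le hα0.le hs
      (by
        have : (9 - 5 * α) / (1 - α) = (8 - 4 * α) / (1 - α) + 1 := by field_simp; ring
        linarith) hk0.le (by linarith)
    rw [div_div_eq_mul_div] at this
    refine le_trans (mul_le_mul_of_nonneg_right ?_ hk0.le) this
    linarith

theorem mem_Icc_opt (hmn : m ≤ n) (hB : 0 < B) : opt w m B ∈ Icc m n := by
  obtain ⟨O, hO, hk⟩ := opt_spec (w := w) hmn hB
  exact hk ▸ mem_Icc.2 ⟨le_card_spanned hO.1, card_spanned_le O⟩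

theorem IsOutput.card_ge (hA : IsLMP 4 A) (hw : IsMetric w) (hm : 1 ≤ m) (hmn : m ≤ n)
    (hα0 : 0 < α) (hα : α < 1) (hB : 0 < B) (hε : 0 < ε) {P : Family n m}
    (h : IsOutput A w m B ε α P) {c : ℝ} (hc₁ : c ≤ (1 - α) / (17 - α))
    (hc₂ : c ≤ α * (1 - α) / (9 - 5 * α)) :
    (c - ε) * opt w m B ≤ (spanned P).card := by
  obtain ⟨R, S, h1, k₀, hk₀, rfl, -, hmax⟩ := h
  have hk := mem_Icc_opt (w := w) hmn hB
  obtain ⟨h2, h3⟩ := guess_opt hA hw hm hmn hα0 hα hB hε (h1 _ hk).1 (h1 _ hk).2 hc₁ hc₂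
  exact h3.trans (by exact_mod_cast hmax _ hk h2)

end

/-! #### The choice of the parameter -/

theorem sqrt_seven_bounds : (2.6457 : ℝ) < √7 ∧ √7 < 2.646 :=
  ⟨Real.lt_sqrt_of_sq_lt (by norm_num), (Real.sqrt_lt' (by norm_num)).2 (by norm_num)⟩

theorem parameter_mem : (11 - 4 * √7 : ℝ) ∈ Set.Ioo (0 : ℝ) 1 := by
  obtain ⟨h1, h2⟩ := sqrt_seven_bounds
  constructor <;> linarith

theorem ratio_first :
    (1 - (11 - 4 * √7)) / (17 - (11 - 4 * √7)) = (4 * √7 - 10) / (6 + 4 * √7) := by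
  congr 1 <;> ring

theorem ratio_second : (11 - 4 * √7) * (1 - (11 - 4 * √7)) / (9 - 5 * (11 - 4 * √7))
    = (4 * √7 - 10) / (6 + 4 * √7) := by
  obtain ⟨h1, h2⟩ := sqrt_seven_bounds
  have h7 : √7 * √7 = 7 := Real.mul_self_sqrt (by norm_num)
  rw [div_eq_div_iff (by linarith) (by linarith)]
  nlinarith

/-- Let `α*` be the value where the two ratios agree. Beyond `α*` the first ratio is smaller than
there. Below `α*` the second one is: after cross-multiplication the difference is `α* - α` times a
linear factor that is nonnegative for `α ≤ α*`. -/
theorem ratio_le {α : ℝ} (h : α ∈ Set.Ioo (0 : ℝ) 1) :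
    min ((1 - α) / (17 - α)) (α * (1 - α) / (9 - 5 * α)) ≤ (4 * √7 - 10) / (6 + 4 * √7) := by
  obtain ⟨h0, h1⟩ := h
  obtain ⟨p0, p1⟩ := parameter_mem
  rcases le_total (11 - 4 * √7) α with ha | ha
  · refine (min_le_left _ _).trans ?_
    rw [← ratio_first, div_le_div_iff₀ (by linarith) (by linarith)]
    nlinarith
  · refine (min_le_right _ _).trans ?_
    obtain ⟨h2, h3⟩ := sqrt_seven_bounds
    have h7 : √7 * √7 = 7 := Real.mul_self_sqrt (by norm_num)
    rw [div_le_div_iff₀ (by linarith) (by linarith)]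
    have h4 : 0 ≤ (24 * √7 - 44) - (6 + 4 * √7) * (α + (11 - 4 * √7)) := by
      have : (6 + 4 * √7) * (α + (11 - 4 * √7)) ≤ (6 + 4 * √7) * (2 * (11 - 4 * √7)) :=
        mul_le_mul_of_nonneg_left (by linarith) (by linarith)
      nlinarith
    have h5 := mul_nonneg (sub_nonneg.2 ha) h4
    -- Since `α*` is a root of this quadratic in `α`, the factor `α* - α` splits off.
    have e : (4 * √7 - 10) * (9 - 5 * α) - α * (1 - α) * (6 + 4 * √7) =
        (11 - 4 * √7 - α) * ((24 * √7 - 44) - (6 + 4 * √7) * (α + (11 - 4 * √7))) := by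
      linear_combination (64 * √7 - 160) * h7
    linarith

theorem lt_ratio : (0.035 : ℝ) < (4 * √7 - 10) / (6 + 4 * √7) := by
  obtain ⟨h1, h2⟩ := sqrt_seven_bounds
  rw [lt_div_iff₀ (by linarith)]
  linarith

end MOP

/-! ### The program for the multi-orienteering problem

Natural arrays: `10` vertices of the current paths, `11`, `12` first positions and lengths of the
current segments, `13` edges used so far; scalars: `20` number of the guess, `21`, `22`, `23`, `26`
counters, `24` offset, `25` number of spanned vertices, `27` number of pieces, `28`, `29` best
sub-path, `30`, `31`, `32` longest unused edge, `33` value of the best solution, `34` half of the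
length of a path. Real arrays: `17` positions; scalars: `10` the guess, `11` weight of the longest
edges, `12`, `13`, `14` bisection, `15`, `16` number of pieces, `18`, `24` pieces, `19`, `20` costs,
`21` weight, `22` longest unused edge, `23` number of spanned vertices. -/

namespace RealRAM

abbrev sc (a : ℕ) : NatExp := .read a c0 c0
abbrev fc (a : ℕ) : RealExp := .read a c0 c0
abbrev put (a : ℕ) (e : NatExp) : Program := .setNat a c0 c0 e
abbrev putR (a : ℕ) (e : RealExp) : Program := .setReal a c0 c0 e
abbrev fone : RealExp := .const 1
/-- The guess. -/
abbrev kE : NatExp := .add mm (sc 20)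
abbrev stE : NatExp := .read 11 (sc 21) c0
abbrev lnE : NatExp := .read 12 (sc 21) c0
/-- A vertex of the current path. -/
abbrev curV (x : NatExp) : NatExp := .read 10 (sc 21) (.add stE x)
/-- The weight of an edge of the current path. -/
abbrev edgeW (x : NatExp) : RealExp := .read 0 (curV x) (curV (.add x c1))

/-- Call the subroutine for the uniform penalty given by the bisection. -/
def callGw : Program :=
  .seq (put 9 (.add (sc 9) c1)) <|
  .seq (forLoop c0 21 nn <|
    .setReal 100 rv (sc 21) (.div (fc 14) (.mul (.sub fone (fc 3)) (fc 10)))) <|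
  .seq gw <|
  .seq (putR 23 (.const 0)) <|
  forLoop c0 21 mm <| forLoop c0 22 (.read 111 rv (sc 21)) <| putR 23 (.add (fc 23) fone)

/-- The subroutine is called again after the loop, since the last call inside need not have been for
the final upper end, and there may have been none. -/
def bisect : Program :=
  .seq (.branch (.realLE (fc 11) (fc 1)) (putR 12 (fc 11)) (putR 12 (fc 1))) <|
  .seq (putR 13 (.const 0)) <|
  .seq (.loop (realLT (.mul (fc 2) (fc 1)) (.sub (fc 12) (fc 13))) <|
    .seq (putR 14 (.div (.add (fc 12) (fc 13)) (.const 2))) <|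
    .seq callGw <|
    .branch (.realLE (fc 23) (.mul (fc 3) (fc 10))) (putR 13 (fc 14)) (putR 12 (fc 14))) <|
  .seq (putR 14 (fc 12)) callGw

/-- Copy the result of the subroutine. -/
def load : Program :=
  .seq (put 24 c0) <|
  forLoop c0 21 mm <|
    .seq (forLoop c0 22 (.read 111 rv (sc 21)) <|
      .setNat 10 (sc 21) (sc 22) (.read 112 rv (.add (sc 24) (sc 22)))) <|
    .seq (.setNat 11 (sc 21) c0 c0) <|
    .seq (.setNat 12 (sc 21) c0 (.read 111 rv (sc 21))) <|
    put 24 (.add (sc 24) nn)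

def countVertices : Program :=
  .seq (put 25 c0) <| forLoop c0 21 mm <| put 25 (.add (sc 25) lnE)

/-- Half of the length is found by counting, as naturals cannot be divided. Both parts have equally
many vertices, so the costs are compared instead of the ratios. Removing the first part shifts the
start of the segment; removing the last part only shortens it. -/
def trimPath : Program :=
  .branch (.natLE (.const 2) lnE)
    (.seq (put 34 c0) <|
      .seq (.loop (.natLE (.add (.add (sc 34) c1) (.add (sc 34) c1)) lnE) <|
        put 34 (.add (sc 34) c1)) <|
      .seq (putR 19 (.const 0)) <|
      .seq (putR 20 (.const 0)) <|
      .seq (forLoop c0 22 (sc 34) <|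
        .seq (putR 19 (.add (fc 19) (edgeW (sc 22)))) <|
          putR 20 (.add (fc 20) (edgeW (.add (.sub (.sub lnE (sc 34)) c1) (sc 22))))) <|
      .branch (.realLE (fc 20) (fc 19))
        (.seq (.setNat 11 (sc 21) c0 (.add stE (sc 34)))
          (.setNat 12 (sc 21) c0 (.sub lnE (sc 34))))
        (.setNat 12 (sc 21) c0 (.sub lnE (sc 34))))
    .skip

def trim : Program :=
  .seq countVertices <|
  .loop (.natLE (.add (.add kE kE) c1) (sc 25)) <|
    .seq (forLoop c0 21 mm trimPath) countVertices

/-- The ceiling is found by counting up. The count is kept both as a natural and as a real number,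
because the machine cannot convert between the two. -/
def setPieces : Program :=
  .seq (.branch (.natLE kE (sc 25))
    (putR 15 (.add (.div (.const 16) (.sub fone (fc 3))) (fc 2)))
    (putR 15 (.add (.div (.sub (.const 8) (.mul (.const 4) (fc 3))) (.sub fone (fc 3)))
      (fc 2)))) <|
  .seq (put 27 c0) <|
  .seq (putR 16 (.const 0)) <|
  .loop (realLT (fc 16) (fc 15)) <|
    .seq (put 27 (.add (sc 27) c1)) (putR 16 (.add (fc 16) fone))

/-- The positions of the vertices of the current path. -/
def setPositions : Program :=
  .seq (.setReal 17 c0 c0 (.const 0)) <|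
  forLoop c0 22 (.sub lnE c1) <|
    .setReal 17 c0 (.add (sc 22) c1) (.add (.read 17 c0 (sc 22)) (edgeW (sc 22)))

/-- All pairs of first and last positions are tried. The comparison of `29 + 22` with `26` accepts
only strictly longer sub-paths and rules out pairs in the wrong order. -/
def searchPiece : Program :=
  forLoop c0 22 lnE <| forLoop c0 26 lnE <|
    .branch (.realLE (.mul (fc 18) (fc 24)) (.read 17 c0 (sc 22)))
      (.branch (.realLE (.read 17 c0 (sc 26)) (.mul (.add (fc 18) fone) (fc 24)))
        (.branch (.natLE (.add (sc 29) (sc 22)) (sc 26))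
          (.seq (put 28 (sc 22)) (put 29 (.sub (.add (sc 26) c1) (sc 22)))) .skip) .skip) .skip

def heaviestPath : Program :=
  .seq setPositions <|
  .seq (putR 24 (.div (.read 17 c0 (.sub lnE c1)) (fc 16))) <|
  .seq (put 29 c0) <|
  .seq (putR 18 (.const 0)) <|
  .seq (forLoop c0 23 (sc 27) <| .seq searchPiece (putR 18 (.add (fc 18) fone))) <|
  .seq (.setNat 11 (sc 21) c0 (.add stE (sc 28))) (.setNat 12 (sc 21) c0 (sc 29))

def sumWeights : Program :=
  .seq (putR 21 (.const 0)) <|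
  forLoop c0 21 mm <| forLoop c0 22 (.sub lnE c1) <| putR 21 (.add (fc 21) (edgeW (sc 22)))

/-- Keep the current solution if it is feasible and better than the previous ones. -/
def keep : Program :=
  .branch (.realLE (fc 21) (fc 1))
    (.branch (.natLE (.add (sc 33) c1) (sc 25))
      (.seq (put 33 (sc 25)) <|
        forLoop c0 21 mm <|
          .seq (.setNat 2 (sc 21) c0 lnE) <|
          forLoop c0 22 lnE <| .setNat 3 (sc 21) (sc 22) (curV (sc 22))) .skip) .skip

/-- Consecutive guesses differ by one, so the weight of the longest edges is updated by a greedy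
choice of one more edge, in quadratic time. -/
def nextEdge : Program :=
  .seq (put 30 c0) <|
  .seq (forLoop c0 21 nn <| forLoop c0 22 nn <|
    .branch (.natLE (.add (sc 21) c1) (sc 22))
      (.branch (natEq (.read 13 (sc 21) (sc 22)) c0)
        (.branch (natEq (sc 30) c0)
          (.seq (put 30 c1) <| .seq (put 31 (sc 21)) <| .seq (put 32 (sc 22)) <|
            putR 22 (.read 0 (sc 21) (sc 22)))
          (.branch (realLT (fc 22) (.read 0 (sc 21) (sc 22)))
            (.seq (put 30 c1) <| .seq (put 31 (sc 21)) <| .seq (put 32 (sc 22)) <|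
              putR 22 (.read 0 (sc 21) (sc 22))) .skip)) .skip) .skip) <|
  .seq (.setNat 13 (sc 31) (sc 32) c1) (putR 11 (.add (fc 11) (fc 22)))

def tryGuess : Program :=
  .seq bisect <| .seq load <| .seq trim <| .seq setPieces <|
  .seq (forLoop c0 21 mm heaviestPath) <| .seq sumWeights <| .seq countVertices <|
  .seq keep <| .seq nextEdge <| putR 10 (.add (fc 10) fone)

/-- The first loop produces a real copy of `m`, from which the real value of the guess is then
maintained. -/
def mainProgram : Program :=
  .seq (forLoop c0 21 mm <| putR 10 (.add (fc 10) fone)) <|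
  forLoop c0 20 (.sub (.add nn c1) mm) tryGuess

/-! ### Calls of the subroutine from the main program. -/

open MOP Finset

/-- The input is in place, and the rows of the subroutine that come next are zero. -/
structure MainCtx {n : ℕ} (w : Fin n → Fin n → ℝ) (m : ℕ) (B ε α : ℝ) (σ : Store) : Prop where
  size : σ.nat 0 0 0 = n
  number : σ.nat 1 0 0 = m
  weights : σ.real 0 = extend w
  budget : σ.real 1 0 0 = B
  eps : σ.real 2 0 0 = ε
  alpha : σ.real 3 0 0 = α
  fresh : Fresh (σ.nat 9 0 0 + 1) σ

theorem MainCtx.frame {n m : ℕ} {w : Fin n → Fin n → ℝ} {B ε α : ℝ} {σ τ : Store}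
    {ns ls : List ℕ} (h : MainCtx w m B ε α σ) (f : Frame ns ls σ τ)
    (hf : (∀ a ∈ ns, 1 < a ∧ a ≠ 9 ∧ a < 100) ∧ ∀ a ∈ ls, 3 < a ∧ a < 100) :
    MainCtx w m B ε α τ := by
  have e : ∀ a, (a ≤ 1 ∨ a = 9 ∨ 100 ≤ a) → τ.nat a = σ.nat a := fun a ha =>
    f.1 a fun hc => by have := hf.1 a hc; omega
  have e' : ∀ a, (a ≤ 3 ∨ 100 ≤ a) → τ.real a = σ.real a := fun a ha =>
    f.2 a fun hc => by have := hf.2 a hc; omega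
  refine ⟨?_, ?_, ?_, ?_, ?_, ?_, fun a ha i hi j => ?_⟩
  · rw [e 0 (by omega), h.size]
  · rw [e 1 (by omega), h.number]
  · rw [e' 0 (by omega), h.weights]
  · rw [e' 1 (by omega), h.budget]
  · rw [e' 2 (by omega), h.eps]
  · rw [e' 3 (by omega), h.alpha]
  · rw [e 9 (by omega)] at hi
    rw [e a (by omega), e' a (by omega)]
    exact h.fresh a ha i hi j

section

variable {n m k : ℕ} {w : Fin n → Fin n → ℝ} {B ε α : ℝ} {σ : Store}

theorem runs_setPenalties (hc : MainCtx w m B ε α σ) {r : ℕ} (hr : σ.nat 9 0 0 = r) {L : ℝ}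
    (hL : σ.real 14 0 0 = L) (hk : σ.real 10 0 0 = k) (hz : ∀ j, σ.real 100 r j = 0) :
    Runs (forLoop c0 21 nn <|
      .setReal 100 rv (sc 21) (.div (fc 14) (.mul (.sub fone (fc 3)) (fc 10)))) σ
      (200 * (n + 1) ^ 1) fun τ => (∀ v < n, τ.real 100 r v = L / ((1 - α) * k)) ∧
        (∀ v, n ≤ v → τ.real 100 r v = 0) ∧
        ∀ i j, i ≠ r → τ.real 100 i j = σ.real 100 i j := by
  refine Runs.for_pow (C := 100) (k := 0) (r := 0) (n := n) (M := n)
    (fun x τ => (∀ v, τ.real 100 r v = if v < x then L / ((1 - α) * k) else 0) ∧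
        ∀ i j, i ≠ r → τ.real 100 i j = σ.real 100 i j) (by decide) (by decide)
    (fun _ _ => rfl) (fun ρ f => ?_) le_rfl (by decide) ?_ ?_ (by norm_num) (by norm_num) ?_
  · simp [NatExp.eval, f.1 0 (by decide), hc.size]
  · simp [hz]
  · rintro x hx τ f hx' ⟨h1, h2⟩
    refine Runs.step_pow rfl (by decide) ?_
    simp [Program.step, NatExp.eval, RealExp.eval, f.1 9 (by decide), hr, hx',
      f.2 14 (by decide), hL, f.2 10 (by decide), hk, f.2 3 (by decide), hc.alpha]
    refine ⟨fun v => ?_, fun i j hi => ?_⟩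
    · by_cases hv : v = x
      · simp [hv]
      · rw [if_neg hv, h1]
        have : v < x ↔ v ≤ x := by omega
        simp [this]
    · simp [hi, h2]
  · rintro τ ⟨h1, h2⟩ -
    exact ⟨fun v hv => by rw [h1, if_pos hv], fun v hv => by rw [h1, if_neg (by omega)], h2⟩

theorem length_le {P : Family n m} (hP : IsPathSystem P) (i : Fin m) : (P i).length ≤ n :=
  (hP.1 i).2.length_le_card.trans (Fintype.card_fin n).le

/-- The result of a call of the subroutine. -/
structure Called (h : 0 < n) (w : Fin n → Fin n → ℝ) (m k : ℕ) (α L : ℝ) (τ : Store) : Prop where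
  eq : prizePaths gwAlgorithm w m k α L = decode h m τ (τ.nat 9 0 0)
  lt : ∀ i < m, ∀ j < τ.nat 111 (τ.nat 9 0 0) i, τ.nat 112 (τ.nat 9 0 0) (i * n + j) < n
  card : τ.real 23 0 0 = (spanned (prizePaths gwAlgorithm w m k α L)).card

/-- Each call uses a new row, and a local program touches only its own row. All later rows therefore
stay zero, and the number of calls need not be bounded. -/
theorem runs_callGw (hw : IsMetric w) (hm : 1 ≤ m) (hmn : m ≤ n) (hα : α < 1)
    (hc : MainCtx w m B ε α σ) {L : ℝ} (hL : σ.real 14 0 0 = L) (hL0 : 0 ≤ L)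
    (hk : σ.real 10 0 0 = k) :
    Runs callGw σ (40000 * (n + 1) ^ 3) fun τ => MainCtx w m B ε α τ ∧
      Called (hm.trans hmn) w m k α L τ := by
  have hn : 0 < n := hm.trans hmn
  refine Runs.seq_pow (C₁ := 20) (C₂ := 39000) (k₁ := 0) (k₂ := 3)
    (Q := fun τ => τ.nat 9 0 0 = σ.nat 9 0 0 + 1)
    (Runs.step_pow rfl (by decide) ?_) ?_ (by norm_num) (by norm_num) le_rfl
  · simp [Program.step, NatExp.eval]
  intro τ₁ hr₁ f₁
  generalize hr : τ₁.nat 9 0 0 = r at *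
  have hc₁ : MainCtx w m B ε α τ₁ := by
    refine ⟨?_, ?_, ?_, ?_, ?_, ?_, fun a ha i hi j => ?_⟩
    · rw [f₁.1 0 (by decide), hc.size]
    · rw [f₁.1 1 (by decide), hc.number]
    · rw [f₁.2 0 (by decide), hc.weights]
    · rw [f₁.2 1 (by decide), hc.budget]
    · rw [f₁.2 2 (by decide), hc.eps]
    · rw [f₁.2 3 (by decide), hc.alpha]
    · have h9 : a ∉ (put 9 (.add (sc 9) c1)).natW := by simp [Program.natW]; omega
      rw [f₁.1 a h9, f₁.2 a (by simp [Program.realW])]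
      exact hc.fresh a ha i (by omega) j
  have hfr : ∀ a, 100 ≤ a → ∀ i, r ≤ i → ∀ j, τ₁.nat a i j = 0 ∧ τ₁.real a i j = 0 := by
    intro a ha i hi j
    have h9 : a ∉ (put 9 (.add (sc 9) c1)).natW := by simp [Program.natW]; omega
    rw [f₁.1 a h9, f₁.2 a (by simp [Program.realW])]
    exact hc.fresh a ha i (by omega) j
  refine Runs.seq_pow (C₁ := 200) (C₂ := 38000) (k₁ := 1) (k₂ := 3)
    (runs_setPenalties (k := k) hc₁ hr (L := L) (by rw [f₁.2 14 (by decide), hL])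
      (by rw [f₁.2 10 (by decide), hk]) fun j => (hfr 100 le_rfl r le_rfl j).2)
    ?_ (by norm_num) (by norm_num) le_rfl
  rintro τ₂ ⟨h1, h2, h3⟩ f₂
  have hctx : Ctx n m (extend w) r τ₂ := by
    refine ⟨?_, ?_, ?_, fun i j => ?_⟩
    · rw [f₂.1 9 (by decide), hr]
    · rw [f₂.1 0 (by decide), hc₁.size]
    · rw [f₂.1 1 (by decide), hc₁.number]
    · rw [f₂.2 0 (by decide), hc₁.weights]
  have e₂ : ∀ a, 100 ≤ a → τ₂.nat a = τ₁.nat a := fun a ha =>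
    f₂.1 a (by simp [forLoop, Program.natW]; omega)
  have e₂' : ∀ a, 100 < a → τ₂.real a = τ₁.real a := fun a ha =>
    f₂.2 a (by simp [forLoop, Program.realW]; omega)
  refine Runs.seq_pow (C₁ := 30000) (C₂ := 8000) (k₁ := 3) (k₂ := 2)
    (runs_gw_relocated hn hmn hw (p := fun _ => L / ((1 - α) * k))
      (fun _ => prize_nonneg hα hL0) hctx (fun v => h1 v v.2) ?_) ?_ (by norm_num) le_rfl
      (by norm_num)
  · intro a ha j
    refine ⟨by rw [e₂ a ha]; exact (hfr a ha r le_rfl j).1, fun hj => ?_⟩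
    rcases ha.lt_or_eq with ha' | rfl
    · rw [e₂' a ha']
      exact (hfr a ha r le_rfl j).2
    · exact h2 j (by omega)
  rintro τ₃ ⟨hdec, hlt, hrf⟩ f₃
  change prizePaths gwAlgorithm w m k α L = _ at hdec
  have hr₃ : τ₃.nat 9 0 0 = r := by rw [f₃.1 9 (by decide), hctx.row]
  have hc₃ : MainCtx w m B ε α τ₃ := by
    refine ⟨?_, ?_, ?_, ?_, ?_, ?_, fun a ha i hi j => ?_⟩
    · rw [f₃.1 0 (by decide), hctx.size]
    · rw [f₃.1 1 (by decide), hctx.number]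
    · rw [f₃.2 0 (by decide), f₂.2 0 (by decide), hc₁.weights]
    · rw [f₃.2 1 (by decide), f₂.2 1 (by decide), hc₁.budget]
    · rw [f₃.2 2 (by decide), f₂.2 2 (by decide), hc₁.eps]
    · rw [f₃.2 3 (by decide), f₂.2 3 (by decide), hc₁.alpha]
    · rw [hr₃] at hi
      rw [hrf.1 a i j (by omega), hrf.2 a i j (by omega), e₂ a ha]
      refine ⟨(hfr a ha i (by omega) j).1, ?_⟩
      rcases ha.lt_or_eq with ha' | rfl
      · rw [e₂' a ha']
        exact (hfr a ha i (by omega) j).2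
      · rw [h3 i j (by omega)]
        exact (hfr 100 le_rfl i (by omega) j).2
  have hps := prizePaths_isPathSystem (k := k) gwAlgorithm_isLMP hw hm hmn hα hL0
  have hcard := card_spanned hps
  have hlen : ∀ i : Fin m, (prizePaths gwAlgorithm w m k α L i).length = τ₃.nat 111 r i := by
    intro i
    rw [hdec]
    simp [decode]
  have hlen' : ∀ i < m, τ₃.nat 111 r i ≤ n := fun i hi => hlen ⟨i, hi⟩ ▸ length_le hps _
  rw [sum_congr rfl fun i _ => hlen i, ← Finset.sum_range] at hcard
  clear f₁ f₂ f₃ hctx hrf h1 h2 h3 e₂ e₂' hfr hr hc₁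
  refine Runs.seq_pow (C₁ := 20) (C₂ := 7000) (k₁ := 0) (k₂ := 2)
    (Q := fun τ => τ.real 23 0 0 = 0)
    (Runs.step_pow rfl (by decide) ?_) ?_ (by norm_num) (by norm_num) le_rfl
  · simp [Program.step, NatExp.eval, RealExp.eval]
  intro τ₄ h23 f₄
  have hc₄ := hc₃.frame f₄ (by decide)
  rw [← f₄.1 9 (by decide)] at hr₃
  rw [← f₄.1 111 (by decide)] at hlen' hcard hlt
  rw [← f₄.1 112 (by decide)] at hlt
  have hdec' : prizePaths gwAlgorithm w m k α L = decode hn m τ₄ r := by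
    rw [hdec]
    funext i
    simp only [decode, f₄.1 111 (by decide), f₄.1 112 (by decide)]
  clear f₄ hc₃ hlen
  -- The spanned vertices are counted by adding real ones, since the count is compared with the real
  -- number `α k`.
  suffices h : Runs (forLoop c0 21 mm <| forLoop c0 22 (.read 111 rv (sc 21)) <|
      putR 23 (.add (fc 23) fone)) τ₄ (7000 * (n + 1) ^ 2)
      fun τ => τ.real 23 0 0 = ((∑ i ∈ range m, τ₄.nat 111 r i : ℕ) : ℝ) by
    refine h.frame.mono le_rfl ?_
    rintro τ ⟨h, f⟩
    refine ⟨hc₄.frame f (by decide), ?_, ?_, ?_⟩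
    · rw [hdec']
      funext i
      simp only [decode, f.1 111 (by decide), f.1 112 (by decide), f.1 9 (by decide), hr₃]
    · rwa [f.1 111 (by decide), f.1 112 (by decide), f.1 9 (by decide), hr₃]
    · rw [h, hcard]
  refine Runs.for_pow (C := 300) (k := 1) (r := 0) (n := m) (M := n)
    (fun x τ => τ.real 23 0 0 = ((∑ i ∈ range x, τ₄.nat 111 r i : ℕ) : ℝ)) (by decide) (by decide)
    (fun _ _ => rfl) (fun ρ f => ?_) hmn (by decide) ?_ ?_ (by norm_num) (by norm_num)
    fun _ h _ => h
  · simp [NatExp.eval, f.1 1 (by decide), hc₄.number]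
  · simpa using h23
  · intro x hx τ f hx' h
    rw [← f.1 9 (by decide)] at hr₃
    rw [← f.1 111 (by decide)] at h hlen' ⊢
    refine Runs.for_pow (C := 50) (k := 0) (r := 0) (n := τ.nat 111 r x) (M := n)
      (fun y ρ => ρ.real 23 0 0 = ((∑ i ∈ range x, τ.nat 111 r i : ℕ) : ℝ) + y)
      (by decide) (by decide)
      (fun _ _ => rfl) (fun ρ f => ?_) (hlen' x hx) (by decide) ?_ ?_ (by norm_num) (by norm_num)
      ?_
    · simp [NatExp.eval, f.1 9 (by decide), f.1 111 (by decide), f.1 21 (by decide), hr₃, hx']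
    · simpa using h
    · intro y hy ρ f hy' h
      refine Runs.step_pow rfl (by decide) ?_
      simp [Program.step, NatExp.eval, RealExp.eval, h]
      ring
    · intro ρ h _
      simpa [sum_range_succ] using h

end

end RealRAM

/-! ### The bisection and the transfer of its result. -/

namespace RealRAM

open MOP Finset

section

variable {n m k : ℕ} {w : Fin n → Fin n → ℝ} {B ε α : ℝ} {σ : Store}

/-- The interval starts with length at most `B` and is halved in every round, so `F` rounds suffice
as soon as `ε B 2 ^ F` is at least `B`. -/
theorem runs_bisect (hw : IsMetric w) (hm : 1 ≤ m) (hmn : m ≤ n) (hα : α < 1) (hB : 0 < B)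
    (hc : MainCtx w m B ε α σ) (hQ : σ.real 11 0 0 = longestEdges w (k - m))
    (hk : σ.real 10 0 0 = k) {F : ℕ} (hF : B ≤ ε * B * 2 ^ F) :
    Runs bisect σ ((F + 2) * (50000 * (n + 1) ^ 3)) fun τ => MainCtx w m B ε α τ ∧
      ∃ L, BinarySearch (fun x => (spanned (prizePaths gwAlgorithm w m k α x)).card) (α * k)
        (ε * B) (min (longestEdges w (k - m)) B) 0 L ∧ Called (hm.trans hmn) w m k α L τ := by
  have hM : 1 ≤ (n + 1) ^ 3 := Nat.one_le_pow _ _ (Nat.succ_pos n)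
  set L₀ := min (longestEdges w (k - m)) B with hL₀
  have hL₀0 : 0 ≤ L₀ := min_longestEdges_nonneg hw hB _
  set bs := BinarySearch (fun x => (spanned (prizePaths gwAlgorithm w m k α x)).card) (α * k)
        (ε * B) with hbs
  have main : Runs (.loop (realLT (.mul (fc 2) (fc 1)) (.sub (fc 12) (fc 13))) <|
    .seq (putR 14 (.div (.add (fc 12) (fc 13)) (.const 2))) <|
    .seq callGw <|
    .branch (.realLE (fc 23) (.mul (fc 3) (fc 10))) (putR 13 (fc 14)) (putR 12 (fc 14)))
    ((σ.setReal 12 0 0 L₀).setReal 13 0 0 0) (F * (40200 * (n + 1) ^ 3) + 100) fun τ =>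
      MainCtx w m B ε α τ ∧ τ.real 10 0 0 = k ∧ ∃ L, 0 ≤ L ∧ τ.real 12 0 0 = L ∧ bs L₀ 0 L := by
    have hcost : (realLT (.mul (fc 2) (fc 1)) (.sub (fc 12) (fc 13))).cost ≤ 50 := by decide
    -- The invariant says that every bisection continued from the present interval is a bisection
    -- from the initial one. When the loop stops, this applies to the constructor `done`.
    refine (Runs.loop (T := 40100 * (n + 1) ^ 3) (fun j τ => MainCtx w m B ε α τ ∧
      τ.real 10 0 0 = k ∧ ∃ L₁ L₂, 0 ≤ L₂ ∧ L₂ ≤ L₁ ∧ τ.real 12 0 0 = L₁ ∧ τ.real 13 0 0 = L₂ ∧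
        L₁ - L₂ ≤ ε * B * 2 ^ j ∧ ∀ L, bs L₁ L₂ L → bs L₀ 0 L) ?_ (k := F) ?_).mono ?_ ?_
    · rintro j τ ⟨hc, hk, L₁, L₂, h0, h12, h1, h2, hj, hL⟩ hb
      simp only [Test.holds, RealExp.eval, NatExp.eval, hc.eps, hc.budget, h1, h2, not_le] at hb
      obtain ⟨i, rfl⟩ : ∃ i, j = i + 1 := by
        refine Nat.exists_eq_succ_of_ne_zero ?_
        rintro rfl
        rw [pow_zero, mul_one] at hj
        linarith
      refine ⟨i, rfl, ?_⟩
      rw [pow_succ] at hj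
      refine Runs.seq_pow (C₁ := 50) (C₂ := 40050) (k₁ := 0) (k₂ := 3)
        (Q := fun τ => τ.real 14 0 0 = (L₁ + L₂) / 2)
        (Runs.step_pow rfl (by decide) ?_) ?_ (by norm_num) (by norm_num) le_rfl
      · simp [Program.step, NatExp.eval, RealExp.eval, h1, h2]
      intro τ₁ h14 f
      have hc := hc.frame f (by decide)
      rw [← f.2 10 (by decide)] at hk
      rw [← f.2 12 (by decide)] at h1
      rw [← f.2 13 (by decide)] at h2
      refine Runs.seq_pow (C₁ := 40000) (C₂ := 50) (k₁ := 3) (k₂ := 0)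
        (runs_callGw hw hm hmn hα hc h14 (by linarith) hk) ?_ (by norm_num) le_rfl (by norm_num)
      rintro τ₂ ⟨hc, hcall⟩ f'
      have hcard := hcall.card
      rw [← f'.2 10 (by decide)] at hk
      rw [← f'.2 12 (by decide)] at h1
      rw [← f'.2 13 (by decide)] at h2
      rw [← f'.2 14 (by decide)] at h14
      clear f f'
      suffices h : Runs (.branch (.realLE (fc 23) (.mul (fc 3) (fc 10)))
          (putR 13 (fc 14)) (putR 12 (fc 14))) τ₂ (50 * (n + 1) ^ 0) fun τ =>
          ∃ L₁ L₂, 0 ≤ L₂ ∧ L₂ ≤ L₁ ∧ τ.real 12 0 0 = L₁ ∧ τ.real 13 0 0 = L₂ ∧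
            L₁ - L₂ ≤ ε * B * 2 ^ i ∧ ∀ L, bs L₁ L₂ L → bs L₀ 0 L by
        refine h.frame.mono le_rfl ?_
        rintro τ ⟨h, f⟩
        refine ⟨hc.frame f (by decide), by rw [f.2 10 (by decide), hk], h⟩
      refine Runs.branch_pow (C := 20) (fun hb' => ?_) (fun hb' => ?_) (by decide) <;>
        simp only [Test.holds, RealExp.eval, NatExp.eval, hcard, hc.alpha, hk] at hb'
      · refine Runs.step_pow rfl (by decide) ⟨L₁, (L₁ + L₂) / 2, by linarith, by linarith, ?_, ?_,
          by linarith, fun L h => hL L (.lower _ _ _ hb hb' h)⟩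
        · simp [Program.step, h1]
        · simp [Program.step, NatExp.eval, RealExp.eval, h14]
      · refine Runs.step_pow rfl (by decide) ⟨(L₁ + L₂) / 2, L₂, by linarith, by linarith, ?_, ?_,
          by linarith, fun L h => hL L (.upper _ _ _ hb (not_le.1 hb') h)⟩
        · simp [Program.step, NatExp.eval, RealExp.eval, h14]
        · simp [Program.step, h2]
    · refine ⟨⟨hc.size, hc.number, ?_, ?_, ?_, ?_, fun a ha i hi j => ?_⟩, by simp [hk], L₀, 0,
        le_rfl, hL₀0, by simp, by simp, ?_, fun L h => h⟩
      · simp [hc.weights]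
      · simp [hc.budget]
      · simp [hc.eps]
      · simp [hc.alpha]
      · rw [real_setReal_of_ne _ (by omega), real_setReal_of_ne _ (by omega)]
        exact hc.fresh a ha i hi j
      · rw [sub_zero]
        exact (min_le_right _ _).trans hF
    · have : F * ((realLT (.mul (fc 2) (fc 1)) (.sub (fc 12) (fc 13))).cost +
        40100 * (n + 1) ^ 3) ≤ F * (40200 * (n + 1) ^ 3) := Nat.mul_le_mul_left _ (by omega)
      omega
    · rintro τ ⟨⟨j, hc, hk, L₁, L₂, h0, h12, h1, h2, hj, hL⟩, hb⟩
      simp only [Test.holds, RealExp.eval, NatExp.eval, hc.eps, hc.budget, h1, h2, not_not] at hb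
      exact ⟨hc, hk, L₁, h0.trans h12, h1, hL L₁ (.done _ _ hb)⟩
  have first : Runs (.branch (.realLE (fc 11) (fc 1)) (putR 12 (fc 11)) (putR 12 (fc 1))) σ 50
      fun τ => τ = σ.setReal 12 0 0 L₀ := by
    refine Runs.of_step rfl (by decide) ?_
    simp only [Program.step, Test.holds, RealExp.eval, NatExp.eval, hQ, hc.budget]
    split_ifs with h
    · rw [hL₀, min_eq_left h]
    · rw [hL₀, min_eq_right (not_le.1 h).le]
  have second : ∀ τ, Runs (putR 13 (.const 0)) τ 50 fun ρ => ρ = τ.setReal 13 0 0 0 := by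
    intro τ
    refine Runs.of_step rfl (by decide) ?_
    simp [Program.step, RealExp.eval, NatExp.eval]
  have last : ∀ τ, MainCtx w m B ε α τ → τ.real 10 0 0 = k → ∀ L, 0 ≤ L → τ.real 12 0 0 = L →
      Runs (.seq (putR 14 (fc 12)) callGw) τ (41000 * (n + 1) ^ 3) fun τ => MainCtx w m B ε α τ ∧
        Called (hm.trans hmn) w m k α L τ := by
    intro τ hc hk L hL h12
    refine Runs.seq_pow (C₁ := 50) (C₂ := 40000) (k₁ := 0) (k₂ := 3)
        (Q := fun τ => τ.real 14 0 0 = L)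
        (Runs.step_pow rfl (by decide) ?_) ?_ (by norm_num) (by norm_num) le_rfl
    · simp [Program.step, NatExp.eval, RealExp.eval, h12]
    intro τ₁ h14 f
    exact runs_callGw hw hm hmn hα (hc.frame f (by decide)) h14 hL
      (by rw [f.2 10 (by decide), hk])
  refine (first.seq (T₂ := 50 + (F * (40200 * (n + 1) ^ 3) + 100 + 41000 * (n + 1) ^ 3))
    ?_).mono ?_ fun _ h => h
  · rintro τ rfl -
    refine (second _).seq ?_
    rintro τ rfl -
    refine main.seq ?_
    rintro τ ⟨hc, hk, L, hL, h12, hbs⟩ -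
    exact (last τ hc hk L hL h12).mono le_rfl fun ρ h => ⟨h.1, L, hbs, h.2⟩
  · have : F * (40200 * (n + 1) ^ 3) ≤ F * (50000 * (n + 1) ^ 3) :=
      Nat.mul_le_mul_left _ (by omega)
    rw [add_mul]
    omega

/-- The segment of length `l` from the position `s` on. -/
def seg (h : 0 < n) (V : ℕ → ℕ) (s l : ℕ) : List (Fin n) :=
  (List.range' s l).map fun j => vtx h (V j)

/-- The current path number `i`. -/
def cur (h : 0 < n) (σ : Store) (i : ℕ) : List (Fin n) :=
  seg h (σ.nat 10 i) (σ.nat 11 i 0) (σ.nat 12 i 0)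

/-- The current path number `i` is stored correctly. -/
structure PathOK (n : ℕ) (σ : Store) (i : ℕ) : Prop where
  len : σ.nat 12 i 0 ≤ n
  lt : ∀ j < σ.nat 12 i 0, σ.nat 10 i (σ.nat 11 i 0 + j) < n

theorem PathOK.congr {σ τ : Store} {i : ℕ} (h : PathOK n σ i) (h10 : τ.nat 10 i = σ.nat 10 i)
    (h11 : τ.nat 11 i 0 = σ.nat 11 i 0) (h12 : τ.nat 12 i 0 = σ.nat 12 i 0) : PathOK n τ i :=
  ⟨by rw [h12]; exact h.len, by rw [h10, h11, h12]; exact h.lt⟩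

theorem cur_congr (h : 0 < n) {σ τ : Store} {i : ℕ} (h10 : τ.nat 10 i = σ.nat 10 i)
    (h11 : τ.nat 11 i 0 = σ.nat 11 i 0) (h12 : τ.nat 12 i 0 = σ.nat 12 i 0) :
    cur h τ i = cur h σ i := by
  rw [cur, cur, h10, h11, h12]

theorem runs_load (hw : IsMetric w) (hm : 1 ≤ m) (hmn : m ≤ n) (hα : α < 1)
    (hc : MainCtx w m B ε α σ) {L : ℝ} (hL : 0 ≤ L) (hcall : Called (hm.trans hmn) w m k α L σ) :
    Runs load σ (1000 * (n + 1) ^ 2) fun τ => (∀ i < m, PathOK n τ i) ∧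
      (fun i : Fin m => cur (hm.trans hmn) τ i) = prizePaths gwAlgorithm w m k α L := by
  have hn : 0 < n := hm.trans hmn
  have hps := prizePaths_isPathSystem (k := k) gwAlgorithm_isLMP hw hm hmn hα hL
  obtain ⟨heq, hlt, -⟩ := hcall
  generalize hr : σ.nat 9 0 0 = r at *
  have hlen : ∀ i < m, σ.nat 111 r i ≤ n := fun i hi => by
    have := length_le hps ⟨i, hi⟩
    rw [heq] at this
    simpa [decode] using this
  refine Runs.seq_pow (C₁ := 20) (C₂ := 900) (k₁ := 0) (k₂ := 2)
    (Q := fun τ => τ.nat 24 0 0 = 0)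
    (Runs.step_pow rfl (by decide) ?_) ?_ (by norm_num) (by norm_num) le_rfl
  · simp [Program.step, NatExp.eval]
  intro τ h24 f₁
  have hc := hc.frame f₁ (by decide)
  refine Runs.for_pow (C := 800) (k := 1) (r := 0) (n := m) (M := n) (fun x τ =>
    τ.nat 24 0 0 = x * n ∧ ∀ i < x, τ.nat 11 i 0 = 0 ∧ τ.nat 12 i 0 = σ.nat 111 r i ∧
      ∀ j < σ.nat 111 r i, τ.nat 10 i j = σ.nat 112 r (i * n + j)) (by decide) (by decide)
    (fun _ _ => rfl) (fun ρ f => ?_) hmn (by decide) ?_ ?_ (by norm_num) (by norm_num) ?_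
  · simp [NatExp.eval, f.1 1 (by decide), hc.number]
  · simpa using h24
  · rintro x hx τ₁ f hx' ⟨h1, h2⟩
    have hc := hc.frame f (by decide)
    rw [← f₁.1 9 (by decide), ← f.1 9 (by decide)] at hr
    rw [← f₁.1 111 (by decide), ← f.1 111 (by decide)] at hlen h2 ⊢
    rw [← f₁.1 112 (by decide), ← f.1 112 (by decide)] at h2 ⊢
    clear f f₁
    refine Runs.seq_pow (C₁ := 200) (C₂ := 100) (k₁ := 1) (k₂ := 0)
      (Q := fun τ => (∀ i, i ≠ x → τ.nat 10 i = τ₁.nat 10 i) ∧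
        ∀ j < τ₁.nat 111 r x, τ.nat 10 x j = τ₁.nat 112 r (x * n + j))
      (Runs.for_pow (C := 100) (k := 0) (r := 0) (n := τ₁.nat 111 r x) (M := n)
        (fun y τ => (∀ i, i ≠ x → τ.nat 10 i = τ₁.nat 10 i) ∧
          ∀ j < y, τ.nat 10 x j = τ₁.nat 112 r (x * n + j)) (by decide) (by decide)
        (fun _ _ => rfl) (fun ρ f => ?_) (hlen x hx) (by decide) ?_ ?_ (by norm_num) (by norm_num)
        fun _ h _ => h) ?_ (by norm_num) le_rfl (by norm_num)
    · simp [NatExp.eval, f.1 9 (by decide), f.1 111 (by decide), f.1 21 (by decide), hr, hx']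
    · simp
    · rintro y hy ρ f hy' ⟨h3, h4⟩
      refine Runs.step_pow rfl (by decide) ?_
      simp only [Program.step, NatExp.eval, f.1 9 (by decide), f.1 112 (by decide),
        f.1 21 (by decide), f.1 24 (by decide), hr, hx', hy', h1]
      constructor
      · intro i hi
        funext j
        simp [hi, h3 i hi]
      · intro j hj
        by_cases hjy : j = y
        · simp [hjy]
        · simp [hjy, h4 j (by omega)]
    · rintro ρ ⟨h3, h4⟩ f
      refine Runs.step_pow rfl (by decide) ?_
      simp [Program.step, NatExp.eval, f.1 9 (by decide), f.1 111 (by decide),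
        f.1 21 (by decide), f.1 24 (by decide), f.1 0 (by decide), f.1 11 (by decide),
        f.1 12 (by decide), hr, hx', h1, hc.size, add_mul]
      intro i hi
      rcases hi.lt_or_eq with hi | rfl
      · simpa [hi.ne, h3 i hi.ne] using h2 i hi
      · simpa using h4
  · rintro τ ⟨-, h⟩ -
    refine ⟨fun i hi => ?_, ?_⟩
    · obtain ⟨h1, h2, h3⟩ := h i hi
      refine ⟨h2 ▸ hlen i hi, fun j hj => ?_⟩
      rw [h2] at hj
      rw [h1, zero_add, h3 j hj]
      exact hlt i hi j hj
    · rw [heq]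
      funext i
      obtain ⟨h1, h2, h3⟩ := h i i.2
      rw [cur, h1, h2, seg, ← List.range_eq_range']
      refine List.map_congr_left fun j hj => ?_
      rw [h3 j (List.mem_range.1 hj)]

end

end RealRAM

/-! ### Counting vertices and trimming one path. -/

namespace RealRAM

open MOP Finset

/-- The current family of paths. -/
def paths {n : ℕ} (h : 0 < n) (m : ℕ) (σ : Store) : Family n m := fun i => cur h σ i

section

variable {n m k : ℕ} {w : Fin n → Fin n → ℝ} {B ε α : ℝ} {σ : Store}

theorem length_seg (h : 0 < n) (V : ℕ → ℕ) (s l : ℕ) : (seg h V s l).length = l := by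
  simp [seg]

theorem take_seg (h : 0 < n) (V : ℕ → ℕ) (s : ℕ) {l t : ℕ} (ht : t ≤ l) :
    (seg h V s l).take t = seg h V s t := by
  rw [seg, ← List.map_take, List.take_range'_of_length_ge ht]
  rfl

theorem drop_seg (h : 0 < n) (V : ℕ → ℕ) (s l t : ℕ) :
    (seg h V s l).drop t = seg h V (s + t) (l - t) := by
  rw [seg, ← List.map_drop, List.drop_range', mul_one]
  rfl

/-- The weight of the edge after the position `x`. -/
noncomputable def edgeAt (w : Fin n → Fin n → ℝ) (V : ℕ → ℕ) (x : ℕ) : ℝ :=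
  extend w (V x) (V (x + 1))

theorem pathWeight_seg (h : 0 < n) (w : Fin n → Fin n → ℝ) {V : ℕ → ℕ} {s l : ℕ}
    (hV : ∀ j < l, V (s + j) < n) :
    pathWeight w (seg h V s l) = ∑ j ∈ range (l - 1), edgeAt w V (s + j) := by
  rw [seg, pathWeight_map_range']
  refine sum_congr rfl fun j hj => ?_
  have hj := mem_range.1 hj
  have h1 := hV j (by omega)
  have h2 : V (s + j + 1) < n := hV (j + 1) (by omega)
  rw [edgeAt, ← extend_coe w, vtx_val h h1, vtx_val h h2]

theorem PathOK.sub {i s l : ℕ} (h : PathOK n σ i) (hs : σ.nat 11 i 0 ≤ s)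
    (hl : s + l ≤ σ.nat 11 i 0 + σ.nat 12 i 0) : ∀ j < l, σ.nat 10 i (s + j) < n := by
  intro j hj
  have := h.lt (s - σ.nat 11 i 0 + j) (by omega)
  rwa [← add_assoc, Nat.add_sub_cancel' hs] at this

theorem card_paths (h : 0 < n) (hP : IsPathSystem (paths h m σ)) :
    (spanned (paths h m σ)).card = ∑ i ∈ range m, σ.nat 12 i 0 := by
  rw [card_spanned hP, Finset.sum_range]
  exact sum_congr rfl fun i _ => length_seg _ _ _ _

theorem runs_countVertices (hc : MainCtx w m B ε α σ) (hmn : m ≤ n) :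
    Runs countVertices σ (200 * (n + 1) ^ 1) fun τ =>
      τ.nat 25 0 0 = ∑ i ∈ range m, σ.nat 12 i 0 := by
  refine Runs.seq_pow (C₁ := 20) (C₂ := 150) (k₁ := 0) (k₂ := 1)
    (Q := fun τ => τ.nat 25 0 0 = 0)
    (Runs.step_pow rfl (by decide) ?_) ?_ (by norm_num) (by norm_num) le_rfl
  · simp [Program.step, NatExp.eval]
  intro τ h25 f₁
  have hc := hc.frame f₁ (by decide)
  rw [← f₁.1 12 (by decide)]
  refine Runs.for_pow (C := 50) (k := 0) (r := 0) (n := m) (M := n) (fun x ρ =>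
    ρ.nat 25 0 0 = ∑ i ∈ range x, τ.nat 12 i 0) (by decide) (by decide)
    (fun _ _ => rfl) (fun ρ f => ?_) hmn (by decide) ?_ ?_ (by norm_num) (by norm_num)
    fun _ h _ => h
  · simp [NatExp.eval, f.1 1 (by decide), hc.number]
  · simpa using h25
  · intro x hx ρ f hx' h
    refine Runs.step_pow rfl (by decide) ?_
    simp [Program.step, NatExp.eval, hx', f.1 12 (by decide), sum_range_succ, h]

/-- Process all paths one by one. -/
theorem runs_forPaths (h : 0 < n) (hmn : m ≤ n) (hc : MainCtx w m B ε α σ) {c : Program}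
    {C C' e e' : ℕ} {Rel : List (Fin n) → List (Fin n) → Prop} (hok : ∀ i < m, PathOK n σ i)
    (hW : 21 ∉ c.natW ∧ 10 ∉ c.natW ∧ 1 ∉ c.natW)
    (body : ∀ i < m, ∀ τ, Frame (21 :: c.natW) c.realW σ τ → τ.nat 21 0 0 = i → PathOK n τ i →
      Runs c τ (C * (n + 1) ^ e) fun ρ => PathOK n ρ i ∧ Rel (cur h τ i) (cur h ρ i) ∧
        ∀ j, j ≠ i → ρ.nat 11 j 0 = τ.nat 11 j 0 ∧ ρ.nat 12 j 0 = τ.nat 12 j 0)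
    (hC : C + 40 ≤ C') (he : e + 1 ≤ e') :
    Runs (forLoop c0 21 mm c) σ (C' * (n + 1) ^ e') fun τ =>
      ∀ i < m, PathOK n τ i ∧ Rel (cur h σ i) (cur h τ i) := by
  refine Runs.for_pow (C := C) (k := e) (r := 0) (n := m) (M := n) (fun x τ =>
    (∀ i < x, PathOK n τ i ∧ Rel (cur h σ i) (cur h τ i)) ∧
      ∀ i, x ≤ i → τ.nat 11 i 0 = σ.nat 11 i 0 ∧ τ.nat 12 i 0 = σ.nat 12 i 0)
    (by decide) (by decide)
    (fun _ _ => rfl) (fun ρ f => ?_) hmn hW.1 ?_ ?_ hC he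
    fun _ h _ i hi => h.1 i hi
  · have : (1 : ℕ) ∉ 21 :: c.natW := by simp [hW.2.2]
    simp [NatExp.eval, f.1 1 this, hc.number]
  · simp
  · rintro x hx τ f hx' ⟨h1, h2⟩
    have e10 : τ.nat 10 = σ.nat 10 := f.1 10 (by simp [hW.2.1])
    have hx2 := h2 x le_rfl
    refine (body x hx τ f hx' ((hok x hx).congr (by rw [e10]) hx2.1 hx2.2)).frame.mono le_rfl ?_
    rintro ρ ⟨⟨h3, h4, h5⟩, g⟩
    have e10' : ρ.nat 10 = τ.nat 10 := g.1 10 hW.2.1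
    have hs : ∀ a, a ≠ 21 → (ρ.setNat 21 0 0 (x + 1)).nat a = ρ.nat a := fun a ha => by simp [ha]
    refine ⟨fun i hi => ?_, fun i hi => ?_⟩
    · rcases Nat.lt_succ_iff_lt_or_eq.1 hi with hi | rfl
      · obtain ⟨h6, h7⟩ := h1 i hi
        obtain ⟨h8, h9⟩ := h5 i hi.ne
        refine ⟨h6.congr ?_ ?_ ?_, ?_⟩
        · rw [hs 10 (by decide), e10']
        · rw [hs 11 (by decide), h8]
        · rw [hs 12 (by decide), h9]
        · rwa [cur_congr h (τ := ρ.setNat 21 0 0 (x + 1)) (σ := τ)]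
          · rw [hs 10 (by decide), e10']
          · rw [hs 11 (by decide), h8]
          · rw [hs 12 (by decide), h9]
      · refine ⟨h3.congr (by rw [hs 10 (by decide)]) (by rw [hs 11 (by decide)])
          (by rw [hs 12 (by decide)]), ?_⟩
        rwa [cur_congr h (τ := ρ.setNat 21 0 0 (i + 1)) (σ := ρ) (by rw [hs 10 (by decide)])
          (by rw [hs 11 (by decide)]) (by rw [hs 12 (by decide)]),
          ← cur_congr h (τ := τ) (σ := σ) (by rw [e10]) hx2.1 hx2.2]
    · obtain ⟨h8, h9⟩ := h5 i (by omega)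
      obtain ⟨h6, h7⟩ := h2 i (by omega)
      rw [hs 11 (by decide), hs 12 (by decide), h8, h9]
      exact ⟨h6, h7⟩

theorem runs_half {i : ℕ} (hi : σ.nat 21 0 0 = i) (h0 : σ.nat 34 0 0 = 0)
    (hn : σ.nat 12 i 0 ≤ n) :
    Runs (.loop (.natLE (.add (.add (sc 34) c1) (.add (sc 34) c1)) lnE) <|
        put 34 (.add (sc 34) c1)) σ (100 * (n + 1) ^ 1) fun τ =>
      τ.nat 34 0 0 = σ.nat 12 i 0 / 2 := by
  have := Runs.loop (b := .natLE (.add (.add (sc 34) c1) (.add (sc 34) c1)) lnE)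
    (c := put 34 (.add (sc 34) c1)) (T := 20)
    (fun j τ => Frame [34] [] σ τ ∧ τ.nat 34 0 0 + j = σ.nat 12 i 0 / 2) ?_
    (k := σ.nat 12 i 0 / 2) (σ := σ) ⟨Frame.refl _ _ _, by rw [h0, zero_add]⟩
  · refine this.mono ?_ ?_
    · have hb : (Test.natLE (.add (.add (sc 34) c1) (.add (sc 34) c1)) lnE).cost ≤ 30 := by decide
      have h1 : σ.nat 12 i 0 / 2 *
          ((Test.natLE (.add (.add (sc 34) c1) (.add (sc 34) c1)) lnE).cost + 20) ≤ n * 50 :=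
        Nat.mul_le_mul (by omega) (by omega)
      rw [pow_one]
      omega
    · rintro τ ⟨⟨j, f, h1⟩, hb⟩
      simp [Test.holds, NatExp.eval, f.1 12 (by decide), f.1 21 (by decide), hi] at hb
      omega
  · rintro j τ ⟨f, h1⟩ hb
    simp [Test.holds, NatExp.eval, f.1 12 (by decide), f.1 21 (by decide), hi] at hb
    refine ⟨j - 1, by omega, ?_⟩
    refine (Runs.of_step (Q := fun ρ => ρ.nat 34 0 0 = τ.nat 34 0 0 + 1) rfl (by decide)
      ?_).frame.mono le_rfl ?_
    · simp [Program.step, NatExp.eval]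
    · rintro ρ ⟨h2, g⟩
      exact ⟨f.trans (g.mono (by decide) (by decide)), by omega⟩

theorem runs_trimPath (h : 0 < n) (hc : MainCtx w m B ε α σ) {i : ℕ} (hi : σ.nat 21 0 0 = i)
    (hok : PathOK n σ i) :
    Runs trimPath σ (1000 * (n + 1) ^ 1) fun τ => PathOK n τ i ∧
      TrimPath w (cur h σ i) (cur h τ i) ∧
        ∀ j, j ≠ i → τ.nat 11 j 0 = σ.nat 11 j 0 ∧ τ.nat 12 j 0 = σ.nat 12 j 0 := by
  obtain ⟨q, hq⟩ : ∃ q, σ.nat 12 i 0 = q := ⟨_, rfl⟩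
  obtain ⟨s, hs⟩ : ∃ s, σ.nat 11 i 0 = s := ⟨_, rfl⟩
  have hqn : q ≤ n := hq ▸ hok.len
  have hlen : (cur h σ i).length = q := (length_seg _ _ _ _).trans hq
  refine Runs.branch_pow (C := 900) (fun hb => ?_) (fun hb => ?_) (by decide)
  swap
  · refine Runs.step_pow rfl (by decide) ⟨hok, .inl ⟨?_, rfl⟩, fun _ _ => ⟨rfl, rfl⟩⟩
    simp [Test.holds, NatExp.eval, hi] at hb
    omega
  simp [Test.holds, NatExp.eval, hi] at hb
  rw [hq] at hb
  refine Runs.seq_pow (C₁ := 10) (C₂ := 850) (k₁ := 0) (k₂ := 1)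
    (Q := fun τ => τ.nat 34 0 0 = 0)
    (Runs.step_pow rfl (by decide) ?_) ?_ (by norm_num) (by norm_num) le_rfl
  · simp [Program.step, NatExp.eval]
  intro τ₁ h1 f₁
  refine Runs.seq_pow (C₁ := 100) (C₂ := 750) (k₁ := 1) (k₂ := 1)
    (runs_half (by rw [f₁.1 21 (by decide), hi]) h1
      (by rw [f₁.1 12 (by decide), hq]; exact hqn)) ?_ (by norm_num) le_rfl le_rfl
  intro τ₂ h34 f₂
  rw [f₁.1 12 (by decide), hq] at h34
  refine Runs.seq_pow (C₁ := 10) (C₂ := 700) (k₁ := 0) (k₂ := 1)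
    (Q := fun τ => τ.real 19 0 0 = 0)
    (Runs.step_pow rfl (by decide) ?_) ?_ (by norm_num) (by norm_num) le_rfl
  · simp [Program.step, NatExp.eval, RealExp.eval]
  intro τ₃ h19 f₃
  refine Runs.seq_pow (C₁ := 10) (C₂ := 650) (k₁ := 0) (k₂ := 1)
    (Q := fun τ => τ.real 20 0 0 = 0)
    (Runs.step_pow rfl (by decide) ?_) ?_ (by norm_num) (by norm_num) le_rfl
  · simp [Program.step, NatExp.eval, RealExp.eval]
  intro τ₄ h20 f₄
  have f : Frame [34] [19, 20] σ τ₄ :=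
    (((f₁.mono (by decide) (by decide)).trans (f₂.mono (by decide) (by decide))).trans
    (f₃.mono (by decide) (by decide))).trans (f₄.mono (by decide) (by decide))
  rw [← f₄.2 19 (by decide)] at h19
  rw [← f₃.1 34 (by decide), ← f₄.1 34 (by decide)] at h34
  clear f₁ f₂ f₃ f₄ h1
  have hc := hc.frame f (by decide)
  rw [← cur_congr h (τ := τ₄) (σ := σ) (by rw [f.1 10 (by decide)])
    (by rw [f.1 11 (by decide)]) (by rw [f.1 12 (by decide)])] at hlen ⊢
  have hok : PathOK n τ₄ i := hok.congr (by rw [f.1 10 (by decide)])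
    (by rw [f.1 11 (by decide)]) (by rw [f.1 12 (by decide)])
  rw [← f.1 11 (by decide)] at hs ⊢
  rw [← f.1 12 (by decide)] at hq ⊢
  rw [← f.1 21 (by decide)] at hi
  clear f
  obtain ⟨d, hd⟩ : ∃ d, q / 2 = d := ⟨_, rfl⟩
  rw [hd] at h34
  refine Runs.seq_pow (C₁ := 400) (C₂ := 200) (k₁ := 1) (k₂ := 0)
    (Q := fun τ => τ.real 19 0 0 = ∑ j ∈ range d, edgeAt w (τ₄.nat 10 i) (s + j) ∧
      τ.real 20 0 0 = ∑ j ∈ range d, edgeAt w (τ₄.nat 10 i) (s + (q - d - 1) + j))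
    (Runs.for_pow (C := 200) (k := 0) (r := 0) (n := d) (M := n)
      (fun y τ => τ.real 19 0 0 = ∑ j ∈ range y, edgeAt w (τ₄.nat 10 i) (s + j) ∧
      τ.real 20 0 0 = ∑ j ∈ range y, edgeAt w (τ₄.nat 10 i) (s + (q - d - 1) + j))
      (by decide) (by decide) (fun _ _ => rfl) (fun ρ f => ?_) (by omega) (by decide) ?_ ?_
      (by norm_num) (by norm_num) fun _ h _ => h) ?_ (by norm_num) le_rfl (by norm_num)
  · simp [NatExp.eval, f.1 34 (by decide), h34]
  · simp [h19, h20]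
  · rintro y hy ρ f hy' ⟨h1, h2⟩
    refine Runs.step_pow rfl (by decide) ?_
    simp [Program.step, NatExp.eval, RealExp.eval, f.1 10 (by decide), f.1 11 (by decide),
      f.1 12 (by decide), f.1 21 (by decide), f.1 34 (by decide), f.2 0 (by decide), hc.weights,
      hi, hs, hq, h34, hy', h1, h2, sum_range_succ, edgeAt, add_assoc]
  · rintro ρ ⟨h1, h2⟩ f
    -- A part of `d` vertices with its attaching edge has `d + 1` vertices and hence `d` edges,
    -- which is the range of the summation loop.
    have w1 : pathWeight w ((cur h τ₄ i).take (d + 1)) = ρ.real 19 0 0 := by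
      rw [h1, cur, take_seg h _ _ (by omega), hs, pathWeight_seg h w (hok.sub (by omega) (by omega)),
        Nat.add_sub_cancel]
    have w2 : pathWeight w ((cur h τ₄ i).drop (q - d - 1)) = ρ.real 20 0 0 := by
      rw [h2, cur, drop_seg, hs, pathWeight_seg h w (hok.sub (by omega) (by omega)), hq,
        show q - (q - d - 1) - 1 = d by omega]
    have e10 : ρ.nat 10 i = τ₄.nat 10 i := by rw [f.1 10 (by decide)]
    have e11 : ρ.nat 11 = τ₄.nat 11 := f.1 11 (by decide)
    have e12 : ρ.nat 12 = τ₄.nat 12 := f.1 12 (by decide)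
    refine Runs.branch_pow (C := 100) (fun hb' => ?_) (fun hb' => ?_) (by decide) <;>
      simp only [Test.holds, RealExp.eval, NatExp.eval] at hb'
    · refine Runs.step_pow rfl (by decide) ?_
      simp only [Program.step, NatExp.eval, f.1 21 (by decide), hi, e11, hs, f.1 34 (by decide),
        h34]
      set ρ' := (ρ.setNat 11 i 0 (s + d)).setNat 12
        ((ρ.setNat 11 i 0 (s + d)).nat 21 0 0) 0 _ with hρ'
      have g10 : ρ'.nat 10 i = τ₄.nat 10 i := by rw [← e10]; simp [hρ']
      have g11 : ∀ j, ρ'.nat 11 j 0 = if j = i then s + d else τ₄.nat 11 j 0 := by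
        intro j
        simp [hρ', e11]
      have g12 : ∀ j, ρ'.nat 12 j 0 = if j = i then q - d else τ₄.nat 12 j 0 := by
        intro j
        simp [hρ', e12, f.1 21 (by decide), hi, f.1 34 (by decide), h34, hq]
      clear_value ρ'
      refine ⟨⟨?_, ?_⟩, .inr (.inl ⟨?_, ?_, ?_⟩), fun j hj => ?_⟩
      · rw [g12, if_pos rfl]
        omega
      · rw [g10, g11, g12, if_pos rfl, if_pos rfl]
        exact hok.sub (by omega) (by omega)
      · rw [hlen]
        exact hb
      · rw [hlen, hd, w1, w2]
        exact div_le_div_of_nonneg_right hb' (Nat.cast_nonneg _)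
      · rw [hlen, hd, cur, cur, drop_seg, g10, g11, g12, if_pos rfl, if_pos rfl, hs, hq]
      · rw [g11, g12, if_neg hj, if_neg hj]
        exact ⟨rfl, rfl⟩
    · refine Runs.step_pow rfl (by decide) ?_
      simp only [Program.step, NatExp.eval, f.1 21 (by decide), hi, e12, hq, f.1 34 (by decide),
        h34]
      set ρ' := ρ.setNat 12 i 0 (q - d) with hρ'
      have g10 : ρ'.nat 10 i = τ₄.nat 10 i := by rw [← e10]; simp [hρ']
      have g11 : ∀ j, ρ'.nat 11 j 0 = τ₄.nat 11 j 0 := by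
        intro j
        simp [hρ', e11]
      have g12 : ∀ j, ρ'.nat 12 j 0 = if j = i then q - d else τ₄.nat 12 j 0 := by
        intro j
        simp [hρ', e12]
      clear_value ρ'
      refine ⟨⟨?_, ?_⟩, .inr (.inr ⟨?_, ?_, ?_⟩), fun j hj => ?_⟩
      · rw [g12, if_pos rfl]
        omega
      · rw [g10, g11, g12, if_pos rfl]
        exact hok.sub (by omega) (by omega)
      · rw [hlen]
        exact hb
      · rw [hlen, hd, w1, w2]
        exact div_le_div_of_nonneg_right (not_le.1 hb').le (Nat.cast_nonneg _)
      · rw [hlen, hd, cur, cur, take_seg h _ _ (by omega), g10, g11, g12, if_pos rfl]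
      · rw [g11, g12, if_neg hj]
        exact ⟨rfl, rfl⟩

end

end RealRAM

/-! ### Termination of the trimming, and pieces in terms of positions. -/

namespace MOP

open Finset

theorem TrimPath.length_le {n : ℕ} {w : Fin n → Fin n → ℝ} {P P' : List (Fin n)}
    (h : TrimPath w P P') : P'.length ≤ P.length ∧ (2 ≤ P.length → P'.length < P.length) := by
  rcases h with ⟨hq, rfl⟩ | ⟨hq, -, rfl⟩ | ⟨hq, -, rfl⟩
  · exact ⟨le_rfl, fun h => by omega⟩
  · rw [List.length_drop]
    omega
  · rw [List.length_take]
    omega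

/-- If `m` paths have more than `m` vertices, one of them has at least two and becomes shorter. This
makes the trimming loop end. -/
theorem card_lt_of_trimPath {n m : ℕ} {w : Fin n → Fin n → ℝ} {P Q : Family n m}
    (hP : IsPathSystem P) (hQ : IsPathSystem Q) (h : ∀ i, TrimPath w (P i) (Q i))
    (hm : m < (spanned P).card) : (spanned Q).card < (spanned P).card := by
  rw [card_spanned hP] at hm ⊢
  rw [card_spanned hQ]
  obtain ⟨i, hi⟩ : ∃ i, 2 ≤ (P i).length := by
    by_contra! hc
    have : ∑ i, (P i).length ≤ ∑ _i : Fin m, 1 := sum_le_sum fun i _ => by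
      have := hc i
      omega
    simp at this
    omega
  exact sum_lt_sum (fun i _ => (h i).length_le.1) ⟨i, mem_univ _, (h i).length_le.2 hi⟩

theorem isPieceSubpath_of {n s a b j : ℕ} {w : Fin n → Fin n → ℝ} {P : List (Fin n)}
    (hab : a ≤ b) (hb : b < P.length) (hj : j < s)
    (h1 : (j : ℝ) * (pathWeight w P / s) ≤ pathWeight w (P.take (a + 1)))
    (h2 : pathWeight w (P.take (b + 1)) ≤ ((j : ℝ) + 1) * (pathWeight w P / s)) :
    IsPieceSubpath w P s ((P.drop a).take (b + 1 - a)) ∧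
      ((P.drop a).take (b + 1 - a)).length = b + 1 - a := by
  have hlen : ((P.drop a).take (b + 1 - a)).length = b + 1 - a := by
    rw [List.length_take, List.length_drop]
    omega
  have e1 : P.take a ++ (P.drop a).take (b + 1 - a) = P.take (b + 1) := by
    rw [← List.take_add]
    congr 1
    omega
  have e2 : P.take a ++ ((P.drop a).take (b + 1 - a)).take 1 = P.take (a + 1) := by
    rw [List.take_take, min_eq_left (by omega), ← List.take_add]
  refine ⟨⟨fun hc => ?_, P.take a, P.drop (b + 1), ?_, j, hj, ?_, ?_⟩, hlen⟩
  · rw [hc] at hlen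
    simp at hlen
    omega
  · rw [e1, List.take_append_drop]
  · rwa [e2]
  · rwa [e1]

/-- A sub-path is determined, for this purpose, by the positions of its first and last vertex. So
the search over pairs of positions is exhaustive. -/
theorem IsPieceSubpath.exists_positions {n s : ℕ} {w : Fin n → Fin n → ℝ} {P Q : List (Fin n)}
    (h : IsPieceSubpath w P s Q) : ∃ a b j, a ≤ b ∧ b < P.length ∧ j < s ∧
      (j : ℝ) * (pathWeight w P / s) ≤ pathWeight w (P.take (a + 1)) ∧
      pathWeight w (P.take (b + 1)) ≤ ((j : ℝ) + 1) * (pathWeight w P / s) ∧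
      Q.length = b + 1 - a := by
  obtain ⟨h0, X, Y, hP, j, hj, h1, h2⟩ := h
  have hQ := List.length_pos_iff.2 h0
  have hlen : P.length = X.length + Q.length + Y.length := by
    rw [hP, List.length_append, List.length_append]
  have e1 : P.take (X.length + 1) = X ++ Q.take 1 := by
    rw [hP, List.append_assoc, List.take_append, List.take_of_length_le (by omega),
      Nat.add_sub_cancel_left, List.take_append_of_le_length (by omega)]
  have e2 : P.take (X.length + Q.length - 1 + 1) = X ++ Q := by
    rw [Nat.sub_add_cancel (by omega), hP, List.take_append_of_le_length (by simp),
      List.take_of_length_le (by simp)]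
  exact ⟨X.length, X.length + Q.length - 1, j, by omega, by omega, hj, by rwa [e1], by rwa [e2],
    by omega⟩

end MOP

/-! ### The trimming loop, the number of pieces, and the heaviest sub-paths. -/

namespace RealRAM

open MOP Finset

section

variable {n m k : ℕ} {w : Fin n → Fin n → ℝ} {B ε α : ℝ} {σ : Store}

theorem paths_frame (h : 0 < n) (m : ℕ) {σ τ : Store} {ns ls : List ℕ} (f : Frame ns ls σ τ)
    (hf : 10 ∉ ns ∧ 11 ∉ ns ∧ 12 ∉ ns) : paths h m τ = paths h m σ := by
  funext i
  exact cur_congr h (by rw [f.1 10 hf.1]) (by rw [f.1 11 hf.2.1]) (by rw [f.1 12 hf.2.2])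

theorem PathOK.frame {i : ℕ} {σ τ : Store} {ns ls : List ℕ} (h : PathOK n σ i)
    (f : Frame ns ls σ τ) (hf : 10 ∉ ns ∧ 11 ∉ ns ∧ 12 ∉ ns) : PathOK n τ i :=
  h.congr (by rw [f.1 10 hf.1]) (by rw [f.1 11 hf.2.1]) (by rw [f.1 12 hf.2.2])

theorem runs_trimRound (hw : IsMetric w) (h : 0 < n) (hmn : m ≤ n) (hc : MainCtx w m B ε α σ)
    (hok : ∀ i < m, PathOK n σ i) (hP : IsPathSystem (paths h m σ)) :
    Runs (.seq (forLoop c0 21 mm trimPath) countVertices) σ (2000 * (n + 1) ^ 2) fun τ =>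
      (∀ i < m, PathOK n τ i) ∧ IsPathSystem (paths h m τ) ∧
      τ.nat 25 0 0 = (spanned (paths h m τ)).card ∧
      ∀ i, TrimPath w (paths h m σ i) (paths h m τ i) := by
  refine Runs.seq_pow (C₁ := 1100) (C₂ := 200) (k₁ := 2) (k₂ := 1)
    (runs_forPaths h hmn hc hok (by decide) (fun i hi τ f hi' hok' =>
      runs_trimPath h (hc.frame f (by decide)) hi' hok') (by norm_num) le_rfl) ?_
    (by norm_num) le_rfl (by norm_num)
  intro τ h1 f
  have hT : ∀ i, TrimPath w (paths h m σ i) (paths h m τ i) := fun i => (h1 i i.2).2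
  have hPτ := hP.of_sublist (fun i => (hT i).length_pos hw (hP.1 i).1) fun i => ((hT i).spec hw).1
  refine (runs_countVertices (hc.frame f (by decide)) hmn).frame.mono le_rfl ?_
  rintro ρ ⟨h2, g⟩
  rw [paths_frame h m g (by decide), h2, card_paths h hPτ]
  exact ⟨fun i hi => (h1 i hi).1.frame g (by decide), hPτ, rfl, hT⟩

/-- Each round lowers the number of spanned vertices, so there are at most `n` rounds of quadratic
cost. -/
theorem runs_trim (hw : IsMetric w) (h : 0 < n) (hmn : m ≤ n) (hc : MainCtx w m B ε α σ)
    (hok : ∀ i < m, PathOK n σ i) (hP : IsPathSystem (paths h m σ))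
    (hk : m + σ.nat 20 0 0 = k) (hm : 1 ≤ m) :
    Runs trim σ (5000 * (n + 1) ^ 3) fun τ => (∀ i < m, PathOK n τ i) ∧
      IsPathSystem (paths h m τ) ∧ τ.nat 25 0 0 = (spanned (paths h m τ)).card ∧
      Trim w k (paths h m σ) (paths h m τ) := by
  refine Runs.seq_pow (C₁ := 200) (C₂ := 3000) (k₁ := 1) (k₂ := 3)
    (runs_countVertices hc hmn) ?_ (by norm_num) (by norm_num) le_rfl
  intro τ h25 f
  have hPτ := paths_frame h m f (by decide)
  rw [← card_paths h hP, ← hPτ] at h25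
  rw [← hPτ] at hP ⊢
  have hc := hc.frame f (by decide)
  have hok : ∀ i < m, PathOK n τ i := fun i hi => (hok i hi).frame f (by decide)
  rw [← f.1 20 (by decide)] at hk
  clear f hPτ
  have := Runs.loop (b := .natLE (.add (.add kE kE) c1) (sc 25))
    (c := .seq (forLoop c0 21 mm trimPath) countVertices) (T := 2000 * (n + 1) ^ 2)
    (fun j ρ => MainCtx w m B ε α ρ ∧ ρ.nat 20 = τ.nat 20 ∧
      (∀ i < m, PathOK n ρ i) ∧ IsPathSystem (paths h m ρ) ∧
      ρ.nat 25 0 0 = (spanned (paths h m ρ)).card ∧ ρ.nat 25 0 0 ≤ j ∧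
      ∀ P, Trim w k (paths h m ρ) P → Trim w k (paths h m τ) P) ?_ (k := n) (σ := τ)
    ⟨hc, rfl, hok, hP, h25, h25 ▸ card_spanned_le _, fun P h => h⟩
  · refine this.mono ?_ ?_
    · have hb : (Test.natLE (.add (.add kE kE) c1) (sc 25)).cost ≤ 50 := by decide
      have h1 : 1 ≤ (n + 1) ^ 2 := Nat.one_le_pow _ _ (Nat.succ_pos n)
      rw [pow_succ _ 2]
      nlinarith
    · rintro ρ ⟨⟨j, hc, h20, hok, hP, h25, -, hT⟩, hb⟩
      refine ⟨hok, hP, h25, hT _ (.done _ ?_)⟩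
      simp only [Test.holds, NatExp.eval, hc.number, h20, h25, hk] at hb
      omega
  · rintro j ρ ⟨hc, h20, hok, hP, h25, hj, hT⟩ hb
    simp only [Test.holds, NatExp.eval, hc.number, h20, hk] at hb
    refine ⟨j - 1, by omega, ?_⟩
    refine (runs_trimRound hw h hmn hc hok hP).frame.mono le_rfl ?_
    rintro ρ' ⟨⟨h1, h2, h3, h4⟩, g⟩
    have hlt := card_lt_of_trimPath hP h2 h4 (by omega)
    exact ⟨hc.frame g (by decide), by rw [g.1 20 (by decide), h20], h1, h2, h3,
      by omega, fun P hP' => hT P (.round _ _ _ (by omega) h4 hP')⟩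

/-- The bounds by `30` make the number of pieces a constant; otherwise it would enter the running
time. -/
theorem runs_setPieces (hc : MainCtx w m B ε α σ) {R : Family n m} (hk : m + σ.nat 20 0 0 = k)
    (h25 : σ.nat 25 0 0 = (spanned R).card) (h1 : 16 / (1 - α) + ε ≤ 30)
    (h2 : (8 - 4 * α) / (1 - α) + ε ≤ 30) :
    Runs setPieces σ (5000 * (n + 1) ^ 0) fun τ => τ.nat 27 0 0 = pieces k ε α R ∧
      τ.real 16 0 0 = (pieces k ε α R : ℝ) ∧ pieces k ε α R ≤ 30 := by
  obtain ⟨x, hx, hxp, hx30⟩ : ∃ x : ℝ, (if k ≤ (spanned R).card then 16 / (1 - α) + ε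
      else (8 - 4 * α) / (1 - α) + ε) = x ∧ pieces k ε α R = ⌈x⌉₊ ∧ x ≤ 30 := by
    refine ⟨_, rfl, ?_, ?_⟩
    · unfold pieces
      split_ifs <;> rfl
    · split_ifs <;> assumption
  have hp30 : ⌈x⌉₊ ≤ 30 := Nat.ceil_le.2 (by exact_mod_cast hx30)
  rw [hxp]
  refine Runs.seq_pow (C₁ := 100) (C₂ := 4000) (k₁ := 0) (k₂ := 0) (Q := fun τ => τ.real 15 0 0 = x)
    (Runs.step_pow rfl (by decide) ?_) ?_ (by norm_num) le_rfl le_rfl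
  · rw [← hx, ← h25]
    simp only [Program.step, Test.holds, NatExp.eval, RealExp.eval, hc.number, hk, hc.alpha, hc.eps]
    split_ifs <;> simp
  intro τ₁ h15 f₁
  refine Runs.seq_pow (C₁ := 100) (C₂ := 3900) (k₁ := 0) (k₂ := 0) (Q := fun τ => τ.nat 27 0 0 = 0)
    (Runs.step_pow rfl (by decide) ?_) ?_ (by norm_num) le_rfl le_rfl
  · simp [Program.step, NatExp.eval]
  intro τ₂ h27 f₂
  rw [← f₂.2 15 (by decide)] at h15
  refine Runs.seq_pow (C₁ := 100) (C₂ := 3800) (k₁ := 0) (k₂ := 0) (Q := fun τ => τ.real 16 0 0 = 0)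
    (Runs.step_pow rfl (by decide) ?_) ?_ (by norm_num) le_rfl le_rfl
  · simp [Program.step, NatExp.eval, RealExp.eval]
  intro τ₃ h16 f₃
  rw [← f₃.2 15 (by decide)] at h15
  rw [← f₃.1 27 (by decide)] at h27
  clear f₁ f₂ f₃
  have := Runs.loop (b := realLT (fc 16) (fc 15))
    (c := .seq (put 27 (.add (sc 27) c1)) (putR 16 (.add (fc 16) fone))) (T := 50)
    (fun j τ => τ.real 15 0 0 = x ∧ ∃ c : ℕ, τ.nat 27 0 0 = c ∧ τ.real 16 0 0 = c ∧ c + j = ⌈x⌉₊) ?_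
    (k := ⌈x⌉₊) (σ := τ₃) ⟨h15, 0, h27, by simpa using h16, by simp⟩
  · refine this.mono ?_ ?_
    · have hb : (realLT (fc 16) (fc 15)).cost ≤ 20 := by decide
      have : ⌈x⌉₊ * ((realLT (fc 16) (fc 15)).cost + 50) ≤ 30 * 70 :=
        Nat.mul_le_mul hp30 (by omega)
      rw [pow_zero]
      omega
    · rintro τ ⟨⟨j, h15, c, h27, h16, hj⟩, hb⟩
      simp only [Test.holds, RealExp.eval, NatExp.eval, h15, h16, not_not] at hb
      have : ⌈x⌉₊ ≤ c := Nat.ceil_le.2 hb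
      obtain rfl : c = ⌈x⌉₊ := by omega
      exact ⟨h27, h16, hp30⟩
  · rintro j τ ⟨h15, c, h27, h16, hj⟩ hb
    simp only [Test.holds, RealExp.eval, NatExp.eval, h15, h16, not_le] at hb
    have : c < ⌈x⌉₊ := Nat.lt_ceil.2 hb
    refine ⟨j - 1, by omega, ?_⟩
    refine Runs.of_step rfl (by decide) ⟨?_, c + 1, ?_, ?_, by omega⟩
    · simp [Program.step, h15]
    · simp [Program.step, NatExp.eval, h27]
    · simp [Program.step, NatExp.eval, RealExp.eval, h16]

theorem runs_setPositions (h : 0 < n) (hc : MainCtx w m B ε α σ) {i : ℕ} (hi : σ.nat 21 0 0 = i)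
    (hok : PathOK n σ i) :
    Runs setPositions σ (500 * (n + 1) ^ 1) fun τ => ∀ t < σ.nat 12 i 0,
      τ.real 17 0 t = pathWeight w ((cur h σ i).take (t + 1)) := by
  refine Runs.seq_pow (C₁ := 20) (C₂ := 400) (k₁ := 0) (k₂ := 1) (Q := fun τ => τ.real 17 0 0 = 0)
    (Runs.step_pow rfl (by decide) ?_) ?_ (by norm_num) (by norm_num) le_rfl
  · simp [Program.step, NatExp.eval, RealExp.eval]
  intro τ h17 f
  have hc := hc.frame f (by decide)
  rw [← cur_congr h (τ := τ) (σ := σ) (by rw [f.1 10 (by decide)])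
    (by rw [f.1 11 (by decide)]) (by rw [f.1 12 (by decide)])]
  have hok := hok.frame f (by decide)
  rw [← f.1 12 (by decide)]
  rw [← f.1 21 (by decide)] at hi
  clear f
  refine Runs.for_pow (C := 200) (k := 0) (r := 0) (n := τ.nat 12 i 0 - 1) (M := n)
      (fun y ρ => ∀ t ≤ y, ρ.real 17 0 t =
        ∑ j ∈ range t, edgeAt w (τ.nat 10 i) (τ.nat 11 i 0 + j))
      (by decide) (by decide) (fun _ _ => rfl) (fun ρ f => ?_)
      ((Nat.sub_le _ _).trans hok.len) (by decide) ?_ ?_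
      (by norm_num) (by norm_num) ?_
  · simp [NatExp.eval, f.1 12 (by decide), f.1 21 (by decide), hi]
  · simp [h17]
  · intro y hy ρ f hy' h1
    refine Runs.step_pow rfl (by decide) ?_
    simp [Program.step, NatExp.eval, RealExp.eval, f.1 10 (by decide), f.1 11 (by decide),
      f.1 21 (by decide), f.2 0 (by decide), hc.weights, hi, hy', h1 y le_rfl]
    intro t ht
    rcases ht.lt_or_eq with ht | rfl
    · rw [if_neg (by omega), h1 t (by omega)]
    · simp [sum_range_succ, edgeAt, add_assoc]
  · intro ρ h1 _ t ht
    rw [h1 t (by omega), cur, take_seg h _ _ (by omega),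
      pathWeight_seg h w (hok.sub le_rfl (by omega)), Nat.add_sub_cancel]

/-- The part of the path between the positions `a` and `b` lies in the piece `j`. -/
def InPiece (q : ℕ) (pos : ℕ → ℝ) (d : ℝ) (j a b : ℕ) : Prop :=
  a < q ∧ b < q ∧ (j : ℝ) * d ≤ pos a ∧ pos b ≤ ((j : ℝ) + 1) * d

/-- The sub-path of length `l` from the position `a` on is the best one among those in `D`. -/
def Best (q : ℕ) (pos : ℕ → ℝ) (d : ℝ) (D : ℕ → ℕ → ℕ → Prop) (s a l : ℕ) : Prop :=
  (l = 0 ∨ ∃ j b, j < s ∧ a ≤ b ∧ InPiece q pos d j a b ∧ l = b + 1 - a) ∧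
    ∀ j a' b', D j a' b' → InPiece q pos d j a' b' → b' + 1 - a' ≤ l

theorem Best.mono {q : ℕ} {pos : ℕ → ℝ} {d : ℝ} {D D' : ℕ → ℕ → ℕ → Prop} {s a l : ℕ}
    (h : Best q pos d D s a l)
    (hD : ∀ j a b, D' j a b → InPiece q pos d j a b → D j a b) : Best q pos d D' s a l :=
  ⟨h.1, fun j a' b' h1 h2 => h.2 j a' b' (hD j a' b' h1 h2) h2⟩

theorem runs_searchPiece {i q : ℕ} (hi : σ.nat 21 0 0 = i) (hq : σ.nat 12 i 0 = q) (hqn : q ≤ n)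
    {pos : ℕ → ℝ} (hpos : ∀ t < q, σ.real 17 0 t = pos t) {d : ℝ} (hd : σ.real 24 0 0 = d)
    {j s : ℕ} (hj : σ.real 18 0 0 = j) (hjs : j < s)
    (hb : Best q pos d (fun j' _ _ => j' < j) s (σ.nat 28 0 0) (σ.nat 29 0 0)) :
    Runs searchPiece σ (500 * (n + 1) ^ 2) fun τ =>
      Best q pos d (fun j' _ _ => j' < j + 1) s (τ.nat 28 0 0) (τ.nat 29 0 0) := by
  -- The third predicate argument of `Best` describes the triples (piece, first, last) examined so
  -- far, in lexicographic order.
  refine Runs.for_pow (C := 400) (k := 1) (r := 0) (n := q) (M := n)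
      (fun x ρ => Best q pos d (fun j' a' _ => j' < j ∨ j' = j ∧ a' < x) s
        (ρ.nat 28 0 0) (ρ.nat 29 0 0))
      (by decide) (by decide) (fun _ _ => rfl) (fun ρ f => ?_) hqn (by decide) ?_ ?_
      (by norm_num) (by norm_num) ?_
  · simp [NatExp.eval, f.1 12 (by decide), f.1 21 (by decide), hi, hq]
  · simpa using hb
  · intro x hx τ f hx' hI
    rw [← f.1 12 (by decide)] at hq
    rw [← f.1 21 (by decide)] at hi
    rw [← f.2 17 (by decide)] at hpos
    rw [← f.2 18 (by decide)] at hj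
    rw [← f.2 24 (by decide)] at hd
    clear f hb
    refine Runs.for_pow (C := 300) (k := 0) (r := 0) (n := q) (M := n)
      (fun y ρ => Best q pos d
        (fun j' a' b' => (j' < j ∨ j' = j ∧ a' < x) ∨ j' = j ∧ a' = x ∧ b' < y) s
        (ρ.nat 28 0 0) (ρ.nat 29 0 0))
      (by decide) (by decide) (fun _ _ => rfl) (fun ρ f => ?_) hqn (by decide) ?_ ?_
      (by norm_num) (by norm_num) ?_
    · simp [NatExp.eval, f.1 12 (by decide), f.1 21 (by decide), hi, hq]
    · simpa using hI
    · intro y hy ρ f hy' hI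
      refine Runs.step_pow rfl (by decide) ?_
      simp only [Program.step, Test.holds, NatExp.eval, RealExp.eval, f.1 22 (by decide), hx', hy',
        f.2 17 (by decide), f.2 18 (by decide), f.2 24 (by decide), hj, hd, hpos x hx, hpos y hy,
        Rat.cast_one]
      have hstay : (InPiece q pos d j x y → y + 1 - x ≤ ρ.nat 29 0 0) →
          Best q pos d
            (fun j' a' b' => (j' < j ∨ j' = j ∧ a' < x) ∨ j' = j ∧ a' = x ∧ b' < y + 1) s
            (ρ.nat 28 0 0) (ρ.nat 29 0 0) := by
        intro hle
        refine ⟨hI.1, fun j' a' b' hD hin => ?_⟩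
        by_cases hnew : j' = j ∧ a' = x ∧ b' = y
        · obtain ⟨rfl, rfl, rfl⟩ := hnew
          exact hle hin
        · exact hI.2 j' a' b' (by omega) hin
      split_ifs with h1 h2 h3
      · have hin : InPiece q pos d j x y := ⟨hx, hy, h1, h2⟩
        simp [f.1 22 (by decide), hx', hy']
        refine ⟨.inr ⟨j, y, hjs, by omega, hin, rfl⟩, fun j' a' b' hD hin' => ?_⟩
        by_cases hnew : j' = j ∧ a' = x ∧ b' = y
        · obtain ⟨rfl, rfl, rfl⟩ := hnew
          exact le_rfl
        · have := hI.2 j' a' b' (by omega) hin'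
          omega
      · simpa using hstay fun _ => by omega
      · simpa using hstay fun h => absurd h.2.2.2 h2
      · simpa using hstay fun h => absurd h.2.2.1 h1
    · intro ρ h _
      simp only [ne_eq, Nat.reduceEqDiff, not_false_eq_true, nat_setNat_of_ne]
      refine h.mono fun j' a' b' hD hin => ?_
      have := hin.2.1
      omega
  · intro ρ h _
    refine h.mono fun j' a' b' hD hin => ?_
    have := hin.1
    omega

theorem Best.isHeaviest {P : List (Fin n)} {s a l : ℕ} (hs : 0 < s) (hP : P ≠ [])
    (hw : IsMetric w)
    (h : Best P.length (fun t => pathWeight w (P.take (t + 1))) (pathWeight w P / s)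
      (fun j _ _ => j < s) s a l) :
    IsHeaviestSubpath w P s ((P.drop a).take l) ∧ a + l ≤ P.length := by
  have hlen := List.length_pos_iff.2 hP
  -- The first vertex alone lies in the piece `0`, so the default length `0` has been replaced.
  have h0 : 1 ≤ l := by
    refine (h.2 0 0 0 hs ⟨hlen, hlen, ?_, ?_⟩)
    · simpa using pathWeight_nonneg hw _
    · have : pathWeight w (P.take (0 + 1)) = 0 := by
        match P with
        | [] => rfl
        | _ :: _ => rfl
      simp only [this]
      exact mul_nonneg (by simp) (div_nonneg (pathWeight_nonneg hw _) (Nat.cast_nonneg _))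
  rcases h.1 with h1 | ⟨j, b, hj, hab, hin, rfl⟩
  · omega
  · obtain ⟨h2, h3⟩ := isPieceSubpath_of hab hin.2.1 hj hin.2.2.1 hin.2.2.2
    refine ⟨⟨h2, fun Q' hQ' => ?_⟩, by have := hin.2.1; omega⟩
    obtain ⟨a', b', j', hab', hb', hj', h4, h5, h6⟩ := hQ'.exists_positions
    rw [h6, h3]
    exact h.2 j' a' b' hj' ⟨by omega, hb', h4, h5⟩

theorem runs_heaviestPath (hw : IsMetric w) (h : 0 < n) (hc : MainCtx w m B ε α σ) {i s : ℕ}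
    (hi : σ.nat 21 0 0 = i) (hok : PathOK n σ i) (hs : 0 < s) (h30 : s ≤ 30)
    (h27 : σ.nat 27 0 0 = s) (h16 : σ.real 16 0 0 = s) :
    Runs heaviestPath σ (20000 * (n + 1) ^ 2) fun τ => PathOK n τ i ∧
      (cur h σ i ≠ [] → IsHeaviestSubpath w (cur h σ i) s (cur h τ i)) ∧
        ∀ j, j ≠ i → τ.nat 11 j 0 = σ.nat 11 j 0 ∧ τ.nat 12 j 0 = σ.nat 12 j 0 := by
  set P := cur h σ i with hP
  obtain ⟨q, hq⟩ : ∃ q, σ.nat 12 i 0 = q := ⟨_, rfl⟩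
  have hqn : q ≤ n := hq ▸ hok.len
  have hlen : P.length = q := (length_seg _ _ _ _).trans hq
  refine Runs.seq_pow (C₁ := 500) (C₂ := 19500) (k₁ := 1) (k₂ := 2)
    (runs_setPositions h hc hi hok) ?_ (by norm_num) (by norm_num) le_rfl
  intro τ₁ h17 f₁
  rw [← hP, hq] at h17
  rw [← f₁.1 12 (by decide)] at hq
  rw [← f₁.1 21 (by decide)] at hi
  rw [← f₁.1 27 (by decide)] at h27
  rw [← f₁.2 16 (by decide)] at h16
  refine Runs.seq_pow (C₁ := 100) (C₂ := 19400) (k₁ := 0) (k₂ := 2)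
    (Q := fun τ => P ≠ [] → τ.real 24 0 0 = pathWeight w P / s)
    (Runs.step_pow rfl (by decide) fun h0 => ?_) ?_ (by norm_num) (by norm_num) le_rfl
  · have hlen0 := List.length_pos_iff.2 h0
    simp [Program.step, NatExp.eval, RealExp.eval, hi, hq, h16, h17 (q - 1) (by omega)]
    rw [Nat.sub_add_cancel (by omega), ← hlen, List.take_length]
  intro τ₂ h24 f₂
  refine Runs.seq_pow (C₁ := 10) (C₂ := 19390) (k₁ := 0) (k₂ := 2) (Q := fun τ => τ.nat 29 0 0 = 0)
    (Runs.step_pow rfl (by decide) ?_) ?_ (by norm_num) (by norm_num) le_rfl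
  · simp [Program.step, NatExp.eval]
  intro τ₃ h29 f₃
  refine Runs.seq_pow (C₁ := 10) (C₂ := 19380) (k₁ := 0) (k₂ := 2) (Q := fun τ => τ.real 18 0 0 = 0)
    (Runs.step_pow rfl (by decide) ?_) ?_ (by norm_num) (by norm_num) le_rfl
  · simp [Program.step, NatExp.eval, RealExp.eval]
  intro τ₄ h18 f₄
  have f : Frame [22, 29] [17, 24, 18] σ τ₄ :=
    (((f₁.mono (by decide) (by decide)).trans (f₂.mono (by decide) (by decide))).trans
    (f₃.mono (by decide) (by decide))).trans (f₄.mono (by decide) (by decide))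
  rw [← f₄.1 29 (by decide)] at h29
  rw [← f₃.2 24 (by decide), ← f₄.2 24 (by decide)] at h24
  rw [← f₂.2 17 (by decide), ← f₃.2 17 (by decide), ← f₄.2 17 (by decide)] at h17
  rw [f₁.1 12 (by decide), ← f.1 12 (by decide)] at hq
  rw [f₁.1 21 (by decide), ← f.1 21 (by decide)] at hi
  rw [f₁.1 27 (by decide), ← f.1 27 (by decide)] at h27
  rw [← cur_congr h (τ := τ₄) (σ := σ) (by rw [f.1 10 (by decide)])
    (by rw [f.1 11 (by decide)]) (by rw [f.1 12 (by decide)])] at hP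
  have hok : PathOK n τ₄ i := hok.frame f (by decide)
  rw [← f.1 11 (by decide), ← f.1 12 (by decide)]
  clear f₁ f₂ f₃ f₄ f h16 hc
  generalize hd : τ₄.real 24 0 0 = d at h24
  set pos := fun t => pathWeight w (P.take (t + 1)) with hpos
  refine Runs.seq_pow (C₁ := 19000) (C₂ := 100) (k₁ := 2) (k₂ := 0)
    (Q := fun τ => Best q pos d (fun j' _ _ => j' < s) s (τ.nat 28 0 0) (τ.nat 29 0 0)) ?_ ?_
    (by norm_num) le_rfl (by norm_num)
  · refine (Runs.for_loop (r := 0) (n := s) (T := 520 * (n + 1) ^ 2) (fun x τ =>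
      τ.real 18 0 0 = x ∧ Best q pos d (fun j' _ _ => j' < x) s (τ.nat 28 0 0) (τ.nat 29 0 0))
      (by decide) (by decide) (fun _ _ => rfl) (fun ρ f => ?_) (by decide) ?_ ?_).mono ?_
      fun τ h => h.1.2
    · simp [NatExp.eval, f.1 27 (by decide), h27]
    · exact ⟨by simpa using h18, .inl (by simpa using h29), by simp⟩
    · rintro x hx τ f hx' ⟨h1, h2⟩
      refine Runs.seq_pow (C₁ := 500) (C₂ := 20) (k₁ := 2) (k₂ := 0)
        (runs_searchPiece (i := i) (by rw [f.1 21 (by decide), hi])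
          (by rw [f.1 12 (by decide), hq]) hqn (pos := pos)
          (fun t ht => by rw [f.2 17 (by decide), h17 t ht]) (by rw [f.2 24 (by decide), hd])
          h1 hx h2) ?_ (by norm_num) le_rfl (by norm_num)
      intro ρ h3 g
      refine Runs.step_pow rfl (by decide) ?_
      simpa [Program.step, NatExp.eval, RealExp.eval, g.2 18 (by decide), h1] using h3
    · have : s * (520 * (n + 1) ^ 2 + 40) ≤ 30 * (520 * (n + 1) ^ 2 + 40) :=
        Nat.mul_le_mul_right _ h30
      have h1 : 1 ≤ (n + 1) ^ 2 := Nat.one_le_pow _ _ (Nat.succ_pos n)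
      omega
  · intro τ hbest f
    -- For an empty path nothing is found and the length stays `0`. The memory invariant is proved
    -- in this case too, so that nonemptiness is needed only for the optimality.
    have key : (τ.nat 29 0 0 = 0 ∨ τ.nat 28 0 0 + τ.nat 29 0 0 ≤ q) ∧
        (P ≠ [] → IsHeaviestSubpath w P s ((P.drop (τ.nat 28 0 0)).take (τ.nat 29 0 0))) := by
      constructor
      · rcases hbest.1 with h1 | ⟨j, b, -, h1, h2, h3⟩
        · exact .inl h1
        · have := h2.2.1
          exact .inr (by omega)
      · intro h0
        rw [h24 h0, ← hlen] at hbest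
        exact (hbest.isHeaviest hs h0 hw).1
    clear hbest
    refine Runs.step_pow rfl (by decide) ?_
    obtain ⟨a, ha⟩ : ∃ a, τ.nat 28 0 0 = a := ⟨_, rfl⟩
    obtain ⟨l, hl⟩ : ∃ l, τ.nat 29 0 0 = l := ⟨_, rfl⟩
    rw [ha, hl] at key
    simp only [Program.step, NatExp.eval, f.1 21 (by decide), hi, f.1 11 (by decide), ha, hl,
      ne_eq, Nat.reduceEqDiff, not_false_eq_true, nat_setNat_of_ne]
    set ρ := (τ.setNat 11 i 0 (τ₄.nat 11 i 0 + a)).setNat 12 i 0 l with hρ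
    have g10 : ρ.nat 10 i = τ₄.nat 10 i := by simp [hρ, f.1 10 (by decide)]
    have g11 : ∀ j, ρ.nat 11 j 0 = if j = i then τ₄.nat 11 i 0 + a else τ₄.nat 11 j 0 := by
      intro j
      simp [hρ, f.1 11 (by decide)]
    have g12 : ∀ j, ρ.nat 12 j 0 = if j = i then l else τ₄.nat 12 j 0 := by
      intro j
      simp [hρ, f.1 12 (by decide)]
    clear_value ρ
    refine ⟨⟨?_, ?_⟩, fun h0 => ?_, fun j hj => ?_⟩
    · rw [g12, if_pos rfl]
      omega
    · rw [g10, g11, g12, if_pos rfl, if_pos rfl]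
      rcases key.1 with rfl | h1
      · simp
      · exact hok.sub (by omega) (by omega)
    · have := key.2 h0
      have hlq : a + l ≤ q ∨ l = 0 := by omega
      have e : cur h ρ i = (P.drop a).take l := by
        rw [hP, cur, cur, g10, g11, g12, if_pos rfl, if_pos rfl, drop_seg, hq]
        rcases hlq with h1 | rfl
        · rw [take_seg h _ _ (by omega)]
        · simp [seg]
      rwa [e]
    · rw [g12, if_neg hj]
      exact ⟨by simp [f.1 11 (by decide), hj], rfl⟩

theorem runs_heaviestPaths (hw : IsMetric w) (h : 0 < n) (hmn : m ≤ n) (hc : MainCtx w m B ε α σ)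
    {s : ℕ} (hok : ∀ i < m, PathOK n σ i) (hP : IsPathSystem (paths h m σ)) (hs : 0 < s)
    (h30 : s ≤ 30) (h27 : σ.nat 27 0 0 = s) (h16 : σ.real 16 0 0 = s) :
    Runs (forLoop c0 21 mm heaviestPath) σ (21000 * (n + 1) ^ 3) fun τ =>
      (∀ i < m, PathOK n τ i) ∧
        ∀ i, IsHeaviestSubpath w (paths h m σ i) s (paths h m τ i) := by
  refine (runs_forPaths h hmn hc hok (by decide)
    (Rel := fun P Q => P ≠ [] → IsHeaviestSubpath w P s Q) (fun i hi τ f hi' hok' =>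
      runs_heaviestPath hw h (hc.frame f (by decide)) hi' hok' hs h30
        (by rw [f.1 27 (by decide), h27]) (by rw [f.2 16 (by decide), h16]))
      (C' := 21000) (e' := 3) (by norm_num) le_rfl).mono le_rfl fun τ h1 =>
    ⟨fun i hi => (h1 i hi).1, fun i => (h1 i i.2).2 (hP.1 i).1⟩

end

end RealRAM

/-! ### Longest edges, weights, and the best solution so far. -/

namespace RealRAM

open MOP Finset

/-- `U` consists of `q` longest edges. -/
structure LongestEdges {n : ℕ} (w : Fin n → Fin n → ℝ) (q : ℕ) (U : Finset (Fin n × Fin n)) :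
    Prop where
  lt : ∀ e ∈ U, e.1 < e.2
  card : U.card = q
  le : ∀ e ∈ U, ∀ e' : Fin n × Fin n, e'.1 < e'.2 → e' ∉ U → w e'.1 e'.2 ≤ w e.1 e.2

/-- Exchange argument: `S \ U` and `U \ S` have the same size, and every edge of the former weighs
at most as much as any edge of the latter. -/
theorem LongestEdges.sum_eq {n q : ℕ} {w : Fin n → Fin n → ℝ} {U : Finset (Fin n × Fin n)}
    (h : LongestEdges w q U) : longestEdges w q = ∑ e ∈ U, w e.1 e.2 := by
  refine IsGreatest.csSup_eq ⟨⟨U, h.lt, h.card, rfl⟩, ?_⟩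
  rintro x ⟨S, hS, hcard, rfl⟩
  have hsdiff : (S \ U).card = (U \ S).card :=
    card_sdiff_comm (hcard.trans h.card.symm)
  have key : ∑ e ∈ S \ U, w e.1 e.2 ≤ ∑ e ∈ U \ S, w e.1 e.2 := by
    rcases (U \ S).eq_empty_or_nonempty with h0 | h0
    · rw [h0, card_empty, card_eq_zero] at hsdiff
      rw [h0, hsdiff]
    · obtain ⟨e, he, hmin⟩ := exists_min_image (U \ S) (fun e => w e.1 e.2) h0
      refine (sum_le_card_nsmul _ _ (w e.1 e.2) fun e' he' => ?_).trans
        (hsdiff ▸ card_nsmul_le_sum _ _ _ hmin)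
      rw [mem_sdiff] at he he'
      exact h.le e he.1 e' (hS e' he'.1) he'.2
  rw [← sum_inter_add_sum_sdiff S U, ← sum_inter_add_sum_sdiff U S, inter_comm U S]
  linarith

/-- The star at the vertex `0` alone has `n - 1` edges, more than `q`. -/
theorem LongestEdges.exists_notMem {n q : ℕ} {w : Fin n → Fin n → ℝ}
    {U : Finset (Fin n × Fin n)} (h : LongestEdges w q U) (hq : q + 1 < n) :
    ∃ e : Fin n × Fin n, e.1 < e.2 ∧ e ∉ U := by
  by_contra! hc
  let z : Fin n := ⟨0, by omega⟩
  have : ((univ.erase z).image fun v => (z, v)) ⊆ U := by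
    intro e he
    obtain ⟨v, hv, rfl⟩ := mem_image.1 he
    refine hc _ (Nat.pos_of_ne_zero fun h0 => ?_)
    exact (mem_erase.1 hv).1 (Fin.ext h0)
  have := card_le_card this
  rw [card_image_of_injective _ (Prod.mk_right_injective z), card_erase_of_mem (mem_univ _),
    card_univ, Fintype.card_fin, h.card] at this
  omega

theorem LongestEdges.insert {n q : ℕ} {w : Fin n → Fin n → ℝ} {U : Finset (Fin n × Fin n)}
    (h : LongestEdges w q U) {e : Fin n × Fin n} (he : e.1 < e.2) (heU : e ∉ U)
    (hmax : ∀ e' : Fin n × Fin n, e'.1 < e'.2 → e' ∉ U → w e'.1 e'.2 ≤ w e.1 e.2) :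
    LongestEdges w (q + 1) (insert e U) where
  lt := forall_mem_insert _ _ _ |>.2 ⟨he, h.lt⟩
  card := by rw [card_insert_of_notMem heU, h.card]
  le := by
    intro e₁ h₁ e' h2 h3
    have h4 : e' ∉ U := fun hc => h3 (mem_insert_of_mem hc)
    rcases mem_insert.1 h₁ with rfl | h₁
    · exact hmax e' h2 h4
    · exact h.le e₁ h₁ e' h2 h4

/-- The used edges are recorded, and they are longest edges. -/
def EdgeState {n : ℕ} (w : Fin n → Fin n → ℝ) (q : ℕ) (σ : Store) : Prop :=
  ∃ U : Finset (Fin n × Fin n), LongestEdges w q U ∧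
    (∀ e : Fin n × Fin n, e.1 < e.2 → (σ.nat 13 e.1 e.2 = 0 ↔ e ∉ U)) ∧
    σ.real 11 0 0 = ∑ e ∈ U, w e.1 e.2

theorem EdgeState.eq {n q : ℕ} {w : Fin n → Fin n → ℝ} {σ : Store} (h : EdgeState w q σ) :
    σ.real 11 0 0 = longestEdges w q := by
  obtain ⟨U, hU, -, h⟩ := h
  rw [h, hU.sum_eq]

theorem EdgeState.frame {n q : ℕ} {w : Fin n → Fin n → ℝ} {σ τ : Store} {ns ls : List ℕ}
    (h : EdgeState w q σ) (f : Frame ns ls σ τ) (hf : 13 ∉ ns ∧ 11 ∉ ls) : EdgeState w q τ := by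
  unfold EdgeState
  rw [f.1 13 hf.1, f.2 11 hf.2]
  exact h

/-- The pair `(a, b)` is a longest unused edge among those in `D`, unless there is none. -/
def BestEdge (n : ℕ) (T : ℕ → ℕ → ℕ) (W : ℕ → ℕ → ℝ) (D : ℕ → ℕ → Prop) (f a b : ℕ) (x : ℝ) :
    Prop :=
  (f = 0 ∧ ∀ i j, D i j → i < j → T i j ≠ 0) ∨
    (f = 1 ∧ a < b ∧ b < n ∧ T a b = 0 ∧ x = W a b ∧
      ∀ i j, D i j → i < j → T i j = 0 → W i j ≤ x)

theorem BestEdge.mono {n : ℕ} {T : ℕ → ℕ → ℕ} {W : ℕ → ℕ → ℝ} {D D' : ℕ → ℕ → Prop} {f a b : ℕ}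
    {x : ℝ} (h : BestEdge n T W D f a b x) (hD : ∀ i j, D' i j → i < j → D i j) :
    BestEdge n T W D' f a b x := by
  rcases h with ⟨h0, h1⟩ | ⟨h0, h1, h2, h3, h4, h5⟩
  · exact .inl ⟨h0, fun i j hd hij => h1 i j (hD i j hd hij) hij⟩
  · exact .inr ⟨h0, h1, h2, h3, h4, fun i j hd hij => h5 i j (hD i j hd hij) hij⟩

section

variable {n m k : ℕ} {w : Fin n → Fin n → ℝ} {B ε α : ℝ} {σ : Store}

theorem runs_sumWeights (h : 0 < n) (hmn : m ≤ n) (hc : MainCtx w m B ε α σ)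
    (hok : ∀ i < m, PathOK n σ i) :
    Runs sumWeights σ (1000 * (n + 1) ^ 2) fun τ => τ.real 21 0 0 = weight w (paths h m σ) := by
  refine Runs.seq_pow (C₁ := 20) (C₂ := 900) (k₁ := 0) (k₂ := 2) (Q := fun τ => τ.real 21 0 0 = 0)
    (Runs.step_pow rfl (by decide) ?_) ?_ (by norm_num) (by norm_num) le_rfl
  · simp [Program.step, NatExp.eval, RealExp.eval]
  intro τ h21 f
  rw [← paths_frame h m f (by decide)]
  have hc := hc.frame f (by decide)
  have hok : ∀ i < m, PathOK n τ i := fun i hi => (hok i hi).frame f (by decide)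
  clear f
  refine Runs.for_pow (C := 800) (k := 1) (r := 0) (n := m) (M := n)
    (fun x ρ => ρ.real 21 0 0 = ∑ i ∈ range x, pathWeight w (cur h τ i)) (by decide) (by decide)
    (fun _ _ => rfl) (fun ρ f => ?_) hmn (by decide) ?_ ?_ (by norm_num) (by norm_num) ?_
  · simp [NatExp.eval, f.1 1 (by decide), hc.number]
  · simpa using h21
  · intro x hx ρ f hx' hI
    refine Runs.for_pow (C := 200) (k := 0) (r := 0) (n := τ.nat 12 x 0 - 1) (M := n)
      (fun y ρ => ρ.real 21 0 0 = ∑ i ∈ range x, pathWeight w (cur h τ i) +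
        ∑ j ∈ range y, edgeAt w (τ.nat 10 x) (τ.nat 11 x 0 + j))
      (by decide) (by decide) (fun _ _ => rfl) (fun ρ' f' => ?_)
      ((Nat.sub_le _ _).trans (hok x hx).len) (by decide) ?_ ?_ (by norm_num) (by norm_num) ?_
    · simp [NatExp.eval, f'.1 12 (by decide), f'.1 21 (by decide), f.1 12 (by decide), hx']
    · simpa using hI
    · intro y hy ρ' f' hy' hI'
      refine Runs.step_pow rfl (by decide) ?_
      simp [Program.step, NatExp.eval, RealExp.eval, f'.1 10 (by decide), f'.1 11 (by decide),
        f'.1 21 (by decide), f'.2 0 (by decide), f.1 10 (by decide), f.1 11 (by decide),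
        f.2 0 (by decide), hc.weights, hx', hy', hI', sum_range_succ, edgeAt, add_assoc]
    · intro ρ' hI' _
      simp only [real_setNat, hI', sum_range_succ]
      rw [cur, pathWeight_seg h w ((hok x hx).sub le_rfl le_rfl)]
  · intro ρ hI _
    rw [hI, weight, Finset.sum_range]
    rfl

theorem runs_keep (h : 0 < n) (hmn : m ≤ n) (hc : MainCtx w m B ε α σ)
    (hok : ∀ i < m, PathOK n σ i) :
    Runs keep σ (1000 * (n + 1) ^ 2) fun τ =>
      (σ.real 21 0 0 ≤ B ∧ σ.nat 33 0 0 < σ.nat 25 0 0 ∧ τ.nat 33 0 0 = σ.nat 25 0 0 ∧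
        Holds τ (paths h m σ)) ∨
      ((σ.real 21 0 0 ≤ B → σ.nat 25 0 0 ≤ σ.nat 33 0 0) ∧ τ = σ) := by
  refine Runs.branch_pow (C := 950) (fun hb => ?_) (fun hb => ?_) (by decide) <;>
    simp only [Test.holds, RealExp.eval, NatExp.eval, hc.budget] at hb
  swap
  · exact Runs.step_pow rfl (by decide) (.inr ⟨fun h => absurd h hb, rfl⟩)
  refine Runs.branch_pow (C := 900) (fun hb' => ?_) (fun hb' => ?_) (by decide) <;>
    simp only [Test.holds, NatExp.eval] at hb'
  swap
  · exact Runs.step_pow rfl (by decide) (.inr ⟨fun _ => by omega, rfl⟩)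
  refine Runs.seq_pow (C₁ := 20) (C₂ := 850) (k₁ := 0) (k₂ := 2)
    (Q := fun τ => τ.nat 33 0 0 = σ.nat 25 0 0)
    (Runs.step_pow rfl (by decide) ?_) ?_ (by norm_num) (by norm_num) le_rfl
  · simp [Program.step, NatExp.eval]
  intro τ h33 f
  suffices hs : Runs (forLoop c0 21 mm <|
          .seq (.setNat 2 (sc 21) c0 lnE) <|
          forLoop c0 22 lnE <| .setNat 3 (sc 21) (sc 22) (curV (sc 22))) τ (850 * (n + 1) ^ 2)
      fun ρ => ∀ i < m, ρ.nat 2 i 0 = τ.nat 12 i 0 ∧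
        ∀ j < τ.nat 12 i 0, ρ.nat 3 i j = τ.nat 10 i (τ.nat 11 i 0 + j) by
    refine hs.frame.mono le_rfl ?_
    rintro ρ ⟨h1, g⟩
    refine .inl ⟨hb, hb', by rw [g.1 33 (by decide), h33], fun i => ?_⟩
    obtain ⟨h2, h3⟩ := h1 i i.2
    rw [f.1 12 (by decide)] at h2 h3
    rw [f.1 10 (by decide), f.1 11 (by decide)] at h3
    have hlen : (paths h m σ i).length = σ.nat 12 i 0 := length_seg _ _ _ _
    refine ⟨h2.trans hlen.symm, fun j hj => ?_⟩
    rw [hlen] at hj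
    rw [h3 j hj]
    simp only [paths, cur, seg, List.getElem_map, List.getElem_range', one_mul]
    exact (vtx_val h ((hok i i.2).lt j hj)).symm
  have hc := hc.frame f (by decide)
  have hok : ∀ i < m, PathOK n τ i := fun i hi => (hok i hi).frame f (by decide)
  clear f hb' hb
  refine Runs.for_pow (C := 800) (k := 1) (r := 0) (n := m) (M := n)
    (fun x ρ => ∀ i < x, ρ.nat 2 i 0 = τ.nat 12 i 0 ∧
        ∀ j < τ.nat 12 i 0, ρ.nat 3 i j = τ.nat 10 i (τ.nat 11 i 0 + j)) (by decide) (by decide)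
    (fun _ _ => rfl) (fun ρ f => ?_) hmn (by decide) ?_ ?_ (by norm_num) (by norm_num)
    fun _ h _ => h
  · simp [NatExp.eval, f.1 1 (by decide), hc.number]
  · simp
  · intro x hx ρ f hx' hI
    refine Runs.seq_pow (C₁ := 50) (C₂ := 700) (k₁ := 0) (k₂ := 1)
      (Q := fun ρ => ρ.nat 2 x 0 = τ.nat 12 x 0 ∧ ∀ i < x, ρ.nat 2 i 0 = τ.nat 12 i 0 ∧
        ∀ j < τ.nat 12 i 0, ρ.nat 3 i j = τ.nat 10 i (τ.nat 11 i 0 + j))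
      (Runs.step_pow rfl (by decide) ?_) ?_ (by norm_num) (by norm_num) le_rfl
    · simp [Program.step, NatExp.eval, hx', f.1 12 (by decide)]
      exact fun i hi => ⟨by rw [if_neg hi.ne, (hI i hi).1], (hI i hi).2⟩
    rintro ρ₁ ⟨h1, h2⟩ f₁
    refine Runs.for_pow (C := 200) (k := 0) (r := 0) (n := τ.nat 12 x 0) (M := n)
      (fun y ρ => (∀ i, ρ.nat 2 i 0 = ρ₁.nat 2 i 0) ∧ (∀ i < x, ρ.nat 3 i = ρ₁.nat 3 i) ∧
        ∀ j < y, ρ.nat 3 x j = τ.nat 10 x (τ.nat 11 x 0 + j))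
      (by decide) (by decide) (fun _ _ => rfl) (fun ρ' f' => ?_)
      (hok x hx).len (by decide) ?_ ?_ (by norm_num) (by norm_num) ?_
    · simp [NatExp.eval, f'.1 12 (by decide), f'.1 21 (by decide), f₁.1 12 (by decide),
        f₁.1 21 (by decide), f.1 12 (by decide), hx']
    · simp
    · rintro y hy ρ' f' hy' ⟨h3, h4, h5⟩
      refine Runs.step_pow rfl (by decide) ?_
      simp only [Program.step, NatExp.eval, f'.1 10 (by decide), f'.1 11 (by decide),
        f'.1 21 (by decide), f₁.1 10 (by decide), f₁.1 11 (by decide), f₁.1 21 (by decide),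
        f.1 10 (by decide), f.1 11 (by decide), hx', hy']
      refine ⟨fun i => by simp [h3], fun i hi => ?_, fun j hj => ?_⟩
      · funext j
        simp [hi.ne, h4 i hi]
      · by_cases hjy : j = y
        · simp [hjy]
        · simp [hjy, h5 j (by omega)]
    · rintro ρ' ⟨h3, h4, h5⟩ _ i hi
      simp only [ne_eq, Nat.reduceEqDiff, not_false_eq_true, nat_setNat_of_ne, h3]
      rcases Nat.lt_succ_iff_lt_or_eq.1 hi with hi | rfl
      · rw [h4 i hi]
        exact h2 i hi
      · exact ⟨h1, h5⟩

theorem runs_searchEdge (hc : MainCtx w m B ε α σ) (h30 : σ.nat 30 0 0 = 0) :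
    Runs (forLoop c0 21 nn <| forLoop c0 22 nn <|
    .branch (.natLE (.add (sc 21) c1) (sc 22))
      (.branch (natEq (.read 13 (sc 21) (sc 22)) c0)
        (.branch (natEq (sc 30) c0)
          (.seq (put 30 c1) <| .seq (put 31 (sc 21)) <| .seq (put 32 (sc 22)) <|
            putR 22 (.read 0 (sc 21) (sc 22)))
          (.branch (realLT (fc 22) (.read 0 (sc 21) (sc 22)))
            (.seq (put 30 c1) <| .seq (put 31 (sc 21)) <| .seq (put 32 (sc 22)) <|
              putR 22 (.read 0 (sc 21) (sc 22))) .skip)) .skip) .skip) σ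
      (1000 * (n + 1) ^ 2) fun τ => BestEdge n (σ.nat 13) (extend w) (fun i j => i < n ∧ j < n)
        (τ.nat 30 0 0) (τ.nat 31 0 0) (τ.nat 32 0 0) (τ.real 22 0 0) := by
  refine Runs.for_pow (C := 900) (k := 1) (r := 0) (n := n) (M := n)
    (fun x τ => BestEdge n (σ.nat 13) (extend w) (fun i j => i < x ∧ j < n)
        (τ.nat 30 0 0) (τ.nat 31 0 0) (τ.nat 32 0 0) (τ.real 22 0 0)) (by decide) (by decide)
    (fun _ _ => rfl) (fun ρ f => ?_) le_rfl (by decide) ?_ ?_ (by norm_num) (by norm_num)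
    fun _ h _ => h
  · simp [NatExp.eval, f.1 0 (by decide), hc.size]
  · exact .inl ⟨by simpa using h30, by simp⟩
  · intro x hx τ f hx' hI
    have hc := hc.frame f (by decide)
    rw [← f.1 13 (by decide)] at hI ⊢
    refine Runs.for_pow (C := 500) (k := 0) (r := 0) (n := n) (M := n)
      (fun y ρ => BestEdge n (τ.nat 13) (extend w) (fun i j => i < x ∧ j < n ∨ i = x ∧ j < y)
        (ρ.nat 30 0 0) (ρ.nat 31 0 0) (ρ.nat 32 0 0) (ρ.real 22 0 0)) (by decide) (by decide)
      (fun _ _ => rfl) (fun ρ f => ?_) le_rfl (by decide) ?_ ?_ (by norm_num) (by norm_num) ?_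
    · simp [NatExp.eval, f.1 0 (by decide), hc.size]
    · simpa using hI
    · intro y hy ρ g hy' hI
      refine Runs.step_pow rfl (by decide) ?_
      have hstay : ¬ (x < y ∧ τ.nat 13 x y = 0 ∧ (ρ.nat 30 0 0 = 0 ∨ ρ.real 22 0 0 < extend w x y)) →
          BestEdge n (τ.nat 13) (extend w) (fun i j => i < x ∧ j < n ∨ i = x ∧ j < y + 1)
            (ρ.nat 30 0 0) (ρ.nat 31 0 0) (ρ.nat 32 0 0) (ρ.real 22 0 0) := by
        intro hn
        rcases hI with ⟨h0, h1⟩ | ⟨h0, h1, h2, h3, h4, h5⟩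
        · refine .inl ⟨h0, fun i j hd hij hT => ?_⟩
          by_cases hnew : i = x ∧ j = y
          · obtain ⟨rfl, rfl⟩ := hnew
            exact hn ⟨hij, hT, .inl h0⟩
          · exact h1 i j (by omega) hij hT
        · refine .inr ⟨h0, h1, h2, h3, h4, fun i j hd hij hT => ?_⟩
          by_cases hnew : i = x ∧ j = y
          · obtain ⟨rfl, rfl⟩ := hnew
            exact not_lt.1 fun hlt => hn ⟨hij, hT, .inr hlt⟩
          · exact h5 i j (by omega) hij hT
      have hnew : x < y → τ.nat 13 x y = 0 →
          (ρ.nat 30 0 0 = 0 ∨ ρ.real 22 0 0 < extend w x y) →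
          BestEdge n (τ.nat 13) (extend w) (fun i j => i < x ∧ j < n ∨ i = x ∧ j < y + 1)
            1 x y (extend w x y) := by
        intro hxy hT hlt
        refine .inr ⟨rfl, hxy, hy, hT, rfl, fun i j hd hij hT => ?_⟩
        by_cases hnew : i = x ∧ j = y
        · obtain ⟨rfl, rfl⟩ := hnew
          exact le_rfl
        · rcases hI with ⟨h0, h1⟩ | ⟨h0, h1, h2, h3, h4, h5⟩
          · exact absurd hT (h1 i j (by omega) hij)
          · have := hlt.resolve_left (by omega)
            exact (h5 i j (by omega) hij hT).trans this.le
      simp only [Program.step, Test.holds, natEq_holds, NatExp.eval, RealExp.eval,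
        g.1 21 (by decide), g.1 13 (by decide), g.2 0 (by decide), hc.weights, hx', hy', not_le]
      split_ifs with h1 h2 h3 h4
      · simpa [g.1 21 (by decide), g.2 0 (by decide), hc.weights, hx', hy'] using
          hnew h1 h2 (.inl h3)
      · simpa [g.1 21 (by decide), g.2 0 (by decide), hc.weights, hx', hy'] using
          hnew h1 h2 (.inr h4)
      · simpa using hstay fun h => h.2.2.elim h3 h4
      · simpa using hstay fun h => h2 h.2.1
      · simpa using hstay fun h => h1 h.1
    · intro ρ h _
      simp only [ne_eq, Nat.reduceEqDiff, not_false_eq_true, nat_setNat_of_ne, real_setNat]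
      refine h.mono fun i j hd _ => ?_
      omega

/-- The program searches for another edge even after the last guess, when there may be none. The
conclusion is conditional because that result is never used. -/
theorem runs_nextEdge (hc : MainCtx w m B ε α σ) {q : ℕ} (hE : EdgeState w q σ) :
    Runs nextEdge σ (2000 * (n + 1) ^ 2) fun τ => q + 1 < n → EdgeState w (q + 1) τ := by
  refine Runs.seq_pow (C₁ := 20) (C₂ := 1900) (k₁ := 0) (k₂ := 2)
    (Q := fun τ => τ.nat 30 0 0 = 0)
    (Runs.step_pow rfl (by decide) ?_) ?_ (by norm_num) (by norm_num) le_rfl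
  · simp [Program.step, NatExp.eval]
  intro τ h30 f
  have hc := hc.frame f (by decide)
  have hE := hE.frame f (by decide)
  refine Runs.seq_pow (C₁ := 1000) (C₂ := 100) (k₁ := 2) (k₂ := 0)
    (runs_searchEdge hc h30) ?_ (by norm_num) le_rfl (by norm_num)
  intro ρ hb g
  obtain ⟨U, hU, hT, h11⟩ := hE
  refine Runs.step_pow rfl (by decide) fun hq => ?_
  obtain ⟨e, he, heU⟩ := hU.exists_notMem hq
  rcases hb with ⟨h0, h1⟩ | ⟨h0, hab, hbn, hTab, hx, hmax⟩
  · exact absurd ((hT e he).2 heU) (h1 e.1 e.2 ⟨e.1.2, e.2.2⟩ he)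
  · obtain ⟨a, ha⟩ : ∃ a : Fin n, ρ.nat 31 0 0 = a := ⟨⟨_, hab.trans hbn⟩, rfl⟩
    obtain ⟨b, hb⟩ : ∃ b : Fin n, ρ.nat 32 0 0 = b := ⟨⟨_, hbn⟩, rfl⟩
    rw [ha, hb, extend_coe] at hx
    rw [ha, hb] at hab hTab
    have habU : (a, b) ∉ U := (hT (a, b) hab).1 hTab
    refine ⟨insert (a, b) U, hU.insert hab habU fun e' h1 h2 => ?_, fun e' h1 => ?_, ?_⟩
    · have := hmax e'.1 e'.2 ⟨e'.1.2, e'.2.2⟩ h1 ((hT e' h1).2 h2)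
      rwa [extend_coe, hx] at this
    · have := hT e' h1
      simp only [Program.step, NatExp.eval, ha, hb, nat_setReal, nat_setNat, g.1 13 (by decide),
        Fin.val_inj, mem_insert, not_or]
      split_ifs with heq
      · simp [Prod.ext_iff, heq]
      · rw [this, Prod.ext_iff]
        simp [heq]
    · rw [sum_insert habU]
      simp [Program.step, NatExp.eval, RealExp.eval, g.2 11 (by decide), h11, hx, add_comm]

end

end RealRAM

/-! ### The loop over the guesses and the output. -/

namespace RealRAM

open MOP Finset

theorem frame_setNat (σ : Store) (a i j x : ℕ) : Frame [a] [] σ (σ.setNat a i j x) :=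
  ⟨fun b hb => nat_setNat_of_ne σ (by simpa using hb) i j x, fun _ _ => rfl⟩

theorem Holds.congr {n m : ℕ} {P : Family n m} {σ τ : Store} (h : Holds σ P)
    (h2 : τ.nat 2 = σ.nat 2) (h3 : τ.nat 3 = σ.nat 3) : Holds τ P := by
  unfold Holds
  rw [h2, h3]
  exact h

theorem pieces_pos {n m k : ℕ} {ε α : ℝ} (hα : α < 1) (hε : 0 < ε) (P : Family n m) :
    0 < pieces k ε α P := by
  have h : 0 < 1 - α := by linarith
  unfold pieces
  split_ifs <;> refine Nat.ceil_pos.2 (add_pos_of_nonneg_of_pos (div_nonneg ?_ h.le) hε) <;>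
    linarith

/-- `R` and `S` are the results for the first `x` guesses, and a feasible `S k` that spans the most
vertices is stored. -/
structure Kept {n m : ℕ} (w : Fin n → Fin n → ℝ) (B ε α : ℝ) (R S : ℕ → Family n m) (x : ℕ)
    (σ : Store) : Prop where
  spec : ∀ k ∈ Ico m (m + x), IsBicriteriaOutput gwAlgorithm w m k B ε α (R k) ∧
    ∀ i, IsHeaviestSubpath w (R k i) (pieces k ε α (R k)) (S k i)
  stored : σ.nat 33 0 0 = 0 ∨ ∃ k ∈ Ico m (m + x), weight w (S k) ≤ B ∧
    (spanned (S k)).card = σ.nat 33 0 0 ∧ Holds σ (S k)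
  max : ∀ k ∈ Ico m (m + x), weight w (S k) ≤ B → (spanned (S k)).card ≤ σ.nat 33 0 0

/-- The invariant of the loop over the guesses. -/
structure GuessInv {n : ℕ} (w : Fin n → Fin n → ℝ) (m : ℕ) (B ε α : ℝ) (x : ℕ) (σ : Store) :
    Prop where
  ctx : MainCtx w m B ε α σ
  guess : σ.real 10 0 0 = ((m + x : ℕ) : ℝ)
  edges : m + x ≤ n → EdgeState w x σ
  kept : ∃ R S : ℕ → Family n m, Kept w B ε α R S x σ

section

variable {n m k : ℕ} {w : Fin n → Fin n → ℝ} {B ε α : ℝ} {σ τ : Store}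

theorem Kept.frame {R S : ℕ → Family n m} {x : ℕ} {ns ls : List ℕ}
    (h : Kept w B ε α R S x σ) (f : Frame ns ls σ τ) (hf : 2 ∉ ns ∧ 3 ∉ ns ∧ 33 ∉ ns) :
    Kept w B ε α R S x τ := by
  obtain ⟨h1, h2, h3⟩ := h
  rw [← f.1 33 hf.2.2] at h2 h3
  refine ⟨h1, h2.imp_right ?_, h3⟩
  rintro ⟨k, hk, h4, h5, h6⟩
  exact ⟨k, hk, h4, h5, h6.congr (f.1 2 hf.1) (f.1 3 hf.2.1)⟩

theorem GuessInv.frame {x : ℕ} {ns ls : List ℕ}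
    (h : GuessInv w m B ε α x σ) (f : Frame ns ls σ τ)
    (hf : ((∀ a ∈ ns, 1 < a ∧ a ≠ 9 ∧ a < 100) ∧ ∀ a ∈ ls, 3 < a ∧ a < 100) ∧ 10 ∉ ls ∧
      (13 ∉ ns ∧ 11 ∉ ls) ∧ 2 ∉ ns ∧ 3 ∉ ns ∧ 33 ∉ ns) : GuessInv w m B ε α x τ := by
  obtain ⟨h1, h2, h3, R, S, h4⟩ := h
  exact ⟨h1.frame f hf.1, by rw [f.2 10 hf.2.1, h2], fun hx => (h3 hx).frame f hf.2.2.1, R, S,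
    h4.frame f hf.2.2.2⟩

/-- The definition of an output speaks of the results for all guesses, whereas the memory holds only
the best one. The families `R` and `S` record the others and are extended by one value per guess. -/
theorem Kept.succ {R S : ℕ → Family n m} {x : ℕ} (h : Kept w B ε α R S x σ) {P Q : Family n m}
    (hP : IsBicriteriaOutput gwAlgorithm w m (m + x) B ε α P)
    (hQ : ∀ i, IsHeaviestSubpath w (P i) (pieces (m + x) ε α P) (Q i))
    (hτ : (weight w Q ≤ B ∧ σ.nat 33 0 0 < (spanned Q).card ∧
        τ.nat 33 0 0 = (spanned Q).card ∧ Holds τ Q) ∨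
      ((weight w Q ≤ B → (spanned Q).card ≤ σ.nat 33 0 0) ∧ τ = σ)) :
    Kept w B ε α (Function.update R (m + x) P) (Function.update S (m + x) Q) (x + 1) τ := by
  have hcases : ∀ k, k ∈ Ico m (m + (x + 1)) → k ∈ Ico m (m + x) ∧ k ≠ m + x ∨ k = m + x := by
    intro k hk
    rw [mem_Ico] at hk ⊢
    omega
  have hlast : m + x ∈ Ico m (m + (x + 1)) := mem_Ico.2 (by omega)
  have hne : ∀ k ∈ Ico m (m + x), k ∈ Ico m (m + (x + 1)) ∧ k ≠ m + x := by
    intro k hk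
    rw [mem_Ico] at hk ⊢
    omega
  refine ⟨fun k hk => ?_, ?_, fun k hk => ?_⟩
  · rcases hcases k hk with ⟨hk, hk'⟩ | rfl
    · rw [Function.update_of_ne hk', Function.update_of_ne hk']
      exact h.spec k hk
    · rw [Function.update_self, Function.update_self]
      exact ⟨hP, hQ⟩
  · rcases hτ with ⟨h1, h2, h3, h4⟩ | ⟨h1, rfl⟩
    · refine .inr ⟨m + x, hlast, ?_⟩
      rw [Function.update_self]
      exact ⟨h1, h3.symm, h4⟩
    · refine h.stored.imp_right ?_
      rintro ⟨k, hk, h2⟩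
      refine ⟨k, (hne k hk).1, ?_⟩
      rwa [Function.update_of_ne (hne k hk).2]
  · have hle : σ.nat 33 0 0 ≤ τ.nat 33 0 0 := by
      rcases hτ with ⟨h1, h2, h3, h4⟩ | ⟨h1, rfl⟩ <;> omega
    rcases hcases k hk with ⟨hk, hk'⟩ | rfl
    · rw [Function.update_of_ne hk']
      exact fun hw => (h.max k hk hw).trans hle
    · rw [Function.update_self]
      intro hw
      rcases hτ with ⟨h1, h2, h3, h4⟩ | ⟨h1, rfl⟩
      · exact h3.ge
      · exact h1 hw

/-- Composition is nested to the right, so the rest of the program is passed as a continuation `d`,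
which may assume the result of the bicriteria algorithm. -/
theorem runs_bicriteria (hw : IsMetric w) (hm : 1 ≤ m) (hmn : m ≤ n) (hα : α < 1)
    (hc : MainCtx w m B ε α σ) (hk : m + σ.nat 20 0 0 = k) {L : ℝ} (hL : 0 ≤ L)
    (hcall : Called (hm.trans hmn) w m k α L σ) {d : Program} {Q : Store → Prop}
    (hbs : BinarySearch (fun x => (spanned (prizePaths gwAlgorithm w m k α x)).card) (α * k)
        (ε * B) (min (longestEdges w (k - m)) B) 0 L)
    (hd : ∀ τ, Frame (Program.seq load trim).natW (Program.seq load trim).realW σ τ →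
      MainCtx w m B ε α τ → (∀ i < m, PathOK n τ i) →
      τ.nat 25 0 0 = (spanned (paths (hm.trans hmn) m τ)).card →
      IsPathSystem (paths (hm.trans hmn) m τ) →
      IsBicriteriaOutput gwAlgorithm w m k B ε α (paths (hm.trans hmn) m τ) →
      Runs d τ (34000 * (n + 1) ^ 3) Q) :
    Runs (.seq load (.seq trim d)) σ (40000 * (n + 1) ^ 3) Q := by
  refine Runs.seq_pow (C₁ := 1000) (C₂ := 39000) (k₁ := 2) (k₂ := 3)
    (runs_load hw hm hmn hα hc hL hcall) ?_ (by norm_num) (by norm_num) le_rfl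
  rintro τ ⟨hok, hP⟩ f
  change paths (hm.trans hmn) m τ = _ at hP
  have hps := prizePaths_isPathSystem (k := k) gwAlgorithm_isLMP hw hm hmn hα hL
  have hc := hc.frame f (by decide)
  refine Runs.seq_pow (C₁ := 5000) (C₂ := 34000) (k₁ := 3) (k₂ := 3)
    (runs_trim hw (hm.trans hmn) hmn hc hok (hP ▸ hps) (k := k)
      (by rw [f.1 20 (by decide), hk]) hm) ?_ (by norm_num) le_rfl le_rfl
  rintro ρ ⟨hok, hps, h25, hT⟩ g
  rw [hP] at hT
  exact hd ρ ((f.mono (by decide) (by decide)).trans (g.mono (by decide) (by decide)))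
    (hc.frame g (by decide)) hok h25 hps ⟨L, hbs, hT⟩

theorem runs_tryGuess (hw : IsMetric w) (hm : 1 ≤ m) (hmn : m ≤ n) (hα : α < 1) (hB : 0 < B)
    (hε : 0 < ε) (h1 : 16 / (1 - α) + ε ≤ 30) (h2 : (8 - 4 * α) / (1 - α) + ε ≤ 30) {F : ℕ}
    (hF : B ≤ ε * B * 2 ^ F) {x : ℕ} (hx : m + x ≤ n) (h20 : σ.nat 20 0 0 = x)
    (hI : GuessInv w m B ε α x σ) :
    Runs tryGuess σ ((F + 2) * (100000 * (n + 1) ^ 3)) (GuessInv w m B ε α (x + 1)) := by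
  have hn : 0 < n := hm.trans hmn
  obtain ⟨hc, hk, hE, R, S, hkept⟩ := hI
  have hE := hE hx
  obtain ⟨k, hkx⟩ : ∃ k, m + x = k := ⟨_, rfl⟩
  rw [hkx] at hk
  have hkm : k - m = x := by omega
  refine ((runs_bisect hw hm hmn hα hB hc (by rw [hkm, hE.eq]) hk hF).seq
    (T₂ := 40000 * (n + 1) ^ 3) ?_).mono ?_ fun _ h => h
  swap
  -- Everything after the bisection costs less than two of its rounds, so doubling the constant
  -- covers it.
  · have : 2 * (50000 * (n + 1) ^ 3) ≤ (F + 2) * (50000 * (n + 1) ^ 3) :=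
      Nat.mul_le_mul_right _ (by omega)
    have e : (F + 2) * (100000 * (n + 1) ^ 3) = (F + 2) * (50000 * (n + 1) ^ 3) +
      (F + 2) * (50000 * (n + 1) ^ 3) := by ring
    omega
  rintro τ₁ ⟨hc, L, hbs, hcall⟩ f₁
  have hE := hE.frame f₁ (by decide)
  have hkept := hkept.frame f₁ (by decide)
  rw [← f₁.1 20 (by decide)] at h20
  rw [← f₁.2 10 (by decide)] at hk
  clear f₁
  refine runs_bicriteria hw hm hmn hα hc (by rw [h20, hkx])
    (hbs.spec le_rfl (min_longestEdges_nonneg hw hB _)).1 hcall hbs ?_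
  intro τ₂ f₂ hc hok h25 hps hP
  have hE := hE.frame f₂ (by decide)
  have hkept := hkept.frame f₂ (by decide)
  rw [← f₂.1 20 (by decide)] at h20
  rw [← f₂.2 10 (by decide)] at hk
  clear f₂ hbs hcall
  refine Runs.seq_pow (C₁ := 5000) (C₂ := 29000) (k₁ := 0) (k₂ := 3)
    (runs_setPieces hc (k := k) (by rw [h20, hkx]) h25 h1 h2) ?_ (by norm_num) (by norm_num) le_rfl
  rintro τ₃ ⟨h27, h16, h30⟩ f₃
  rw [← paths_frame hn m f₃ (by decide)] at h27 h16 h30 hps hP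
  have hok : ∀ i < m, PathOK n τ₃ i := fun i hi => (hok i hi).frame f₃ (by decide)
  have hc := hc.frame f₃ (by decide)
  have hE := hE.frame f₃ (by decide)
  have hkept := hkept.frame f₃ (by decide)
  rw [← f₃.2 10 (by decide)] at hk
  clear f₃ h25 h20
  refine Runs.seq_pow (C₁ := 21000) (C₂ := 8000) (k₁ := 3) (k₂ := 3)
    (runs_heaviestPaths hw hn hmn hc hok hps (pieces_pos hα hε _) h30 h27 h16) ?_
    (by norm_num) le_rfl le_rfl
  rintro τ₄ ⟨hok, hheavy⟩ f₄
  have hQ := heaviest_isPathSystem hps hheavy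
  have hc := hc.frame f₄ (by decide)
  have hE := hE.frame f₄ (by decide)
  have hkept := hkept.frame f₄ (by decide)
  rw [← f₄.2 10 (by decide)] at hk
  generalize paths hn m τ₃ = P at *
  clear f₄ h27 h16 h30
  refine Runs.seq_pow (C₁ := 1000) (C₂ := 7000) (k₁ := 2) (k₂ := 3)
    (runs_sumWeights hn hmn hc hok) ?_ (by norm_num) (by norm_num) le_rfl
  intro τ₅ h21 f₅
  rw [← paths_frame hn m f₅ (by decide)] at h21 hQ hheavy
  have hok : ∀ i < m, PathOK n τ₅ i := fun i hi => (hok i hi).frame f₅ (by decide)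
  have hc := hc.frame f₅ (by decide)
  have hE := hE.frame f₅ (by decide)
  have hkept := hkept.frame f₅ (by decide)
  rw [← f₅.2 10 (by decide)] at hk
  clear f₅
  refine Runs.seq_pow (C₁ := 200) (C₂ := 6000) (k₁ := 1) (k₂ := 3)
    (runs_countVertices hc hmn) ?_ (by norm_num) (by norm_num) le_rfl
  intro τ₆ h25 f₆
  rw [← card_paths hn hQ, ← paths_frame hn m f₆ (by decide)] at h25
  rw [← paths_frame hn m f₆ (by decide)] at h21 hQ hheavy
  rw [← f₆.2 21 (by decide)] at h21
  have hok : ∀ i < m, PathOK n τ₆ i := fun i hi => (hok i hi).frame f₆ (by decide)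
  have hc := hc.frame f₆ (by decide)
  have hE := hE.frame f₆ (by decide)
  have hkept := hkept.frame f₆ (by decide)
  rw [← f₆.2 10 (by decide)] at hk
  clear f₆
  refine Runs.seq_pow (C₁ := 1000) (C₂ := 5000) (k₁ := 2) (k₂ := 3)
    (runs_keep hn hmn hc hok) ?_ (by norm_num) (by norm_num) le_rfl
  intro τ₇ h33 f₇
  rw [h25, h21] at h33
  rw [← hkx] at hP hheavy
  have hkept := hkept.succ hP hheavy h33
  have hc := hc.frame f₇ (by decide)
  have hE := hE.frame f₇ (by decide)
  rw [← f₇.2 10 (by decide)] at hk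
  clear f₇ h33 h21 h25 hok
  refine Runs.seq_pow (C₁ := 2000) (C₂ := 100) (k₁ := 2) (k₂ := 0)
    (runs_nextEdge hc hE) ?_ (by norm_num) (by norm_num) (by norm_num)
  intro τ₈ hE f₈
  have hc := hc.frame f₈ (by decide)
  have hkept := hkept.frame f₈ (by decide)
  rw [← f₈.2 10 (by decide)] at hk
  refine (Runs.step_pow (C := 100) (Q := fun ρ => ρ.real 10 0 0 = k + 1) rfl (by decide)
    ?_).frame.mono le_rfl ?_
  · simp [Program.step, NatExp.eval, RealExp.eval, hk]
  · rintro ρ ⟨h10, g⟩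
    refine ⟨hc.frame g (by decide), ?_, fun h => (hE (by omega)).frame g (by decide), _, _,
      hkept.frame g (by decide)⟩
    rw [h10, ← hkx]
    push_cast
    ring

theorem input_mainCtx (w : Fin n → Fin n → ℝ) (m : ℕ) (B ε α : ℝ) :
    MainCtx w m B ε α (input w m B ε α) := by
  refine ⟨by simp [input], by simp [input], ?_, by simp [input], by simp [input], by simp [input],
    fun a ha i hi j => ?_⟩
  · funext i j
    simp [input, extend]
  · have h1 : i ≠ 0 := by simp [input] at hi; omega
    have h2 : a ≠ 0 := by omega
    simp [input, h1, h2]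

theorem input_edgeState (w : Fin n → Fin n → ℝ) (m : ℕ) (B ε α : ℝ) :
    EdgeState w 0 (input w m B ε α) :=
  ⟨∅, ⟨by simp, rfl, by simp⟩, fun e _ => by simp [input], by simp [input]⟩

theorem runs_mainProgram (hw : IsMetric w) (hm : 1 ≤ m) (hmn : m ≤ n) (hα : α < 1) (hB : 0 < B)
    (hε : 0 < ε) (h1 : 16 / (1 - α) + ε ≤ 30) (h2 : (8 - 4 * α) / (1 - α) + ε ≤ 30) {F : ℕ}
    (hF : B ≤ ε * B * 2 ^ F) :
    Runs mainProgram (input w m B ε α) ((F + 2) * (101000 * (n + 1) ^ 4))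
      (GuessInv w m B ε α (n + 1 - m)) := by
  have hc := input_mainCtx w m B ε α
  have h0 : Runs (forLoop c0 21 mm <| putR 10 (.add (fc 10) fone)) (input w m B ε α)
      (100 * (n + 1) ^ 1) fun τ => τ.real 10 0 0 = m := by
    refine Runs.for_pow (C := 50) (k := 0) (r := 0) (n := m) (M := n)
      (fun x ρ => ρ.real 10 0 0 = x) (by decide) (by decide) (fun _ _ => rfl) (fun ρ f => ?_)
      hmn (by decide) ?_ ?_ (by norm_num) (by norm_num) fun _ h _ => h
    · simp [NatExp.eval, f.1 1 (by decide), hc.number]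
    · simp [input]
    · intro x hx ρ f hx' h
      refine Runs.step_pow rfl (by decide) ?_
      simp [Program.step, NatExp.eval, RealExp.eval, h]
  refine (h0.seq (T₂ := n * ((F + 2) * (100000 * (n + 1) ^ 3) + 40) + 40) ?_).mono ?_ fun _ h => h
  · intro τ h10 f
    have hc' := hc.frame f (by decide)
    have hinit : GuessInv w m B ε α 0 τ := by
      refine ⟨hc', by simpa using h10, fun _ => (input_edgeState w m B ε α).frame f (by decide),
        fun _ _ => [], fun _ _ => [], by simp, .inl ?_, by simp⟩
      rw [f.1 33 (by decide)]
      simp [input]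
    refine (Runs.for_loop (r := 0) (n := n + 1 - m) (GuessInv w m B ε α) (by decide) (by decide)
      (fun _ _ => rfl) (fun ρ f => ?_) (by decide) (hinit.frame (frame_setNat _ _ _ _ _) (by decide))
      (T := (F + 2) * (100000 * (n + 1) ^ 3)) ?_).mono ?_ fun _ h => h.1
    · simp [NatExp.eval, f.1 0 (by decide), f.1 1 (by decide), hc'.size, hc'.number]
    · intro x hx ρ g hx' hI
      exact (runs_tryGuess hw hm hmn hα hB hε h1 h2 hF (by omega) hx' hI).mono le_rfl fun ρ' h =>
        h.frame (frame_setNat _ _ _ _ _) (by decide)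
    · gcongr
      omega
  · have h3 : 1 ≤ (n + 1) ^ 3 := Nat.one_le_pow _ _ (Nat.succ_pos n)
    have h4 : 1 * 1 ≤ (F + 2) * (n + 1) ^ 3 := Nat.mul_le_mul (by omega) h3
    generalize hX : (F + 2) * (n + 1) ^ 3 = X at h4
    have e1 : (F + 2) * (100000 * (n + 1) ^ 3) = 100000 * X := by rw [← hX]; ring
    have e2 : (F + 2) * (101000 * (n + 1) ^ 4) = (n + 1) * (101000 * X) := by rw [← hX]; ring
    rw [e1, e2]
    nlinarith

/-- A stored value `0` would mean that no feasible solution was found. But the guess equal to the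
optimum yields one, and it spans at least `m ≥ 1` vertices. -/
theorem GuessInv.isOutput (hw : IsMetric w) (hm : 1 ≤ m) (hmn : m ≤ n) (hα0 : 0 < α) (hα : α < 1)
    (hB : 0 < B) (hε : 0 < ε) (h : GuessInv w m B ε α (n + 1 - m) σ) :
    ∃ P : Family n m, Holds σ P ∧ IsOutput gwAlgorithm w m B ε α P := by
  obtain ⟨-, -, -, R, S, h1, h2, h3⟩ := h
  have e : Ico m (m + (n + 1 - m)) = Icc m n := by
    ext k
    rw [mem_Ico, mem_Icc]
    omega
  rw [e] at h1 h2 h3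
  have hk := mem_Icc_opt (w := w) hmn hB
  obtain ⟨h4, h5⟩ := h1 _ hk
  have hS := heaviest_isPathSystem (h4.isPathSystem gwAlgorithm_isLMP hw hm hmn hα hB) h5
  have h6 := (guess_opt gwAlgorithm_isLMP hw hm hmn hα0 hα hB hε h4 h5 (min_le_left _ _)
    (min_le_right _ _)).1
  have h7 := (le_card_spanned hS).trans (h3 _ hk h6)
  obtain ⟨k, hk, h8, h9, h10⟩ := h2.resolve_left (by omega)
  exact ⟨S k, h10, R, S, h1, k, hk, rfl, h8, fun k' hk' h => (h3 k' hk' h).trans h9.ge⟩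

theorem mainProgram_spec (hw : IsMetric w) (hm : 1 ≤ m) (hmn : m ≤ n) (hα0 : 0 < α) (hα : α < 1)
    (hB : 0 < B) (hε : 0 < ε) (hε1 : ε < 1) (h1 : 16 / (1 - α) + ε ≤ 30)
    (h2 : (8 - 4 * α) / (1 - α) + ε ≤ 30) :
    ∃ (t : ℕ) (σ : Store) (P : Family n m), Exec mainProgram (input w m B ε α) t σ ∧
      Holds σ P ∧ IsOutput gwAlgorithm w m B ε α P ∧
      (t : ℝ) ≤ 13000000 * (1 / ε) * (n : ℝ) ^ 4 * Real.log ((n : ℝ) + 1) := by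
  -- The crude estimate `x ≤ 2 ^ ⌈x⌉` already fits the claimed factor `1/ε`; logarithmically many
  -- rounds would do.
  have hF : B ≤ ε * B * 2 ^ ⌈1 / ε⌉₊ := by
    have h3 : 1 / ε ≤ 2 ^ ⌈1 / ε⌉₊ :=
      (Nat.le_ceil _).trans (by exact_mod_cast Nat.lt_two_pow_self.le)
    rw [div_le_iff₀ hε] at h3
    nlinarith
  obtain ⟨t, σ, hex, ht, hI⟩ := runs_mainProgram hw hm hmn hα hB hε h1 h2 hF
  obtain ⟨P, hP, hout⟩ := hI.isOutput hw hm hmn hα0 hα hB hε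
  refine ⟨t, σ, P, hex, hP, hout, ?_⟩
  have hn1 : (1 : ℝ) ≤ n := by exact_mod_cast hm.trans hmn
  have hε' : 1 ≤ 1 / ε := (one_le_div hε).2 hε1.le
  have hceil : (⌈1 / ε⌉₊ : ℝ) + 2 ≤ 4 * (1 / ε) := by
    have := (Nat.ceil_lt_add_one (by positivity : 0 ≤ 1 / ε)).le
    linarith
  have hpow : ((n : ℝ) + 1) ^ 4 ≤ 16 * (n : ℝ) ^ 4 := by
    calc ((n : ℝ) + 1) ^ 4 ≤ (2 * n) ^ 4 := by gcongr; linarith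
      _ = 16 * (n : ℝ) ^ 4 := by ring
  -- The logarithmic factor is not needed; it is merely bounded below by `log 2`.
  have hlog : 1 / 2 ≤ Real.log ((n : ℝ) + 1) := by
    have : Real.log 2 ≤ Real.log ((n : ℝ) + 1) := Real.log_le_log (by norm_num) (by linarith)
    have := Real.log_two_gt_d9
    linarith
  calc (t : ℝ) ≤ (⌈1 / ε⌉₊ + 2) * (101000 * ((n : ℝ) + 1) ^ 4) := by exact_mod_cast ht
    _ ≤ (4 * (1 / ε)) * (101000 * (16 * (n : ℝ) ^ 4)) := by gcongr
    -- The constant is `4 · 101000 · 16 · 2`; the last factor makes room for the lower bound `1/2`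
    -- of the logarithm.
    _ = 12928000 * (1 / ε) * (n : ℝ) ^ 4 * (1 / 2) := by ring
    _ ≤ _ := by gcongr; norm_num

end

end RealRAM

/-! ### The theorem. -/

theorem mainTheorem2 :
    -- the choice of the parameter and the resulting constant
    ((11 - 4 * √7 : ℝ) ∈ Set.Ioo (0 : ℝ) 1 ∧
      (1 - (11 - 4 * √7)) / (17 - (11 - 4 * √7)) = (4 * √7 - 10) / (6 + 4 * √7) ∧
      (11 - 4 * √7) * (1 - (11 - 4 * √7)) / (9 - 5 * (11 - 4 * √7))
        = (4 * √7 - 10) / (6 + 4 * √7) ∧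
      (∀ α ∈ Set.Ioo (0 : ℝ) 1,
        min ((1 - α) / (17 - α)) (α * (1 - α) / (9 - 5 * α)) ≤ (4 * √7 - 10) / (6 + 4 * √7)) ∧
      (0.035 : ℝ) < (4 * √7 - 10) / (6 + 4 * √7)) ∧
    ∃ C : ℝ, 0 < C ∧
      -- approximation guarantee, for every `4`-LMP subroutine and every way of breaking ties
      (∀ A : MOP.PrizeAlgorithm, MOP.IsLMP 4 A →
        ∀ (n : ℕ) (w : Fin n → Fin n → ℝ) (m : ℕ) (B ε : ℝ), MOP.IsMetric w →
          1 ≤ m → m ≤ n → 0 < B → 0 < ε → ε < 1 →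
          ∀ P : MOP.Family n m, MOP.IsOutput A w m B ε (11 - 4 * √7) P →
            MOP.IsFeasible w m B P ∧
            ((4 * √7 - 10) / (6 + 4 * √7) - C * ε) * (MOP.opt w m B : ℝ)
              ≤ ((MOP.spanned P).card : ℝ)) ∧
      -- a `4`-LMP subroutine and an implementation with the claimed running time exist
      (∃ A : MOP.PrizeAlgorithm, MOP.IsLMP 4 A ∧
        ∃ prog : RealRAM.Program,
          ∀ (n : ℕ) (w : Fin n → Fin n → ℝ) (m : ℕ) (B ε : ℝ), MOP.IsMetric w →
            1 ≤ m → m ≤ n → 0 < B → 0 < ε → ε < 1 →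
            ∃ (t : ℕ) (σ : RealRAM.Store) (P : MOP.Family n m),
              RealRAM.Exec prog (RealRAM.input w m B ε (11 - 4 * √7)) t σ ∧
              RealRAM.Holds σ P ∧
              MOP.IsOutput A w m B ε (11 - 4 * √7) P ∧
              (t : ℝ) ≤ C * (1 / ε) * (n : ℝ) ^ 4 * Real.log ((n : ℝ) + 1)) := by
  -- The constant is dictated by the running time. The approximation guarantee holds with `ε` itself
  -- in place of `C * ε`.
  refine ⟨⟨MOP.parameter_mem, MOP.ratio_first, MOP.ratio_second, fun α => MOP.ratio_le,
    MOP.lt_ratio⟩, 13000000, by norm_num, ?_, RealRAM.gwAlgorithm, RealRAM.gwAlgorithm_isLMP,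
    RealRAM.mainProgram, ?_⟩
  · intro A hA n w m B ε hw hm hmn hB hε _ P hP
    refine ⟨hP.isFeasible hA hw hm hmn MOP.parameter_mem.2 hB, ?_⟩
    refine le_trans ?_ (hP.card_ge hA hw hm hmn MOP.parameter_mem.1 MOP.parameter_mem.2 hB hε
      MOP.ratio_first.ge MOP.ratio_second.ge)
    gcongr
    linarith
  · intro n w m B ε hw hm hmn hB hε hε1
    obtain ⟨h1, h2⟩ := MOP.sqrt_seven_bounds
    refine RealRAM.mainProgram_spec hw hm hmn MOP.parameter_mem.1 MOP.parameter_mem.2 hB hε hε1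
      ?_ ?_
    -- Here `1 - α* = 4 √7 - 10` is about `0.583`, so the quotient is about `27.5`; with `ε < 1`
    -- this stays below `30`.
    · have : 16 / (1 - (11 - 4 * √7)) ≤ 29 := by
        rw [div_le_iff₀ (by linarith)]
        linarith
      linarith
    · have : (8 - 4 * (11 - 4 * √7)) / (1 - (11 - 4 * √7)) ≤ 29 := by
        rw [div_le_iff₀ (by linarith)]
        linarith
      linarith
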